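/- **Conventions.** Let $n\ge 2$, $S^{n-1}$ the unit sphere of $\mathbb R^n$, $\mathcal F^{-1}m(t)=\frac1{2\pi}\int m(\lambda)e^{-i\lambda t}d\lambda$, $t_+^a=t^a$ for $t>0$ and $0$ otherwise, $t_-^a=(-t)_+^a$. Let $H\in C^\infty(\mathbb R^n\setminus 0)$ be real-valued and homogeneous of degree one, $\Theta_0\in S^{n-1}$, $x_0=H'(\Theta_0)$. For $\alpha\in S^{n-1}$ let $\check H''(\alpha)$ be the $(n-1)\times(n-1)$ Hessian matrix of $H$ along the plane tangent to $S^{n-1}$ at $\alpha$, evaluated at $\alpha$. Let $\Omega\subset S^{n-1}$ be a sufficiently small open neighborhood of $\Theta_0$ (how small depends only on $n$, $H$, $\Theta_0$) such that $H(-\alpha)=-H(\alpha)$ and $\check H''(\alpha)$ is negative definite for $\alpha\in\Omega$. **Operator.** Let $\beta\in\mathbb R$, $\tilde B_0\in C^\infty(S^{n-1})$, $\tilde B(\alpha,\lambda)=\lambda^\beta\tilde B_0(\alpha)$ for $\lambda>0$, $\tilde B(-\alpha,-\lambda)=\tilde B(\alpha,\lambda)$, and let $B(\alpha,\cdot)=\mathcal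 F^{-1}\tilde B(\alpha,\cdot)$ in the sense of distributions. **Data.** Let $s\ge (n+1)/2$, $a_0\in C_0^\infty(\Omega\cup(-\Omega))$, and $g_0(\alpha,H(\alpha)+p)=a_0(\alpha)p_+^{s-1}+a_0(-\alpha)p_-^{s-1}$ for $\alpha\in\Omega\cup(-\Omega)$, $p\in\mathbb R$. Let $\kappa_2=\beta-s-\frac{n-3}2>0$ and $\kappa_1=s-\frac{n+1}2$. **Kernel.** Let $\varphi:\mathbb R\to\mathbb R$ be compactly supported with $\int\varphi=1$, $\sum_{j\in\mathbb Z}j^m\varphi(t-j)=t^m$ for all integers $0\le m\le\lceil\beta\rceil$ and all $t$, and with bounded (weak) derivatives up to order $\lfloor\beta\rfloor+1$. **Sampling.** Let $U\subset\mathbb R^{n-1}$ be an open neighborhood of $0$, $T_\pm:U\to\pm\Omega$ smooth diffeomorphisms with $T_\pm(0)=\pm\Theta_0$, $u_\varepsilon\in[0,1)^{n-1}$ for $\varepsilon>0$, and let the sampled directions be $\alpha_k^\pm=T_\pm(\varepsilon(k+u_\varepsilon))$, $k\in\mathbb Z^{n-1}$, $\varepsilon(k+u_\varepsilon)\in U$.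 Let $|\Delta\alpha_k^\pm|$ be the surface area of the elementary domain $T_\pm\big((\varepsilon(k+u_\varepsilon)+\varepsilon Q)\cap U\big)$, where $Q\subset\mathbb R^{n-1}$ is a bounded measurable reference cell of volume one. Assume that $x_0$ is generic: each of the vectors $\partial(T_\pm(u)\cdot x_0)/\partial u|_{u=0}$ has at least one irrational component. Put $$(\mathcal B^\pm_\varepsilon g_0)(x)=\sum_k\sum_{j\in\mathbb Z}\int B(\alpha_k^\pm,\alpha_k^\pm\cdot x-p)\,\varphi\Big(\frac{p-\varepsilon j}\varepsilon\Big)dp\;g_0(\alpha_k^\pm,\varepsilon j)\,|\Delta\alpha_k^\pm|,$$ and $\mathcal B_\varepsilon g_0=\mathcal B_\varepsilon^+g_0+\mathcal B_\varepsilon^-g_0$. **Theorem.** The integrals (as oscillatory integrals) and the series above converge. For each $\check x\in\mathbb R^n$, with $h=\check x\cdot\Theta_0$, $$\lim_{\varepsilon\to0+}\varepsilon^{\kappa_2}\,2(\mathcal B^+_\varepsilon g_0)(x_0+\varepsilon\check x)=(\varphi*\mu)(h),\qquad \lim_{\varepsilon\to0+}\varepsilon^{\kappa_2}(\mathcal B_\varepsilon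 g_0)(x_0+\varepsilon\check x)=(\varphi_{e}*\mu)(h),$$ where $\varphi_{e}(t)=\frac12(\varphi(t)+\varphi(-t))$ (so $\varphi_e=\varphi$ if $\varphi$ is even), $$\mu(t)=\frac{(2\pi)^{(n-1)/2}}{|\det\check H''(\Theta_0)|^{1/2}}\frac{\Gamma(\kappa_2)}\pi\Big(c_+^{(2)}e^{-i\kappa_2\pi/2}(t-i0)^{-\kappa_2}+c_-^{(2)}e^{i\kappa_2\pi/2}(t+i0)^{-\kappa_2}\Big),$$ $$c^{(2)}_\pm=e^{\mp i\frac{n-1}2\frac\pi2}\,\Gamma(s)\,\tilde B_0(\pm\Theta_0)\Big(a_0(\Theta_0)e^{\pm i\frac\pi2 s}+a_0(-\Theta_0)e^{\mp i\frac\pi2 s}\Big),$$ and $(\varphi*\mu)(h)$ is well defined, that is, it is the limit as $\delta\to0+$ of the integrals with $t\mp i0$ replaced by $t\mp i\delta$. Let moreover $\tilde v_0:S^{n-1}\to\mathbb C$, let $\omega(\alpha)=(2\pi)^{-(n-1)/2}|\det\check H''(\alpha)|^{1/2}e^{-\frac{i\pi}4\mathrm{sgn}\check H''(\alpha)}$ ($\mathrm{sgn}$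 is the number of positive minus the number of negative eigenvalues), and suppose that $g_0(\alpha,H(\alpha)+p)=\hat f_0(\alpha,p)$ for $\alpha\in\Omega\cup(-\Omega)$, $p\in\mathbb R$, where $\hat f_0$ is the leading singularity of a Radon transform: if $s\notin\mathbb Z$, then $\hat f_0(\alpha,p)=a_+(\alpha)p_+^{s-1}+a_-(\alpha)p_-^{s-1}$ with $$a_\pm(\alpha)=\frac1{2\sin(\pi s)\Gamma(s)}\Big(\omega(\alpha)\tilde v_0(\alpha)e^{\pm i(s-1)\frac\pi2}+\omega(-\alpha)\tilde v_0(-\alpha)e^{\mp i(s-1)\frac\pi2}\Big),$$ and if $s\in\mathbb Z$, then $\hat f_0(\alpha,p)=\frac{\omega(\alpha)\tilde v_0(\alpha)}{2i^s(s-1)!}p^{s-1}\mathrm{sgn}(p)$ and $\tilde v_0(-\alpha)=e^{-i(\kappa_1+1)\pi}\tilde v_0(\alpha)$ for $\alpha\in\Omega$. Then, with $\mu_\pm=2\tilde B_0(\pm\Theta_0)\tilde v_0(\pm\Theta_0)$, $$\mu=\mathcal F^{-1}\big(\mu_+\lambda_+^{\kappa_2-1}+\mu_-\lambda_-^{\kappa_2-1}\big)=\frac{\Gamma(\kappa_2)}{2\pi}\Big[e^{-i\kappa_2\frac\pi2}\mu_+(t-i0)^{-\kappa_2}+e^{i\kappa_2\frac\pi2}\mu_-(t+i0)^{-\kappa_2}\Big].$$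 -/

import Mathlib

open Filter Topology MeasureTheory Module
open scoped ContDiff Manifold RealInnerProductSpace Pointwise SchwartzMap

namespace DTB

/-- Euclidean space `ℝⁿ`. -/
abbrev Vec (n : ℕ) := EuclideanSpace ℝ (Fin n)

/-- The unit sphere `S^{n-1}` of `ℝⁿ`. -/
abbrev Sph (n : ℕ) := Metric.sphere (0 : EuclideanSpace ℝ (Fin n)) 1

instance factFinrank (d : ℕ) : Fact (finrank ℝ (EuclideanSpace ℝ (Fin (d + 1))) = d + 1) :=
  ⟨by simp⟩

noncomputable section

/-- `t_+^a`: equal to `t ^ a` for `t > 0` and to `0` for `t ≤ 0` (also when `a = 0`). -/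
def posPow (t a : ℝ) : ℝ := if 0 < t then t ^ a else 0

/-- `t_-^a = (-t)_+^a`. -/
def negPow (t a : ℝ) : ℝ := posPow (-t) a

/-- `κ₁ = s - (n+1)/2`. -/
def kappa₁ (n : ℕ) (s : ℝ) : ℝ := s - ((n : ℝ) + 1) / 2

/-- `κ₂ = β - s - (n-3)/2`. -/
def kappa₂ (n : ℕ) (β s : ℝ) : ℝ := β - s - ((n : ℝ) - 3) / 2

/-! ### The function `H` and its Hessian on the tangent plane -/

/-- The `(n-1) × (n-1)` Hessian matrix of `H` along the plane tangent to the sphere at `α`, evaluated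
at `α`, in an orthonormal basis of `α^⊥`. Only its determinant, its eigenvalues and its
definiteness are used, and these do not depend on the basis. -/
def hessMatrix {n : ℕ} (H : Vec n → ℝ) (α : Vec n) :
    Matrix (Fin (finrank ℝ (ℝ ∙ α)ᗮ)) (Fin (finrank ℝ (ℝ ∙ α)ᗮ)) ℝ :=
  Matrix.of fun j k =>
    fderiv ℝ (fderiv ℝ H) α (stdOrthonormalBasis ℝ (ℝ ∙ α)ᗮ j : Vec n)
      (stdOrthonormalBasis ℝ (ℝ ∙ α)ᗮ k : Vec n)

/-- Negative definiteness of the Hessian of `H` along the tangent plane at `α`. -/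
def HessNegDef {n : ℕ} (H : Vec n → ℝ) (α : Vec n) : Prop :=
  (-hessMatrix H α).PosDef

/-- The number of positive minus the number of negative eigenvalues of the Hessian along the tangent
plane, counted with multiplicity. -/
def hessSignature {n : ℕ} (H : Vec n → ℝ) (α : Vec n) : ℤ :=
  ((hessMatrix H α).charpoly.roots.map fun x => (SignType.sign x : ℤ)).sum

/-- `ω(α) = |det Ȟ''(α)|^{1/2} e^{-i(π/4) sgn Ȟ''(α)} / (2π)^{(n-1)/2}`. -/
def omega {n : ℕ} (H : Vec n → ℝ) (α : Vec n) : ℂ :=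
  ((Real.sqrt |(hessMatrix H α).det| / (2 * Real.pi) ^ (((n : ℝ) - 1) / 2) : ℝ) : ℂ)
    * Complex.exp (-(Complex.I * (Real.pi / 4) * (hessSignature H α : ℂ)))

/-! ### The interpolation kernel -/

/-- The assumptions on the interpolation kernel `φ` for an operator of order `β`. Here
`⌈β⌉₊` is the required degree of exactness. The bounded derivatives required are those of order
`j ≤ ⌊β⌋₊ + 1`, which is `β + 1` if `β` is an integer and `⌈β⌉` otherwise; for a compactly supported
function this means that `φ` is `⌊β⌋₊` times continuously differentiable with a Lipschitz derivative
of order `⌊β⌋₊` (the derivative of order `⌊β⌋₊ + 1` is a bounded weak derivative). -/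
structure IsInterpKernel (β : ℝ) (φ : ℝ → ℝ) : Prop where
  exact : ∀ m : ℕ, m ≤ ⌈β⌉₊ → ∀ t : ℝ, ∑' j : ℤ, (j : ℝ) ^ m * φ (t - j) = t ^ m
  compact : HasCompactSupport φ
  smooth : ContDiff ℝ ⌊β⌋₊ φ
  lipschitz : ∃ K, LipschitzWith K (iteratedDeriv ⌊β⌋₊ φ)
  normalized : ∫ t, φ t = 1

/-! ### The filtering operator -/

/-- The regularization `(2π)⁻¹ ∫ B̃(λ) e^{-iλp} e^{-δλ²} dλ` of the oscillatory integral
`B(p) = (2π)⁻¹ ∫ B̃(λ) e^{-iλp} dλ`, which converges to `B` as a distribution when `δ → 0+`. -/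
def regKernel (Bt : ℝ → ℂ) (δ p : ℝ) : ℂ :=
  1 / (2 * Real.pi) *
    ∫ l : ℝ, Bt l * Complex.exp (-(Complex.I * l * p)) * Complex.exp (-(δ * l ^ 2 : ℝ))

/-- `∫ B_δ(t - p) ψ(p) dp` with the regularized kernel. -/
def applyApprox (Bt : ℝ → ℂ) (ψ : ℝ → ℝ) (t δ : ℝ) : ℂ :=
  ∫ p : ℝ, regKernel Bt δ (t - p) * ψ p

/-- `∫ B(t - p) ψ(p) dp` for the distribution `B` with Fourier transform `B̃`. -/
def applyB (Bt : ℝ → ℂ) (ψ : ℝ → ℝ) (t : ℝ) : ℂ :=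
  limUnder (𝓝[>] 0) (applyApprox Bt ψ t)

/-! ### The sampled directions -/

/-- `T` is a smooth diffeomorphism of the open set `U ∋ 0` onto the open set `Ω` of the sphere that
maps `0` to `Θ`. -/
structure IsDirectionMap {d : ℕ} (T : OpenPartialHomeomorph (Vec d) (Sph (d + 1)))
    (U : Set (Vec d)) (Ω : Set (Sph (d + 1))) (Θ : Sph (d + 1)) : Prop where
  source_eq : T.source = U
  target_eq : T.target = Ω
  smooth : ContMDiffOn (𝓡 d) (𝓡 d) ∞ T U
  smooth_symm : ContMDiffOn (𝓡 d) (𝓡 d) ∞ T.symm Ω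
  zero_mem : (0 : Vec d) ∈ U
  map_zero : T 0 = Θ

/-- The vector `∂(T(u)·x₀)/∂u` at `u = 0` has at least one irrational component. -/
def IsGenericFor {d : ℕ} (T : OpenPartialHomeomorph (Vec d) (Sph (d + 1)))
    (x₀ : Vec (d + 1)) : Prop :=
  ∃ i : Fin d, Irrational
    (fderiv ℝ (fun v : Vec d => ⟪(T v : Vec (d + 1)), x₀⟫) 0 (EuclideanSpace.single i 1))

/-- The reference cell of the lattice, for instance the unit cube. -/
structure IsCell {d : ℕ} (Q : Set (Vec d)) : Prop where
  measurable : MeasurableSet Q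
  bounded : Bornology.IsBounded Q
  volume_eq : volume Q = 1

/-- The grid point `ε(k + u)`. -/
def gridPt {d : ℕ} (ε : ℝ) (u : Vec d) (k : Fin d → ℤ) : Vec d :=
  ε • (WithLp.toLp 2 (fun i => (k i : ℝ)) + u)

/-- The surface area `|Δα_k|` of the elementary domain
`Δα_k = T (ε(k + u + Q))` of the sphere (`T` being applied to the part in its domain). -/
def cellArea {d : ℕ} (T : OpenPartialHomeomorph (Vec d) (Sph (d + 1)))
    (Q : Set (Vec d)) (ε : ℝ) (u : Vec d) (k : Fin d → ℤ) : ℝ :=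
  (volume : Measure (Vec (d + 1))).toSphere.real
    (T '' (((fun q => gridPt ε u k + ε • q) '' Q) ∩ T.source))

/-! ### The reconstruction from discrete data -/

/-- The term of index `j` of the filtered and interpolated data:
`∫ B(α, α·x - p) φ((p - εj)/ε) dp g(α, εj)`. -/
def filteredTerm {n : ℕ} (Bt : Sph n → ℝ → ℂ) (φ : ℝ → ℝ) (g : Sph n → ℝ → ℂ)
    (ε : ℝ) (x : Vec n) (α : Sph n) (j : ℤ) : ℂ :=
  applyB (Bt α) (fun p => φ ((p - ε * j) / ε)) ⟪(α : Vec n), x⟫ * g α (ε * j)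

/-- The contribution of a sampled direction `α_k = T(ε(k+u))`. -/
def directionTerm {d : ℕ} (Bt : Sph (d + 1) → ℝ → ℂ) (φ : ℝ → ℝ) (g : Sph (d + 1) → ℝ → ℂ)
    (T : OpenPartialHomeomorph (Vec d) (Sph (d + 1))) (Q : Set (Vec d)) (u : Vec d)
    (ε : ℝ) (x : Vec (d + 1)) (k : Fin d → ℤ) : ℂ :=
  (∑' j : ℤ, filteredTerm Bt φ g ε x (T (gridPt ε u k)) j) * (cellArea T Q ε u k : ℂ)

/-- The reconstruction from the sampled directions `α_k = T(ε(k+u))`, `ε(k+u) ∈ U`, in the range of one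
direction map `T`. -/
def discreteB {d : ℕ} (Bt : Sph (d + 1) → ℝ → ℂ) (φ : ℝ → ℝ) (g : Sph (d + 1) → ℝ → ℂ)
    (T : OpenPartialHomeomorph (Vec d) (Sph (d + 1))) (Q : Set (Vec d)) (u : Vec d)
    (ε : ℝ) (x : Vec (d + 1)) : ℂ :=
  ∑' k : {k : Fin d → ℤ // gridPt ε u k ∈ T.source}, directionTerm Bt φ g T Q u ε x k

/-! ### The limiting distribution -/

/-- `∫ (C₊ (t - iδ)^{-κ} + C₋ (t + iδ)^{-κ}) ψ(t) dt`. -/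
def boundaryApprox (κ : ℝ) (Cp Cm : ℂ) (ψ : ℝ → ℂ) (δ : ℝ) : ℂ :=
  ∫ t : ℝ, (Cp * ((t : ℂ) - δ * Complex.I) ^ (-(κ : ℂ))
    + Cm * ((t : ℂ) + δ * Complex.I) ^ (-(κ : ℂ))) * ψ t

/-- The distribution `C₊ (t - i0)^{-κ} + C₋ (t + i0)^{-κ}`, as a functional on test functions. -/
def boundaryDist (κ : ℝ) (Cp Cm : ℂ) : (ℝ → ℂ) → ℂ := fun ψ =>
  limUnder (𝓝[>] 0) (boundaryApprox κ Cp Cm ψ)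

/-- `c⁽¹⁾_± = Γ(s) b_± (a_+ e^{±iπs/2} + a_- e^{∓iπs/2})`, where `σ = ±1` is the sign and
`b = b_±`. -/
def cOne (s σ : ℝ) (b ap am : ℂ) : ℂ :=
  (Real.Gamma s : ℂ) * b *
    (ap * Complex.exp (Complex.I * σ * (Real.pi / 2) * s)
      + am * Complex.exp (-(Complex.I * σ * (Real.pi / 2) * s)))

/-- `c⁽²⁾_± = e^{∓i((n-1)/2)(π/2)} c⁽¹⁾_±`, where `σ = ±1` is the sign. -/
def cTwo (n : ℕ) (s σ : ℝ) (b ap am : ℂ) : ℂ :=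
  Complex.exp (-(Complex.I * σ * (((n : ℝ) - 1) / 2 : ℝ) * (Real.pi / 2))) * cOne s σ b ap am

/-- The factor `(2π)^{(n-1)/2} |det Ȟ''(Θ)|^{-1/2} Γ(κ) / π`. -/
def muFactor {n : ℕ} (H : Vec n → ℝ) (κ : ℝ) (Θ : Sph n) : ℝ :=
  (2 * Real.pi) ^ (((n : ℝ) - 1) / 2) / Real.sqrt |(hessMatrix H (Θ : Vec n)).det|
    * (Real.Gamma κ / Real.pi)

/-- The coefficient of `(t - i0)^{-κ₂}` in `μ`. -/
def muPlus {n : ℕ} (H : Vec n → ℝ) (B₀ a₀ : Sph n → ℂ) (β s : ℝ) (Θ : Sph n) : ℂ :=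
  (muFactor H (kappa₂ n β s) Θ : ℂ) * cTwo n s 1 (B₀ Θ) (a₀ Θ) (a₀ (-Θ))
    * Complex.exp (-(Complex.I * kappa₂ n β s * (Real.pi / 2)))

/-- The coefficient of `(t + i0)^{-κ₂}` in `μ`. -/
def muMinus {n : ℕ} (H : Vec n → ℝ) (B₀ a₀ : Sph n → ℂ) (β s : ℝ) (Θ : Sph n) : ℂ :=
  (muFactor H (kappa₂ n β s) Θ : ℂ) * cTwo n s (-1) (B₀ (-Θ)) (a₀ Θ) (a₀ (-Θ))
    * Complex.exp (Complex.I * kappa₂ n β s * (Real.pi / 2))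

/-- The distribution `μ`. -/
def mu {n : ℕ} (H : Vec n → ℝ) (B₀ a₀ : Sph n → ℂ) (β s : ℝ) (Θ : Sph n) : (ℝ → ℂ) → ℂ :=
  boundaryDist (kappa₂ n β s) (muPlus H B₀ a₀ β s Θ) (muMinus H B₀ a₀ β s Θ)

/-- The test function `t ↦ φ(h - t)`, so that `(φ * μ)(h) = ⟨μ, shiftTest φ h⟩`. -/
def shiftTest (φ : ℝ → ℝ) (h : ℝ) : ℝ → ℂ := fun t => (φ (h - t) : ℂ)

/-! ### The continuous transition behavior and the leading singularity of the Radon transform -/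

/-- The coefficient `μ_± = 2 B̃₀(±Θ) ṽ₀(±Θ)`, with `α = ±Θ`. -/
def muCoef {n : ℕ} (B₀ v₀ : Sph n → ℂ) (α : Sph n) : ℂ := 2 * B₀ α * v₀ α

/-- The distribution
`(Γ(κ)/(2π)) [q μ_+ (t - i0)^{-κ} + q⁻¹ μ_- (t + i0)^{-κ}]`, `q = e^{-iκπ/2}`. -/
def muCTB (κ : ℝ) (mp mm : ℂ) : (ℝ → ℂ) → ℂ :=
  boundaryDist κ
    ((Real.Gamma κ / (2 * Real.pi) : ℝ) * (Complex.exp (-(Complex.I * κ * (Real.pi / 2))) * mp))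
    ((Real.Gamma κ / (2 * Real.pi) : ℝ) * (mm / Complex.exp (-(Complex.I * κ * (Real.pi / 2)))))

/-- The value at `ψ` of the distribution `𝓕⁻¹(μ_+ λ_+^{κ-1} + μ_- λ_-^{κ-1})`, where
`(𝓕⁻¹ m)(t) = (2π)⁻¹ ∫ m(λ) e^{-iλt} dλ`. -/
def invFourierPairing (κ : ℝ) (mp mm : ℂ) (ψ : ℝ → ℂ) : ℂ :=
  1 / (2 * Real.pi) *
    ∫ l : ℝ, (mp * (posPow l (κ - 1) : ℂ) + mm * (negPow l (κ - 1) : ℂ)) *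
      ∫ t : ℝ, ψ t * Complex.exp (-(Complex.I * l * t))

/-- The coefficient `a_±(α)` of the leading singularity of the Radon transform for non-integer `s`,
where `σ = ±1` is the sign. -/
def radonCoef {n : ℕ} (H : Vec n → ℝ) (v₀ : Sph n → ℂ) (s σ : ℝ) (α : Sph n) : ℂ :=
  ((1 / (2 * Real.sin (Real.pi * s) * Real.Gamma s) : ℝ) : ℂ) *
    (omega H (α : Vec n) * v₀ α * Complex.exp (Complex.I * σ * ((s - 1 : ℝ) : ℂ) * (Real.pi / 2))
      + omega H (-(α : Vec n)) * v₀ (-α)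
        * Complex.exp (-(Complex.I * σ * ((s - 1 : ℝ) : ℂ) * (Real.pi / 2))))

/-- The leading singularity `f̂₀(α, p)` of the Radon transform at `p = H(α)`, as a function of the
shifted variable `p`. It is `a_+(α) p_+^{s-1} + a_-(α) p_-^{s-1}` if `s` is not an integer, and
`ω(α) ṽ₀(α) / (2 i^s (s-1)!) p^{s-1} sgn p` if `s` is an integer. -/
def radonLead {n : ℕ} (H : Vec n → ℝ) (v₀ : Sph n → ℂ) (s : ℝ) (α : Sph n) (p : ℝ) : ℂ :=
  if s = ⌊s⌋₊ then
    omega H (α : Vec n) * v₀ α / (2 * Complex.I ^ ⌊s⌋₊ * ((⌊s⌋₊ - 1).factorial : ℂ))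
      * ((p ^ (⌊s⌋₊ - 1) * (SignType.sign p : ℝ) : ℝ) : ℂ)
  else
    radonCoef H v₀ s 1 α * (posPow p (s - 1) : ℂ) + radonCoef H v₀ s (-1) α * (negPow p (s - 1) : ℂ)

end

end DTB

/-! Write d = n - 1, a = s - 1, and let Ψ be the filtered kernel `psi`, the inverse Fourier
transform of λ_+^β times the transform of φ. Applied to the rescaled translate φ((p - εj)/ε), the
operator gives ε^(-β) times a combination of Ψ and its conjugate, one for each half-line of
frequencies. The data are one-sided powers of degree a in p - H(α). Hence the sum over j for one
direction is ε^(a-β) times a combination of functions G(X, P) = ∑_j Ψ(X + P - j) A(j - P) and their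
conjugates, where A is a one-sided power, X = (α·x - H(α))/ε and P = H(α)/ε (`hasSum_filteredTerm`).

The function G has period one in P. It also decays in X: since φ reproduces polynomials, Ψ has
vanishing discrete moments (`tsum_pow_mul_psi`), and subtracting from A its Taylor polynomial at X
leaves a bound |X|^(-γ) (`exists_sampled_bound`). The condition κ₂ > 0 says a + d/2 < β, and this is
what allows γ > d/2.

At x = x₀ + εx̌ the variable X is α·x̌ plus (α·x₀ - H(α))/ε. By Euler's identity and the negative
definite Hessian, α·x₀ - H(α) vanishes at Θ₀ and is at least a multiple of |α - Θ₀|² nearby. So only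
directions at distance of order √ε from Θ₀ matter, and the total size is ε^(a-β) ε^(d/2) = ε^(-κ₂).
On this scale X varies slowly from one grid point to the next, whereas P increases by nearly a fixed
amount, which is irrational in a suitable coordinate because x₀ is generic. Weyl equidistribution,
uniform in the starting phase, replaces G(X, ·) by its mean over a period, and the lattice sum
becomes an integral over the tangent plane (`tendsto_average_gridPt`, `tendsto_lattice_sum`).

The mean of G is the convolution of Ψ with A, an integral `halfWave` over positive frequencies with
exponent β - s (`integral_sampled`, `integral_psi_mul_rpow`). Integrating it over the quadratic
phase multiplies the frequency l by (2π/l)^(d/2) e^(-iπd/4) (`integral_halfWave_sq`), which lowers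
the exponent to κ₂ - 1; this is the pairing of φ with μ (`tendsto_boundaryApprox_mu`). The
directions in -Ω give the same sum with φ reflected (`discreteB_negMap`), whence the even part of φ.
For Radon data the coefficients of μ are evaluated explicitly (`cOne_radon`, `muPlus_radon`,
`muMinus_radon`). -/

namespace DTB

noncomputable section

/-! ### Laplace integrals -/

/-- `∫_0^∞ l^a g(l) e^{-rl} dl`. -/
def lap (a : ℝ) (g : ℝ → ℂ) (r : ℂ) : ℂ :=
  ∫ l in Set.Ioi (0 : ℝ), ((l ^ a : ℝ) : ℂ) * g l * Complex.exp (-(r * l))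

theorem integrableOn_rpow_mul_exp {a b : ℝ} (ha : -1 < a) (hb : 0 < b) :
    IntegrableOn (fun l : ℝ => l ^ a * Real.exp (-(b * l))) (Set.Ioi 0) := by
  simpa using integrableOn_rpow_mul_exp_neg_mul_rpow (p := 1) ha one_pos hb

theorem norm_lap_integrand_le {a C : ℝ} {g : ℝ → ℂ} {r : ℂ} (hg : ∀ l, ‖g l‖ ≤ C) {l : ℝ}
    (hl : 0 < l) {b : ℝ} (hb : b ≤ r.re) :
    ‖((l ^ a : ℝ) : ℂ) * g l * Complex.exp (-(r * l))‖ ≤ C * (l ^ a * Real.exp (-(b * l))) := by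
  rw [norm_mul, norm_mul, Complex.norm_real, Real.norm_of_nonneg (Real.rpow_nonneg hl.le _),
    Complex.norm_exp]
  have h1 : (-(r * l)).re ≤ -(b * l) := by
    simp only [Complex.neg_re, Complex.mul_re, Complex.ofReal_re, Complex.ofReal_im, mul_zero,
      sub_zero]
    nlinarith
  have h2 := Real.exp_le_exp.2 h1
  have h3 : 0 ≤ l ^ a := Real.rpow_nonneg hl.le _
  have := hg l
  have h4 : 0 ≤ C := (norm_nonneg _).trans this
  calc l ^ a * ‖g l‖ * Real.exp (-(r * l)).re ≤ l ^ a * C * Real.exp (-(b * l)) := by gcongr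
    _ = _ := by ring

theorem measurable_lap_integrand {a : ℝ} {g : ℝ → ℂ} (hm : Measurable g) (r : ℂ) :
    Measurable fun l : ℝ => ((l ^ a : ℝ) : ℂ) * g l * Complex.exp (-(r * l)) := by
  fun_prop

theorem lap_integrable {a C : ℝ} {g : ℝ → ℂ} {r : ℂ} (ha : -1 < a) (hr : 0 < r.re)
    (hm : Measurable g) (hg : ∀ l, ‖g l‖ ≤ C) :
    IntegrableOn (fun l : ℝ => ((l ^ a : ℝ) : ℂ) * g l * Complex.exp (-(r * l))) (Set.Ioi 0) := by
  refine Integrable.mono' ((integrableOn_rpow_mul_exp ha hr).const_mul C)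
    (measurable_lap_integrand hm r).aestronglyMeasurable ?_
  filter_upwards [ae_restrict_mem measurableSet_Ioi] with l hl
  exact norm_lap_integrand_le hg hl le_rfl

theorem lap_hasDerivAt {a C : ℝ} {g : ℝ → ℂ} {r : ℂ} (ha : -1 < a) (hr : 0 < r.re)
    (hm : Measurable g) (hg : ∀ l, ‖g l‖ ≤ C) : HasDerivAt (lap a g) (-lap (a + 1) g r) r := by
  -- Half of the real part of `r` bounds `z.re` from below for all `z` near `r`, which gives one
  -- integrable majorant for the whole neighborhood.
  have hb : 0 < r.re / 2 := by positivity
  have hs : {z : ℂ | r.re / 2 < z.re} ∈ 𝓝 r :=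
    (isOpen_lt continuous_const Complex.continuous_re).mem_nhds (by simp; linarith)
  have := hasDerivAt_integral_of_dominated_loc_of_deriv_le (𝕜 := ℂ)
    (μ := volume.restrict (Set.Ioi (0 : ℝ)))
    (F := fun (r : ℂ) (l : ℝ) => ((l ^ a : ℝ) : ℂ) * g l * Complex.exp (-(r * l)))
    (F' := fun (r : ℂ) (l : ℝ) => -(((l ^ (a + 1) : ℝ) : ℂ) * g l * Complex.exp (-(r * l))))
    (bound := fun l => C * (l ^ (a + 1) * Real.exp (-(r.re / 2 * l)))) (x₀ := r) hs
    (Eventually.of_forall fun z => (measurable_lap_integrand hm z).aestronglyMeasurable)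
    (lap_integrable ha hr hm hg) (measurable_lap_integrand hm r).neg.aestronglyMeasurable
    ?_ ((integrableOn_rpow_mul_exp (by linarith) hb).const_mul C) ?_
  · have h2 := this.2
    rw [integral_neg] at h2
    exact h2
  · filter_upwards [ae_restrict_mem measurableSet_Ioi] with l hl z hz
    rw [norm_neg]
    exact norm_lap_integrand_le hg hl (le_of_lt hz)
  · filter_upwards [ae_restrict_mem measurableSet_Ioi] with l hl z hz
    have h1 : HasDerivAt (fun z : ℂ => -(z * l)) (-(l : ℂ)) z := by
      simpa using ((hasDerivAt_id z).mul_const (l : ℂ)).fun_neg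
    have h2 := (h1.cexp).const_mul (((l ^ a : ℝ) : ℂ) * g l)
    refine h2.congr_deriv ?_
    rw [Real.rpow_add_one (ne_of_gt hl)]
    push_cast
    ring

/-- Integration by parts: the derivative of l^(a+1) e^(-rl) integrates to zero over the half-line,
the boundary term at 0 vanishing because a + 1 > 0. This is the functional equation of the Gamma
function with a complex scale r. -/
theorem lap_one_add_one {a : ℝ} {r : ℂ} (ha : -1 < a) (hr : 0 < r.re) :
    r * lap (a + 1) (fun _ => 1) r = (a + 1) * lap a (fun _ => 1) r := by
  have i1 := lap_integrable (g := fun _ => 1) (C := 1) ha hr measurable_const (by simp)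
  have i2 := lap_integrable (a := a + 1) (g := fun _ => 1) (C := 1) (by linarith) hr
    measurable_const (by simp)
  have hder : ∀ l ∈ Set.Ioi (0 : ℝ), HasDerivAt
      (fun l : ℝ => ((l ^ (a + 1) : ℝ) : ℂ) * Complex.exp (-(r * l)))
      ((a + 1) * (((l ^ a : ℝ) : ℂ) * 1 * Complex.exp (-(r * l)))
        - r * (((l ^ (a + 1) : ℝ) : ℂ) * 1 * Complex.exp (-(r * l)))) l := by
    intro l hl
    have h1 : HasDerivAt (fun l : ℝ => ((l ^ (a + 1) : ℝ) : ℂ)) (((a + 1) * l ^ a : ℝ) : ℂ) l := by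
      have := (Real.hasDerivAt_rpow_const (x := l) (p := a + 1) (Or.inl (ne_of_gt hl))).ofReal_comp
      simpa using this
    have h2 : HasDerivAt (fun l : ℝ => -(r * (l : ℂ))) (-r) l := by
      simpa using ((hasDerivAt_id l).ofReal_comp.const_mul r).fun_neg
    refine (h1.fun_mul h2.cexp).congr_deriv ?_
    push_cast
    ring
  have hcont : ContinuousWithinAt (fun l : ℝ => ((l ^ (a + 1) : ℝ) : ℂ) * Complex.exp (-(r * l)))
      (Set.Ici 0) 0 := by
    have h : Continuous fun l : ℝ => l ^ (a + 1) :=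
      Real.continuous_rpow_const (by linarith)
    exact Continuous.continuousWithinAt (by fun_prop)
  have hlim : Tendsto (fun l : ℝ => ((l ^ (a + 1) : ℝ) : ℂ) * Complex.exp (-(r * l))) atTop (𝓝 0) := by
    rw [tendsto_zero_iff_norm_tendsto_zero]
    refine (tendsto_rpow_mul_exp_neg_mul_atTop_nhds_zero (a + 1) r.re hr).congr' ?_
    filter_upwards [eventually_gt_atTop 0] with l hl
    rw [norm_mul, Complex.norm_real, Real.norm_of_nonneg (Real.rpow_nonneg hl.le _),
      Complex.norm_exp]
    simp
  have key := integral_Ioi_of_hasDerivAt_of_tendsto hcont hder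
    ((i1.const_mul _).sub (i2.const_mul _)) hlim
  rw [integral_sub (i1.const_mul _) (i2.const_mul _), integral_const_mul, integral_const_mul] at key
  simp only [Real.zero_rpow (by linarith : a + 1 ≠ 0), Complex.ofReal_zero, zero_mul, sub_zero]
    at key
  unfold lap
  linear_combination -key

/-- By the recursion above, the product of the integral with r^(a+1) has zero derivative on the
right half-plane, hence is constant there; r = 1 identifies the constant as Γ(a+1). -/
theorem lap_one {a : ℝ} {r : ℂ} (ha : -1 < a) (hr : 0 < r.re) :
    lap a (fun _ => 1) r = (Real.Gamma (a + 1) : ℂ) * r ^ (-(a + 1 : ℂ)) := by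
  set S : Set ℂ := {z : ℂ | 0 < z.re}
  have hS : IsOpen S := isOpen_lt continuous_const Complex.continuous_re
  have hconv : Convex ℝ S := convex_halfSpace_re_gt 0
  have hder : ∀ z ∈ S, HasDerivAt (fun z : ℂ => lap a (fun _ => 1) z * z ^ (a + 1 : ℂ)) 0 z := by
    intro z hz
    have hz0 : z ≠ 0 := by rintro rfl; simp [S] at hz
    have h1 := lap_hasDerivAt (g := fun _ => 1) (C := 1) ha hz measurable_const (by simp)
    have h2 := (hasDerivAt_id z).cpow_const (c := (a + 1 : ℂ)) (Or.inl hz)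
    refine (h1.fun_mul h2).congr_deriv ?_
    have h3 := lap_one_add_one ha hz
    have h4 : z ^ (a + 1 : ℂ) = z ^ (a + 1 - 1 : ℂ) * z := by
      rw [Complex.cpow_sub _ _ hz0, Complex.cpow_one]
      field_simp
    simp only [id]
    rw [h4]
    linear_combination -z ^ (a + 1 - 1 : ℂ) * h3
  have hconst := hconv.is_const_of_fderivWithin_eq_zero (𝕜 := ℂ) (s := S)
    (f := fun z : ℂ => lap a (fun _ => 1) z * z ^ (a + 1 : ℂ))
    (fun z hz => (hder z hz).differentiableAt.differentiableWithinAt)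
    (fun z hz => by
      rw [fderivWithin_of_isOpen hS hz]
      have := (hder z hz).hasFDerivAt.fderiv
      rw [this]; ext; simp) (x := r) (y := 1) hr (by simp [S])
  have h1 : lap a (fun _ => 1) 1 = (Real.Gamma (a + 1) : ℂ) := by
    have h := Real.integral_rpow_mul_exp_neg_mul_Ioi (a := a + 1) (r := 1) (by linarith) one_pos
    simp only [div_one, Real.one_rpow, one_mul] at h
    rw [← h, ← integral_complex_ofReal]
    unfold lap
    simp
  have hr0 : r ≠ 0 := by rintro rfl; simp at hr
  rw [h1] at hconst
  simp only [Complex.one_cpow, mul_one] at hconst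
  rw [← hconst, mul_assoc, ← Complex.cpow_add _ _ hr0]
  simp

end

end DTB


namespace DTB

noncomputable section

/-! ### The Fourier transform and the half-line kernel -/

/-- `∫ ψ(y) e^{ily} dy`. -/
def ft (ψ : ℝ → ℂ) (l : ℝ) : ℂ := ∫ y : ℝ, ψ y * Complex.exp (Complex.I * l * y)

/-- The kernel `(2π)⁻¹ ∫_0^∞ l^a e^{-rl} dl`. -/
def halfKer (a : ℝ) (r : ℂ) : ℂ :=
  ((Real.Gamma (a + 1) / (2 * Real.pi) : ℝ) : ℂ) * r ^ (-(a + 1 : ℂ))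

/-- The Abel means `(2π)⁻¹ ∫_0^∞ l^a ψ̂(l) e^{-ilt} e^{-ηl} dl`. -/
def abelExt (a : ℝ) (ψ : ℝ → ℂ) (η t : ℝ) : ℂ :=
  1 / (2 * Real.pi) * lap a (ft ψ) (η + Complex.I * t)

theorem norm_cexp_I_mul (l y : ℝ) : ‖Complex.exp (Complex.I * l * y)‖ = 1 := by
  rw [Complex.norm_exp]; simp

theorem integrable_ft_integrand {ψ : ℝ → ℂ} (hψ : Integrable ψ) (l : ℝ) :
    Integrable fun y : ℝ => ψ y * Complex.exp (Complex.I * l * y) := by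
  refine hψ.norm.mono' (hψ.aestronglyMeasurable.mul (by fun_prop)) (Eventually.of_forall fun y => ?_)
  rw [norm_mul, norm_cexp_I_mul, mul_one]

theorem norm_ft_le (ψ : ℝ → ℂ) (l : ℝ) : ‖ft ψ l‖ ≤ ∫ y, ‖ψ y‖ := by
  refine (norm_integral_le_integral_norm _).trans (le_of_eq ?_)
  congr 1; ext y; rw [norm_mul, norm_cexp_I_mul, mul_one]

theorem continuous_ft {ψ : ℝ → ℂ} (hψ : Integrable ψ) : Continuous (ft ψ) := by
  refine continuous_of_dominated (bound := fun y => ‖ψ y‖)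
    (fun l => (integrable_ft_integrand hψ l).aestronglyMeasurable)
    (fun l => Eventually.of_forall fun y => ?_) hψ.norm (Eventually.of_forall fun y => ?_)
  · rw [norm_mul, norm_cexp_I_mul, mul_one]
  · fun_prop

theorem halfKer_eq {a : ℝ} {r : ℂ} (ha : -1 < a) (hr : 0 < r.re) :
    halfKer a r = 1 / (2 * Real.pi) * lap a (fun _ => 1) r := by
  rw [lap_one ha hr, halfKer]; push_cast; ring

/-- Fubini turns the Abel means into a convolution with an explicit power of η + i(t - y). Size
estimates and cancellations are read off from this form. -/
theorem abelExt_eq {a η : ℝ} {ψ : ℝ → ℂ} (ha : -1 < a) (hη : 0 < η) (hψ : Integrable ψ) (t : ℝ) :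
    abelExt a ψ η t = ∫ y : ℝ, halfKer a (η + Complex.I * ((t - y : ℝ) : ℂ)) * ψ y := by
  have hre : ∀ y : ℝ, 0 < ((η : ℂ) + Complex.I * ((t - y : ℝ) : ℂ)).re := by intro y; simpa using hη
  simp_rw [fun y => halfKer_eq ha (hre y)]
  unfold abelExt lap
  have hint : Integrable (Function.uncurry fun (l y : ℝ) => ((l ^ a : ℝ) : ℂ) * (ψ y *
      Complex.exp (-((η + Complex.I * ((t - y : ℝ) : ℂ)) * l))))
      ((volume.restrict (Set.Ioi (0 : ℝ))).prod volume) := by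
    have h1 := (integrableOn_rpow_mul_exp ha hη).integrable.mul_prod hψ.norm
    refine h1.mono' ?_ ?_
    · have hm : Measurable fun z : ℝ × ℝ => ((z.1 ^ a : ℝ) : ℂ) *
        Complex.exp (-((η + Complex.I * ((t - z.2 : ℝ) : ℂ)) * z.1)) := by fun_prop
      have h2 : AEStronglyMeasurable (fun z : ℝ × ℝ => ψ z.2)
        ((volume.restrict (Set.Ioi (0 : ℝ))).prod volume) := hψ.aestronglyMeasurable.comp_snd
      refine (hm.aestronglyMeasurable.mul h2).congr (Eventually.of_forall fun z => ?_)
      simp only [Pi.mul_apply, Function.uncurry]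
      ring
    · have hpos : ∀ᵐ z : ℝ × ℝ ∂((volume.restrict (Set.Ioi (0 : ℝ))).prod volume), 0 < z.1 := by
        have := Measure.quasiMeasurePreserving_fst (μ := volume.restrict (Set.Ioi (0 : ℝ)))
          (ν := (volume : Measure ℝ))
        exact this.ae (ae_restrict_mem measurableSet_Ioi)
      filter_upwards [hpos] with z hz
      simp only [Function.uncurry]
      rw [norm_mul, norm_mul, Complex.norm_real, Real.norm_of_nonneg (Real.rpow_nonneg hz.le _),
        Complex.norm_exp]
      simp only [Complex.neg_re, Complex.mul_re, Complex.add_re, Complex.ofReal_re, Complex.I_re,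
        Complex.I_im, Complex.ofReal_im, Complex.add_im, Complex.mul_im]
      ring_nf
      rfl
  have hsw := integral_integral_swap hint
  have e1 : ∀ l : ℝ, ((l ^ a : ℝ) : ℂ) * ft ψ l * Complex.exp (-((η + Complex.I * t) * l))
      = ∫ y : ℝ, ((l ^ a : ℝ) : ℂ) * (ψ y *
      Complex.exp (-((η + Complex.I * ((t - y : ℝ) : ℂ)) * l))) := by
    intro l
    rw [ft, ← integral_const_mul, ← integral_mul_const]
    congr 1; ext y
    rw [mul_assoc, mul_assoc, ← Complex.exp_add]
    congr 3
    push_cast; ring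
  simp_rw [e1]
  rw [hsw, ← integral_const_mul]
  congr 1; ext y
  rw [mul_assoc, ← integral_mul_const]
  congr 2; ext l
  ring

/-! ### Integrals of powers of `η + iu` -/

theorem norm_eta_add_ge (η u : ℝ) : |u| ≤ ‖(η : ℂ) + Complex.I * u‖ := by
  have := Complex.abs_im_le_norm ((η : ℂ) + Complex.I * u)
  simpa using this

theorem norm_eta_add_ge' (η u : ℝ) : |η| ≤ ‖(η : ℂ) + Complex.I * u‖ := by
  have := Complex.abs_re_le_norm ((η : ℂ) + Complex.I * u)
  simpa using this

theorem eta_add_ne_zero {η : ℝ} (hη : 0 < η) (u : ℝ) : (η : ℂ) + Complex.I * u ≠ 0 := by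
  intro h
  have := norm_eta_add_ge' η u
  rw [h, norm_zero, abs_of_pos hη] at this
  linarith

theorem eta_add_mem_slitPlane {η : ℝ} (hη : 0 < η) (u : ℝ) :
    (η : ℂ) + Complex.I * u ∈ Complex.slitPlane := Or.inl (by simpa using hη)

theorem continuous_eta_cpow {η : ℝ} (hη : 0 < η) (b : ℂ) :
    Continuous fun u : ℝ => ((η : ℂ) + Complex.I * u) ^ b := by
  refine Continuous.cpow (by fun_prop) continuous_const fun u => ?_
  exact eta_add_mem_slitPlane hη u

theorem norm_eta_cpow (η u b : ℝ) :
    ‖((η : ℂ) + Complex.I * u) ^ (-(b : ℂ))‖ = ‖(η : ℂ) + Complex.I * u‖ ^ (-b) := by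
  rw [← Complex.ofReal_neg, Complex.norm_cpow_real]

theorem integrable_abs_rpow_mul {η θ b : ℝ} (hη : 0 < η) (hθ : 0 ≤ θ) (hb : θ + 1 < b) :
    Integrable fun u : ℝ => |u| ^ θ * ‖(η : ℂ) + Complex.I * u‖ ^ (-b) := by
  have hc : 0 < min η 1 / 2 := by positivity
  have h1 := (integrable_one_add_norm (E := ℝ) (μ := volume) (r := b - θ) (by simp; linarith)).const_mul
    ((min η 1 / 2) ^ (-b))
  refine h1.mono' ?_ (Eventually.of_forall fun u => ?_)
  · have hcont : Continuous fun u : ℝ => ‖(η : ℂ) + Complex.I * u‖ ^ (-b) := by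
      refine Continuous.rpow_const (by fun_prop) fun u => Or.inl ?_
      exact norm_ne_zero_iff.2 (eta_add_ne_zero hη u)
    have h2 : Continuous fun u : ℝ => |u| ^ θ := by
      exact continuous_abs.rpow_const fun _ => Or.inr hθ
    exact (h2.mul hcont).aestronglyMeasurable
  · have h3 : min η 1 / 2 * (1 + ‖u‖) ≤ ‖(η : ℂ) + Complex.I * u‖ := by
      have a1 := norm_eta_add_ge η u
      have a2 := norm_eta_add_ge' η u
      rw [abs_of_pos hη] at a2
      have a3 := min_le_left η 1
      have a4 := min_le_right η 1
      have a5 := abs_nonneg u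
      rw [Real.norm_eq_abs]
      nlinarith
    have h4 : 0 < 1 + ‖u‖ := by positivity
    have h5 : ‖(η : ℂ) + Complex.I * u‖ ^ (-b) ≤ (min η 1 / 2 * (1 + ‖u‖)) ^ (-b) :=
      Real.rpow_le_rpow_of_nonpos (by positivity) h3 (by linarith)
    rw [Real.norm_of_nonneg (by positivity)]
    have h6 : |u| ^ θ ≤ (1 + ‖u‖) ^ θ :=
      Real.rpow_le_rpow (abs_nonneg _) (by rw [Real.norm_eq_abs]; linarith) hθ
    calc |u| ^ θ * ‖(η : ℂ) + Complex.I * u‖ ^ (-b)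
        ≤ (1 + ‖u‖) ^ θ * (min η 1 / 2 * (1 + ‖u‖)) ^ (-b) := by gcongr
      _ = (min η 1 / 2) ^ (-b) * (1 + ‖u‖) ^ (-(b - θ)) := by
        rw [Real.mul_rpow hc.le h4.le, neg_sub, sub_eq_add_neg, Real.rpow_add h4]; ring

/-- The integrand is homogeneous in (η, u), so replacing u by ηu leaves a pure power of η. -/
theorem integral_abs_rpow_mul {η θ b : ℝ} (hη : 0 < η) :
    ∫ u : ℝ, |u| ^ θ * ‖(η : ℂ) + Complex.I * u‖ ^ (-b)
      = η ^ (θ - b + 1) * ∫ u : ℝ, |u| ^ θ * ‖((1 : ℝ) : ℂ) + Complex.I * u‖ ^ (-b) := by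
  have h := Measure.integral_comp_mul_left
    (fun u : ℝ => |u| ^ θ * ‖(η : ℂ) + Complex.I * u‖ ^ (-b)) η
  have e : ∀ u : ℝ, |η * u| ^ θ * ‖(η : ℂ) + Complex.I * ((η * u : ℝ) : ℂ)‖ ^ (-b)
      = η ^ (θ - b) * (|u| ^ θ * ‖((1 : ℝ) : ℂ) + Complex.I * u‖ ^ (-b)) := by
    intro u
    have : (η : ℂ) + Complex.I * ((η * u : ℝ) : ℂ) = η * (((1 : ℝ) : ℂ) + Complex.I * u) := by
      push_cast; ring
    rw [this, norm_mul, Complex.norm_real, Real.norm_of_nonneg hη.le, abs_mul, abs_of_pos hη,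
      Real.mul_rpow hη.le (abs_nonneg _), Real.mul_rpow hη.le (norm_nonneg _), sub_eq_add_neg,
      Real.rpow_add hη]
    ring
  simp_rw [e] at h
  rw [integral_const_mul, smul_eq_mul, abs_of_pos (inv_pos.2 hη)] at h
  have h2 : ∫ u : ℝ, |u| ^ θ * ‖(η : ℂ) + Complex.I * u‖ ^ (-b)
      = η * (η ^ (θ - b) * ∫ u : ℝ, |u| ^ θ * ‖((1 : ℝ) : ℂ) + Complex.I * u‖ ^ (-b)) := by
    rw [h]; field_simp
  rw [h2, Real.rpow_add hη, Real.rpow_one]; ring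

theorem integrable_pow_mul_eta_cpow {η b : ℝ} {k : ℕ} (hη : 0 < η) (hb : k + 1 < b) :
    Integrable fun u : ℝ => (u : ℂ) ^ k * ((η : ℂ) + Complex.I * u) ^ (-(b : ℂ)) := by
  refine (integrable_abs_rpow_mul hη (Nat.cast_nonneg k) hb).mono' ?_
    (Eventually.of_forall fun u => ?_)
  · exact (Continuous.mul (by fun_prop) (continuous_eta_cpow hη _)).aestronglyMeasurable
  · rw [norm_mul, norm_eta_cpow, norm_pow, Complex.norm_real, Real.norm_eq_abs, Real.rpow_natCast]

/-- The primitive is a multiple of (η + iu)^(1-b) and tends to zero at both ends because b > 1. The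
branch cut is not met, since η + iu stays in the right half-plane. -/
theorem integral_eta_cpow {η b : ℝ} (hη : 0 < η) (hb : 1 < b) :
    ∫ u : ℝ, ((η : ℂ) + Complex.I * u) ^ (-(b : ℂ)) = 0 := by
  have hint := integrable_pow_mul_eta_cpow (k := 0) hη (by simpa using hb)
  simp only [pow_zero, one_mul] at hint
  have hb0 : (1 - b : ℂ) ≠ 0 := by
    rw [← Complex.ofReal_one, ← Complex.ofReal_sub, Complex.ofReal_ne_zero]; linarith
  have hder : ∀ u : ℝ, HasDerivAt (fun u : ℝ => (Complex.I * (1 - b))⁻¹ *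
      ((η : ℂ) + Complex.I * u) ^ (1 - b : ℂ)) (((η : ℂ) + Complex.I * u) ^ (-(b : ℂ))) u := by
    intro u
    have h1 : HasDerivAt (fun u : ℂ => (η : ℂ) + Complex.I * u) Complex.I u := by
      simpa using ((hasDerivAt_id (u : ℂ)).const_mul Complex.I).const_add (η : ℂ)
    have h2 := (h1.cpow_const (c := (1 - b : ℂ)) (eta_add_mem_slitPlane hη u)).const_mul
      (Complex.I * (1 - b : ℂ))⁻¹
    refine h2.comp_ofReal.congr_deriv ?_
    have : (1 - b - 1 : ℂ) = -(b : ℂ) := by ring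
    rw [this]
    field_simp
  have hlim : ∀ l : Filter ℝ, Tendsto (fun u : ℝ => |u|) l atTop →
      Tendsto (fun u : ℝ => (Complex.I * (1 - b))⁻¹ * ((η : ℂ) + Complex.I * u) ^ (1 - b : ℂ)) l
      (𝓝 0) := by
    intro l hl
    rw [← mul_zero ((Complex.I * (1 - b : ℂ))⁻¹)]
    refine Tendsto.const_mul _ ?_
    rw [tendsto_zero_iff_norm_tendsto_zero]
    have h1 : ∀ u : ℝ, ‖((η : ℂ) + Complex.I * u) ^ (1 - b : ℂ)‖
        = ‖(η : ℂ) + Complex.I * u‖ ^ (-(b - 1)) := by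
      intro u
      rw [← Complex.norm_cpow_real]; congr 2; push_cast; ring
    simp_rw [h1]
    exact (tendsto_rpow_neg_atTop (by linarith)).comp
      (tendsto_atTop_mono (norm_eta_add_ge η) hl)
  have := integral_of_hasDerivAt_of_tendsto hder hint (hlim _ tendsto_abs_atBot_atTop)
    (hlim _ tendsto_abs_atTop_atTop)
  simpa using this

/-- One factor u equals -i(η + iu) + iη, which lowers k together with b or k alone; both terms keep
the gap b > k + 1. This cancellation is the source of the vanishing moments of the filtered kernel.
-/
theorem integral_pow_mul_eta_cpow {η : ℝ} (hη : 0 < η) (k : ℕ) :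
    ∀ b : ℝ, k + 1 < b → ∫ u : ℝ, (u : ℂ) ^ k * ((η : ℂ) + Complex.I * u) ^ (-(b : ℂ)) = 0 := by
  induction k with
  | zero => intro b hb; simpa using integral_eta_cpow hη (by simpa using hb)
  | succ k ih =>
    intro b hb
    push_cast at hb
    have e : ∀ u : ℝ, (u : ℂ) ^ (k + 1) * ((η : ℂ) + Complex.I * u) ^ (-(b : ℂ))
        = -Complex.I * ((u : ℂ) ^ k * ((η : ℂ) + Complex.I * u) ^ (-((b - 1 : ℝ) : ℂ)))
          + Complex.I * η * ((u : ℂ) ^ k * ((η : ℂ) + Complex.I * u) ^ (-(b : ℂ))) := by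
      intro u
      have h0 := eta_add_ne_zero hη u
      have h1 : -((b - 1 : ℝ) : ℂ) = -(b : ℂ) + 1 := by push_cast; ring
      rw [h1, Complex.cpow_add _ _ h0, Complex.cpow_one, pow_succ]
      linear_combination ((u : ℂ) * (u : ℂ) ^ k * ((η : ℂ) + Complex.I * u) ^ (-(b : ℂ)))
        * Complex.I_mul_I
    simp_rw [e]
    rw [integral_add, integral_const_mul, integral_const_mul, ih (b - 1) (by linarith),
      ih b (by linarith)]
    · simp
    · exact (integrable_pow_mul_eta_cpow hη (by linarith)).const_mul _
    · exact (integrable_pow_mul_eta_cpow hη (by linarith)).const_mul _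

end

end DTB


namespace DTB

noncomputable section

/-! ### Compactly supported kernels of class `C^{m,1}` -/

/-- Compactly supported functions of class `C^m` whose derivative of order `m` is Lipschitz. -/
structure IsTestKernel (m : ℕ) (φ : ℝ → ℝ) : Prop where
  compact : HasCompactSupport φ
  smooth : ContDiff ℝ m φ
  lipschitz : ∃ K, LipschitzWith K (iteratedDeriv m φ)

namespace IsTestKernel

variable {m : ℕ} {φ : ℝ → ℝ}

theorem continuous (hφ : IsTestKernel m φ) : Continuous φ := hφ.smooth.continuous

theorem hasCompactSupport_iteratedDeriv (hφ : IsTestKernel m φ) (k : ℕ) :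
    HasCompactSupport (iteratedDeriv k φ) := by
  induction k with
  | zero => simpa using hφ.compact
  | succ k ih => rw [iteratedDeriv_succ]; exact ih.deriv

theorem continuous_iteratedDeriv (hφ : IsTestKernel m φ) {k : ℕ} (hk : k ≤ m) :
    Continuous (iteratedDeriv k φ) :=
  hφ.smooth.continuous_iteratedDeriv k (by exact_mod_cast hk)

theorem integrable_iteratedDeriv (hφ : IsTestKernel m φ) {k : ℕ} (hk : k ≤ m) :
    Integrable fun y => ((iteratedDeriv k φ y : ℝ) : ℂ) :=
  ((hφ.continuous_iteratedDeriv hk).integrable_of_hasCompactSupport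
    (hφ.hasCompactSupport_iteratedDeriv k)).ofReal

theorem integrable (hφ : IsTestKernel m φ) : Integrable fun y => ((φ y : ℝ) : ℂ) := by
  simpa using hφ.integrable_iteratedDeriv (Nat.zero_le m)

theorem ft_iteratedDeriv (hφ : IsTestKernel m φ) (l : ℝ) {k : ℕ} (hk : k ≤ m) :
    ft (fun y => ((iteratedDeriv k φ y : ℝ) : ℂ)) l
      = (-(Complex.I * l)) ^ k * ft (fun y => (φ y : ℂ)) l := by
  induction k with
  | zero => simp
  | succ k ih =>
    rw [pow_succ', mul_assoc, ← ih (by omega)]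
    have hd : ∀ y : ℝ, HasDerivAt (fun y => ((iteratedDeriv k φ y : ℝ) : ℂ))
        ((iteratedDeriv (k + 1) φ y : ℝ) : ℂ) y := by
      intro y
      have h1 : DifferentiableAt ℝ (iteratedDeriv k φ) y :=
        hφ.smooth.differentiable_iteratedDeriv k (by exact_mod_cast hk) y
      have := h1.hasDerivAt.ofReal_comp
      rwa [← iteratedDeriv_succ] at this
    have he : ∀ y : ℝ, HasDerivAt (fun y : ℝ => Complex.exp (Complex.I * l * y))
        (Complex.exp (Complex.I * l * y) * (Complex.I * l)) y := by
      intro y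
      have h1 : HasDerivAt (fun u : ℂ => Complex.I * l * u) (Complex.I * l) (y : ℂ) := by
        simpa using (hasDerivAt_id (y : ℂ)).const_mul (Complex.I * l)
      exact h1.cexp.comp_ofReal
    have i1 := integrable_ft_integrand (hφ.integrable_iteratedDeriv hk) l
    have i2 := integrable_ft_integrand (hφ.integrable_iteratedDeriv (by omega : k ≤ m)) l
    have := integral_mul_deriv_eq_deriv_mul_of_integrable (fun y _ => he y) (fun y _ => hd y)
      (by simpa [Pi.mul_def, mul_comm] using i1)
      (by
        refine (i2.const_mul (Complex.I * l)).congr (Eventually.of_forall fun y => ?_)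
        simp only [Pi.mul_apply]; ring)
      (by simpa [Pi.mul_def, mul_comm] using i2)
    unfold ft
    rw [← integral_const_mul]
    calc _ = ∫ y : ℝ, Complex.exp (Complex.I * l * y) * ((iteratedDeriv (k + 1) φ y : ℝ) : ℂ) := by
          congr 1; ext y; ring
      _ = _ := by rw [this, ← integral_neg]; congr 1; ext y; ring

theorem pow_mul_ft (hφ : IsTestKernel m φ) (l : ℝ) :
    (l : ℂ) ^ m * ft (fun y => (φ y : ℂ)) l
      = Complex.I ^ m * ft (fun y => ((iteratedDeriv m φ y : ℝ) : ℂ)) l := by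
  rw [hφ.ft_iteratedDeriv l le_rfl, ← mul_assoc, ← mul_pow]
  congr 2
  linear_combination (l : ℂ) * Complex.I_mul_I

theorem exists_support (hφ : IsTestKernel m φ) : ∃ R : ℝ, 1 ≤ R ∧ ∀ k, ∀ y,
    R < |y| → iteratedDeriv k φ y = 0 := by
  obtain ⟨R, hR⟩ := hφ.compact.isBounded.subset_closedBall 0
  have hs : ∀ k, tsupport (iteratedDeriv k φ) ⊆ tsupport φ := by
    intro k
    induction k with
    | zero => simp
    | succ k ih => rw [iteratedDeriv_succ]; exact tsupport_deriv_subset.trans ih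
  refine ⟨max R 1, le_max_right _ _, fun k y hy => image_eq_zero_of_notMem_tsupport fun h => ?_⟩
  have := hR (hs k h)
  rw [mem_closedBall_zero_iff, Real.norm_eq_abs] at this
  exact absurd this (not_le.2 ((le_max_left _ _).trans_lt hy))

/-- Shifting y by the half-period π/l changes the sign of e^(ily), so twice the transform is the
transform of f(y) - f(y + π/l), a function of size at most Kπ/|l|. This gains one power of l without
differentiating f. -/
theorem abs_mul_ft_lipschitz {f : ℝ → ℝ} {K : NNReal} (hf : LipschitzWith K f) {R : ℝ}
    (hR : 0 ≤ R) (hsupp : ∀ y, R < |y| → f y = 0) {l : ℝ} (hl : 1 ≤ |l|) :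
    |l| * ‖ft (fun y => (f y : ℂ)) l‖ ≤ K * Real.pi * (R + 4) := by
  have hl0 : l ≠ 0 := by rintro rfl; simp at hl; linarith
  have hcs : HasCompactSupport f := HasCompactSupport.of_support_subset_isCompact
    (isCompact_closedBall (0 : ℝ) R) fun y hy => by
      rw [mem_closedBall_zero_iff, Real.norm_eq_abs]
      by_contra h
      exact hy (hsupp y (not_le.1 h))
  have hint : Integrable fun y => (f y : ℂ) :=
    (hf.continuous.integrable_of_hasCompactSupport hcs).ofReal
  have i1 := integrable_ft_integrand hint l
  have e1 : ft (fun y => (f y : ℂ)) l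
      = -∫ y : ℝ, (f (y + Real.pi / l) : ℂ) * Complex.exp (Complex.I * l * y) := by
    unfold ft
    rw [← integral_add_right_eq_self _ (Real.pi / l), ← integral_neg]
    congr 1; ext y
    have : Complex.I * l * ((y + Real.pi / l : ℝ) : ℂ) = Complex.I * l * y + Real.pi * Complex.I := by
      have : (l : ℂ) ≠ 0 := Complex.ofReal_ne_zero.2 hl0
      push_cast; field_simp
    rw [this, Complex.exp_add, Complex.exp_pi_mul_I]; ring
  have i2 : Integrable fun y : ℝ => (f (y + Real.pi / l) : ℂ) * Complex.exp (Complex.I * l * y) :=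
    integrable_ft_integrand (ψ := fun y => (f (y + Real.pi / l) : ℂ))
      (hint.comp_add_right (Real.pi / l)) l
  have e2 : 2 * ft (fun y => (f y : ℂ)) l = ∫ y : ℝ, (((f y : ℂ)
      - (f (y + Real.pi / l) : ℂ)) * Complex.exp (Complex.I * l * y)) := by
    rw [two_mul]
    nth_rewrite 2 [e1]
    unfold ft
    rw [← sub_eq_add_neg, ← integral_sub i1 i2]
    congr 1; ext y; ring
  have hb : ∀ y : ℝ, ‖((f y : ℂ) - (f (y + Real.pi / l) : ℂ)) * Complex.exp (Complex.I * l * y)‖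
      ≤ (Set.Icc (-(R + 4)) (R + 4)).indicator (fun _ => K * (Real.pi / |l|)) y := by
    intro y
    -- For |l| ≥ 1 the shift is at most π ≤ 4, so both terms of the difference vanish outside [-(R +
    -- 4), R + 4].
    have hpl : |Real.pi / l| ≤ 4 := by
      rw [abs_div, abs_of_pos Real.pi_pos, div_le_iff₀ (by linarith)]
      nlinarith [Real.pi_le_four]
    rw [norm_mul, norm_cexp_I_mul, mul_one, ← Complex.ofReal_sub, Complex.norm_real]
    by_cases hy : y ∈ Set.Icc (-(R + 4)) (R + 4)
    · rw [Set.indicator_of_mem hy]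
      have := hf.dist_le_mul y (y + Real.pi / l)
      rw [Real.dist_eq, Real.dist_eq] at this
      rw [Real.norm_eq_abs]
      refine this.trans (le_of_eq ?_)
      rw [show y - (y + Real.pi / l) = -(Real.pi / l) by ring, abs_neg, abs_div,
        abs_of_pos Real.pi_pos]
    · rw [Set.indicator_of_notMem hy]
      have hy2 : R + 4 < |y| := by
        rw [Set.mem_Icc, ← abs_le] at hy; exact not_le.1 hy
      rw [hsupp y (by linarith), hsupp (y + Real.pi / l)]
      · simp
      · have := abs_sub_abs_le_abs_sub y (-(Real.pi / l))
        rw [abs_neg, sub_neg_eq_add] at this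
        linarith
  have hbi : Integrable ((Set.Icc (-(R + 4)) (R + 4)).indicator
      (fun _ : ℝ => (K : ℝ) * (Real.pi / |l|))) :=
    (integrable_indicator_iff measurableSet_Icc).2 (integrableOn_const (by simp))
  have h3 := norm_integral_le_of_norm_le hbi (Eventually.of_forall hb)
  rw [← e2, integral_indicator measurableSet_Icc, setIntegral_const, norm_mul] at h3
  simp only [Complex.norm_ofNat, Real.volume_real_Icc, smul_eq_mul] at h3
  rw [max_eq_left (by linarith)] at h3
  have hlp : 0 < |l| := by linarith
  have : |l| * (2 * ‖ft (fun y => (f y : ℂ)) l‖) ≤ 2 * (K * Real.pi * (R + 4)) := by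
    calc _ ≤ |l| * ((R + 4 - -(R + 4)) * (K * (Real.pi / |l|))) := by gcongr
      _ = _ := by field_simp; ring
  linarith

/-- Integration by parts gives m powers of decay, and the Lipschitz bound on the last derivative
gives one more. -/
theorem exists_ft_bound (hφ : IsTestKernel m φ) : ∃ C : ℝ, 0 ≤ C ∧ ∀ l : ℝ,
    ‖ft (fun y => (φ y : ℂ)) l‖ ≤ C * (1 + |l|) ^ (-((m : ℝ) + 1)) := by
  obtain ⟨R, hR, hsupp⟩ := hφ.exists_support
  obtain ⟨K, hK⟩ := hφ.lipschitz
  set A := ∫ y, ‖(φ y : ℂ)‖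
  have hA : 0 ≤ A := integral_nonneg fun _ => norm_nonneg _
  set B : ℝ := K * Real.pi * (R + 4)
  have hB : 0 ≤ B := by positivity
  refine ⟨(A + B) * 2 ^ ((m : ℝ) + 1), by positivity, fun l => ?_⟩
  rw [Real.rpow_neg (by positivity), ← div_eq_mul_inv, le_div_iff₀ (by positivity)]
  rcases le_or_gt |l| 1 with hl | hl
  · have h1 : ‖ft (fun y => (φ y : ℂ)) l‖ ≤ A := norm_ft_le _ _
    have h2 : (1 + |l|) ^ ((m : ℝ) + 1) ≤ 2 ^ ((m : ℝ) + 1) :=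
      Real.rpow_le_rpow (by positivity) (by linarith) (by positivity)
    gcongr; linarith
  · have h1 := abs_mul_ft_lipschitz hK (by linarith) (hsupp m) hl.le
    have h2 : |l| ^ m * ‖ft (fun y => (φ y : ℂ)) l‖
        = ‖ft (fun y => ((iteratedDeriv m φ y : ℝ) : ℂ)) l‖ := by
      have := congrArg norm (hφ.pow_mul_ft l)
      simpa [norm_mul, norm_pow] using this
    rw [← h2] at h1
    have h3 : (1 + |l|) ^ ((m : ℝ) + 1) ≤ (2 * |l|) ^ ((m : ℝ) + 1) :=
      Real.rpow_le_rpow (by positivity) (by linarith) (by positivity)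
    have h4 : (2 * |l|) ^ ((m : ℝ) + 1) = 2 ^ ((m : ℝ) + 1) * (|l| * |l| ^ m) := by
      rw [Real.mul_rpow (by norm_num) (by positivity), Real.rpow_add_one (x := |l|) (by positivity),
        Real.rpow_natCast]; ring
    calc _ ≤ ‖ft (fun y => (φ y : ℂ)) l‖ * (2 ^ ((m : ℝ) + 1) * (|l| * |l| ^ m)) := by
          rw [← h4]; gcongr
      _ = 2 ^ ((m : ℝ) + 1) * (|l| * (|l| ^ m * ‖ft (fun y => (φ y : ℂ)) l‖)) := by ring
      _ ≤ 2 ^ ((m : ℝ) + 1) * B := by gcongr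
      _ ≤ _ := by nlinarith [Real.rpow_pos_of_pos (two_pos : (0 : ℝ) < 2) ((m : ℝ) + 1)]

/-- Decay of order m + 1 makes every exponent below m absolutely integrable. The exponent β of the
filter lies in [m, m + 1) and is not covered; for this reason `psi` is defined by Abel summation. -/
theorem integrable_rpow_mul_ft (hφ : IsTestKernel m φ) {a : ℝ} (ha : -1 < a) (ham : a < m) :
    IntegrableOn (fun l : ℝ => l ^ a * ‖ft (fun y => (φ y : ℂ)) l‖) (Set.Ioi 0) := by
  obtain ⟨C, hC, hb⟩ := hφ.exists_ft_bound
  have hm : AEStronglyMeasurable (fun l : ℝ => l ^ a * ‖ft (fun y => (φ y : ℂ)) l‖)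
      (volume : Measure ℝ) := by
    have := (continuous_ft hφ.integrable).measurable
    exact Measurable.aestronglyMeasurable (by fun_prop)
  rw [← Set.Ioc_union_Ioi_eq_Ioi (zero_le_one (α := ℝ))]
  refine IntegrableOn.union ?_ ?_
  · have h1 : IntegrableOn (fun l : ℝ => C * l ^ a) (Set.Ioc 0 1) := by
      have := (intervalIntegral.intervalIntegrable_rpow' (a := 0) (b := 1) ha).const_mul C
      rwa [intervalIntegrable_iff_integrableOn_Ioc_of_le zero_le_one] at this
    refine Integrable.mono' h1 hm.restrict ?_
    filter_upwards [ae_restrict_mem measurableSet_Ioc] with l hl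
    have h2 : 0 ≤ l ^ a := Real.rpow_nonneg hl.1.le _
    have h3 : ‖ft (fun y => (φ y : ℂ)) l‖ ≤ C := (hb l).trans (by
      have : (1 + |l|) ^ (-((m : ℝ) + 1)) ≤ 1 :=
        Real.rpow_le_one_of_one_le_of_nonpos (by linarith [abs_nonneg l]) (by linarith [(Nat.cast_nonneg m : (0:ℝ) ≤ m)])
      nlinarith)
    rw [Real.norm_of_nonneg (by positivity)]
    nlinarith
  · have h1 : IntegrableOn (fun l : ℝ => C * l ^ (a - (m + 1))) (Set.Ioi 1) :=
      (integrableOn_Ioi_rpow_of_lt (by linarith) one_pos).const_mul C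
    refine Integrable.mono' h1 hm.restrict ?_
    filter_upwards [ae_restrict_mem measurableSet_Ioi] with l hl
    have hl0 : (0 : ℝ) < l := lt_trans one_pos hl
    have h2 : 0 ≤ l ^ a := Real.rpow_nonneg hl0.le _
    rw [Real.norm_of_nonneg (by positivity)]
    have h3 : (1 + |l|) ^ (-((m : ℝ) + 1)) ≤ l ^ (-((m : ℝ) + 1)) :=
      Real.rpow_le_rpow_of_nonpos hl0 (by rw [abs_of_pos hl0]; linarith)
        (by linarith [(Nat.cast_nonneg m : (0:ℝ) ≤ m)])
    calc _ ≤ l ^ a * (C * l ^ (-((m : ℝ) + 1))) := by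
          gcongr; exact (hb l).trans (by gcongr)
      _ = _ := by rw [sub_eq_add_neg, Real.rpow_add hl0]; ring

/-- Trades l^m for m derivatives of φ, so that the critical exponent meets a function that is merely
Lipschitz. -/
theorem lap_add_natCast (hφ : IsTestKernel m φ) (a : ℝ) (r : ℂ) :
    lap (a + m) (ft fun y => (φ y : ℂ)) r
      = Complex.I ^ m * lap a (ft fun y => ((iteratedDeriv m φ y : ℝ) : ℂ)) r := by
  unfold lap
  rw [← integral_const_mul]
  refine setIntegral_congr_fun measurableSet_Ioi fun l hl => ?_
  have h := hφ.pow_mul_ft l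
  rw [Real.rpow_add hl, Real.rpow_natCast]
  push_cast
  linear_combination ((l ^ a : ℝ) : ℂ) * Complex.exp (-(r * l)) * h

end IsTestKernel

end

end DTB


namespace DTB

noncomputable section

/-! ### The filtered kernel as a boundary value -/

/-- The continuous function `(2π)⁻¹ ∫_0^∞ l^β φ̂(l) e^{-ilt} dl`, defined by Abel summation. -/
def psi (β : ℝ) (φ : ℝ → ℝ) (t : ℝ) : ℂ :=
  limUnder (𝓝[>] 0) fun η => abelExt β (fun y => (φ y : ℂ)) η t

theorem norm_halfKer (a η u : ℝ) (ha : -1 < a) :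
    ‖halfKer a (η + Complex.I * u)‖
      = Real.Gamma (a + 1) / (2 * Real.pi) * ‖(η : ℂ) + Complex.I * u‖ ^ (-(a + 1)) := by
  have : 0 < Real.Gamma (a + 1) := Real.Gamma_pos_of_pos (by linarith)
  rw [halfKer, norm_mul, Complex.norm_real, Real.norm_of_nonneg (by positivity)]
  have h : (-(a + 1 : ℂ)) = -((a + 1 : ℝ) : ℂ) := by push_cast; ring
  rw [h, norm_eta_cpow]

/-- Points at distance at most one use the Lipschitz bound, points farther apart use boundedness. -/
theorem holder_of_lipschitz {f : ℝ → ℝ} {K : NNReal} (hf : LipschitzWith K f) {M θ : ℝ}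
    (hM : ∀ y, |f y| ≤ M) (h0 : 0 ≤ θ) (h1 : θ ≤ 1) (x y : ℝ) :
    |f x - f y| ≤ (K + 2 * M) * |x - y| ^ θ := by
  have hM0 : 0 ≤ M := (abs_nonneg _).trans (hM 0)
  rcases le_or_gt |x - y| 1 with h | h
  · have h2 := hf.dist_le_mul x y
    rw [Real.dist_eq, Real.dist_eq] at h2
    have h3 : |x - y| ≤ |x - y| ^ θ := by
      simpa using Real.rpow_le_rpow_of_exponent_ge' (abs_nonneg (x - y)) h h0 h1
    calc _ ≤ K * |x - y| := h2
      _ ≤ (K + 2 * M) * |x - y| ^ θ := by gcongr; linarith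
  · have h3 : 1 ≤ |x - y| ^ θ := Real.one_le_rpow h.le h0
    calc |f x - f y| ≤ |f x| + |f y| := abs_sub _ _
      _ ≤ (K + 2 * M) * 1 := by linarith [hM x, hM y, K.2]
      _ ≤ _ := by gcongr

theorem continuous_abelExt {a η : ℝ} {ψ : ℝ → ℂ} (ha : -1 < a) (hη : 0 < η) (hψ : Integrable ψ) :
    Continuous fun t => abelExt a ψ η t := by
  unfold abelExt
  refine continuous_const.mul (continuous_iff_continuousAt.2 fun t => ?_)
  have h := (lap_hasDerivAt (r := η + Complex.I * t) ha (by simpa using hη)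
    (continuous_ft hψ).measurable (norm_ft_le ψ)).continuousAt
  exact ContinuousAt.comp (f := fun t : ℝ => (η : ℂ) + Complex.I * t) h (by fun_prop)

theorem abelExt_hasDerivAt {a η : ℝ} {ψ : ℝ → ℂ} (ha : -1 < a) (hη : 0 < η) (hψ : Integrable ψ)
    (t : ℝ) : HasDerivAt (fun η => abelExt a ψ η t) (-abelExt (a + 1) ψ η t) η := by
  have h := lap_hasDerivAt (r := η + Complex.I * t) ha (by simpa using hη)
    (continuous_ft hψ).measurable (norm_ft_le ψ)
  have h1 : HasDerivAt (fun z : ℂ => z + Complex.I * t) 1 (η : ℂ) := by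
    simpa using (hasDerivAt_id (η : ℂ)).add_const (Complex.I * t)
  have h2 := ((h.comp (η : ℂ) h1).comp_ofReal).const_mul (1 / (2 * Real.pi : ℂ))
  refine h2.congr_deriv ?_
  unfold abelExt; ring

/-- The kernel has integral zero, so f(t) may be subtracted under the integral; the difference
vanishes at u = 0 and compensates the singularity that forms as η → 0. -/
theorem abelExt_eq_sub {ρ η : ℝ} {f : ℝ → ℂ} (hρ : 0 ≤ ρ) (hη : 0 < η) (hf : Integrable f) (t : ℝ) :
    abelExt (ρ + 1) f η t = ∫ u : ℝ, halfKer (ρ + 1) (η + Complex.I * u) * (f (t - u) - f t) := by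
  rw [abelExt_eq (by linarith) hη hf, ← integral_sub_left_eq_self _ volume t]
  simp only [sub_sub_cancel]
  have h0 := integral_eta_cpow hη (b := ρ + 1 + 1) (by linarith)
  have hi := integrable_pow_mul_eta_cpow (k := 0) (b := ρ + 1 + 1) hη (by simp; linarith)
  have e : ∀ u : ℝ, halfKer (ρ + 1) (η + Complex.I * u) * f t
      = ((Real.Gamma (ρ + 1 + 1) / (2 * Real.pi) : ℝ) : ℂ) * f t *
        (((η : ℂ) + Complex.I * u) ^ (-((ρ + 1 + 1 : ℝ) : ℂ))) := by
    intro u; rw [halfKer]; push_cast; ring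
  have hi2 : Integrable fun u : ℝ => halfKer (ρ + 1) (η + Complex.I * u) * f t := by
    simp_rw [e]
    simp only [pow_zero, one_mul] at hi
    exact hi.const_mul _
  have hz : ∫ u : ℝ, halfKer (ρ + 1) (η + Complex.I * u) * f t = 0 := by
    simp_rw [e]; rw [integral_const_mul, h0, mul_zero]
  have hi1 : Integrable fun u : ℝ => halfKer (ρ + 1) (η + Complex.I * u) * f (t - u) := by
    refine Integrable.bdd_mul (c := Real.Gamma (ρ + 1 + 1) / (2 * Real.pi) * η ^ (-(ρ + 1 + 1)))
      (hf.comp_sub_left t) ?_ (Eventually.of_forall fun u => ?_)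
    · exact (continuous_const.mul (continuous_eta_cpow hη _)).aestronglyMeasurable
    · have : 0 < Real.Gamma (ρ + 1 + 1) := Real.Gamma_pos_of_pos (by linarith)
      have h := norm_eta_add_ge' η u
      rw [abs_of_pos hη] at h
      have h' := Real.rpow_le_rpow_of_nonpos hη h (show -(ρ + 1 + 1) ≤ 0 by linarith)
      rw [norm_halfKer (ρ + 1) η u (by linarith)]
      exact mul_le_mul_of_nonneg_left h' (by positivity)
  simp_rw [mul_sub]
  rw [integral_sub hi1 hi2, hz, sub_zero]

variable {m : ℕ} {φ : ℝ → ℝ} {β : ℝ}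

namespace IsTestKernel

/-- The η-derivative of the Abel means is, up to sign, the Abel mean with exponent β + 1. After m
derivatives are moved onto φ and the value at t is subtracted, a kernel of size |η + iu|^(-(ρ+2))
meets a Hölder factor |u|^θ, and scaling gives η^(θ-ρ-1), which is integrable at η = 0. -/
theorem exists_deriv_bound (hφ : IsTestKernel m φ) (h1 : m ≤ β) (h2 : β < m + 1) :
    ∃ C ν : ℝ, 0 ≤ C ∧ 0 < ν ∧ ∀ η, 0 < η → ∀ t,
      ‖abelExt (β + 1) (fun y => (φ y : ℂ)) η t‖ ≤ C * η ^ (ν - 1) := by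
  set ρ := β - m with hρ
  have hρ0 : 0 ≤ ρ := by linarith
  have hρ1 : ρ < 1 := by linarith
  -- Any exponent strictly between ρ and 1 would do: above ρ the power of η exceeds -1, and below 1
  -- it is an admissible Hölder exponent of a bounded Lipschitz function.
  set θ := (1 + ρ) / 2 with hθ
  obtain ⟨K, hK⟩ := hφ.lipschitz
  set f := iteratedDeriv m φ with hf
  have hcs := hφ.hasCompactSupport_iteratedDeriv m
  obtain ⟨M, hM⟩ := hcs.exists_bound_of_continuous (hφ.continuous_iteratedDeriv le_rfl)
  have hM0 : 0 ≤ M := (norm_nonneg _).trans (hM 0)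
  have hG : 0 < Real.Gamma (ρ + 1 + 1) := Real.Gamma_pos_of_pos (by linarith)
  set J := ∫ u : ℝ, |u| ^ θ * ‖((1 : ℝ) : ℂ) + Complex.I * u‖ ^ (-(ρ + 1 + 1))
  have hJ : 0 ≤ J := integral_nonneg fun u => by positivity
  set A := Real.Gamma (ρ + 1 + 1) / (2 * Real.pi) * (K + 2 * M)
  refine ⟨A * J, (1 - ρ) / 2, by positivity, by linarith, fun η hη t => ?_⟩
  have e1 : abelExt (β + 1) (fun y => (φ y : ℂ)) η t
      = Complex.I ^ m * abelExt (ρ + 1) (fun y => (f y : ℂ)) η t := by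
    unfold abelExt
    have : β + 1 = (ρ + 1) + m := by rw [hρ]; ring
    rw [this, hφ.lap_add_natCast]; ring
  rw [e1, norm_mul, norm_pow, Complex.norm_I, one_pow, one_mul,
    abelExt_eq_sub hρ0 hη (hφ.integrable_iteratedDeriv le_rfl)]
  have hi := (integrable_abs_rpow_mul (θ := θ) (b := ρ + 1 + 1) hη (by linarith)
    (by linarith)).const_mul A
  refine (norm_integral_le_of_norm_le hi (Eventually.of_forall fun u => ?_)).trans (le_of_eq ?_)
  · rw [norm_mul, norm_halfKer _ _ _ (by linarith), ← Complex.ofReal_sub, Complex.norm_real,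
      Real.norm_eq_abs]
    have h3 := holder_of_lipschitz hK (M := M) (θ := θ) hM (by linarith) (by linarith) (t - u) t
    rw [show t - u - t = -u by ring, abs_neg] at h3
    calc _ ≤ Real.Gamma (ρ + 1 + 1) / (2 * Real.pi) * ‖(η : ℂ) + Complex.I * u‖ ^ (-(ρ + 1 + 1)) *
          ((K + 2 * M) * |u| ^ θ) := by gcongr
      _ = _ := by ring
  · rw [integral_const_mul, integral_abs_rpow_mul hη]
    have : θ - (ρ + 1 + 1) + 1 = (1 - ρ) / 2 - 1 := by rw [hθ]; ring
    rw [this]; ring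

/-- The derivative bound is integrated from ζ to η, its primitive being (C/ν)η^ν. The Abel means
therefore converge as η → 0, uniformly in t. -/
theorem exists_cauchy_bound (hφ : IsTestKernel m φ) (h1 : m ≤ β) (h2 : β < m + 1) :
    ∃ C ν : ℝ, 0 ≤ C ∧ 0 < ν ∧ ∀ η ζ, 0 < ζ → ζ ≤ η → ∀ t,
      ‖abelExt β (fun y => (φ y : ℂ)) η t - abelExt β (fun y => (φ y : ℂ)) ζ t‖ ≤ C * η ^ ν := by
  obtain ⟨C, ν, hC, hν, hb⟩ := hφ.exists_deriv_bound h1 h2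
  have hβ : -1 < β := by linarith [(Nat.cast_nonneg m : (0 : ℝ) ≤ m)]
  refine ⟨C / ν, ν, by positivity, hν, fun η ζ hζ hζη t => ?_⟩
  have hder : ∀ x, 0 < x → HasDerivAt (fun x => abelExt β (fun y => (φ y : ℂ)) x t -
      abelExt β (fun y => (φ y : ℂ)) ζ t) (-abelExt (β + 1) (fun y => (φ y : ℂ)) x t) x :=
    fun x hx => (abelExt_hasDerivAt hβ hx hφ.integrable t).sub_const _
  have hB : ∀ x, 0 < x → HasDerivAt (fun x : ℝ => C / ν * (x ^ ν - ζ ^ ν)) (C * x ^ (ν - 1)) x := by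
    intro x hx
    have := ((Real.hasDerivAt_rpow_const (x := x) (p := ν) (Or.inl hx.ne')).sub_const
      (ζ ^ ν)).const_mul (C / ν)
    refine this.congr_deriv ?_
    field_simp
  have key := image_norm_le_of_norm_deriv_right_le_deriv_boundary' (a := ζ) (b := η)
    (fun x hx => (hder x (hζ.trans_le hx.1)).continuousAt.continuousWithinAt)
    (fun x hx => (hder x (hζ.trans_le hx.1)).hasDerivWithinAt)
    (B := fun x : ℝ => C / ν * (x ^ ν - ζ ^ ν)) (by simp)
    (fun x hx => (hB x (hζ.trans_le hx.1)).continuousAt.continuousWithinAt)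
    (fun x hx => (hB x (hζ.trans_le hx.1)).hasDerivWithinAt)
    (fun x hx => by rw [norm_neg]; exact hb x (hζ.trans_le hx.1) t)
    (Set.right_mem_Icc.2 hζη)
  refine key.trans ?_
  have : 0 ≤ ζ ^ ν := by positivity
  gcongr
  linarith

theorem tendsto_psi (hφ : IsTestKernel m φ) (h1 : m ≤ β) (h2 : β < m + 1) (t : ℝ) :
    Tendsto (fun η => abelExt β (fun y => (φ y : ℂ)) η t) (𝓝[>] 0) (𝓝 (psi β φ t)) := by
  obtain ⟨C, ν, hC, hν, hb⟩ := hφ.exists_cauchy_bound h1 h2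
  refine tendsto_nhds_limUnder (cauchy_map_iff_exists_tendsto.1 (Metric.cauchy_iff.2
    ⟨inferInstance, fun ε hε => ?_⟩))
  have hlim : Tendsto (fun η : ℝ => C * η ^ ν) (𝓝[>] 0) (𝓝 0) := by
    have := ((Real.continuous_rpow_const (q := ν) hν.le).tendsto 0).const_mul C
    rw [Real.zero_rpow hν.ne', mul_zero] at this
    exact this.mono_left nhdsWithin_le_nhds
  have hev := (hlim.eventually (gt_mem_nhds hε)).and self_mem_nhdsWithin
  refine ⟨_, image_mem_map hev, ?_⟩
  rintro _ ⟨x, ⟨hx, hx0⟩, rfl⟩ _ ⟨y, ⟨hy, hy0⟩, rfl⟩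
  rcases le_total x y with h | h
  · rw [dist_comm, dist_eq_norm]; exact (hb y x hx0 h t).trans_lt hy
  · rw [dist_eq_norm]; exact (hb x y hy0 h t).trans_lt hx

theorem exists_psi_bound (hφ : IsTestKernel m φ) (h1 : m ≤ β) (h2 : β < m + 1) :
    ∃ C ν : ℝ, 0 ≤ C ∧ 0 < ν ∧ ∀ η, 0 < η → ∀ t,
      ‖abelExt β (fun y => (φ y : ℂ)) η t - psi β φ t‖ ≤ C * η ^ ν := by
  obtain ⟨C, ν, hC, hν, hb⟩ := hφ.exists_cauchy_bound h1 h2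
  refine ⟨C, ν, hC, hν, fun η hη t => ?_⟩
  refine le_of_tendsto ((tendsto_const_nhds.sub (hφ.tendsto_psi h1 h2 t)).norm) ?_
  filter_upwards [Ioc_mem_nhdsGT hη] with ζ hζ
  exact hb η ζ hζ.1 hζ.2 t

/-- A uniform limit of the Abel means, each of which is continuous in t. -/
theorem continuous_psi (hφ : IsTestKernel m φ) (h1 : m ≤ β) (h2 : β < m + 1) :
    Continuous (psi β φ) := by
  obtain ⟨C, ν, hC, hν, hb⟩ := hφ.exists_psi_bound h1 h2
  have hβ : -1 < β := by linarith [(Nat.cast_nonneg m : (0 : ℝ) ≤ m)]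
  have hlim : Tendsto (fun η : ℝ => C * η ^ ν) (𝓝[>] 0) (𝓝 0) := by
    have := ((Real.continuous_rpow_const (q := ν) hν.le).tendsto 0).const_mul C
    rw [Real.zero_rpow hν.ne', mul_zero] at this
    exact this.mono_left nhdsWithin_le_nhds
  have hu : TendstoUniformly (fun η t => abelExt β (fun y => (φ y : ℂ)) η t) (psi β φ) (𝓝[>] 0) := by
    rw [Metric.tendstoUniformly_iff]
    intro ε hε
    filter_upwards [hlim.eventually (gt_mem_nhds hε), self_mem_nhdsWithin] with η hη hη0 t
    rw [dist_comm, dist_eq_norm]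
    exact (hb η hη0 t).trans_lt hη
  refine hu.continuous (Eventually.frequently ?_)
  filter_upwards [self_mem_nhdsWithin] with η hη
  exact continuous_abelExt hβ hη hφ.integrable

/-- Far from the support of φ the convolution kernel is of size |t|^(-(β+1)), uniformly in η. For
bounded t the means at η are compared with those at η = 1 through their common limit. -/
theorem exists_abelExt_decay (hφ : IsTestKernel m φ) (h1 : m ≤ β) (h2 : β < m + 1) :
    ∃ C : ℝ, 0 ≤ C ∧ ∀ η, 0 < η → η ≤ 1 → ∀ t,
      ‖abelExt β (fun y => (φ y : ℂ)) η t‖ ≤ C * (1 + |t|) ^ (-(β + 1)) := by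
  obtain ⟨C, ν, hC, hν, hb⟩ := hφ.exists_psi_bound h1 h2
  obtain ⟨R, hR, hsupp⟩ := hφ.exists_support
  have hβ : -1 < β := by linarith [(Nat.cast_nonneg m : (0 : ℝ) ≤ m)]
  have hG : 0 < Real.Gamma (β + 1) := Real.Gamma_pos_of_pos (by linarith)
  set A := ∫ y, ‖(φ y : ℂ)‖
  have hA : 0 ≤ A := integral_nonneg fun _ => norm_nonneg _
  set g := Real.Gamma (β + 1) / (2 * Real.pi)
  have hg : 0 < g := by positivity
  have hker : ∀ η t c : ℝ, 0 < η → (0 < c) → (∀ y, |y| ≤ R → c ≤ ‖(η : ℂ) + Complex.I * ((t - y : ℝ) : ℂ)‖) →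
      ‖abelExt β (fun y => (φ y : ℂ)) η t‖ ≤ g * c ^ (-(β + 1)) * A := by
    intro η t c hη hc hy
    rw [abelExt_eq hβ hη hφ.integrable, ← integral_const_mul]
    refine norm_integral_le_of_norm_le (hφ.integrable.norm.const_mul _)
      (Eventually.of_forall fun y => ?_)
    rcases le_or_gt |y| R with h | h
    · have h' := Real.rpow_le_rpow_of_nonpos hc (hy y h) (show -(β + 1) ≤ 0 by linarith)
      rw [norm_mul, norm_halfKer _ _ _ hβ]
      gcongr
    · have := hsupp 0 y h
      rw [iteratedDeriv_zero] at this
      simp [this]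
  have hbig : ∀ η t, 0 < η → 2 * R ≤ |t| → ‖abelExt β (fun y => (φ y : ℂ)) η t‖
      ≤ g * 4 ^ (β + 1) * A * (1 + |t|) ^ (-(β + 1)) := by
    intro η t hη ht
    refine (hker η t ((1 + |t|) / 4) hη (by positivity) fun y hy => ?_).trans (le_of_eq ?_)
    · refine le_trans ?_ (norm_eta_add_ge η (t - y))
      have := abs_sub_abs_le_abs_sub t y
      linarith
    · rw [Real.div_rpow (by positivity) (by norm_num), Real.rpow_neg (by norm_num : (0 : ℝ) ≤ 4)]
      field_simp
  have hone : ∀ t, ‖abelExt β (fun y => (φ y : ℂ)) 1 t‖ ≤ g * A := by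
    intro t
    simpa using hker 1 t 1 one_pos one_pos fun y _ => by
      simpa using norm_eta_add_ge' 1 (t - y)
  have hsmall : ∀ η t, 0 < η → η ≤ 1 → ‖abelExt β (fun y => (φ y : ℂ)) η t‖ ≤ g * A + 2 * C := by
    intro η t hη hη1
    have a1 := hb 1 one_pos t
    have a2 := hb η hη t
    have a3 : η ^ ν ≤ 1 := Real.rpow_le_one hη.le hη1 hν.le
    rw [Real.one_rpow, mul_one] at a1
    have a4 := norm_sub_le (abelExt β (fun y => (φ y : ℂ)) 1 t)
      ((abelExt β (fun y => (φ y : ℂ)) 1 t - psi β φ t)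
        - (abelExt β (fun y => (φ y : ℂ)) η t - psi β φ t))
    have a5 := norm_sub_le (abelExt β (fun y => (φ y : ℂ)) 1 t - psi β φ t)
      (abelExt β (fun y => (φ y : ℂ)) η t - psi β φ t)
    rw [sub_sub_sub_cancel_right, sub_sub_cancel] at a4
    rw [sub_sub_sub_cancel_right] at a5
    nlinarith [hone t]
  refine ⟨g * 4 ^ (β + 1) * A + (g * A + 2 * C) * (1 + 2 * R) ^ (β + 1), by positivity,
    fun η hη hη1 t => ?_⟩
  have hp : 0 ≤ (1 + |t|) ^ (-(β + 1)) := by positivity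
  rcases le_or_gt (2 * R) |t| with h | h
  · refine (hbig η t hη h).trans ?_
    gcongr
    exact le_add_of_nonneg_right (by positivity)
  · refine (hsmall η t hη hη1).trans ?_
    have : 1 ≤ (1 + 2 * R) ^ (β + 1) * (1 + |t|) ^ (-(β + 1)) := by
      rw [Real.rpow_neg (by positivity), ← div_eq_mul_inv, one_le_div (by positivity)]
      exact Real.rpow_le_rpow (by positivity) (by linarith) (by linarith)
    have h0 : 0 ≤ g * 4 ^ (β + 1) * A * (1 + |t|) ^ (-(β + 1)) := by positivity
    have h3 : 0 ≤ g * A + 2 * C := by positivity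
    nlinarith

theorem psi_decay_of_abelExt (hφ : IsTestKernel m φ) (h1 : m ≤ β) (h2 : β < m + 1) {C : ℝ}
    (hC : ∀ η, 0 < η → η ≤ 1 → ∀ t,
      ‖abelExt β (fun y => (φ y : ℂ)) η t‖ ≤ C * (1 + |t|) ^ (-(β + 1))) (t : ℝ) :
    ‖psi β φ t‖ ≤ C * (1 + |t|) ^ (-(β + 1)) := by
  refine le_of_tendsto (hφ.tendsto_psi h1 h2 t).norm ?_
  filter_upwards [Ioc_mem_nhdsGT one_pos] with η hη
  exact hC η hη.1 hη.2 t

end IsTestKernel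

end

end DTB


namespace DTB

noncomputable section

/-! ### Gaussian summation -/

/-- The Gauss means `(2π)⁻¹ ∫_0^∞ l^β φ̂(l) e^{-ilt} e^{-δl²} dl`. -/
def gaussExt (β : ℝ) (φ : ℝ → ℂ) (δ t : ℝ) : ℂ :=
  1 / (2 * Real.pi) * ∫ l in Set.Ioi (0 : ℝ), ((l ^ β : ℝ) : ℂ) * ft φ l *
    Complex.exp (-(Complex.I * l * t)) * Complex.exp (-((δ * l ^ 2 : ℝ) : ℂ))

/-- `∫_0^∞ l^β e^{-ilp} e^{-δl²} dl`. -/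
def gaussKer (β δ p : ℝ) : ℂ :=
  ∫ l in Set.Ioi (0 : ℝ), ((l ^ β : ℝ) : ℂ) *
    Complex.exp (-(Complex.I * l * p)) * Complex.exp (-((δ * l ^ 2 : ℝ) : ℂ))

theorem integrableOn_rpow_mul_gauss {β δ : ℝ} (hβ : -1 < β) (hδ : 0 < δ) :
    IntegrableOn (fun l : ℝ => l ^ β * Real.exp (-(δ * l ^ 2))) (Set.Ioi 0) := by
  have := integrableOn_rpow_mul_exp_neg_mul_rpow (p := 2) hβ two_pos hδ
  simpa using this

theorem norm_cexp_neg_I (l p : ℝ) : ‖Complex.exp (-(Complex.I * l * p))‖ = 1 := by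
  rw [Complex.norm_exp]; simp

theorem norm_cexp_neg_ofReal (x : ℝ) : ‖Complex.exp (-(x : ℂ))‖ = Real.exp (-x) := by
  rw [Complex.norm_exp, Complex.neg_re, Complex.ofReal_re]

theorem integrable_gaussKer_integrand {β δ : ℝ} (hβ : -1 < β) (hδ : 0 < δ) (p : ℝ) :
    IntegrableOn (fun l : ℝ => ((l ^ β : ℝ) : ℂ) *
      Complex.exp (-(Complex.I * l * p)) * Complex.exp (-((δ * l ^ 2 : ℝ) : ℂ))) (Set.Ioi 0) := by
  refine Integrable.mono' (integrableOn_rpow_mul_gauss hβ hδ)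
    (Measurable.aestronglyMeasurable (by fun_prop)) ?_
  filter_upwards [ae_restrict_mem measurableSet_Ioi] with l hl
  rw [norm_mul, norm_mul, norm_cexp_neg_I, norm_cexp_neg_ofReal, Complex.norm_real,
    Real.norm_of_nonneg (Real.rpow_nonneg (le_of_lt hl) _), mul_one]

theorem gaussKer_neg (β δ p : ℝ) : gaussKer β δ (-p) = (starRingEnd ℂ) (gaussKer β δ p) := by
  unfold gaussKer
  rw [← integral_conj]
  congr 1; ext l
  simp only [map_mul, Complex.conj_ofReal, ← Complex.exp_conj, map_neg, Complex.conj_I,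
    Complex.ofReal_neg]
  congr 3; ring

/-- Negative frequencies, reflected to the positive half-line, contribute the kernel at -p, which is
the complex conjugate since l^β and the Gaussian are real. -/
theorem regKernel_eq {Bt : ℝ → ℂ} {β δ : ℝ} {bp bm : ℂ} (hβ : -1 < β) (hδ : 0 < δ)
    (hp : ∀ l : ℝ, 0 < l → Bt l = ((l ^ β : ℝ) : ℂ) * bp)
    (hm : ∀ l : ℝ, 0 < l → Bt (-l) = ((l ^ β : ℝ) : ℂ) * bm) (p : ℝ) :
    regKernel Bt δ p = 1 / (2 * Real.pi) *
      (bp * gaussKer β δ p + bm * (starRingEnd ℂ) (gaussKer β δ p)) := by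
  unfold regKernel
  congr 1
  set F : ℝ → ℂ := fun l => Bt l * Complex.exp (-(Complex.I * l * p)) *
    Complex.exp (-((δ * l ^ 2 : ℝ) : ℂ))
  have e1 : Set.EqOn F (fun l => bp * (((l ^ β : ℝ) : ℂ) *
      Complex.exp (-(Complex.I * l * p)) * Complex.exp (-((δ * l ^ 2 : ℝ) : ℂ)))) (Set.Ioi 0) := by
    intro l hl
    simp only [F]; rw [hp l hl]; ring
  have e2 : Set.EqOn (fun l => F (-l)) (fun l => bm * (((l ^ β : ℝ) : ℂ) *
      Complex.exp (-(Complex.I * l * (-p : ℝ))) * Complex.exp (-((δ * l ^ 2 : ℝ) : ℂ))))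
      (Set.Ioi 0) := by
    intro l hl
    simp only [F]; rw [hm l hl]; push_cast; ring_nf
  have i1 : IntegrableOn F (Set.Ioi 0) :=
    IntegrableOn.congr_fun ((integrable_gaussKer_integrand hβ hδ p).const_mul bp) e1.symm
      measurableSet_Ioi
  have i2 : IntegrableOn (fun l => F (-l)) (Set.Ioi 0) :=
    IntegrableOn.congr_fun ((integrable_gaussKer_integrand hβ hδ (-p)).const_mul bm) e2.symm
      measurableSet_Ioi
  have i3 : IntegrableOn F (Set.Iic 0) := by
    have := (Measure.measurePreserving_neg (volume : Measure ℝ)).integrableOn_comp_preimage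
      (MeasurableEquiv.neg ℝ).measurableEmbedding (f := F) (s := Set.Iio 0)
    rw [integrableOn_Iic_iff_integrableOn_Iio, ← this]
    simpa [Function.comp_def] using i2
  rw [← gaussKer_neg]
  change ∫ l, F l = _
  rw [← setIntegral_univ, ← Set.Iic_union_Ioi (a := (0 : ℝ)), setIntegral_union
    (Set.Iic_disjoint_Ioi le_rfl) measurableSet_Ioi i3 i1, setIntegral_congr_fun measurableSet_Ioi e1,
    integral_const_mul, add_comm]
  congr 1
  have := integral_comp_neg_Ioi (0 : ℝ) F
  rw [neg_zero] at this
  rw [← this, setIntegral_congr_fun measurableSet_Ioi e2, integral_const_mul]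
  rfl

theorem continuous_gaussKer {β δ : ℝ} (hβ : -1 < β) (hδ : 0 < δ) : Continuous (gaussKer β δ) := by
  unfold gaussKer
  refine continuous_of_dominated (bound := fun l => l ^ β * Real.exp (-(δ * l ^ 2)))
    (fun p => ?_) (fun p => ?_) (integrableOn_rpow_mul_gauss hβ hδ) (Eventually.of_forall fun l => ?_)
  · exact (integrable_gaussKer_integrand hβ hδ p).aestronglyMeasurable
  · filter_upwards [ae_restrict_mem measurableSet_Ioi] with l hl
    rw [norm_mul, norm_mul, norm_cexp_neg_I, norm_cexp_neg_ofReal, Complex.norm_real,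
      Real.norm_of_nonneg (Real.rpow_nonneg (le_of_lt hl) _), mul_one]
  · fun_prop

theorem norm_gaussKer_le {β δ : ℝ} (p : ℝ) :
    ‖gaussKer β δ p‖ ≤ ∫ l in Set.Ioi (0 : ℝ), l ^ β * Real.exp (-(δ * l ^ 2)) := by
  unfold gaussKer
  refine (norm_integral_le_integral_norm _).trans (le_of_eq ?_)
  refine setIntegral_congr_fun measurableSet_Ioi fun l hl => ?_
  rw [norm_mul, norm_mul, norm_cexp_neg_I, norm_cexp_neg_ofReal, Complex.norm_real,
    Real.norm_of_nonneg (Real.rpow_nonneg (le_of_lt hl) _), mul_one]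

theorem integrable_gaussKer_mul {β δ : ℝ} (hβ : -1 < β) (hδ : 0 < δ) {φ : ℝ → ℂ}
    (hφ : Integrable φ) (t : ℝ) : Integrable fun p => gaussKer β δ (t - p) * φ p := by
  refine Integrable.bdd_mul (c := ∫ l in Set.Ioi (0 : ℝ), l ^ β * Real.exp (-(δ * l ^ 2))) hφ ?_
    (Eventually.of_forall fun p => norm_gaussKer_le _)
  exact ((continuous_gaussKer hβ hδ).comp (by fun_prop)).aestronglyMeasurable

theorem integral_gaussKer_mul {β δ : ℝ} (hβ : -1 < β) (hδ : 0 < δ) {φ : ℝ → ℂ}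
    (hφ : Integrable φ) (t : ℝ) :
    1 / (2 * Real.pi) * ∫ p : ℝ, gaussKer β δ (t - p) * φ p = gaussExt β φ δ t := by
  unfold gaussExt gaussKer
  congr 1
  have hint : Integrable (Function.uncurry fun (p l : ℝ) => ((l ^ β : ℝ) : ℂ) *
      Complex.exp (-(Complex.I * l * ((t - p : ℝ) : ℂ))) * Complex.exp (-((δ * l ^ 2 : ℝ) : ℂ)) * φ p)
      (volume.prod (volume.restrict (Set.Ioi (0 : ℝ)))) := by
    have h1 := hφ.norm.mul_prod (integrableOn_rpow_mul_gauss hβ hδ).integrable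
    refine h1.mono' ?_ ?_
    · have hm : Measurable fun z : ℝ × ℝ => ((z.2 ^ β : ℝ) : ℂ) *
        Complex.exp (-(Complex.I * z.2 * ((t - z.1 : ℝ) : ℂ))) *
        Complex.exp (-((δ * z.2 ^ 2 : ℝ) : ℂ)) := by fun_prop
      have h2 : AEStronglyMeasurable (fun z : ℝ × ℝ => φ z.1)
        (volume.prod (volume.restrict (Set.Ioi (0 : ℝ)))) := hφ.aestronglyMeasurable.comp_fst
      exact hm.aestronglyMeasurable.mul h2
    · have hpos : ∀ᵐ z : ℝ × ℝ ∂(volume.prod (volume.restrict (Set.Ioi (0 : ℝ)))), 0 < z.2 :=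
        (Measure.quasiMeasurePreserving_snd (ν := volume.restrict (Set.Ioi (0 : ℝ)))
          (μ := (volume : Measure ℝ))).ae (ae_restrict_mem measurableSet_Ioi)
      filter_upwards [hpos] with z hz
      simp only [Function.uncurry]
      rw [norm_mul, norm_mul, norm_mul, norm_cexp_neg_I, norm_cexp_neg_ofReal, Complex.norm_real,
        Real.norm_of_nonneg (Real.rpow_nonneg hz.le _), mul_one]
      linarith
  simp_rw [← integral_mul_const]
  rw [integral_integral_swap hint]
  congr 1; ext l
  rw [ft, mul_assoc, mul_assoc, ← integral_mul_const, ← integral_const_mul]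
  congr 1; ext p
  have : Complex.exp (-(Complex.I * l * ((t - p : ℝ) : ℂ)))
      = Complex.exp (Complex.I * l * p) * Complex.exp (-(Complex.I * l * t)) := by
    rw [← Complex.exp_add]; congr 1; push_cast; ring
  rw [this]; push_cast; ring

/-- Since φ is real, pairing it with the conjugate kernel gives the conjugate of the Gauss means;
one function describes both halves of the symbol. -/
theorem applyApprox_eq {Bt : ℝ → ℂ} {β δ : ℝ} {bp bm : ℂ} (hβ : -1 < β) (hδ : 0 < δ)
    (hp : ∀ l : ℝ, 0 < l → Bt l = ((l ^ β : ℝ) : ℂ) * bp)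
    (hm : ∀ l : ℝ, 0 < l → Bt (-l) = ((l ^ β : ℝ) : ℂ) * bm) {φ : ℝ → ℝ}
    (hφ : Integrable fun y => (φ y : ℂ)) (t : ℝ) :
    applyApprox Bt φ t δ = bp * gaussExt β (fun y => (φ y : ℂ)) δ t
      + bm * (starRingEnd ℂ) (gaussExt β (fun y => (φ y : ℂ)) δ t) := by
  unfold applyApprox
  have i1 := integrable_gaussKer_mul hβ hδ hφ t
  have i2 : Integrable fun p => (starRingEnd ℂ) (gaussKer β δ (t - p) * (φ p : ℂ)) := by
    exact Complex.conjCLE.toContinuousLinearMap.integrable_comp i1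
  simp_rw [fun p => regKernel_eq hβ hδ hp hm p]
  rw [← integral_gaussKer_mul hβ hδ hφ t, map_mul, ← integral_conj, ← mul_assoc, ← mul_assoc,
    ← integral_const_mul, ← integral_const_mul, ← integral_add (i1.const_mul _) (i2.const_mul _)]
  congr 1; ext p
  simp only [map_mul, map_div₀, map_one, Complex.conj_ofReal, map_ofNat]
  ring

theorem ft_comp_affine {φ : ℝ → ℂ} {ε : ℝ} (hε : 0 < ε) (c l : ℝ) :
    ft (fun y => φ ((y - ε * c) / ε)) l
      = ε * Complex.exp (Complex.I * l * (ε * c)) * ft φ (ε * l) := by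
  unfold ft
  have h := Measure.integral_comp_div
    (fun y : ℝ => φ (y - c) * Complex.exp (Complex.I * l * (ε * y))) ε
  have h2 := integral_sub_right_eq_self
    (fun y : ℝ => φ y * Complex.exp (Complex.I * l * (ε * (y + c)))) (μ := volume) c
  have e1 : ∀ y : ℝ, φ ((y - ε * c) / ε) * Complex.exp (Complex.I * l * y)
      = φ (y / ε - c) * Complex.exp (Complex.I * l * (ε * ((y / ε : ℝ) : ℂ))) := by
    intro y
    have : (ε : ℂ) ≠ 0 := Complex.ofReal_ne_zero.2 hε.ne'
    congr 2
    · field_simp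
    · push_cast; field_simp
  simp_rw [e1]
  rw [h, abs_of_pos hε, Complex.real_smul, mul_assoc]
  congr 1
  rw [← integral_const_mul]
  simp only [Complex.ofReal_sub, sub_add_cancel] at h2
  rw [h2]
  congr 1; ext y
  rw [mul_left_comm (Complex.exp _), ← Complex.exp_add]
  congr 2; push_cast; ring

/-- Scaling the frequency by ε brings out ε^(-β) and turns the regularization δ into δ/ε², which
still tends to zero with δ for fixed ε. -/
theorem gaussExt_comp_affine {φ : ℝ → ℂ} {ε β δ : ℝ} (hε : 0 < ε) (c t : ℝ) :
    gaussExt β (fun y => φ ((y - ε * c) / ε)) δ t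
      = ((ε ^ (-β) : ℝ) : ℂ) * gaussExt β φ (δ / ε ^ 2) (t / ε - c) := by
  unfold gaussExt
  rw [mul_left_comm]
  congr 1
  have h := integral_comp_mul_left_Ioi (fun l : ℝ => ((l ^ β : ℝ) : ℂ) * ft φ l *
    Complex.exp (-(Complex.I * l * ((t / ε - c : ℝ) : ℂ))) *
    Complex.exp (-((δ / ε ^ 2 * l ^ 2 : ℝ) : ℂ))) 0 hε
  rw [mul_zero] at h
  have h2 := congrArg (fun z => (ε : ℂ) * z) h
  simp only [Complex.real_smul, ← mul_assoc] at h2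
  have hε' : (ε : ℂ) ≠ 0 := Complex.ofReal_ne_zero.2 hε.ne'
  rw [Complex.ofReal_inv, mul_inv_cancel₀ hε', one_mul] at h2
  rw [← h2, ← integral_const_mul, ← integral_const_mul]
  refine setIntegral_congr_fun measurableSet_Ioi fun l (hl : 0 < l) => ?_
  rw [ft_comp_affine hε, Real.mul_rpow hε.le hl.le, Real.rpow_neg hε.le]
  have h3 : ((ε ^ β : ℝ) : ℂ) ≠ 0 := Complex.ofReal_ne_zero.2 (Real.rpow_pos_of_pos hε _).ne'
  have h4 : Complex.exp (-(Complex.I * ((ε * l : ℝ) : ℂ) * ((t / ε - c : ℝ) : ℂ)))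
      = Complex.exp (Complex.I * l * (ε * c)) * Complex.exp (-(Complex.I * l * t)) := by
    rw [← Complex.exp_add]; congr 1; push_cast; field_simp; ring
  have h5 : δ / ε ^ 2 * (ε * l) ^ 2 = δ * l ^ 2 := by field_simp
  rw [h4, h5]
  push_cast
  field_simp

namespace IsTestKernel

variable {m : ℕ} {φ : ℝ → ℝ} {β : ℝ}

/-- A Gaussian average over the translations by δz multiplies the frequency l by e^(-δ²l²). Gauss
means are thus averages of Abel means, which carries convergence over to the regularization in the
definition of the operator. -/
theorem integral_abelExt_gauss (hφ : IsTestKernel m φ) (hβ : -1 < β) {η : ℝ} (hη : 0 < η)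
    (δ t : ℝ) :
    ∫ z : ℝ, abelExt β (fun y => (φ y : ℂ)) η (t - δ * z) * Complex.exp (-(1 / 4) * (z : ℂ) ^ 2)
      = (Real.pi / (1 / 4) : ℂ) ^ (1 / 2 : ℂ) * (1 / (2 * Real.pi) * ∫ l in Set.Ioi (0 : ℝ),
        ((l ^ β : ℝ) : ℂ) * ft (fun y => (φ y : ℂ)) l * Complex.exp (-((η + Complex.I * t) * l)) *
        Complex.exp (-((δ ^ 2 * l ^ 2 : ℝ) : ℂ))) := by
  have hft := (continuous_ft hφ.integrable).measurable
  have hgi : Integrable fun z : ℝ => Complex.exp (-(1 / 4) * (z : ℂ) ^ 2) :=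
    integrable_cexp_neg_mul_sq (by norm_num)
  unfold abelExt lap
  simp_rw [mul_assoc (1 / (2 * Real.pi : ℂ))]
  rw [integral_const_mul, mul_left_comm]
  congr 1
  simp_rw [← integral_mul_const]
  have hint : Integrable (Function.uncurry fun (z l : ℝ) => ((l ^ β : ℝ) : ℂ) *
      ft (fun y => (φ y : ℂ)) l * Complex.exp (-((η + Complex.I * ((t - δ * z : ℝ) : ℂ)) * l)) *
      Complex.exp (-(1 / 4) * (z : ℂ) ^ 2))
      (volume.prod (volume.restrict (Set.Ioi (0 : ℝ)))) := by
    have h1 := hgi.norm.mul_prod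
      ((integrableOn_rpow_mul_exp hβ hη).integrable.const_mul (∫ y, ‖(φ y : ℂ)‖))
    refine h1.mono' (Measurable.aestronglyMeasurable (by fun_prop)) ?_
    · have hpos : ∀ᵐ z : ℝ × ℝ ∂(volume.prod (volume.restrict (Set.Ioi (0 : ℝ)))), 0 < z.2 :=
        (Measure.quasiMeasurePreserving_snd (ν := volume.restrict (Set.Ioi (0 : ℝ)))
          (μ := (volume : Measure ℝ))).ae (ae_restrict_mem measurableSet_Ioi)
      filter_upwards [hpos] with z hz
      simp only [Function.uncurry]
      rw [norm_mul, mul_comm]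
      refine mul_le_mul_of_nonneg_left ?_ (norm_nonneg _)
      exact norm_lap_integrand_le (norm_ft_le _) hz (by simp)
  rw [integral_integral_swap hint, ← integral_const_mul]
  congr 1; ext l
  have hg := fourierIntegral_gaussian (b := 1 / 4) (by norm_num) (l * δ : ℂ)
  have e : ∀ z : ℝ, ((l ^ β : ℝ) : ℂ) *
      ft (fun y => (φ y : ℂ)) l * Complex.exp (-((η + Complex.I * ((t - δ * z : ℝ) : ℂ)) * l)) *
      Complex.exp (-(1 / 4) * (z : ℂ) ^ 2) = ((l ^ β : ℝ) : ℂ) *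
      ft (fun y => (φ y : ℂ)) l * Complex.exp (-((η + Complex.I * t) * l)) *
      (Complex.exp (Complex.I * (l * δ) * z) * Complex.exp (-(1 / 4) * (z : ℂ) ^ 2)) := by
    intro z
    have : Complex.exp (-((η + Complex.I * ((t - δ * z : ℝ) : ℂ)) * l))
        = Complex.exp (-((η + Complex.I * t) * l)) * Complex.exp (Complex.I * (l * δ) * z) := by
      rw [← Complex.exp_add]; congr 1; push_cast; ring
    rw [this]; ring
  simp_rw [e]
  rw [integral_const_mul, hg]
  have : (-(l * δ : ℂ) ^ 2 / (4 * (1 / 4))) = (-((δ ^ 2 * l ^ 2 : ℝ) : ℂ)) := by push_cast; ring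
  rw [this]; ring

theorem exists_psi_norm_le (hφ : IsTestKernel m φ) (h1 : m ≤ β) (h2 : β < m + 1) :
    ∃ C, 0 ≤ C ∧ (∀ η, 0 < η → η ≤ 1 → ∀ t, ‖abelExt β (fun y => (φ y : ℂ)) η t‖ ≤ C) ∧
      ∀ t, ‖psi β φ t‖ ≤ C := by
  obtain ⟨C, hC, hb⟩ := hφ.exists_abelExt_decay h1 h2
  have h3 : ∀ t : ℝ, C * (1 + |t|) ^ (-(β + 1)) ≤ C := by
    intro t
    have : (1 + |t|) ^ (-(β + 1)) ≤ 1 :=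
      Real.rpow_le_one_of_one_le_of_nonpos (by linarith [abs_nonneg t])
        (by linarith [(Nat.cast_nonneg m : (0:ℝ) ≤ m)])
    nlinarith
  exact ⟨C, hC, fun η h h' t => (hb η h h' t).trans (h3 t),
    fun t => (hφ.psi_decay_of_abelExt h1 h2 hb t).trans (h3 t)⟩

theorem integral_psi_gauss (hφ : IsTestKernel m φ) (h1 : m ≤ β) (h2 : β < m + 1) {δ : ℝ}
    (hδ : 0 < δ) (t : ℝ) :
    ∫ z : ℝ, psi β φ (t - δ * z) * Complex.exp (-(1 / 4) * (z : ℂ) ^ 2)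
      = (Real.pi / (1 / 4) : ℂ) ^ (1 / 2 : ℂ) * gaussExt β (fun y => (φ y : ℂ)) (δ ^ 2) t := by
  have hβ : -1 < β := by linarith [(Nat.cast_nonneg m : (0 : ℝ) ≤ m)]
  obtain ⟨C, hC, hCa, hCp⟩ := hφ.exists_psi_norm_le h1 h2
  have hgi : Integrable fun z : ℝ => Complex.exp (-(1 / 4) * (z : ℂ) ^ 2) :=
    integrable_cexp_neg_mul_sq (by norm_num)
  have hft := (continuous_ft hφ.integrable).measurable
  have hη1 : ∀ᶠ η : ℝ in 𝓝[>] 0, 0 < η ∧ η ≤ 1 := Ioc_mem_nhdsGT one_pos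
  have l1 : Tendsto (fun η => ∫ z : ℝ, abelExt β (fun y => (φ y : ℂ)) η (t - δ * z) *
      Complex.exp (-(1 / 4) * (z : ℂ) ^ 2)) (𝓝[>] 0)
      (𝓝 (∫ z : ℝ, psi β φ (t - δ * z) * Complex.exp (-(1 / 4) * (z : ℂ) ^ 2))) := by
    refine tendsto_integral_filter_of_dominated_convergence
      (fun z => C * ‖Complex.exp (-(1 / 4) * (z : ℂ) ^ 2)‖) ?_ ?_ (hgi.norm.const_mul C) ?_
    · filter_upwards [hη1] with η hη
      have := continuous_abelExt hβ hη.1 hφ.integrable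
      exact Continuous.aestronglyMeasurable (by fun_prop)
    · filter_upwards [hη1] with η hη
      refine Eventually.of_forall fun z => ?_
      rw [norm_mul]
      exact mul_le_mul_of_nonneg_right (hCa η hη.1 hη.2 _) (norm_nonneg _)
    · exact Eventually.of_forall fun z => (hφ.tendsto_psi h1 h2 _).mul_const _
  have l2 : Tendsto (fun η : ℝ => (Real.pi / (1 / 4) : ℂ) ^ (1 / 2 : ℂ) * (1 / (2 * Real.pi) *
      ∫ l in Set.Ioi (0 : ℝ), ((l ^ β : ℝ) : ℂ) * ft (fun y => (φ y : ℂ)) l *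
      Complex.exp (-((η + Complex.I * t) * l)) * Complex.exp (-((δ ^ 2 * l ^ 2 : ℝ) : ℂ)))) (𝓝[>] 0)
      (𝓝 ((Real.pi / (1 / 4) : ℂ) ^ (1 / 2 : ℂ) * gaussExt β (fun y => (φ y : ℂ)) (δ ^ 2) t)) := by
    unfold gaussExt
    refine Tendsto.const_mul _ (Tendsto.const_mul _ ?_)
    refine tendsto_integral_filter_of_dominated_convergence
      (fun l => (∫ y, ‖(φ y : ℂ)‖) * (l ^ β * Real.exp (-(δ ^ 2 * l ^ 2)))) ?_ ?_
      ((integrableOn_rpow_mul_gauss hβ (by positivity)).integrable.const_mul _) ?_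
    · exact Eventually.of_forall fun η => Measurable.aestronglyMeasurable (by fun_prop)
    · filter_upwards [hη1] with η hη
      filter_upwards [ae_restrict_mem measurableSet_Ioi] with l hl
      rw [norm_mul, norm_cexp_neg_ofReal]
      have := norm_lap_integrand_le (a := β) (norm_ft_le (fun y => (φ y : ℂ))) hl (b := 0)
        (r := η + Complex.I * t) (by simpa using hη.1.le)
      simp only [zero_mul, neg_zero, Real.exp_zero, mul_one] at this
      calc _ ≤ ((∫ y, ‖(φ y : ℂ)‖) * l ^ β) * Real.exp (-(δ ^ 2 * l ^ 2)) := by gcongr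
        _ = _ := by ring
    · refine Eventually.of_forall fun l => ?_
      refine Tendsto.mul_const _ (Tendsto.const_mul _ ?_)
      have : Continuous fun η : ℝ => Complex.exp (-((η + Complex.I * t) * l)) := by fun_prop
      have h := (this.tendsto 0).mono_left (nhdsWithin_le_nhds (s := Set.Ioi 0))
      convert h using 2
      simp; ring_nf
  refine tendsto_nhds_unique l1 (l2.congr' ?_)
  filter_upwards [self_mem_nhdsWithin] with η hη
  exact (hφ.integral_abelExt_gauss hβ hη δ t).symm

/-- Gauss means are Gaussian averages, at scale √δ, of the bounded continuous function `psi`, so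
they tend to its value. -/
theorem tendsto_gaussExt (hφ : IsTestKernel m φ) (h1 : m ≤ β) (h2 : β < m + 1) (t : ℝ) :
    Tendsto (fun δ => gaussExt β (fun y => (φ y : ℂ)) δ t) (𝓝[>] 0) (𝓝 (psi β φ t)) := by
  obtain ⟨C, hC, hCa, hCp⟩ := hφ.exists_psi_norm_le h1 h2
  have hgi : Integrable fun z : ℝ => Complex.exp (-(1 / 4) * (z : ℂ) ^ 2) :=
    integrable_cexp_neg_mul_sq (by norm_num)
  have hc := hφ.continuous_psi h1 h2
  have h0 : (Real.pi / (1 / 4) : ℂ) ^ (1 / 2 : ℂ) ≠ 0 := by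
    rw [Ne, Complex.cpow_eq_zero_iff]
    simp [Real.pi_ne_zero]
  have l1 : Tendsto (fun δ : ℝ => ∫ z : ℝ, psi β φ (t - δ * z) *
      Complex.exp (-(1 / 4) * (z : ℂ) ^ 2)) (𝓝[>] 0)
      (𝓝 (∫ z : ℝ, psi β φ t * Complex.exp (-(1 / 4) * (z : ℂ) ^ 2))) := by
    refine tendsto_integral_filter_of_dominated_convergence
      (fun z => C * ‖Complex.exp (-(1 / 4) * (z : ℂ) ^ 2)‖) ?_ ?_ (hgi.norm.const_mul C) ?_
    · exact Eventually.of_forall fun δ => Continuous.aestronglyMeasurable (by fun_prop)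
    · refine Eventually.of_forall fun δ => Eventually.of_forall fun z => ?_
      rw [norm_mul]
      exact mul_le_mul_of_nonneg_right (hCp _) (norm_nonneg _)
    · refine Eventually.of_forall fun z => Tendsto.mul_const _ ?_
      have : Continuous fun δ : ℝ => psi β φ (t - δ * z) := by fun_prop
      simpa using (this.tendsto 0).mono_left (nhdsWithin_le_nhds (s := Set.Ioi 0))
  have hg := fourierIntegral_gaussian (b := 1 / 4) (by norm_num) 0
  simp only [mul_zero, zero_mul, Complex.exp_zero, one_mul, ne_eq, OfNat.ofNat_ne_zero,
    not_false_eq_true, zero_pow, neg_zero, zero_div, mul_one] at hg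
  rw [integral_const_mul, hg, mul_comm] at l1
  have hs : Tendsto (fun δ : ℝ => √δ) (𝓝[>] 0) (𝓝[>] 0) := by
    refine tendsto_nhdsWithin_iff.2 ⟨?_, ?_⟩
    · simpa using (Real.continuous_sqrt.tendsto 0).mono_left (nhdsWithin_le_nhds (s := Set.Ioi 0))
    · filter_upwards [self_mem_nhdsWithin] with δ hδ
      exact Real.sqrt_pos.2 hδ
  have l2 := (l1.comp hs).const_mul ((Real.pi / (1 / 4) : ℂ) ^ (1 / 2 : ℂ))⁻¹
  rw [inv_mul_cancel_left₀ h0] at l2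
  refine l2.congr' ?_
  filter_upwards [self_mem_nhdsWithin] with δ hδ
  simp only [Function.comp]
  rw [hφ.integral_psi_gauss h1 h2 (Real.sqrt_pos.2 hδ), inv_mul_cancel_left₀ h0,
    Real.sq_sqrt (le_of_lt hδ)]

theorem tendsto_applyApprox (hφ : IsTestKernel m φ) (h1 : m ≤ β) (h2 : β < m + 1)
    {Bt : ℝ → ℂ} {bp bm : ℂ}
    (hp : ∀ l : ℝ, 0 < l → Bt l = ((l ^ β : ℝ) : ℂ) * bp)
    (hm : ∀ l : ℝ, 0 < l → Bt (-l) = ((l ^ β : ℝ) : ℂ) * bm) {ε : ℝ} (hε : 0 < ε) (c t : ℝ) :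
    Tendsto (applyApprox Bt (fun p => φ ((p - ε * c) / ε)) t) (𝓝[>] 0)
      (𝓝 (((ε ^ (-β) : ℝ) : ℂ) *
        (bp * psi β φ (t / ε - c) + bm * (starRingEnd ℂ) (psi β φ (t / ε - c))))) := by
  have hβ : -1 < β := by linarith [(Nat.cast_nonneg m : (0 : ℝ) ≤ m)]
  have hi : Integrable fun y => ((φ ((y - ε * c) / ε) : ℝ) : ℂ) :=
    (hφ.integrable.comp_div hε.ne').comp_sub_right (ε * c)
  have hs : Tendsto (fun δ : ℝ => δ / ε ^ 2) (𝓝[>] 0) (𝓝[>] 0) := by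
    refine tendsto_nhdsWithin_iff.2 ⟨?_, ?_⟩
    · have : Continuous fun δ : ℝ => δ / ε ^ 2 := by fun_prop
      simpa using (this.tendsto 0).mono_left (nhdsWithin_le_nhds (s := Set.Ioi 0))
    · filter_upwards [self_mem_nhdsWithin] with δ hδ
      exact div_pos (Set.mem_Ioi.1 hδ) (pow_pos hε 2)
  have hg := (hφ.tendsto_gaussExt h1 h2 (t / ε - c)).comp hs
  have hg' := (Complex.continuous_conj.tendsto _).comp hg
  refine (((hg.const_mul bp).add (hg'.const_mul bm)).const_mul ((ε ^ (-β) : ℝ) : ℂ)).congr' ?_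
  filter_upwards [self_mem_nhdsWithin] with δ hδ
  rw [applyApprox_eq hβ hδ hp hm hi, gaussExt_comp_affine (φ := fun y => (φ y : ℂ)) hε, map_mul,
    Complex.conj_ofReal]
  simp only [Function.comp]
  ring

end IsTestKernel

end

end DTB


namespace DTB

noncomputable section

/-! ### Vanishing discrete moments -/

theorem summable_int_one_add_abs {b : ℝ} (hb : 1 < b) :
    Summable fun j : ℤ => (1 + |(j : ℝ)|) ^ (-b) := by
  have h1 := Real.summable_abs_int_rpow hb
  have h2 : Summable fun j : ℤ => if j = 0 then (1 : ℝ) else 0 :=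
    summable_of_hasFiniteSupport ((Set.finite_singleton (0 : ℤ)).subset fun j hj => by
      by_contra h; simp only [Set.mem_singleton_iff] at h; simp [h] at hj)
  refine Summable.of_nonneg_of_le (fun j => by positivity) (fun j => ?_) (h1.add h2)
  by_cases hj : j = 0
  · subst hj; simp; positivity
  · simp only [hj, if_false, add_zero]
    exact Real.rpow_le_rpow_of_nonpos (by positivity) (by linarith) (by linarith)

theorem one_add_abs_floor_le (r : ℝ) (j : ℤ) :
    (1 + |((j - ⌊r⌋ : ℤ) : ℝ)|) / 2 ≤ 1 + |r - j| := by
  have h1 := Int.fract_nonneg r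
  have h2 := (Int.fract_lt_one r).le
  have h3 : ((j - ⌊r⌋ : ℤ) : ℝ) = Int.fract r - (r - j) := by
    rw [Int.fract]; push_cast; ring
  have h4 := abs_sub (Int.fract r) (r - j)
  rw [h3]
  rw [abs_of_nonneg h1] at h4
  linarith [abs_nonneg (r - j)]

theorem one_add_abs_sub_rpow_le {b : ℝ} (hb : 0 < b) (r : ℝ) (j : ℤ) :
    (1 + |r - j|) ^ (-b) ≤ 2 ^ b * (1 + |((j - ⌊r⌋ : ℤ) : ℝ)|) ^ (-b) := by
  have h := Real.rpow_le_rpow_of_nonpos (by positivity) (one_add_abs_floor_le r j)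
    (neg_nonpos.2 hb.le)
  refine h.trans (le_of_eq ?_)
  rw [Real.div_rpow (by positivity) (by norm_num), Real.rpow_neg (by norm_num : (0 : ℝ) ≤ 2)]
  field_simp

theorem summable_one_add_abs_sub {b : ℝ} (hb : 1 < b) (r : ℝ) :
    Summable fun j : ℤ => (1 + |r - j|) ^ (-b) := by
  have h1 : Summable fun j : ℤ => 2 ^ b * (1 + |((j - ⌊r⌋ : ℤ) : ℝ)|) ^ (-b) :=
    ((Equiv.subRight ⌊r⌋).summable_iff.2 (summable_int_one_add_abs hb)).mul_left _
  exact Summable.of_nonneg_of_le (fun j => by positivity)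
    (one_add_abs_sub_rpow_le (by linarith) r) h1

theorem tsum_one_add_abs_sub_le {b : ℝ} (hb : 1 < b) (r : ℝ) :
    ∑' j : ℤ, (1 + |r - j|) ^ (-b) ≤ 2 ^ b * ∑' j : ℤ, (1 + |(j : ℝ)|) ^ (-b) := by
  have h1 : Summable fun j : ℤ => 2 ^ b * (1 + |((j - ⌊r⌋ : ℤ) : ℝ)|) ^ (-b) :=
    ((Equiv.subRight ⌊r⌋).summable_iff.2 (summable_int_one_add_abs hb)).mul_left _
  refine ((summable_one_add_abs_sub hb r).tsum_le_tsum (one_add_abs_sub_rpow_le (by linarith) r)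
    h1).trans (le_of_eq ?_)
  rw [tsum_mul_left]
  congr 1
  exact (Equiv.subRight ⌊r⌋).tsum_eq fun j : ℤ => (1 + |(j : ℝ)|) ^ (-b)

/-- A Peetre inequality: decay in t - y becomes decay in t at the price of a factor in y. -/
theorem one_add_abs_le_mul (x y : ℝ) : 1 + |x + y| ≤ (1 + |x|) * (1 + |y|) := by
  nlinarith [abs_add_le x y, abs_nonneg x, abs_nonneg y]

/-- Reproduction of polynomials of degree at most `N` by the integer translates of `φ`. -/
def Reproduces (N : ℕ) (φ : ℝ → ℝ) : Prop :=
  ∀ k : ℕ, k ≤ N → ∀ t : ℝ, ∑' j : ℤ, (j : ℝ) ^ k * φ (t - j) = t ^ k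

theorem finite_support_translates {φ : ℝ → ℝ} {R : ℝ} (hR : ∀ y, R < |y| → φ y = 0) (y : ℝ)
    (c : ℤ → ℝ) : (Function.support fun j : ℤ => c j * φ (y - j)).Finite := by
  refine (Set.finite_Icc ⌊y - R⌋ ⌈y + R⌉).subset fun j hj => ?_
  have h1 : |y - j| ≤ R := by
    by_contra h
    exact hj (by simp [hR _ (not_le.1 h)])
  rw [abs_le] at h1
  constructor
  · exact Int.floor_le_iff.2 (by linarith)
  · exact Int.le_ceil_iff.2 (by linarith)

/-- Binomial expansion in j; only finitely many translates are nonzero at a given y, so the sums may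
be interchanged. -/
theorem Reproduces.sub_pow {N : ℕ} {φ : ℝ → ℝ} (h : Reproduces N φ) {R : ℝ}
    (hR : ∀ y, R < |y| → φ y = 0) {k : ℕ} (hk : k ≤ N) (r y : ℝ) :
    ∑' j : ℤ, (r - j) ^ k * φ (y - j) = (r - y) ^ k := by
  have e : ∀ j : ℤ, (r - j) ^ k * φ (y - j) = ∑ i ∈ Finset.range (k + 1),
      ((k.choose i : ℝ) * r ^ i * (-1) ^ (k - i)) * ((j : ℝ) ^ (k - i) * φ (y - j)) := by
    intro j
    rw [sub_eq_add_neg, add_pow, Finset.sum_mul]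
    refine Finset.sum_congr rfl fun i _ => ?_
    rw [neg_pow (j : ℝ)]; ring
  simp_rw [e]
  rw [Summable.tsum_finsetSum]
  · simp_rw [tsum_mul_left]
    rw [sub_eq_add_neg, add_pow]
    refine Finset.sum_congr rfl fun i _ => ?_
    rw [h (k - i) (by omega), neg_pow y]; ring
  · intro i _
    exact (summable_of_hasFiniteSupport (finite_support_translates hR y _)).mul_left _

namespace IsTestKernel

variable {m : ℕ} {φ : ℝ → ℝ} {β : ℝ}

/-- Decay for fixed η with the absolute value inside the integral, as needed to interchange the sum
over j with the convolution integral. -/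
theorem exists_integral_halfKer_bound (hφ : IsTestKernel m φ) (hβ : -1 < β) {η : ℝ} (hη : 0 < η) :
    ∃ C, 0 ≤ C ∧ ∀ t : ℝ, ∫ y : ℝ, ‖halfKer β (η + Complex.I * ((t - y : ℝ) : ℂ)) * (φ y : ℂ)‖
      ≤ C * (1 + |t|) ^ (-(β + 1)) := by
  obtain ⟨R, hR, hsupp⟩ := hφ.exists_support
  have hG : 0 < Real.Gamma (β + 1) := Real.Gamma_pos_of_pos (by linarith)
  set g := Real.Gamma (β + 1) / (2 * Real.pi)
  have hg : 0 < g := by positivity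
  set c := min η 1 / (2 * (1 + R)) with hc
  have hc0 : 0 < c := by positivity
  have hA : 0 ≤ ∫ y, ‖(φ y : ℂ)‖ := integral_nonneg fun _ => norm_nonneg _
  refine ⟨g * c ^ (-(β + 1)) * ∫ y, ‖(φ y : ℂ)‖, by positivity, fun t => ?_⟩
  calc _ ≤ ∫ y : ℝ, g * c ^ (-(β + 1)) * (1 + |t|) ^ (-(β + 1)) * ‖(φ y : ℂ)‖ := by
        refine integral_mono_of_nonneg (Eventually.of_forall fun y => norm_nonneg _)
          (hφ.integrable.norm.const_mul _) (Eventually.of_forall fun y => ?_)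
        simp only
        rw [norm_mul]
        rcases le_or_gt |y| R with hy | hy
        · refine mul_le_mul_of_nonneg_right ?_ (norm_nonneg _)
          rw [norm_halfKer _ _ _ hβ, mul_assoc, ← Real.mul_rpow hc0.le (by positivity)]
          refine mul_le_mul_of_nonneg_left ?_ hg.le
          refine Real.rpow_le_rpow_of_nonpos (by positivity) ?_ (by linarith)
          have a1 := norm_eta_add_ge η (t - y)
          have a2 := norm_eta_add_ge' η (t - y)
          rw [abs_of_pos hη] at a2
          have a3 := min_le_left η 1
          have a4 := min_le_right η 1
          have a5 := abs_nonneg (t - y)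
          have a6 := one_add_abs_le_mul (t - y) y
          rw [sub_add_cancel] at a6
          have a7 : (1 + |t|) ≤ (1 + |t - y|) * (1 + R) := a6.trans (by gcongr)
          have a8 : min η 1 / 2 * (1 + |t - y|) ≤ ‖(η : ℂ) + Complex.I * ((t - y : ℝ) : ℂ)‖ := by
            have : 0 < min η 1 := by positivity
            nlinarith
          refine le_trans ?_ a8
          rw [hc, div_mul_eq_mul_div, div_le_iff₀ (by positivity)]
          have : 0 < min η 1 := by positivity
          nlinarith
        · have := hsupp 0 y hy
          rw [iteratedDeriv_zero] at this
          simp [this]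
    _ = _ := by rw [integral_const_mul]; ring

/-- When the sum over j is taken under the convolution integral, the reproduction property replaces
the translates of φ by (r - y)^k. What remains is the k-th moment of (η + iu)^(-(β+1)), which
vanishes because k < β. -/
theorem tsum_pow_mul_abelExt (hφ : IsTestKernel m φ) {N : ℕ} (hN : Reproduces N φ) {k : ℕ}
    (hk : k ≤ N) (hkβ : k < β) {η : ℝ} (hη : 0 < η) (r : ℝ) :
    ∑' j : ℤ, ((r - j : ℝ) : ℂ) ^ k * abelExt β (fun y => (φ y : ℂ)) η (r - j) = 0 := by
  have hβ : -1 < β := by linarith [(Nat.cast_nonneg k : (0 : ℝ) ≤ k)]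
  obtain ⟨R, hR, hsupp⟩ := hφ.exists_support
  have hsupp0 : ∀ y, R < |y| → φ y = 0 := by simpa using hsupp 0
  obtain ⟨C, hC, hb⟩ := hφ.exists_integral_halfKer_bound hβ hη
  set F : ℤ → ℝ → ℂ := fun j y => ((r - j : ℝ) : ℂ) ^ k *
    (halfKer β (η + Complex.I * ((r - y : ℝ) : ℂ)) * (φ (y - j) : ℂ))
  have hker : Continuous fun y : ℝ => halfKer β (η + Complex.I * ((r - y : ℝ) : ℂ)) := by
    have := (continuous_eta_cpow hη (-(β + 1 : ℂ)))
    exact continuous_const.mul (this.comp (by fun_prop : Continuous fun y : ℝ => r - y))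
  have hFint : ∀ j, Integrable (F j) := by
    intro j
    refine Integrable.const_mul ?_ _
    have hcs : HasCompactSupport fun y : ℝ => φ (y - j) := by
      simp only [sub_eq_add_neg]
      exact hφ.compact.comp_homeomorph (Homeomorph.addRight (-(j : ℝ)))
    have hc : Continuous fun y : ℝ => φ (y - j) := hφ.continuous.comp (by fun_prop)
    have hc2 : HasCompactSupport fun y : ℝ => ((φ (y - j) : ℝ) : ℂ) :=
      hcs.comp_left (g := fun x : ℝ => (x : ℂ)) Complex.ofReal_zero
    exact (hker.mul (Complex.continuous_ofReal.comp hc)).integrable_of_hasCompactSupport hc2.mul_left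
  -- The translation by j is moved into the kernel, so that the decay bound applies at t = r - j.
  have hshift : ∀ (j : ℤ) (h : ℂ → ℝ), ∫ y : ℝ, h (halfKer β (η + Complex.I * ((r - y : ℝ) : ℂ)) *
      (φ (y - j) : ℂ)) = ∫ y : ℝ, h (halfKer β (η + Complex.I * ((r - j - y : ℝ) : ℂ)) * (φ y : ℂ)) := by
    intro j h
    rw [← integral_add_right_eq_self _ (j : ℝ)]
    congr 1; ext y; congr 3 <;> · congr 1; push_cast; ring
  have hsum : Summable fun j => ∫ y, ‖F j y‖ := by
    have hs := (summable_one_add_abs_sub (b := β + 1 - k) (by linarith) r).mul_left C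
    refine Summable.of_nonneg_of_le (fun j => integral_nonneg fun _ => norm_nonneg _) (fun j => ?_) hs
    have : ∀ y, ‖F j y‖ = |r - j| ^ k * ‖halfKer β (η + Complex.I * ((r - y : ℝ) : ℂ)) *
        (φ (y - j) : ℂ)‖ := by
      intro y; rw [norm_mul, norm_pow, Complex.norm_real, Real.norm_eq_abs]
    simp_rw [this]
    rw [integral_const_mul, hshift j norm]
    have h0 : 0 < 1 + |r - j| := by positivity
    calc _ ≤ (1 + |r - j|) ^ k * (C * (1 + |r - j|) ^ (-(β + 1))) := by
          gcongr
          · linarith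
          · exact hb (r - j)
      _ = _ := by
        rw [← Real.rpow_natCast, mul_left_comm, ← Real.rpow_add h0]
        congr 2; ring
  have hs := hasSum_integral_of_summable_integral_norm hFint hsum
  have e2 : ∀ j : ℤ, ∫ y, F j y = ((r - j : ℝ) : ℂ) ^ k * abelExt β (fun y => (φ y : ℂ)) η (r - j) := by
    intro j
    rw [abelExt_eq hβ hη hφ.integrable, integral_const_mul]
    congr 1
    rw [← integral_add_right_eq_self _ (j : ℝ)]
    congr 1; ext y
    rw [add_sub_cancel_right]; congr 3; push_cast; ring
  have e3 : ∀ y, ∑' j, F j y = ((Real.Gamma (β + 1) / (2 * Real.pi) : ℝ) : ℂ) *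
      (((r - y : ℝ) : ℂ) ^ k * (η + Complex.I * ((r - y : ℝ) : ℂ)) ^ (-((β + 1 : ℝ) : ℂ))) := by
    intro y
    have h1 := hN.sub_pow hsupp0 hk r y
    have h2 : ∀ j, F j y = halfKer β (η + Complex.I * ((r - y : ℝ) : ℂ)) *
        ((((r - j) ^ k * φ (y - j) : ℝ)) : ℂ) := by
      intro j; simp only [F]; push_cast; ring
    simp_rw [h2]
    rw [tsum_mul_left, ← Complex.ofReal_tsum, h1, halfKer]
    push_cast; ring
  have h4 := hs.tsum_eq
  simp_rw [e2, e3] at h4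
  rw [h4, integral_const_mul, integral_sub_left_eq_self (fun u : ℝ => (u : ℂ) ^ k *
    (η + Complex.I * (u : ℂ)) ^ (-((β + 1 : ℝ) : ℂ))) volume r,
    integral_pow_mul_eta_cpow hη k _ (by linarith), mul_zero]

theorem norm_pow_mul_le {C : ℝ} {z : ℂ} {k : ℕ} {x : ℝ}
    (h : ‖z‖ ≤ C * (1 + |x|) ^ (-(β + 1))) :
    ‖(x : ℂ) ^ k * z‖ ≤ C * (1 + |x|) ^ (-(β + 1 - k)) := by
  have h0 : 0 < 1 + |x| := by positivity
  rw [norm_mul, norm_pow, Complex.norm_real, Real.norm_eq_abs]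
  calc _ ≤ (1 + |x|) ^ k * (C * (1 + |x|) ^ (-(β + 1))) := by
        gcongr
        linarith
    _ = _ := by
      rw [← Real.rpow_natCast, mul_left_comm, ← Real.rpow_add h0]
      congr 2; ring

theorem summable_pow_mul_psi (hφ : IsTestKernel m φ) (h1 : m ≤ β) (h2 : β < m + 1) {k : ℕ}
    (hkβ : k < β) (r : ℝ) : Summable fun j : ℤ => ((r - j : ℝ) : ℂ) ^ k * psi β φ (r - j) := by
  obtain ⟨C, hC, hb⟩ := hφ.exists_abelExt_decay h1 h2
  refine Summable.of_norm_bounded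
    ((summable_one_add_abs_sub (b := β + 1 - k) (by linarith) r).mul_left C) fun j => ?_
  exact norm_pow_mul_le (hφ.psi_decay_of_abelExt h1 h2 hb _)

/-- The vanishing moments pass to the limit η → 0 by dominated convergence; the majorant (1 + |r -
j|)^(-(β+1-k)) is summable because k < β. -/
theorem tsum_pow_mul_psi (hφ : IsTestKernel m φ) (h1 : m ≤ β) (h2 : β < m + 1) {N : ℕ}
    (hN : Reproduces N φ) {k : ℕ} (hk : k ≤ N) (hkβ : k < β) (r : ℝ) :
    ∑' j : ℤ, ((r - j : ℝ) : ℂ) ^ k * psi β φ (r - j) = 0 := by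
  obtain ⟨C, hC, hb⟩ := hφ.exists_abelExt_decay h1 h2
  have hlim := tendsto_tsum_of_dominated_convergence (𝓕 := 𝓝[>] (0 : ℝ))
    (f := fun η (j : ℤ) => ((r - j : ℝ) : ℂ) ^ k * abelExt β (fun y => (φ y : ℂ)) η (r - j))
    (g := fun j : ℤ => ((r - j : ℝ) : ℂ) ^ k * psi β φ (r - j))
    ((summable_one_add_abs_sub (b := β + 1 - k) (by linarith) r).mul_left C)
    (fun j => (hφ.tendsto_psi h1 h2 _).const_mul _) (by
      filter_upwards [Ioc_mem_nhdsGT one_pos] with η hη j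
      exact norm_pow_mul_le (hb η hη.1 hη.2 _))
  refine tendsto_nhds_unique hlim (tendsto_const_nhds.congr' ?_)
  filter_upwards [self_mem_nhdsWithin] with η hη
  exact (hφ.tsum_pow_mul_abelExt hN hk hkβ hη r).symm

end IsTestKernel

end

end DTB


namespace DTB

noncomputable section

/-! ### One-sided powers -/

/-- Continuous functions of growth `|x|^a` that are approximated to order `θ` by polynomials of degree
less than `N` around the points of the positive half-line. -/
structure IsAmplitude (a θ : ℝ) (N : ℕ) (A : ℝ → ℝ) : Prop where
  continuous : Continuous A
  bound : ∀ x, |A x| ≤ |x| ^ a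
  taylor : ∃ C : ℝ, 0 ≤ C ∧ ∀ X : ℝ, 1 ≤ X → ∃ c : ℕ → ℝ, ∀ x : ℝ,
    |A x - ∑ k ∈ Finset.range N, c k * (x - X) ^ k| ≤ C * X ^ (a - θ) * |x - X| ^ θ

theorem posPow_eq_max {a : ℝ} (ha : 0 < a) (x : ℝ) : posPow x a = (max x 0) ^ a := by
  unfold posPow
  split_ifs with h
  · rw [max_eq_left h.le]
  · rw [max_eq_right (not_lt.1 h), Real.zero_rpow ha.ne']

theorem continuous_posPow {a : ℝ} (ha : 0 < a) : Continuous fun x => posPow x a := by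
  simp_rw [posPow_eq_max ha]
  exact (continuous_id.max continuous_const).rpow_const fun _ => Or.inr ha.le

theorem posPow_nonneg (x a : ℝ) : 0 ≤ posPow x a := by
  unfold posPow
  split_ifs with h
  · positivity
  · rfl

theorem abs_posPow_le (x a : ℝ) : |posPow x a| ≤ |x| ^ a := by
  rw [abs_of_nonneg (posPow_nonneg x a)]
  unfold posPow
  split_ifs with h
  · rw [abs_of_pos h]
  · positivity

theorem posPow_mul {X : ℝ} (hX : 0 < X) (x a : ℝ) : posPow (X * x) a = X ^ a * posPow x a := by
  unfold posPow
  by_cases h : 0 < x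
  · rw [if_pos h, if_pos (mul_pos hX h), Real.mul_rpow hX.le h.le]
  · rw [if_neg h, if_neg (by rwa [mul_pos_iff_of_pos_left hX]), mul_zero]

/-- Near y = 0 this is Taylor's formula, with the term of order N absorbed because θ ≤ N. Away from
0 nothing has to cancel: a and every degree below N are at most θ, so each term alone is bounded by
a multiple of |y|^θ. The singular point y = -1 falls in the second range. -/
theorem exists_taylor_posPow {a θ : ℝ} {N : ℕ} (ha : 0 ≤ a) (h : a ≤ θ) (h0 : 0 < θ)
    (h1 : (N : ℝ) - 1 ≤ θ) (h2 : θ ≤ N) : ∃ (c : ℕ → ℝ) (C : ℝ), 0 ≤ C ∧ ∀ y : ℝ,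
      |posPow (1 + y) a - ∑ k ∈ Finset.range N, c k * y ^ k| ≤ C * |y| ^ θ := by
  have hcd : ContDiffOn ℝ N (fun y : ℝ => (1 + y) ^ a) (Set.Ioi (-1)) := by
    refine ContDiffOn.rpow_const_of_ne (by fun_prop) fun y hy => ?_
    have := Set.mem_Ioi.1 hy
    linarith
  have ht := taylor_isLittleO (convex_Ioi (-1 : ℝ)) (x₀ := 0) (by simp) hcd
  simp only [taylor_within_apply, sub_zero, smul_eq_mul] at ht
  rw [nhdsWithin_eq_nhds.2 (Ioi_mem_nhds (by norm_num))] at ht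
  set c : ℕ → ℝ := fun k => (k.factorial : ℝ)⁻¹ *
    iteratedDerivWithin k (fun y : ℝ => (1 + y) ^ a) (Set.Ioi (-1)) 0 with hc
  have hev := ht.bound one_pos
  rw [Metric.eventually_nhds_iff] at hev
  obtain ⟨δ₀, hδ₀, hδ⟩ := hev
  -- The bound 1/2 keeps away from the singularity at y = -1, and halving `δ₀` makes the inequality
  -- with it strict.
  set δ := min (δ₀ / 2) (1 / 2) with hδdef
  have hδpos : 0 < δ := by positivity
  have hδ1 : δ ≤ 1 / 2 := min_le_right _ _
  have hδ2 : δ < δ₀ := (min_le_left _ _).trans_lt (by linarith)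
  set S := ∑ k ∈ Finset.range N, |c k| * δ ^ ((k : ℝ) - θ) with hS
  have hS0 : 0 ≤ S := Finset.sum_nonneg fun k _ => by positivity
  refine ⟨c, (1 + |c N|) + ((1 / δ + 1) ^ a * δ ^ (a - θ) + S), by positivity, fun y => ?_⟩
  have hyθ : 0 ≤ |y| ^ θ := by positivity
  rcases lt_or_ge |y| δ with hy | hy
  · have hy1 : 0 < 1 + y := by linarith [neg_abs_le y]
    have hb := @hδ y (by rw [Real.dist_eq, sub_zero]; linarith)
    rw [Finset.sum_range_succ] at hb
    have hpp : posPow (1 + y) a = (1 + y) ^ a := if_pos hy1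
    have hyN : |y| ^ N ≤ |y| ^ θ := by
      rcases eq_or_lt_of_le (abs_nonneg y) with h3 | h3
      · rw [← h3, Real.zero_rpow h0.ne']
        have : N ≠ 0 := by rintro rfl; simp at h2; linarith
        simp [this]
      · rw [← Real.rpow_natCast]
        exact Real.rpow_le_rpow_of_exponent_ge h3 (by linarith) h2
    have e : ∀ k, (k.factorial : ℝ)⁻¹ * y ^ k *
        iteratedDerivWithin k (fun y : ℝ => (1 + y) ^ a) (Set.Ioi (-1)) 0 = c k * y ^ k := by
      intro k; simp only [hc]; ring
    simp only [e, one_mul, Real.norm_eq_abs, abs_pow] at hb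
    have h4 : |posPow (1 + y) a - ∑ k ∈ Finset.range N, c k * y ^ k| ≤ (1 + |c N|) * |y| ^ N := by
      rw [hpp]
      calc _ = |((1 + y) ^ a - (∑ k ∈ Finset.range N, c k * y ^ k + c N * y ^ N)) + c N * y ^ N| := by
            congr 1; ring
        _ ≤ |y| ^ N + |c N * y ^ N| := (abs_add_le _ _).trans (by gcongr)
        _ = _ := by rw [abs_mul, abs_pow]; ring
    calc _ ≤ (1 + |c N|) * |y| ^ N := h4
      _ ≤ (1 + |c N|) * |y| ^ θ := by gcongr
      _ ≤ _ := by
        refine mul_le_mul_of_nonneg_right ?_ hyθ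
        have : 0 ≤ (1 / δ + 1) ^ a * δ ^ (a - θ) := by positivity
        linarith
  · have hy0 : 0 < |y| := by linarith
    have h5 : ∀ b : ℝ, b ≤ θ → |y| ^ b ≤ δ ^ (b - θ) * |y| ^ θ := by
      intro b hb
      have : |y| ^ b = |y| ^ (b - θ) * |y| ^ θ := by rw [← Real.rpow_add hy0]; congr 1; ring
      rw [this]
      refine mul_le_mul_of_nonneg_right ?_ hyθ
      exact Real.rpow_le_rpow_of_nonpos hδpos hy (by linarith)
    have h6 : |posPow (1 + y) a| ≤ (1 / δ + 1) ^ a * δ ^ (a - θ) * |y| ^ θ := by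
      calc _ ≤ |1 + y| ^ a := abs_posPow_le _ _
        _ ≤ ((1 / δ + 1) * |y|) ^ a := by
          refine Real.rpow_le_rpow (abs_nonneg _) ?_ ha
          have : 1 ≤ 1 / δ * |y| := by rw [one_div, ← div_eq_inv_mul, le_div_iff₀ hδpos]; linarith
          calc _ ≤ |1| + |y| := abs_add_le _ _
            _ ≤ _ := by rw [abs_one]; linarith
        _ = (1 / δ + 1) ^ a * |y| ^ a := Real.mul_rpow (by positivity) (by positivity)
        _ ≤ _ := by rw [mul_assoc]; gcongr; exact h5 a h
    have h7 : |∑ k ∈ Finset.range N, c k * y ^ k| ≤ S * |y| ^ θ := by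
      refine (Finset.abs_sum_le_sum_abs _ _).trans ?_
      rw [hS, Finset.sum_mul]
      refine Finset.sum_le_sum fun k hk => ?_
      rw [abs_mul, abs_pow, mul_assoc, ← Real.rpow_natCast]
      gcongr
      refine h5 k ?_
      have : (k : ℝ) + 1 ≤ N := by exact_mod_cast Finset.mem_range.1 hk
      linarith
    calc _ ≤ _ := abs_sub _ _
      _ ≤ (1 / δ + 1) ^ a * δ ^ (a - θ) * |y| ^ θ + S * |y| ^ θ := add_le_add h6 h7
      _ ≤ _ := by
        have : 0 ≤ (1 + |c N|) * |y| ^ θ := by positivity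
        linarith

/-- The expansion at 1 is carried to X by homogeneity, writing x = X(1 + (x - X)/X); this produces
the factor X^(a-θ). -/
theorem isAmplitude_posPow {a θ : ℝ} {N : ℕ} (ha : 0 < a) (h : a ≤ θ)
    (h1 : (N : ℝ) - 1 ≤ θ) (h2 : θ ≤ N) : IsAmplitude a θ N fun x => posPow x a := by
  refine ⟨continuous_posPow ha, fun x => abs_posPow_le x a, ?_⟩
  obtain ⟨c, C, hC, hb⟩ := exists_taylor_posPow ha.le h (ha.trans_le h) h1 h2
  refine ⟨C, hC, fun X hX => ⟨fun k => X ^ a * (c k / X ^ k), fun x => ?_⟩⟩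
  have hX0 : 0 < X := by linarith
  have e1 : posPow x a = X ^ a * posPow (1 + (x - X) / X) a := by
    rw [← posPow_mul hX0]; congr 1; field_simp; ring
  have e2 : ∑ k ∈ Finset.range N, X ^ a * (c k / X ^ k) * (x - X) ^ k
      = X ^ a * ∑ k ∈ Finset.range N, c k * ((x - X) / X) ^ k := by
    rw [Finset.mul_sum]
    refine Finset.sum_congr rfl fun k _ => ?_
    rw [div_pow]; field_simp
  rw [e1, e2, ← mul_sub, abs_mul, abs_of_nonneg (Real.rpow_nonneg hX0.le a)]
  calc _ ≤ X ^ a * (C * |(x - X) / X| ^ θ) := by gcongr; exact hb _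
    _ = _ := by
      rw [abs_div, abs_of_pos hX0, Real.div_rpow (abs_nonneg _) hX0.le, Real.rpow_sub hX0]
      field_simp

/-- The Taylor polynomial at a positive point is zero. Where x_-^a does not vanish, |x - X| is at
least |x| and at least X, and the bound follows from a ≤ θ. -/
theorem isAmplitude_negPow {a θ : ℝ} (N : ℕ) (ha : 0 < a) (h : a ≤ θ) :
    IsAmplitude a θ N fun x => negPow x a := by
  refine ⟨(continuous_posPow ha).comp continuous_neg, fun x => ?_, 1, zero_le_one, fun X hX =>
    ⟨fun _ => 0, fun x => ?_⟩⟩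
  · simpa [negPow] using abs_posPow_le (-x) a
  · simp only [zero_mul, Finset.sum_const_zero, sub_zero, one_mul]
    have hX0 : 0 < X := by linarith
    unfold negPow posPow
    split_ifs with hx
    · have h3 : -x ≤ |x - X| := by rw [abs_sub_comm]; exact le_trans (by linarith) (le_abs_self _)
      have h4 : X ≤ |x - X| := by rw [abs_sub_comm]; exact le_trans (by linarith) (le_abs_self _)
      rw [abs_of_nonneg (by positivity)]
      have h5 : 0 < |x - X| := by linarith
      calc (-x) ^ a ≤ |x - X| ^ a := Real.rpow_le_rpow hx.le h3 ha.le
        _ = |x - X| ^ (a - θ) * |x - X| ^ θ := by rw [← Real.rpow_add h5]; congr 1; ring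
        _ ≤ _ := by
          refine mul_le_mul_of_nonneg_right ?_ (by positivity)
          exact Real.rpow_le_rpow_of_nonpos hX0 h4 (by linarith)
    · rw [abs_zero]; positivity

/-! ### The sampled convolution -/

/-- `∑_j Ψ(X + p - j) A(j - p)`, where `Ψ` is the filtered kernel. -/
def sampled (β : ℝ) (φ A : ℝ → ℝ) (X p : ℝ) : ℂ :=
  ∑' j : ℤ, psi β φ (X + p - j) * (A (j - p) : ℂ)

theorem sampled_add_one (β : ℝ) (φ A : ℝ → ℝ) (X p : ℝ) :
    sampled β φ A X (p + 1) = sampled β φ A X p := by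
  unfold sampled
  rw [← (Equiv.addRight (1 : ℤ)).tsum_eq]
  congr 1; ext j
  simp only [Equiv.coe_addRight]
  push_cast
  congr 2
  · ring
  · congr 1; ring

namespace IsTestKernel

variable {m : ℕ} {φ A : ℝ → ℝ} {β a θ : ℝ} {N : ℕ}

theorem exists_psi_decay (hφ : IsTestKernel m φ) (h1 : m ≤ β) (h2 : β < m + 1) :
    ∃ C : ℝ, 0 ≤ C ∧ ∀ t, ‖psi β φ t‖ ≤ C * (1 + |t|) ^ (-(β + 1)) := by
  obtain ⟨C, hC, hb⟩ := hφ.exists_abelExt_decay h1 h2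
  exact ⟨C, hC, hφ.psi_decay_of_abelExt h1 h2 hb⟩

theorem norm_mul_amplitude_le {C : ℝ} {z : ℂ} (hA : IsAmplitude a θ N A) (ha : 0 ≤ a) {t X : ℝ}
    (hz : ‖z‖ ≤ C * (1 + |t|) ^ (-(β + 1))) :
    ‖z * (A (X - t) : ℂ)‖ ≤ C * (1 + |X|) ^ a * (1 + |t|) ^ (-(β + 1 - a)) := by
  have h0 : 0 < 1 + |t| := by positivity
  rw [norm_mul, Complex.norm_real, Real.norm_eq_abs]
  have h3 : |A (X - t)| ≤ (1 + |X|) ^ a * (1 + |t|) ^ a := by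
    refine (hA.bound _).trans ?_
    rw [← Real.mul_rpow (by positivity) (by positivity)]
    refine Real.rpow_le_rpow (abs_nonneg _) ?_ ha
    have := one_add_abs_le_mul X (-t)
    rw [abs_neg, ← sub_eq_add_neg] at this
    linarith
  calc _ ≤ (C * (1 + |t|) ^ (-(β + 1))) * ((1 + |X|) ^ a * (1 + |t|) ^ a) := by
        gcongr
        exact (norm_nonneg _).trans hz
    _ = C * (1 + |X|) ^ a * ((1 + |t|) ^ (-(β + 1)) * (1 + |t|) ^ a) := by ring
    _ = _ := by rw [← Real.rpow_add h0]; congr 2; ring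

theorem summable_sampled (hφ : IsTestKernel m φ) (h1 : m ≤ β) (h2 : β < m + 1)
    (hA : IsAmplitude a θ N A) (ha : 0 ≤ a) (haβ : a < β) (X p : ℝ) :
    Summable fun j : ℤ => psi β φ (X + p - j) * (A (j - p) : ℂ) := by
  obtain ⟨C, hC, hb⟩ := hφ.exists_psi_decay h1 h2
  refine Summable.of_norm_bounded ((summable_one_add_abs_sub (b := β + 1 - a) (by linarith)
    (X + p)).mul_left (C * (1 + |X|) ^ a)) fun j => ?_
  have := norm_mul_amplitude_le (X := X) hA ha (hb (X + p - j))
  rwa [show X - (X + p - j) = j - p by ring] at this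

theorem continuous_sampled (hφ : IsTestKernel m φ) (h1 : m ≤ β) (h2 : β < m + 1)
    (hA : IsAmplitude a θ N A) (ha : 0 ≤ a) (haβ : a < β) :
    Continuous (Function.uncurry (sampled β φ A)) := by
  obtain ⟨C, hC, hb⟩ := hφ.exists_psi_decay h1 h2
  have hc := hφ.continuous_psi h1 h2
  have hAc := hA.continuous
  rw [continuous_iff_continuousAt]
  intro z
  set R := ‖z‖ + 1 with hR
  have hR0 : 0 ≤ R := by positivity
  have hs : Summable fun j : ℤ => C * (1 + R) ^ a * (1 + 2 * R) ^ (β + 1 - a) *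
      (1 + |(j : ℝ)|) ^ (-(β + 1 - a)) :=
    (summable_int_one_add_abs (by linarith)).mul_left _
  have hcont : ContinuousOn (Function.uncurry (sampled β φ A)) (Metric.ball 0 R) := by
    refine continuousOn_tsum (f := fun (j : ℤ) (z : ℝ × ℝ) =>
      psi β φ (z.1 + z.2 - j) * (A (j - z.2) : ℂ)) (fun j => Continuous.continuousOn (by fun_prop)) hs
      fun j w hw => ?_
    rw [mem_ball_zero_iff] at hw
    have hw1 : |w.1| ≤ R := (norm_fst_le w).trans hw.le
    have hw2 : |w.2| ≤ R := (norm_snd_le w).trans hw.le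
    have h3 := norm_mul_amplitude_le (X := w.1) hA ha (hb (w.1 + w.2 - j))
    rw [show w.1 - (w.1 + w.2 - j) = j - w.2 by ring] at h3
    refine h3.trans ?_
    have h4 : (1 + |w.1|) ^ a ≤ (1 + R) ^ a := Real.rpow_le_rpow (by positivity) (by linarith) ha
    have h5 : (1 + |w.1 + w.2 - j|) ^ (-(β + 1 - a))
        ≤ (1 + 2 * R) ^ (β + 1 - a) * (1 + |(j : ℝ)|) ^ (-(β + 1 - a)) := by
      have h6 : (1 + |(j : ℝ)|) / (1 + 2 * R) ≤ 1 + |w.1 + w.2 - j| := by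
        rw [div_le_iff₀ (by positivity)]
        have h7 := one_add_abs_le_mul (w.1 + w.2 - j) (-(w.1 + w.2))
        rw [show w.1 + w.2 - j + -(w.1 + w.2) = -(j : ℝ) by ring, abs_neg, abs_neg] at h7
        refine h7.trans ?_
        have := abs_add_le w.1 w.2
        gcongr
        linarith
      refine (Real.rpow_le_rpow_of_nonpos (by positivity) h6 (by linarith)).trans (le_of_eq ?_)
      rw [Real.div_rpow (by positivity) (by positivity), Real.rpow_neg (by positivity : 0 ≤ 1 + 2 * R)]
      field_simp
    calc _ ≤ C * (1 + R) ^ a * ((1 + 2 * R) ^ (β + 1 - a) * (1 + |(j : ℝ)|) ^ (-(β + 1 - a))) := by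
          gcongr
      _ = _ := by ring
  exact hcont.continuousAt (Metric.isOpen_ball.mem_nhds (by rw [mem_ball_zero_iff]; linarith))

/-- Let r = X + p. In the polynomial approximating A at X the variable is j - p - X = -(r - j), so
its contribution is a combination of discrete moments of `psi` and vanishes. The remainder has size
X^(a-θ)|r - j|^θ, which is summable against the decay of `psi` because θ < β. For X < 1 the trivial
bound suffices, as X ≥ -C₀ confines X to a bounded set. -/
theorem exists_sampled_bound (hφ : IsTestKernel m φ) (h1 : m ≤ β) (h2 : β < m + 1)
    (hrep : Reproduces N φ) (hNβ : (N : ℝ) - 1 < β) (hA : IsAmplitude a θ N A) (ha : 0 < a)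
    (haθ : a ≤ θ) (hθ : θ < β) (C₀ : ℝ) :
    ∃ C : ℝ, 0 ≤ C ∧ ∀ X p : ℝ, -C₀ ≤ X → ‖sampled β φ A X p‖ ≤ C * (1 + |X|) ^ (a - θ) := by
  obtain ⟨C, hC, hb⟩ := hφ.exists_psi_decay h1 h2
  obtain ⟨D, hD, hT⟩ := hA.taylor
  set S : ℝ → ℝ := fun b => 2 ^ b * ∑' j : ℤ, (1 + |(j : ℝ)|) ^ (-b)
  have hS : ∀ b, 0 ≤ S b := fun b => mul_nonneg (by positivity) (tsum_nonneg fun j => by positivity)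
  have hlarge : ∀ X p : ℝ, 1 ≤ X → ‖sampled β φ A X p‖ ≤ C * D * S (β + 1 - θ) * X ^ (a - θ) := by
    intro X p hX
    obtain ⟨c, hc⟩ := hT X hX
    set r := X + p
    have e : ∀ j : ℤ, psi β φ (r - j) * (A (j - p) : ℂ)
        = psi β φ (r - j) * ((A (j - p) - ∑ k ∈ Finset.range N, c k * (j - p - X) ^ k : ℝ) : ℂ)
          + ∑ k ∈ Finset.range N, (c k * (-1) ^ k : ℂ) * (((r - j : ℝ) : ℂ) ^ k * psi β φ (r - j)) := by
      intro j
      have : ∑ k ∈ Finset.range N, (c k * (-1) ^ k : ℂ) * (((r - j : ℝ) : ℂ) ^ k * psi β φ (r - j))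
          = psi β φ (r - j) * ((∑ k ∈ Finset.range N, c k * (j - p - X) ^ k : ℝ) : ℂ) := by
        rw [Complex.ofReal_sum, Finset.mul_sum]
        refine Finset.sum_congr rfl fun k _ => ?_
        have : ((j : ℝ) - p - X) = -(r - j) := by simp only [r]; ring
        rw [this, neg_pow (r - j : ℝ)]; push_cast; ring
      rw [this, ← mul_add, ← Complex.ofReal_add, sub_add_cancel]
    have hkβ : ∀ k ∈ Finset.range N, (k : ℝ) < β := by
      intro k hk
      have : (k : ℝ) + 1 ≤ N := by exact_mod_cast Finset.mem_range.1 hk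
      linarith
    have hbd : ∀ j : ℤ, ‖psi β φ (r - j) *
        ((A (j - p) - ∑ k ∈ Finset.range N, c k * (j - p - X) ^ k : ℝ) : ℂ)‖
        ≤ C * D * X ^ (a - θ) * (1 + |r - j|) ^ (-(β + 1 - θ)) := by
      intro j
      have h0 : 0 < 1 + |r - j| := by positivity
      rw [norm_mul, Complex.norm_real, Real.norm_eq_abs]
      have h3 := hc (j - p)
      rw [show (j : ℝ) - p - X = -(r - j) by simp only [r]; ring, abs_neg] at h3
      have h4 : |r - j| ^ θ ≤ (1 + |r - j|) ^ θ :=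
        Real.rpow_le_rpow (abs_nonneg _) (by linarith) (by linarith)
      rw [show (j : ℝ) - p - X = -(r - j) by simp only [r]; ring]
      have hX0 : 0 ≤ X ^ (a - θ) := by positivity
      calc _ ≤ (C * (1 + |r - j|) ^ (-(β + 1))) * (D * X ^ (a - θ) * (1 + |r - j|) ^ θ) := by
            gcongr
            · exact hb _
            · exact h3.trans (by gcongr)
        _ = C * D * X ^ (a - θ) * ((1 + |r - j|) ^ (-(β + 1)) * (1 + |r - j|) ^ θ) := by ring
        _ = _ := by rw [← Real.rpow_add h0]; congr 2; ring
    have hs1 := (summable_one_add_abs_sub (b := β + 1 - θ) (by linarith) r).mul_left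
      (C * D * X ^ (a - θ))
    have hs2 := Summable.of_norm_bounded hs1 hbd
    have hs3 : ∀ k ∈ Finset.range N, Summable fun j : ℤ =>
        (c k * (-1) ^ k : ℂ) * (((r - j : ℝ) : ℂ) ^ k * psi β φ (r - j)) :=
      fun k hk => (hφ.summable_pow_mul_psi h1 h2 (hkβ k hk) r).mul_left _
    have e2 : sampled β φ A X p = ∑' j : ℤ, psi β φ (r - j) *
        ((A (j - p) - ∑ k ∈ Finset.range N, c k * (j - p - X) ^ k : ℝ) : ℂ) := by
      unfold sampled
      simp_rw [show ∀ j : ℤ, X + p - (j : ℝ) = r - j from fun j => rfl]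
      simp_rw [e]
      rw [hs2.tsum_add (summable_sum hs3), Summable.tsum_finsetSum hs3]
      rw [Finset.sum_eq_zero, add_zero]
      intro k hk
      rw [tsum_mul_left, hφ.tsum_pow_mul_psi h1 h2 hrep (Finset.mem_range.1 hk).le (hkβ k hk),
        mul_zero]
    rw [e2]
    refine (tsum_of_norm_bounded hs1.hasSum hbd).trans ?_
    rw [tsum_mul_left]
    have := tsum_one_add_abs_sub_le (b := β + 1 - θ) (by linarith) r
    have hX0 : 0 ≤ X ^ (a - θ) := by positivity
    calc _ ≤ C * D * X ^ (a - θ) * S (β + 1 - θ) := by gcongr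
      _ = _ := by ring
  have hsmall : ∀ X p : ℝ, ‖sampled β φ A X p‖ ≤ C * (1 + |X|) ^ a * S (β + 1 - a) := by
    intro X p
    have hs1 := (summable_one_add_abs_sub (b := β + 1 - a) (by linarith)
      (X + p)).mul_left (C * (1 + |X|) ^ a)
    refine (tsum_of_norm_bounded hs1.hasSum fun j => ?_).trans ?_
    · have := norm_mul_amplitude_le (X := X) hA ha.le (hb (X + p - j))
      rwa [show X - (X + p - j) = j - p by ring] at this
    · rw [tsum_mul_left]
      gcongr
      exact tsum_one_add_abs_sub_le (by linarith) _
  -- `B` bounds 1 + |X| on the range -C₀ ≤ X < 1 that is left to the trivial estimate.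
  set B := 1 + max C₀ 1 with hB
  have hB1 : 1 ≤ B := by rw [hB]; linarith [le_max_right C₀ 1]
  refine ⟨C * D * S (β + 1 - θ) * 2 ^ (θ - a) + C * B ^ a * S (β + 1 - a) * B ^ (θ - a), ?_,
    fun X p hX => ?_⟩
  · have := hS (β + 1 - θ); have := hS (β + 1 - a); positivity
  have hX0 : 0 ≤ (1 + |X|) ^ (a - θ) := by positivity
  have hSθ := hS (β + 1 - θ)
  have hSa := hS (β + 1 - a)
  rw [add_mul]
  rcases le_or_gt 1 X with h | h
  · refine (hlarge X p h).trans (le_trans ?_ (le_add_of_nonneg_right (by positivity)))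
    rw [mul_assoc (C * D * S (β + 1 - θ))]
    gcongr
    have h3 : (1 + |X|) / 2 ≤ X := by rw [abs_of_pos (by linarith)]; linarith
    refine (Real.rpow_le_rpow_of_nonpos (by positivity) h3 (by linarith)).trans (le_of_eq ?_)
    rw [Real.div_rpow (by positivity) (by norm_num), show a - θ = -(θ - a) by ring,
      Real.rpow_neg (by norm_num : (0 : ℝ) ≤ 2)]
    field_simp
  · refine (hsmall X p).trans (le_trans ?_ (le_add_of_nonneg_left (by positivity)))
    have h3 : 1 + |X| ≤ B := by
      rw [hB]
      gcongr
      rw [abs_le]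
      exact ⟨by linarith [le_max_left C₀ 1], by linarith [le_max_right C₀ 1]⟩
    have h4 : (1 + |X|) ^ a ≤ B ^ a := Real.rpow_le_rpow (by positivity) h3 ha.le
    have h5 : 1 ≤ B ^ (θ - a) * (1 + |X|) ^ (a - θ) := by
      rw [show a - θ = -(θ - a) by ring, Real.rpow_neg (by positivity), ← div_eq_mul_inv,
        one_le_div (by positivity)]
      exact Real.rpow_le_rpow (by positivity) h3 (by linarith)
    calc _ ≤ C * B ^ a * S (β + 1 - a) * 1 := by rw [mul_one]; gcongr
      _ ≤ C * B ^ a * S (β + 1 - a) * (B ^ (θ - a) * (1 + |X|) ^ (a - θ)) := by gcongr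
      _ = _ := by ring

end IsTestKernel

end

end DTB


namespace DTB

noncomputable section

/-! ### The mean of the sampled convolution -/

/-- `∫_0^∞ l^b φ̂(l) e^{-ilX} dl`. -/
def halfWave (b : ℝ) (φ : ℝ → ℂ) (X : ℝ) : ℂ :=
  ∫ l in Set.Ioi (0 : ℝ), ((l ^ b : ℝ) : ℂ) * ft φ l * Complex.exp (-(Complex.I * l * X))

theorem ofReal_mul_cpow {x : ℝ} (hx : 0 < x) {z : ℂ} (hz : z ≠ 0) (w : ℂ) :
    ((x : ℂ) * z) ^ w = (x : ℂ) ^ w * z ^ w := by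
  have hx' : (x : ℂ) ≠ 0 := Complex.ofReal_ne_zero.2 hx.ne'
  rw [Complex.cpow_def_of_ne_zero (mul_ne_zero hx' hz), Complex.cpow_def_of_ne_zero hx',
    Complex.cpow_def_of_ne_zero hz, Complex.log_ofReal_mul hx hz, ← Complex.exp_add,
    Complex.ofReal_log hx.le]
  congr 1; ring

theorem neg_I_mul_cpow {l σ b : ℝ} (hl : 0 < l) (hσ : σ = 1 ∨ σ = -1) :
    (-(σ * Complex.I * l)) ^ (-(b : ℂ))
      = ((l ^ (-b) : ℝ) : ℂ) * Complex.exp (Complex.I * σ * (Real.pi / 2) * b) := by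
  have h1 : (-(σ * Complex.I * l) : ℂ) = (l : ℂ) * (-(σ * Complex.I)) := by ring
  have h2 : (-(σ * Complex.I) : ℂ) ≠ 0 := by
    rcases hσ with rfl | rfl <;> simp
  have h3 : Complex.log (-(σ * Complex.I)) = -(σ * (Real.pi / 2) * Complex.I) := by
    rcases hσ with rfl | rfl
    · simp [Complex.log_neg_I]
    · simp [Complex.log_I]
  rw [h1, ← Complex.ofReal_neg, ofReal_mul_cpow hl h2, ← Complex.ofReal_cpow hl.le]
  congr 1
  rw [Complex.cpow_def_of_ne_zero h2, h3]
  congr 1; push_cast; ring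

namespace IsTestKernel

variable {m : ℕ} {φ A : ℝ → ℝ} {β a θ : ℝ} {N : ℕ}

theorem integrable_psi_mul_amplitude (hφ : IsTestKernel m φ) (h1 : m ≤ β) (h2 : β < m + 1)
    (hA : IsAmplitude a θ N A) (ha : 0 ≤ a) (haβ : a < β) (X : ℝ) :
    Integrable fun y : ℝ => psi β φ (X - y) * (A y : ℂ) := by
  obtain ⟨C, hC, hb⟩ := hφ.exists_psi_decay h1 h2
  have hc := hφ.continuous_psi h1 h2
  have hAc := hA.continuous
  have hi := ((integrable_one_add_norm (E := ℝ) (μ := volume) (r := β + 1 - a)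
    (by simp; linarith)).comp_sub_left X).const_mul (C * (1 + |X|) ^ a)
  refine hi.mono' (Continuous.aestronglyMeasurable (by fun_prop)) (Eventually.of_forall fun y => ?_)
  have := norm_mul_amplitude_le (X := X) hA ha (hb (X - y))
  rwa [sub_sub_cancel] at this

/-- Unfolding: a sum over integer translates, integrated over one period, is an integral over the
line. -/
theorem integral_sampled (hφ : IsTestKernel m φ) (h1 : m ≤ β) (h2 : β < m + 1)
    (hA : IsAmplitude a θ N A) (ha : 0 ≤ a) (haβ : a < β) (X : ℝ) :
    ∫ p in (0 : ℝ)..1, sampled β φ A X p = ∫ y : ℝ, psi β φ (X - y) * (A y : ℂ) := by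
  have hi := (hφ.integrable_psi_mul_amplitude h1 h2 hA ha haβ X).comp_neg
  simp only [sub_neg_eq_add] at hi
  have e0 : ∫ y : ℝ, psi β φ (X - y) * (A y : ℂ) = ∫ z : ℝ, psi β φ (X + z) * (A (-z) : ℂ) := by
    rw [← integral_neg_eq_self]; simp
  have hs := hi.hasSum_intervalIntegral_comp_add_int
  have hs' := (hi.norm.hasSum_intervalIntegral_comp_add_int).summable
  simp only [intervalIntegral.integral_of_le zero_le_one] at hs hs' ⊢
  have hii : ∀ n : ℤ, Integrable (fun x : ℝ => psi β φ (X + (x + n)) * (A (-(x + n)) : ℂ))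
      (volume.restrict (Set.Ioc 0 1)) := fun n => (hi.comp_add_right (n : ℝ)).integrableOn
  have key := hasSum_integral_of_summable_integral_norm hii hs'
  rw [e0, hs.unique key]
  refine integral_congr_ae (Eventually.of_forall fun p => ?_)
  simp only [sampled]
  rw [← (Equiv.neg ℤ).tsum_eq]
  congr 1; ext n
  simp only [Equiv.neg_apply]
  push_cast
  congr 2
  · ring
  · congr 1; ring

/-- The damping e^(-ηy) together with the Abel factor makes the double integral absolutely
convergent. The y-integral is then the Laplace integral of a pure power at η - iσl. -/
theorem integral_abelExt_mul_rpow (hφ : IsTestKernel m φ) (hβ : -1 < β) (ha : -1 < a) {σ : ℝ}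
    {η : ℝ} (hη : 0 < η) (X : ℝ) :
    ∫ y in Set.Ioi (0 : ℝ), abelExt β (fun y => (φ y : ℂ)) η (X - σ * y) *
        (((y ^ a : ℝ) : ℂ) * Complex.exp (-(η * y)))
      = 1 / (2 * Real.pi) * ∫ l in Set.Ioi (0 : ℝ), ((l ^ β : ℝ) : ℂ) * ft (fun y => (φ y : ℂ)) l *
        Complex.exp (-((η + Complex.I * X) * l)) *
        ((Real.Gamma (a + 1) : ℂ) * (η + -(σ * Complex.I * l)) ^ (-((a + 1 : ℝ) : ℂ))) := by
  have hft := (continuous_ft hφ.integrable).measurable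
  unfold abelExt lap
  simp_rw [mul_assoc (1 / (2 * Real.pi : ℂ))]
  rw [integral_const_mul]
  congr 1
  simp_rw [← integral_mul_const]
  have hint : Integrable (Function.uncurry fun (y l : ℝ) => ((l ^ β : ℝ) : ℂ) *
      ft (fun y => (φ y : ℂ)) l * Complex.exp (-((η + Complex.I * ((X - σ * y : ℝ) : ℂ)) * l)) *
      (((y ^ a : ℝ) : ℂ) * Complex.exp (-(η * y))))
      ((volume.restrict (Set.Ioi (0 : ℝ))).prod (volume.restrict (Set.Ioi (0 : ℝ)))) := by
    have h1 := (integrableOn_rpow_mul_exp ha hη).integrable.mul_prod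
      ((integrableOn_rpow_mul_exp hβ hη).integrable.const_mul (∫ y, ‖(φ y : ℂ)‖))
    refine h1.mono' (Measurable.aestronglyMeasurable (by fun_prop)) ?_
    have hpos1 : ∀ᵐ z : ℝ × ℝ ∂((volume.restrict (Set.Ioi (0 : ℝ))).prod
        (volume.restrict (Set.Ioi (0 : ℝ)))), 0 < z.1 :=
      Measure.quasiMeasurePreserving_fst.ae (ae_restrict_mem measurableSet_Ioi)
    have hpos2 : ∀ᵐ z : ℝ × ℝ ∂((volume.restrict (Set.Ioi (0 : ℝ))).prod
        (volume.restrict (Set.Ioi (0 : ℝ)))), 0 < z.2 :=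
      Measure.quasiMeasurePreserving_snd.ae (ae_restrict_mem measurableSet_Ioi)
    filter_upwards [hpos1, hpos2] with z hz1 hz2
    simp only [Function.uncurry]
    rw [norm_mul, mul_comm]
    have h3 : ‖((z.1 ^ a : ℝ) : ℂ) * Complex.exp (-(η * z.1))‖ = z.1 ^ a * Real.exp (-(η * z.1)) := by
      rw [norm_mul, Complex.norm_real, Real.norm_of_nonneg (Real.rpow_nonneg hz1.le _),
        ← Complex.ofReal_mul, norm_cexp_neg_ofReal]
    rw [h3]
    refine mul_le_mul_of_nonneg_left ?_ (by positivity)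
    exact norm_lap_integrand_le (norm_ft_le _) hz2 (by simp)
  rw [integral_integral_swap hint]
  congr 1; ext l
  have hl := lap_one (a := a) (r := η + -(σ * Complex.I * l)) ha (by simpa using hη)
  have e1 : (-(a + 1 : ℂ)) = -((a + 1 : ℝ) : ℂ) := by push_cast; ring
  rw [e1] at hl
  rw [← hl, lap, ← integral_const_mul]
  congr 1; ext y
  have : Complex.exp (-((η + Complex.I * ((X - σ * y : ℝ) : ℂ)) * l)) * Complex.exp (-(η * y))
      = Complex.exp (-((η + Complex.I * X) * l)) * Complex.exp (-((η + -(σ * Complex.I * l)) * y)) := by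
    rw [← Complex.exp_add, ← Complex.exp_add]; congr 1; push_cast; ring
  linear_combination ((l ^ β : ℝ) : ℂ) * ft (fun y => (φ y : ℂ)) l * ((y ^ a : ℝ) : ℂ) * this

/-- The Fourier transform of a one-sided power: convolution with |y|^a on the half-line of sign σ
divides the symbol by l^(a+1) and contributes the phase e^(iσπ(a+1)/2). The new exponent β - (a + 1)
is below m, so the frequency integral converges absolutely and both sides pass to the limit η → 0.
-/
theorem integral_psi_mul_rpow (hφ : IsTestKernel m φ) (h1 : m ≤ β) (h2 : β < m + 1)
    (ha : 0 < a) (haβ : a < β) {σ : ℝ} (hσ : σ = 1 ∨ σ = -1) (X : ℝ) :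
    ∫ y in Set.Ioi (0 : ℝ), psi β φ (X - σ * y) * ((y ^ a : ℝ) : ℂ)
      = 1 / (2 * Real.pi) * (Real.Gamma (a + 1) : ℂ) *
        Complex.exp (Complex.I * σ * (Real.pi / 2) * ((a + 1 : ℝ) : ℂ)) *
        halfWave (β - (a + 1)) (fun y => (φ y : ℂ)) X := by
  have hβ : -1 < β := by linarith
  obtain ⟨C, hC, hb⟩ := hφ.exists_abelExt_decay h1 h2
  have hft := (continuous_ft hφ.integrable).measurable
  have hη1 : ∀ᶠ η : ℝ in 𝓝[>] 0, 0 < η ∧ η ≤ 1 := Ioc_mem_nhdsGT one_pos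
  have l1 : Tendsto (fun η : ℝ => ∫ y in Set.Ioi (0 : ℝ), abelExt β (fun y => (φ y : ℂ)) η (X - σ * y) *
        (((y ^ a : ℝ) : ℂ) * Complex.exp (-(η * y)))) (𝓝[>] 0)
      (𝓝 (∫ y in Set.Ioi (0 : ℝ), psi β φ (X - σ * y) * ((y ^ a : ℝ) : ℂ))) := by
    have hi := ((integrable_one_add_norm (E := ℝ) (μ := volume) (r := β + 1 - a)
      (by simp; linarith)).comp_sub_left (σ * X)).const_mul (C * (1 + |X|) ^ a)
    refine tendsto_integral_filter_of_dominated_convergence _ ?_ ?_ hi.integrableOn.integrable ?_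
    · filter_upwards [hη1] with η hη
      have hc := (continuous_abelExt hβ hη.1 hφ.integrable).measurable
      exact Measurable.aestronglyMeasurable (by fun_prop)
    · filter_upwards [hη1] with η hη
      filter_upwards [ae_restrict_mem measurableSet_Ioi] with y hy
      have hy0 : 0 < y := hy
      have e : |X - σ * y| = ‖σ * X - y‖ := by
        rw [Real.norm_eq_abs]
        rcases hσ with rfl | rfl
        · simp
        · rw [← abs_neg]; congr 1; ring
      have h0 : 0 < 1 + |X - σ * y| := by positivity
      have hy1 : y ^ a ≤ (1 + |X|) ^ a * (1 + |X - σ * y|) ^ a := by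
        rw [← Real.mul_rpow (by positivity) (by positivity)]
        refine Real.rpow_le_rpow hy0.le ?_ ha.le
        have h3 := one_add_abs_le_mul X (-(X - σ * y))
        rw [abs_neg, show X + -(X - σ * y) = σ * y by ring, abs_mul,
          show |σ| = 1 by rcases hσ with rfl | rfl <;> simp, one_mul, abs_of_pos hy0] at h3
        linarith
      have h4 : ‖Complex.exp (-(η * y : ℂ))‖ ≤ 1 := by
        rw [← Complex.ofReal_mul, norm_cexp_neg_ofReal, Real.exp_le_one_iff]
        nlinarith [hη.1]
      rw [norm_mul, norm_mul, Complex.norm_real, Real.norm_of_nonneg (Real.rpow_nonneg hy0.le _), ← e]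
      calc _ ≤ (C * (1 + |X - σ * y|) ^ (-(β + 1))) *
            (((1 + |X|) ^ a * (1 + |X - σ * y|) ^ a) * 1) := by
            gcongr
            exact hb η hη.1 hη.2 _
        _ = C * (1 + |X|) ^ a * ((1 + |X - σ * y|) ^ (-(β + 1)) * (1 + |X - σ * y|) ^ a) := by ring
        _ = _ := by rw [← Real.rpow_add h0]; congr 2; ring
    · refine Eventually.of_forall fun y => (hφ.tendsto_psi h1 h2 _).mul ?_
      have : Continuous fun η : ℝ => ((y ^ a : ℝ) : ℂ) * Complex.exp (-(η * y)) := by fun_prop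
      simpa using (this.tendsto 0).mono_left (nhdsWithin_le_nhds (s := Set.Ioi 0))
  have l2 : Tendsto (fun η : ℝ => 1 / (2 * Real.pi : ℂ) * ∫ l in Set.Ioi (0 : ℝ), ((l ^ β : ℝ) : ℂ) *
        ft (fun y => (φ y : ℂ)) l * Complex.exp (-((η + Complex.I * X) * l)) *
        ((Real.Gamma (a + 1) : ℂ) * (η + -(σ * Complex.I * l)) ^ (-((a + 1 : ℝ) : ℂ)))) (𝓝[>] 0)
      (𝓝 (1 / (2 * Real.pi : ℂ) * ∫ l in Set.Ioi (0 : ℝ), ((l ^ β : ℝ) : ℂ) *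
        ft (fun y => (φ y : ℂ)) l * Complex.exp (-(Complex.I * X * l)) *
        ((Real.Gamma (a + 1) : ℂ) * (-(σ * Complex.I * l)) ^ (-((a + 1 : ℝ) : ℂ))))) := by
    refine Tendsto.const_mul _ ?_
    have hG : 0 < Real.Gamma (a + 1) := Real.Gamma_pos_of_pos (by linarith)
    have hi := (hφ.integrable_rpow_mul_ft (a := β - (a + 1)) (by linarith) (by linarith)).const_mul
      (Real.Gamma (a + 1))
    refine tendsto_integral_filter_of_dominated_convergence _ ?_ ?_ hi ?_
    · exact Eventually.of_forall fun η => Measurable.aestronglyMeasurable (by fun_prop)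
    · filter_upwards [hη1] with η hη
      filter_upwards [ae_restrict_mem measurableSet_Ioi] with l hl
      have hl0 : 0 < l := hl
      have e : (η : ℂ) + -(σ * Complex.I * l) = (η : ℂ) + Complex.I * ((-(σ * l) : ℝ) : ℂ) := by
        push_cast; ring
      rw [e, norm_mul, norm_mul, norm_mul, norm_mul, norm_eta_cpow, Complex.norm_real,
        Complex.norm_real, Real.norm_of_nonneg (Real.rpow_nonneg hl0.le _),
        Real.norm_of_nonneg hG.le]
      have h3 : ‖Complex.exp (-((η + Complex.I * X) * l))‖ ≤ 1 := by
        rw [Complex.norm_exp, Real.exp_le_one_iff]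
        simp; nlinarith [hη.1]
      have h4 : ‖(η : ℂ) + Complex.I * ((-(σ * l) : ℝ) : ℂ)‖ ^ (-(a + 1)) ≤ l ^ (-(a + 1)) := by
        refine Real.rpow_le_rpow_of_nonpos hl0 ?_ (by linarith)
        refine le_trans (le_of_eq ?_) (norm_eta_add_ge η (-(σ * l)))
        rw [abs_neg, abs_mul, show |σ| = 1 by rcases hσ with rfl | rfl <;> simp, one_mul,
          abs_of_pos hl0]
      calc _ ≤ l ^ β * ‖ft (fun y => (φ y : ℂ)) l‖ * 1 * (Real.Gamma (a + 1) * l ^ (-(a + 1))) := by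
            gcongr
        _ = Real.Gamma (a + 1) * ((l ^ β * l ^ (-(a + 1))) * ‖ft (fun y => (φ y : ℂ)) l‖) := by ring
        _ = _ := by rw [← Real.rpow_add hl0]; congr 2
    · filter_upwards [ae_restrict_mem measurableSet_Ioi] with l hl
      have hl0 : 0 < l := hl
      refine Tendsto.mul (Tendsto.const_mul _ ?_) (Tendsto.const_mul _ ?_)
      · have : Continuous fun η : ℝ => Complex.exp (-((η + Complex.I * X) * l)) := by fun_prop
        simpa using (this.tendsto 0).mono_left (nhdsWithin_le_nhds (s := Set.Ioi 0))
      · have hc : ContinuousAt (fun η : ℝ => ((η : ℂ) + -(σ * Complex.I * l)) ^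
            (-((a + 1 : ℝ) : ℂ))) 0 := by
          refine ContinuousAt.cpow (by fun_prop) continuousAt_const (Or.inr ?_)
          simp only [Complex.ofReal_zero, zero_add]
          rcases hσ with rfl | rfl <;> simp [hl0.ne']
        have := hc.tendsto.mono_left (nhdsWithin_le_nhds (s := Set.Ioi 0))
        simpa using this
  have key := tendsto_nhds_unique l1 (l2.congr' (by
    filter_upwards [self_mem_nhdsWithin] with η hη
    exact (hφ.integral_abelExt_mul_rpow hβ (by linarith) hη X).symm))
  rw [key, mul_assoc, mul_assoc]
  congr 1
  unfold halfWave
  rw [← integral_const_mul, ← integral_const_mul]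
  refine setIntegral_congr_fun measurableSet_Ioi fun l hl => ?_
  have hl0 : 0 < l := hl
  rw [neg_I_mul_cpow hl0 hσ, sub_eq_add_neg, Real.rpow_add hl0]
  push_cast
  ring_nf

theorem integrable_halfWave_integrand (hφ : IsTestKernel m φ) {b : ℝ} (hb : -1 < b) (hbm : b < m)
    (X : ℝ) : IntegrableOn (fun l : ℝ => ((l ^ b : ℝ) : ℂ) * ft (fun y => (φ y : ℂ)) l *
      Complex.exp (-(Complex.I * l * X))) (Set.Ioi 0) := by
  have hft := (continuous_ft hφ.integrable).measurable
  refine Integrable.mono' (hφ.integrable_rpow_mul_ft hb hbm)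
    (Measurable.aestronglyMeasurable (by fun_prop)) ?_
  filter_upwards [ae_restrict_mem measurableSet_Ioi] with l hl
  rw [norm_mul, norm_mul, norm_cexp_neg_I, Complex.norm_real,
    Real.norm_of_nonneg (Real.rpow_nonneg (le_of_lt hl) _), mul_one]

theorem continuous_halfWave (hφ : IsTestKernel m φ) {b : ℝ} (hb : -1 < b) (hbm : b < m) :
    Continuous (halfWave b fun y => (φ y : ℂ)) := by
  refine continuous_of_dominated (fun X => (hφ.integrable_halfWave_integrand hb hbm
    X).aestronglyMeasurable) (fun X => ?_) (hφ.integrable_rpow_mul_ft hb hbm)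
    (Eventually.of_forall fun l => by fun_prop)
  filter_upwards [ae_restrict_mem measurableSet_Ioi] with l hl
  rw [norm_mul, norm_mul, norm_cexp_neg_I, Complex.norm_real,
    Real.norm_of_nonneg (Real.rpow_nonneg (le_of_lt hl) _), mul_one]

/-- Fubini and the Gaussian integral in d variables with the complex parameter (η + il)/2. -/
theorem integral_halfWave_gauss (hφ : IsTestKernel m φ) {b : ℝ} (hb : -1 < b) (hbm : b < m) (d : ℕ)
    {η : ℝ} (hη : 0 < η) (h : ℝ) :
    ∫ z : Vec d, halfWave b (fun y => (φ y : ℂ)) (h + ‖z‖ ^ 2 / 2) *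
        Complex.exp (-((η / 2 * ‖z‖ ^ 2 : ℝ) : ℂ))
      = ∫ l in Set.Ioi (0 : ℝ), ((l ^ b : ℝ) : ℂ) * ft (fun y => (φ y : ℂ)) l *
        Complex.exp (-(Complex.I * l * h)) *
        (Real.pi / ((η + Complex.I * l) / 2)) ^ ((d : ℂ) / 2) := by
  have hft := (continuous_ft hφ.integrable).measurable
  unfold halfWave
  simp_rw [← integral_mul_const]
  have hg : Integrable fun z : Vec d => Real.exp (-(η / 2 * ‖z‖ ^ 2)) := by
    have := GaussianFourier.integrable_cexp_neg_mul_sq_norm_add (V := Vec d) (b := ((η / 2 : ℝ) : ℂ))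
      (by simpa using hη) 0 0
    refine this.norm.congr (Eventually.of_forall fun z => ?_)
    simp only [zero_mul, add_zero]
    rw [Complex.norm_exp]
    congr 1
    simp [← Complex.ofReal_pow]
  have hint : Integrable (Function.uncurry fun (z : Vec d) (l : ℝ) => ((l ^ b : ℝ) : ℂ) *
      ft (fun y => (φ y : ℂ)) l * Complex.exp (-(Complex.I * l * ((h + ‖z‖ ^ 2 / 2 : ℝ) : ℂ))) *
      Complex.exp (-((η / 2 * ‖z‖ ^ 2 : ℝ) : ℂ)))
      (volume.prod (volume.restrict (Set.Ioi (0 : ℝ)))) := by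
    have h1 := hg.mul_prod (hφ.integrable_rpow_mul_ft hb hbm).integrable
    refine h1.mono' (Measurable.aestronglyMeasurable (by fun_prop)) ?_
    have hpos2 : ∀ᵐ z : Vec d × ℝ ∂(volume.prod (volume.restrict (Set.Ioi (0 : ℝ)))), 0 < z.2 :=
      Measure.quasiMeasurePreserving_snd.ae (ae_restrict_mem measurableSet_Ioi)
    filter_upwards [hpos2] with z hz2
    simp only [Function.uncurry]
    rw [norm_mul, norm_mul, norm_mul, norm_cexp_neg_ofReal, norm_cexp_neg_I, Complex.norm_real,
      Real.norm_of_nonneg (Real.rpow_nonneg hz2.le _), mul_one, mul_comm]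
  rw [integral_integral_swap hint]
  congr 1; ext l
  have hG := GaussianFourier.integral_cexp_neg_mul_sq_norm (V := Vec d)
    (b := (η + Complex.I * l) / 2) (by simpa using hη)
  rw [finrank_euclideanSpace_fin] at hG
  rw [← hG, ← integral_const_mul]
  congr 1; ext z
  have : Complex.exp (-(Complex.I * l * ((h + ‖z‖ ^ 2 / 2 : ℝ) : ℂ))) *
      Complex.exp (-((η / 2 * ‖z‖ ^ 2 : ℝ) : ℂ)) = Complex.exp (-(Complex.I * l * h)) *
      Complex.exp (-((η + Complex.I * l) / 2) * (‖z‖ : ℂ) ^ 2) := by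
    rw [← Complex.exp_add, ← Complex.exp_add]; congr 1; push_cast; ring
  rw [mul_assoc, this]; ring

/-- A Fresnel integral: as η → 0 the Gaussian factor tends to (2π/l)^(d/2) e^(-iπd/4). The decay
`hW` is of order 2γ > d in z and justifies the limit on the side of the z-integral. -/
theorem integral_halfWave_sq (hφ : IsTestKernel m φ) {b : ℝ} (hb : -1 < b) (hbm : b < m) {d : ℕ}
    (hbd : -1 < b - d / 2) {h C γ : ℝ} (hγ : (d : ℝ) / 2 < γ)
    (hW : ∀ X, h ≤ X → ‖halfWave b (fun y => (φ y : ℂ)) X‖ ≤ C * (1 + |X|) ^ (-γ)) :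
    Integrable (fun z : Vec d => halfWave b (fun y => (φ y : ℂ)) (h + ‖z‖ ^ 2 / 2)) ∧
    ∫ z : Vec d, halfWave b (fun y => (φ y : ℂ)) (h + ‖z‖ ^ 2 / 2)
      = (((2 * Real.pi) ^ ((d : ℝ) / 2) : ℝ) : ℂ) *
        Complex.exp (-(Complex.I * ((d : ℝ) / 2 : ℝ) * (Real.pi / 2))) *
        halfWave (b - d / 2) (fun y => (φ y : ℂ)) h := by
  have hft := (continuous_ft hφ.integrable).measurable
  have hcW := hφ.continuous_halfWave hb hbm
  have hγ0 : 0 < γ := lt_of_le_of_lt (by positivity) hγ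
  have hC : 0 ≤ C := by
    have h3 := (norm_nonneg _).trans (hW h le_rfl)
    by_contra h4
    exact absurd h3 (not_le.2 (mul_neg_of_neg_of_pos (not_le.1 h4) (by positivity)))
  obtain ⟨D, hD, hWz⟩ : ∃ D : ℝ, 0 ≤ D ∧ ∀ z : Vec d,
      ‖halfWave b (fun y => (φ y : ℂ)) (h + ‖z‖ ^ 2 / 2)‖ ≤ D * (1 + ‖z‖) ^ (-(2 * γ)) := by
    refine ⟨C * (4 * (1 + |h|)) ^ γ, by positivity, fun z => ?_⟩
    refine (hW _ (by nlinarith [sq_nonneg ‖z‖])).trans ?_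
    rw [mul_assoc]
    refine mul_le_mul_of_nonneg_left ?_ hC
    have h3 : (1 + ‖z‖) ^ 2 / (4 * (1 + |h|)) ≤ 1 + |h + ‖z‖ ^ 2 / 2| := by
      rw [div_le_iff₀ (by positivity)]
      have h4 := one_add_abs_le_mul (h + ‖z‖ ^ 2 / 2) (-h)
      rw [abs_neg, show h + ‖z‖ ^ 2 / 2 + -h = ‖z‖ ^ 2 / 2 by ring,
        abs_of_nonneg (by positivity : 0 ≤ ‖z‖ ^ 2 / 2)] at h4
      nlinarith [sq_nonneg (‖z‖ - 1)]
    refine (Real.rpow_le_rpow_of_nonpos (by positivity) h3 (by linarith)).trans (le_of_eq ?_)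
    rw [Real.div_rpow (by positivity) (by positivity), ← Real.rpow_natCast,
      ← Real.rpow_mul (by positivity), Real.rpow_neg (by positivity : 0 ≤ 4 * (1 + |h|))]
    rw [div_inv_eq_mul, mul_comm]
    congr 2; push_cast; ring
  have hjb := (integrable_one_add_norm (E := Vec d) (μ := volume) (r := 2 * γ)
    (by rw [finrank_euclideanSpace_fin]; linarith)).const_mul D
  have hcz : Continuous fun z : Vec d => halfWave b (fun y => (φ y : ℂ)) (h + ‖z‖ ^ 2 / 2) := by
    fun_prop
  refine ⟨hjb.mono' hcz.aestronglyMeasurable (Eventually.of_forall hWz), ?_⟩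
  have l1 : Tendsto (fun η : ℝ => ∫ z : Vec d, halfWave b (fun y => (φ y : ℂ)) (h + ‖z‖ ^ 2 / 2) *
        Complex.exp (-((η / 2 * ‖z‖ ^ 2 : ℝ) : ℂ))) (𝓝[>] 0)
      (𝓝 (∫ z : Vec d, halfWave b (fun y => (φ y : ℂ)) (h + ‖z‖ ^ 2 / 2))) := by
    refine tendsto_integral_filter_of_dominated_convergence _ ?_ ?_ hjb ?_
    · exact Eventually.of_forall fun η => Continuous.aestronglyMeasurable (by fun_prop)
    · filter_upwards [self_mem_nhdsWithin] with η hη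
      refine Eventually.of_forall fun z => ?_
      have hη0 : 0 < η := hη
      rw [norm_mul, norm_cexp_neg_ofReal]
      have : Real.exp (-(η / 2 * ‖z‖ ^ 2)) ≤ 1 := by
        rw [Real.exp_le_one_iff, neg_nonpos]; positivity
      calc _ ≤ D * (1 + ‖z‖) ^ (-(2 * γ)) * 1 := by
            gcongr
            exact hWz z
        _ = _ := mul_one _
    · refine Eventually.of_forall fun z => ?_
      have : Continuous fun η : ℝ => halfWave b (fun y => (φ y : ℂ)) (h + ‖z‖ ^ 2 / 2) *
        Complex.exp (-((η / 2 * ‖z‖ ^ 2 : ℝ) : ℂ)) := by fun_prop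
      simpa using (this.tendsto 0).mono_left (nhdsWithin_le_nhds (s := Set.Ioi 0))
  have hnorm : ∀ (η l : ℝ), 0 < l → ‖((Real.pi / ((η + Complex.I * l) / 2)) ^ ((d : ℂ) / 2) : ℂ)‖
      ≤ (2 * Real.pi) ^ ((d : ℝ) / 2) * l ^ (-((d : ℝ) / 2)) := by
    intro η l hl
    have e1 : ((d : ℂ) / 2) = (((d : ℝ) / 2 : ℝ) : ℂ) := by push_cast; ring
    rw [e1, Complex.norm_cpow_real, norm_div, norm_div, Complex.norm_real, Complex.norm_ofNat,
      Real.norm_of_nonneg Real.pi_pos.le, div_div_eq_mul_div, mul_comm Real.pi,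
      Real.rpow_neg hl.le, ← div_eq_mul_inv, ← Real.div_rpow (by positivity) hl.le]
    have := norm_eta_add_ge η l
    rw [abs_of_pos hl] at this
    gcongr
  have l2 : Tendsto (fun η : ℝ => ∫ l in Set.Ioi (0 : ℝ), ((l ^ b : ℝ) : ℂ) *
        ft (fun y => (φ y : ℂ)) l * Complex.exp (-(Complex.I * l * h)) *
        (Real.pi / ((η + Complex.I * l) / 2)) ^ ((d : ℂ) / 2)) (𝓝[>] 0)
      (𝓝 (∫ l in Set.Ioi (0 : ℝ), ((l ^ b : ℝ) : ℂ) *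
        ft (fun y => (φ y : ℂ)) l * Complex.exp (-(Complex.I * l * h)) *
        ((((2 * Real.pi) ^ ((d : ℝ) / 2) : ℝ) : ℂ) * (((l ^ (-((d : ℝ) / 2)) : ℝ) : ℂ) *
        Complex.exp (-(Complex.I * ((d : ℝ) / 2 : ℝ) * (Real.pi / 2))))))) := by
    have hi := (hφ.integrable_rpow_mul_ft (a := b - d / 2) hbd (by
      have : (0 : ℝ) ≤ d / 2 := by positivity
      linarith)).const_mul ((2 * Real.pi) ^ ((d : ℝ) / 2))
    refine tendsto_integral_filter_of_dominated_convergence _ ?_ ?_ hi ?_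
    · exact Eventually.of_forall fun η => Measurable.aestronglyMeasurable (by fun_prop)
    · refine Eventually.of_forall fun η => ?_
      filter_upwards [ae_restrict_mem measurableSet_Ioi] with l hl
      have hl0 : 0 < l := hl
      rw [norm_mul, norm_mul, norm_mul, norm_cexp_neg_I, Complex.norm_real,
        Real.norm_of_nonneg (Real.rpow_nonneg hl0.le _), mul_one]
      calc _ ≤ l ^ b * ‖ft (fun y => (φ y : ℂ)) l‖ *
            ((2 * Real.pi) ^ ((d : ℝ) / 2) * l ^ (-((d : ℝ) / 2))) := by
            gcongr
            exact hnorm η l hl0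
        _ = (2 * Real.pi) ^ ((d : ℝ) / 2) * ((l ^ b * l ^ (-((d : ℝ) / 2))) *
            ‖ft (fun y => (φ y : ℂ)) l‖) := by ring
        _ = _ := by rw [← Real.rpow_add hl0, ← sub_eq_add_neg]
    · filter_upwards [ae_restrict_mem measurableSet_Ioi] with l hl
      have hl0 : 0 < l := hl
      refine Tendsto.const_mul _ ?_
      have hIl : Complex.I * (l : ℂ) ≠ 0 := by simp [hl0.ne']
      -- The factor -i is the origin of the phase e^(-iπd/4).
      have hval : (Real.pi / ((0 + Complex.I * l) / 2) : ℂ)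
          = ((2 * Real.pi / l : ℝ) : ℂ) * (-Complex.I) := by
        have : (l : ℂ) ≠ 0 := Complex.ofReal_ne_zero.2 hl0.ne'
        rw [zero_add]; push_cast; field_simp
        linear_combination Complex.I_sq
      have hc : ContinuousAt (fun η : ℝ => (Real.pi / ((η + Complex.I * l) / 2) : ℂ) ^
          ((d : ℂ) / 2)) 0 := by
        refine ContinuousAt.cpow ?_ continuousAt_const (Or.inr ?_)
        · refine ContinuousAt.div continuousAt_const (by fun_prop) ?_
          simp [hl0.ne']
        · rw [Complex.ofReal_zero, hval, Complex.im_ofReal_mul]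
          simp [hl0.ne', Real.pi_ne_zero]
      have h3 := hc.tendsto.mono_left (nhdsWithin_le_nhds (s := Set.Ioi 0))
      convert h3 using 2
      rw [Complex.ofReal_zero, hval, ofReal_mul_cpow (by positivity) (by simp),
        show ((d : ℂ) / 2) = (((d : ℝ) / 2 : ℝ) : ℂ) by push_cast; ring,
        ← Complex.ofReal_cpow (by positivity), Complex.cpow_def_of_ne_zero (by simp : -Complex.I ≠ 0),
        Complex.log_neg_I, Real.div_rpow (by positivity) hl0.le, Real.rpow_neg hl0.le]
      push_cast
      ring_nf
  have key := tendsto_nhds_unique l1 (l2.congr' (by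
    filter_upwards [self_mem_nhdsWithin] with η hη
    exact (hφ.integral_halfWave_gauss hb hbm d hη h).symm))
  rw [key]
  conv_rhs => unfold halfWave
  rw [← integral_const_mul]
  refine setIntegral_congr_fun measurableSet_Ioi fun l hl => ?_
  have hl0 : 0 < l := hl
  rw [sub_eq_add_neg, Real.rpow_add hl0]
  push_cast
  ring

end IsTestKernel

end

end DTB


namespace DTB

noncomputable section

/-! ### Uniform equidistribution -/

/-- A geometric sum; the bound depends neither on the number of terms nor on the starting point. -/
theorem norm_sum_fourier_le (n : ℤ) (ξ : ℝ) (x : AddCircle (1 : ℝ)) (L : ℕ)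
    (h : fourier n (ξ : AddCircle (1 : ℝ)) ≠ (1 : ℂ)) :
    ‖∑ l ∈ Finset.range L, fourier n (x + ((l * ξ : ℝ) : AddCircle (1 : ℝ)))‖
      ≤ 2 / ‖(fourier n (ξ : AddCircle (1 : ℝ)) : ℂ) - 1‖ := by
  set z : ℂ := fourier n (ξ : AddCircle (1 : ℝ)) with hz
  have hz1 : ‖z‖ = 1 := by rw [hz, fourier_apply]; exact Circle.norm_coe _
  have e : ∀ l : ℕ, fourier n (x + ((l * ξ : ℝ) : AddCircle (1 : ℝ))) = fourier n x * z ^ l := by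
    intro l
    have h1 : ∀ l : ℕ, fourier n ((l * ξ : ℝ) : AddCircle (1 : ℝ)) = z ^ l := by
      intro l
      rw [hz, fourier_coe_apply, fourier_coe_apply, ← Complex.exp_nat_mul]
      congr 1; push_cast; ring
    rw [fourier_apply, smul_add, AddCircle.toCircle_add, Circle.coe_mul, ← fourier_apply,
      ← fourier_apply, h1]
  simp_rw [e]
  rw [← Finset.mul_sum, norm_mul, geom_sum_eq h, norm_div, fourier_apply, Circle.norm_coe, one_mul]
  gcongr
  calc _ ≤ ‖z ^ L‖ + ‖(1 : ℂ)‖ := norm_sub_le _ _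
    _ = 2 := by rw [norm_pow, hz1]; norm_num

theorem fourier_irrational_ne_one {n : ℤ} (hn : n ≠ 0) {ξ : ℝ} (hξ : Irrational ξ) :
    fourier n (ξ : AddCircle (1 : ℝ)) ≠ (1 : ℂ) := by
  rw [fourier_coe_apply, Ne, Complex.exp_eq_one_iff]
  rintro ⟨k, hk⟩
  have h1 : (n : ℂ) * ξ = k := by
    have h2 : (2 * Real.pi * Complex.I : ℂ) ≠ 0 := Complex.two_pi_I_ne_zero
    apply mul_left_cancel₀ h2
    rw [Complex.ofReal_one, div_one] at hk
    linear_combination hk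
  have h3 : (n : ℝ) * ξ = k := by exact_mod_cast h1
  refine hξ ⟨k / n, ?_⟩
  have : (n : ℝ) ≠ 0 := by exact_mod_cast hn
  push_cast
  field_simp
  linarith

theorem integral_fourier {n : ℤ} (hn : n ≠ 0) :
    ∫ a in (0 : ℝ)..1, (fourier n (a : AddCircle (1 : ℝ)) : ℂ) = 0 := by
  have e : ∀ a : ℝ, (fourier n (a : AddCircle (1 : ℝ)) : ℂ)
      = Complex.exp ((2 * Real.pi * Complex.I * n) * a) := by
    intro a; rw [fourier_coe_apply]; simp
  simp_rw [e]
  have h0 : (2 * Real.pi * Complex.I * n : ℂ) ≠ 0 :=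
    mul_ne_zero Complex.two_pi_I_ne_zero (by exact_mod_cast hn)
  rw [integral_exp_mul_complex h0]
  have : Complex.exp (2 * Real.pi * Complex.I * n * ((1 : ℝ) : ℂ)) = 1 := by
    rw [Complex.exp_eq_one_iff]; exact ⟨n, by push_cast; ring⟩
  rw [this]; simp

/-- The orbit averages of `F` under the rotation by `ξ` converge uniformly to the mean of `F`. -/
def Equidistributes (ξ : ℝ) (F : C(AddCircle (1 : ℝ), ℂ)) : Prop :=
  ∀ η : ℝ, 0 < η → ∃ L₀ : ℕ, ∀ L : ℕ, L₀ ≤ L → ∀ x : AddCircle (1 : ℝ),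
    ‖(∑ l ∈ Finset.range L, F (x + ((l * ξ : ℝ) : AddCircle (1 : ℝ))))
      - L * ∫ a in (0 : ℝ)..1, F (a : AddCircle (1 : ℝ))‖ ≤ η * L

theorem continuous_comp_coe (F : C(AddCircle (1 : ℝ), ℂ)) :
    Continuous fun a : ℝ => F (a : AddCircle (1 : ℝ)) :=
  F.continuous.comp (AddCircle.continuous_mk' 1)

theorem equidistributes_fourier {ξ : ℝ} (hξ : Irrational ξ) (n : ℤ) :
    Equidistributes ξ (fourier n) := by
  intro η hη
  by_cases hn : n = 0
  · subst hn
    refine ⟨0, fun L _ x => ?_⟩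
    simp
    positivity
  · set B := 2 / ‖(fourier n (ξ : AddCircle (1 : ℝ)) : ℂ) - 1‖
    obtain ⟨L₀, hL₀⟩ := exists_nat_ge (B / η)
    refine ⟨L₀, fun L hL x => ?_⟩
    rw [integral_fourier hn, mul_zero, sub_zero]
    refine (norm_sum_fourier_le n ξ x L (fourier_irrational_ne_one hn hξ)).trans ?_
    have h1 : B / η ≤ L := hL₀.trans (by exact_mod_cast hL)
    rwa [div_le_iff₀ hη, mul_comm] at h1

theorem equidistributes_of_mem_span {ξ : ℝ} (hξ : Irrational ξ) {F : C(AddCircle (1 : ℝ), ℂ)}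
    (hF : F ∈ Submodule.span ℂ (Set.range (@fourier 1))) : Equidistributes ξ F := by
  induction hF using Submodule.span_induction with
  | mem F h => obtain ⟨n, rfl⟩ := h; exact equidistributes_fourier hξ n
  | zero => intro η hη; refine ⟨0, fun L _ x => ?_⟩; simp; positivity
  | add F G _ _ hF hG =>
    intro η hη
    obtain ⟨L₁, h1⟩ := hF (η / 2) (by positivity)
    obtain ⟨L₂, h2⟩ := hG (η / 2) (by positivity)
    refine ⟨max L₁ L₂, fun L hL x => ?_⟩
    have a1 := h1 L (le_of_max_le_left hL) x
    have a2 := h2 L (le_of_max_le_right hL) x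
    simp only [ContinuousMap.add_apply]
    rw [intervalIntegral.integral_add ((continuous_comp_coe F).intervalIntegrable _ _)
      ((continuous_comp_coe G).intervalIntegrable _ _), Finset.sum_add_distrib, mul_add,
      add_sub_add_comm]
    refine (norm_add_le _ _).trans ?_
    linarith
  | smul c F _ hF =>
    intro η hη
    obtain ⟨L₁, h1⟩ := hF (η / (‖c‖ + 1)) (by positivity)
    refine ⟨L₁, fun L hL x => ?_⟩
    have a1 := h1 L hL x
    simp only [ContinuousMap.smul_apply, smul_eq_mul]
    rw [intervalIntegral.integral_const_mul, ← Finset.mul_sum, mul_left_comm, ← mul_sub, norm_mul]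
    calc _ ≤ ‖c‖ * (η / (‖c‖ + 1) * L) := by gcongr
      _ ≤ (‖c‖ + 1) * (η / (‖c‖ + 1) * L) := by gcongr; linarith
      _ = _ := by field_simp

/-- Weyl's criterion: trigonometric polynomials are uniformly dense, and uniformity in the starting
point survives because the approximation is in the supremum norm. -/
theorem equidistributes {ξ : ℝ} (hξ : Irrational ξ) (F : C(AddCircle (1 : ℝ), ℂ)) :
    Equidistributes ξ F := by
  intro η hη
  have : Fact (0 < (1 : ℝ)) := ⟨one_pos⟩
  have hF : F ∈ closure (Submodule.span ℂ (Set.range (@fourier 1)) : Set C(AddCircle (1 : ℝ), ℂ)) := by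
    rw [← Submodule.topologicalClosure_coe, span_fourier_closure_eq_top]; trivial
  obtain ⟨G, hG, hFG⟩ := Metric.mem_closure_iff.1 hF (η / 3) (by positivity)
  obtain ⟨L₀, h⟩ := equidistributes_of_mem_span hξ hG (η / 3) (by positivity)
  refine ⟨L₀, fun L hL x => ?_⟩
  have hd : ∀ x, ‖F x - G x‖ ≤ η / 3 := by
    intro x
    rw [← dist_eq_norm]
    exact (ContinuousMap.dist_apply_le_dist x).trans hFG.le
  have a1 := h L hL x
  have a2 : ‖∑ l ∈ Finset.range L, (F (x + ((l * ξ : ℝ) : AddCircle (1 : ℝ)))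
      - G (x + ((l * ξ : ℝ) : AddCircle (1 : ℝ))))‖ ≤ η / 3 * L := by
    refine (norm_sum_le_of_le _ fun l _ => hd _).trans ?_
    simp [mul_comm]
  have a3 : ‖∫ a in (0 : ℝ)..1, (F (a : AddCircle (1 : ℝ)) - G (a : AddCircle (1 : ℝ)))‖ ≤ η / 3 := by
    have := intervalIntegral.norm_integral_le_of_norm_le_const (a := 0) (b := 1)
      (f := fun a : ℝ => F (a : AddCircle (1 : ℝ)) - G (a : AddCircle (1 : ℝ))) (C := η / 3)
      fun a _ => hd a
    simpa using this
  rw [intervalIntegral.integral_sub ((continuous_comp_coe F).intervalIntegrable _ _)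
      ((continuous_comp_coe G).intervalIntegrable _ _)] at a3
  rw [Finset.sum_sub_distrib] at a2
  set SF := ∑ l ∈ Finset.range L, F (x + ((l * ξ : ℝ) : AddCircle (1 : ℝ)))
  set SG := ∑ l ∈ Finset.range L, G (x + ((l * ξ : ℝ) : AddCircle (1 : ℝ)))
  set IF := ∫ a in (0 : ℝ)..1, F (a : AddCircle (1 : ℝ))
  set IG := ∫ a in (0 : ℝ)..1, G (a : AddCircle (1 : ℝ))
  have a4 : ‖(L : ℂ) * (IF - IG)‖ ≤ η / 3 * L := by
    rw [norm_mul, Complex.norm_natCast, mul_comm]; gcongr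
  calc _ = ‖(SF - SG) + (SG - L * IG) - L * (IF - IG)‖ := by congr 1; ring
    _ ≤ ‖SF - SG‖ + ‖SG - L * IG‖ + ‖L * (IF - IG)‖ :=
      (norm_sub_le _ _).trans (by gcongr; exact norm_add_le _ _)
    _ ≤ _ := by linarith

theorem equidistribution {ξ : ℝ} (hξ : Irrational ξ) {f : ℝ → ℂ} (hf : Continuous f)
    (hp : ∀ p, f (p + 1) = f p) {η : ℝ} (hη : 0 < η) : ∃ L₀ : ℕ, ∀ L : ℕ, L₀ ≤ L → ∀ p : ℝ,
      ‖(∑ l ∈ Finset.range L, f (p + l * ξ)) - L * ∫ a in (0 : ℝ)..1, f a‖ ≤ η * L := by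
  have hper : Function.Periodic f 1 := hp
  set F : C(AddCircle (1 : ℝ), ℂ) := ⟨hper.lift, by
    exact Continuous.quotient_liftOn' hf _⟩
  have hF : ∀ a : ℝ, F (a : AddCircle (1 : ℝ)) = f a := fun a => hper.lift_coe a
  obtain ⟨L₀, h⟩ := equidistributes hξ F η hη
  refine ⟨L₀, fun L hL p => ?_⟩
  have := h L hL (p : AddCircle (1 : ℝ))
  simp only [← AddCircle.coe_add, hF] at this
  exact this

end

end DTB

namespace DTB
noncomputable section

/-! ### Concentration and equidistribution of lattice sums. -/

section Lattice

variable {d : ℕ}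

/-- The index of the cell of the lattice `r(k + u)` that contains `y`. -/
def cellIndex (r : ℝ) (u y : Vec d) : Fin d → ℤ := fun j => ⌊y j / r - u j⌋

theorem cellIndex_eq_iff {r : ℝ} (hr : 0 < r) (u y : Vec d) (k : Fin d → ℤ) :
    cellIndex r u y = k ↔ ∀ j, y j ∈ Set.Ico (r * (k j + u j)) (r * (k j + u j + 1)) := by
  rw [funext_iff]
  refine forall_congr' fun j => ?_
  rw [cellIndex, Int.floor_eq_iff, Set.mem_Ico, le_sub_iff_add_le, sub_lt_iff_lt_add,
    le_div_iff₀ hr, div_lt_iff₀ hr]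
  refine and_congr (by rw [mul_comm]) ?_
  rw [show (k j + 1 + u j : ℝ) = k j + u j + 1 by ring, mul_comm]

theorem volume_cellIndex_preimage {r : ℝ} (hr : 0 < r) (u : Vec d) (k : Fin d → ℤ) :
    volume ((cellIndex r u) ⁻¹' {k}) = ENNReal.ofReal (r ^ d) := by
  have h1 : (cellIndex r u) ⁻¹' {k} = (WithLp.ofLp : Vec d → Fin d → ℝ) ⁻¹'
      (Set.univ.pi fun j => Set.Ico (r * (k j + u j)) (r * (k j + u j + 1))) := by
    ext y
    simp only [Set.mem_preimage, Set.mem_singleton_iff, cellIndex_eq_iff hr, Set.mem_univ_pi]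
  rw [h1, (PiLp.volume_preserving_ofLp (Fin d)).measure_preimage
    (MeasurableSet.univ_pi fun j => measurableSet_Ico).nullMeasurableSet, Real.volume_pi_Ico]
  have h2 : ∀ j, r * (k j + u j + 1) - r * (k j + u j) = r := fun j => by ring
  simp only [h2]
  rw [Finset.prod_const, Finset.card_univ, Fintype.card_fin, ENNReal.ofReal_pow hr.le]

theorem measurable_cellIndex (r : ℝ) (u : Vec d) : Measurable (cellIndex r u) := by
  refine measurable_pi_lambda _ fun j => ?_
  exact Int.measurable_floor.comp (by fun_prop)

theorem integral_comp_cellIndex {r : ℝ} (hr : 0 < r) (u : Vec d) {s : (Fin d → ℤ) → ℂ}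
    (hs : (Function.support s).Finite) :
    Integrable (fun y : Vec d => s (cellIndex r u y)) ∧
      ∫ y : Vec d, s (cellIndex r u y) = ((r ^ d : ℝ) : ℂ) * ∑' k, s k := by
  have hm : ∀ k, MeasurableSet ((cellIndex r u) ⁻¹' {k}) := fun k =>
    measurable_cellIndex r u (measurableSet_singleton k)
  have h1 : (fun y : Vec d => s (cellIndex r u y)) = fun y => ∑ k ∈ hs.toFinset,
      ((cellIndex r u) ⁻¹' {k}).indicator (fun _ => s k) y := by
    funext y
    by_cases h : s (cellIndex r u y) = 0
    · rw [h, Finset.sum_eq_zero]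
      intro k _
      by_cases hk : cellIndex r u y = k
      · rw [Set.indicator_of_mem (by simpa using hk), ← hk, h]
      · rw [Set.indicator_of_notMem (by simpa using hk)]
    · rw [Finset.sum_eq_single (cellIndex r u y)]
      · rw [Set.indicator_of_mem (by simp)]
      · intro k _ hk
        rw [Set.indicator_of_notMem (by simpa using hk.symm)]
      · intro hk
        exact absurd (by simpa using hk) h
  have h2 : ∀ k, Integrable (((cellIndex r u) ⁻¹' {k}).indicator (fun _ => s k) : Vec d → ℂ) := by
    intro k
    rw [integrable_indicator_iff (hm k)]
    exact integrableOn_const (by rw [volume_cellIndex_preimage hr]; exact ENNReal.ofReal_ne_top)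
  rw [h1]
  refine ⟨integrable_finsetSum _ fun k _ => h2 k, ?_⟩
  rw [integral_finsetSum _ fun k _ => h2 k,
    tsum_eq_sum (s := hs.toFinset) (fun k hk => by simpa using hk), Finset.mul_sum]
  refine Finset.sum_congr rfl fun k _ => ?_
  rw [integral_indicator_const _ (hm k), measureReal_def, volume_cellIndex_preimage hr,
    ENNReal.toReal_ofReal (by positivity)]
  rfl

/-- The sum is, up to the cell volume, the integral of a step function constant on cells of side r.
Shifting the index by multiples of e does not change the sum, so an average over L shifts may be put
under the integral; at each fixed y it is an orbit average to which equidistribution can be applied.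
-/
theorem tsum_eq_integral_average {r : ℝ} (hr : 0 < r) (u : Vec d) {s : (Fin d → ℤ) → ℂ}
    (hs : (Function.support s).Finite) (e : Fin d → ℤ) {L : ℕ} (hL : 0 < L) :
    ∑' k, s k = ((r ^ d : ℝ) : ℂ)⁻¹ *
      ∫ y : Vec d, (L : ℂ)⁻¹ * ∑ l ∈ Finset.range L, s (cellIndex r u y + (l : ℤ) • e) := by
  have hf : ∀ l : ℕ, (Function.support fun k => s (k + (l : ℤ) • e)).Finite := fun l =>
    hs.preimage (add_left_injective ((l : ℤ) • e)).injOn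
  have h1 : ∀ l : ℕ, ∑' k, s (k + (l : ℤ) • e) = ∑' k, s k := fun l =>
    (Equiv.addRight ((l : ℤ) • e)).tsum_eq s
  have hr' : ((r ^ d : ℝ) : ℂ) ≠ 0 := by exact_mod_cast (pow_pos hr d).ne'
  have hL' : (L : ℂ) ≠ 0 := by exact_mod_cast hL.ne'
  rw [integral_const_mul, integral_finsetSum _ fun l _ =>
    (integral_comp_cellIndex hr u (hf l)).1]
  rw [Finset.sum_congr rfl fun l _ => (integral_comp_cellIndex hr u (hf l)).2]
  simp only [h1, Finset.sum_const, Finset.card_range, nsmul_eq_mul]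
  field_simp

/-- Under v = √ε y, cells of side √ε in y become cells of side ε of the grid; the l shifts add εl
times the length of e. -/
theorem gridPt_cellIndex_add {ε : ℝ} (hε : 0 < ε) (u y : Vec d) (e : Fin d → ℤ) (l : ℕ) :
    ‖gridPt ε u (cellIndex (√ε) u y + (l : ℤ) • e) - √ε • y‖
      ≤ ε * d + ε * (l * ‖(WithLp.toLp 2 (fun i => (e i : ℝ)) : Vec d)‖) := by
  have hs : 0 < √ε := Real.sqrt_pos.2 hε
  set k := cellIndex (√ε) u y with hk
  have h1 := (cellIndex_eq_iff hs u y k).1 rfl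
  have h2 : gridPt ε u (k + (l : ℤ) • e) - √ε • y
      = (gridPt ε u k - √ε • y) + (ε * l) • (WithLp.toLp 2 (fun i => (e i : ℝ)) : Vec d) := by
    ext j
    simp [gridPt]
    ring
  have h3 : ∀ j, ‖(gridPt ε u k - √ε • y : Vec d) j‖ ≤ ε := by
    intro j
    have h4 := h1 j
    have h5 : (gridPt ε u k - √ε • y : Vec d) j = √ε * (√ε * (k j + u j) - y j) := by
      simp [gridPt]
      rw [mul_sub, ← mul_assoc, Real.mul_self_sqrt hε.le]
      ring
    rw [h5, norm_mul, Real.norm_of_nonneg hs.le, ← Real.mul_self_sqrt hε.le]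
    rw [Real.sqrt_mul_self hs.le]
    refine mul_le_mul_of_nonneg_left ?_ hs.le
    rw [Real.norm_eq_abs, abs_le]
    rw [Set.mem_Ico, mul_add (√ε) (_ + _) 1, mul_one] at h4
    constructor <;> linarith [h4.1, h4.2]
  have h6 : ‖gridPt ε u k - √ε • y‖ ≤ ε * d := by
    refine (EuclideanSpace.basisFun (Fin d) ℝ).sum_repr (gridPt ε u k - √ε • y) ▸ ?_
    refine (norm_sum_le _ _).trans ?_
    calc _ ≤ ∑ _j : Fin d, ε := by
            refine Finset.sum_le_sum fun j _ => ?_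
            rw [norm_smul, OrthonormalBasis.norm_eq_one, mul_one]
            simpa using h3 j
      _ = ε * d := by simp [mul_comm]
  rw [h2]
  refine (norm_add_le _ _).trans (add_le_add h6 ?_)
  rw [norm_smul, norm_mul, Real.norm_of_nonneg hε.le, Real.norm_of_nonneg (Nat.cast_nonneg l),
    mul_assoc]

theorem finite_gridPt_mem {ε : ℝ} (hε : 0 < ε) (u : Vec d) {K : Set (Vec d)}
    (hK : Bornology.IsBounded K) : {k : Fin d → ℤ | gridPt ε u k ∈ K}.Finite := by
  obtain ⟨R, hR⟩ := hK.exists_norm_le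
  refine (Set.finite_Icc (fun j => ⌊-(R / ε) - u j⌋) (fun j => ⌈R / ε - u j⌉)).subset ?_
  intro k hk
  have h1 : ∀ j, |(k j : ℝ) + u j| ≤ R / ε := by
    intro j
    have h2 := (PiLp.norm_apply_le (gridPt ε u k) j).trans (hR _ hk)
    rw [le_div_iff₀ hε]
    simpa [gridPt, abs_mul, abs_of_pos hε, ← mul_add, mul_comm] using h2
  refine ⟨fun j => ?_, fun j => ?_⟩
  · have := abs_le.1 (h1 j)
    refine Int.floor_le_iff.2 ?_
    linarith [this.1]
  · have := abs_le.1 (h1 j)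
    refine Int.le_ceil_iff.2 ?_
    linarith [this.2]

/-- Pairs `(ε, l)` with `ε → 0+` and `l < L(ε)`. -/
def stripFilter (L : ℝ → ℕ) : Filter (ℝ × ℕ) :=
  comap Prod.fst (𝓝[>] 0) ⊓ 𝓟 {q | q.2 < L q.1}

theorem eventually_strip {L : ℝ → ℕ} {p : ℝ × ℕ → Prop} :
    (∀ᶠ q in stripFilter L, p q) ↔ ∀ᶠ ε in 𝓝[>] (0 : ℝ), ∀ l < L ε, p (ε, l) := by
  rw [stripFilter, eventually_inf_principal, eventually_comap]
  refine eventually_congr (Eventually.of_forall fun ε => ?_)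
  constructor
  · intro h l hl
    exact h (ε, l) rfl hl
  · rintro h ⟨ε', l⟩ rfl hl
    exact h l hl

theorem tendsto_strip_fst (L : ℝ → ℕ) : Tendsto Prod.fst (stripFilter L) (𝓝[>] (0 : ℝ)) :=
  tendsto_comap.mono_left inf_le_left

/-- Convergence along the strip is uniform in l < L(ε), which is what averages over l need. -/
theorem tendsto_average_zero {L : ℝ → ℕ} {A : ℝ × ℕ → ℂ}
    (hA : Tendsto A (stripFilter L) (𝓝 0)) :
    Tendsto (fun ε => (L ε : ℂ)⁻¹ * ∑ l ∈ Finset.range (L ε), A (ε, l)) (𝓝[>] 0) (𝓝 0) := by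
  rw [Metric.tendsto_nhds]
  intro η hη
  have h1 := eventually_strip.1 ((Metric.tendsto_nhds.1 hA) (η / 2) (half_pos hη))
  filter_upwards [h1] with ε h
  rw [dist_zero_right]
  have h2 : ‖∑ l ∈ Finset.range (L ε), A (ε, l)‖ ≤ L ε * (η / 2) := by
    refine (norm_sum_le _ _).trans ?_
    refine (Finset.sum_le_card_nsmul _ _ (η / 2) fun l hl => ?_).trans (by simp)
    simpa using (h l (Finset.mem_range.1 hl)).le
  rw [norm_mul, norm_inv, Complex.norm_natCast]
  rcases Nat.eq_zero_or_pos (L ε) with h0 | h0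
  · simp [h0, hη]
  have h3 : (0 : ℝ) < L ε := by exact_mod_cast h0
  calc _ ≤ (L ε : ℝ)⁻¹ * (L ε * (η / 2)) := by gcongr
    _ = η / 2 := by field_simp
    _ < η := half_lt_self hη

/-- About ε^(-1/4) shifts: their number tends to infinity, as equidistribution requires, while a
displacement by L grid steps is still negligible on the scale √ε. -/
theorem exists_shift_count : ∃ L : ℝ → ℕ, (∀ ε, 0 < L ε) ∧ Tendsto L (𝓝[>] 0) atTop ∧
    Tendsto (fun ε => √ε * L ε) (𝓝[>] 0) (𝓝 0) := by
  refine ⟨fun ε => ⌊(√(√ε))⁻¹⌋₊ + 1, fun ε => Nat.succ_pos _, ?_, ?_⟩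
  · refine (tendsto_add_atTop_nat 1).comp (tendsto_nat_floor_atTop.comp ?_)
    refine tendsto_inv_nhdsGT_zero.comp (tendsto_nhdsWithin_iff.2 ⟨?_, ?_⟩)
    · have : Continuous fun ε : ℝ => √(√ε) := by fun_prop
      simpa using (this.tendsto 0).mono_left nhdsWithin_le_nhds
    · filter_upwards [self_mem_nhdsWithin] with ε hε
      exact Real.sqrt_pos.2 (Real.sqrt_pos.2 hε)
  · have h1 : Tendsto (fun ε : ℝ => √(√ε) + √ε) (𝓝[>] 0) (𝓝 0) := by
      have : Continuous fun ε : ℝ => √(√ε) + √ε := by fun_prop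
      simpa using (this.tendsto 0).mono_left nhdsWithin_le_nhds
    refine squeeze_zero' (Eventually.of_forall fun ε => by positivity) ?_ h1
    filter_upwards [self_mem_nhdsWithin] with ε hε
    have h2 : 0 < √(√ε) := Real.sqrt_pos.2 (Real.sqrt_pos.2 hε)
    have h3 : (⌊(√(√ε))⁻¹⌋₊ : ℝ) ≤ (√(√ε))⁻¹ := Nat.floor_le (by positivity)
    push_cast
    calc √ε * (⌊(√(√ε))⁻¹⌋₊ + 1) ≤ √ε * ((√(√ε))⁻¹ + 1) := by gcongr
      _ = √(√ε) * √(√ε) * (√(√ε))⁻¹ + √ε := by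
          rw [Real.mul_self_sqrt (Real.sqrt_nonneg _)]; ring
      _ = _ := by field_simp

/-- A continuous function `G(X, p)` of period one in `p` that decays as `X → ∞`. -/
structure IsProfile (G : ℝ → ℝ → ℂ) (C₀ γ : ℝ) : Prop where
  continuous : Continuous (Function.uncurry G)
  periodic : ∀ X p, G X (p + 1) = G X p
  decay : ∃ C, ∀ X p, -C₀ ≤ X → ‖G X p‖ ≤ C * (1 + |X|) ^ (-γ)

/-- The phase functions and weights of an oscillatory sum over the grid `ε(k + u)` that
concentrates at the origin. -/
structure IsGridPhase (K : Set (Vec d)) (f F P q : Vec d → ℝ) (w : ℝ → (Fin d → ℤ) → ℝ)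
    (u : ℝ → Vec d) (C₀ J : ℝ) : Prop where
  bounded : Bornology.IsBounded K
  abs_le : ∀ v ∈ K, |f v| ≤ C₀
  lower : ∃ c₁ : ℝ, 0 < c₁ ∧ c₁ ≤ 1 ∧ ∀ v ∈ K, c₁ * ‖v‖ ^ 2 ≤ F v
  phase : ∀ y, Tendsto (fun z : ℝ × Vec d => f (√z.1 • z.2) + F (√z.1 • z.2) / z.1)
    (𝓝[>] 0 ×ˢ 𝓝 y) (𝓝 (f 0 + q y))
  generic : ∃ P' : Vec d →L[ℝ] ℝ, (∃ i, Irrational (P' (EuclideanSpace.single i 1))) ∧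
    ∃ c, ∀ᶠ z in 𝓝 (0 : Vec d × Vec d),
      |P z.1 - P z.2 - P' (z.1 - z.2)| ≤ c * (‖z.1‖ + ‖z.2‖) * ‖z.1 - z.2‖
  weight_le : ∃ Cw, ∀ᶠ ε in 𝓝[>] (0 : ℝ), ∀ k, gridPt ε (u ε) k ∈ K → |w ε k| ≤ Cw * ε ^ d
  weight : Tendsto (fun z : ℝ × (Fin d → ℤ) => w z.1 z.2 / z.1 ^ d)
    (comap Prod.fst (𝓝[>] 0) ⊓ comap (fun z => gridPt z.1 (u z.1) z.2) (𝓝 0)) (𝓝 J)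

theorem IsProfile.periodic_int {G : ℝ → ℝ → ℂ} {C₀ γ : ℝ} (hG : IsProfile G C₀ γ) (X p : ℝ)
    (n : ℤ) : G X (p + n) = G X p := by
  have h : Function.Periodic (G X) 1 := hG.periodic X
  simpa using h.int_mul n p

/-- In the application p is of size 1/ε and does not converge, so continuity of G is used near the
compact set {X₀} × [0, 1], after reduction modulo one. -/
theorem IsProfile.tendsto_sub {G : ℝ → ℝ → ℂ} {C₀ γ : ℝ} (hG : IsProfile G C₀ γ)
    {ι : Type*} {l : Filter ι} {X p p' : ι → ℝ} {X₀ : ℝ} (hX : Tendsto X l (𝓝 X₀))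
    (hp : Tendsto (fun z => p z - p' z) l (𝓝 0)) :
    Tendsto (fun z => G (X z) (p z) - G X₀ (p' z)) l (𝓝 0) := by
  rw [Metric.tendsto_nhds]
  intro η hη
  have hs : IsCompact (({X₀} : Set ℝ) ×ˢ Set.Icc (0 : ℝ) 1) :=
    isCompact_singleton.prod isCompact_Icc
  obtain ⟨δ, hδ, h⟩ := Metric.mem_uniformity_dist.1
    (hs.uniformContinuousAt_of_continuousAt (Function.uncurry G)
      (fun a _ => hG.continuous.continuousAt) (Metric.dist_mem_uniformity hη))
  filter_upwards [(Metric.tendsto_nhds.1 hX) δ hδ, (Metric.tendsto_nhds.1 hp) δ hδ] with z h1 h2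
  -- Both phases are reduced by the same integer, the floor of `p' z`; reducing each of them modulo
  -- one could separate close values.
  have h3 : dist (X₀, Int.fract (p' z)) (X z, p z - ⌊p' z⌋) < δ := by
    rw [Prod.dist_eq, max_lt_iff]
    refine ⟨by rwa [dist_comm], ?_⟩
    rw [dist_zero_right, Real.norm_eq_abs, abs_sub_comm] at h2
    rwa [Real.dist_eq, show Int.fract (p' z) - (p z - ⌊p' z⌋) = p' z - p z by
      rw [Int.fract]; ring]
  have h4 := h h3 ⟨rfl, (Int.fract_nonneg _), (Int.fract_lt_one _).le⟩
  simp only [Function.uncurry_apply_pair] at h4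
  have h5 : G X₀ (Int.fract (p' z)) = G X₀ (p' z) := by
    rw [← hG.periodic_int X₀ _ ⌊p' z⌋, Int.fract_add_floor]
  have h6 : G (X z) (p z - ⌊p' z⌋) = G (X z) (p z) := by
    rw [← hG.periodic_int (X z) _ ⌊p' z⌋, sub_add_cancel]
  change dist (G X₀ _) (G (X z) _) < η at h4
  rw [h5, h6, dist_comm, dist_eq_norm] at h4
  simpa using h4

/-- Along L shifts in an irrational coordinate direction, X stays near f(0) + q(y), and c and the
normalized weight stay near their limits at the origin. The phase P/ε advances by the same
irrational amount at every step, up to an error that tends to zero. The starting phase has no limit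
as ε → 0, but equidistribution is uniform in it. -/
theorem tendsto_average_gridPt {K : Set (Vec d)} {f F P q : Vec d → ℝ}
    {w : ℝ → (Fin d → ℤ) → ℝ} {u : ℝ → Vec d} {C₀ J γ : ℝ} (hP : IsGridPhase K f F P q w u C₀ J)
    {G : ℝ → ℝ → ℂ} (hG : IsProfile G C₀ γ) {c : Vec d → ℂ} (hc : ContinuousAt c 0)
    {P' : Vec d →L[ℝ] ℝ} {i : Fin d} (hξ : Irrational (P' (EuclideanSpace.single i 1)))
    (hP' : ∃ c, ∀ᶠ z in 𝓝 (0 : Vec d × Vec d),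
      |P z.1 - P z.2 - P' (z.1 - z.2)| ≤ c * (‖z.1‖ + ‖z.2‖) * ‖z.1 - z.2‖)
    {L : ℝ → ℕ} (hL0 : ∀ ε, 0 < L ε) (hL : Tendsto L (𝓝[>] 0) atTop)
    (hL' : Tendsto (fun ε => √ε * L ε) (𝓝[>] 0) (𝓝 0)) (y : Vec d) (g : ℝ × ℕ → Fin d → ℤ)
    (hg : ∀ z, g z = cellIndex (√z.1) (u z.1) y + (z.2 : ℤ) • Pi.single i 1) :
    Tendsto (fun ε => (L ε : ℂ)⁻¹ * ∑ l ∈ Finset.range (L ε),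
      c (gridPt ε (u ε) (g (ε, l))) * ((w ε (g (ε, l)) / ε ^ d : ℝ) : ℂ) *
        G (f (gridPt ε (u ε) (g (ε, l))) + F (gridPt ε (u ε) (g (ε, l))) / ε)
          (P (gridPt ε (u ε) (g (ε, l))) / ε)) (𝓝[>] 0)
      (𝓝 (c 0 * J * ∫ p in (0 : ℝ)..1, G (f 0 + q y) p)) := by
  have he : (WithLp.toLp 2 (fun j => ((Pi.single i 1 : Fin d → ℤ) j : ℝ)) : Vec d)
      = EuclideanSpace.single i 1 := by
    ext j
    by_cases h : j = i
    · subst h; simp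
    · simp [h]
  have hn : ‖(EuclideanSpace.single i 1 : Vec d)‖ = 1 := by simp
  set v : ℝ × ℕ → Vec d := fun z => gridPt z.1 (u z.1) (g z) with hv
  set ζ : ℝ × ℕ → Vec d := fun z => (√z.1)⁻¹ • v z with hζdef
  have hpos : ∀ᶠ z in stripFilter L, 0 < z.1 ∧ z.2 < L z.1 := by
    rw [eventually_strip]
    filter_upwards [self_mem_nhdsWithin] with ε hε l hl using ⟨hε, hl⟩
  have hfst := tendsto_strip_fst L
  have hsq : Tendsto (fun z : ℝ × ℕ => √z.1) (stripFilter L) (𝓝 0) := by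
    have h : Tendsto (fun ε : ℝ => √ε) (𝓝[>] 0) (𝓝 0) := by
      simpa using (Real.continuous_sqrt.tendsto 0).mono_left nhdsWithin_le_nhds
    exact h.comp hfst
  have hζy : ∀ z : ℝ × ℕ, 0 < z.1 → ‖ζ z - y‖ ≤ √z.1 * d + √z.1 * z.2 := by
    intro z hz
    have h1 := gridPt_cellIndex_add hz (u z.1) y (Pi.single i 1) z.2
    rw [he, hn, mul_one, ← hg z] at h1
    have h2 : 0 < √z.1 := Real.sqrt_pos.2 hz
    have h3 : ζ z - y = (√z.1)⁻¹ • (v z - √z.1 • y) := by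
      rw [smul_sub, smul_smul, inv_mul_cancel₀ h2.ne', one_smul]
    rw [h3, norm_smul, norm_inv, Real.norm_of_nonneg h2.le, inv_mul_le_iff₀ h2]
    refine h1.trans (le_of_eq ?_)
    rw [mul_add, ← mul_assoc, ← mul_assoc, Real.mul_self_sqrt hz.le]
  have hζ : Tendsto ζ (stripFilter L) (𝓝 y) := by
    rw [tendsto_iff_norm_sub_tendsto_zero]
    refine squeeze_zero' (Eventually.of_forall fun _ => norm_nonneg _)
      (hpos.mono fun z hz => (hζy z hz.1).trans (add_le_add_right (b := √z.1 * z.2)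
        (c := √z.1 * L z.1) (mul_le_mul_of_nonneg_left (by exact_mod_cast hz.2.le)
          (Real.sqrt_nonneg _)) (√z.1 * d))) ?_
    simpa using (hsq.mul_const (d : ℝ)).add (hL'.comp hfst)
  have hvζ : ∀ z : ℝ × ℕ, 0 < z.1 → v z = √z.1 • ζ z := by
    intro z hz
    rw [hζdef]
    simp only
    rw [smul_smul, mul_inv_cancel₀ (Real.sqrt_pos.2 hz).ne', one_smul]
  have hv0 : Tendsto v (stripFilter L) (𝓝 0) := by
    have h : Tendsto (fun z => √z.1 • ζ z) (stripFilter L) (𝓝 ((0 : ℝ) • y)) := hsq.smul hζ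
    rw [zero_smul] at h
    exact h.congr' (hpos.mono fun z hz => (hvζ z hz.1).symm)
  have hX : Tendsto (fun z => f (v z) + F (v z) / z.1) (stripFilter L) (𝓝 (f 0 + q y)) := by
    refine ((hP.phase y).comp (hfst.prodMk hζ)).congr' (hpos.mono fun z hz => ?_)
    simp only [Function.comp_apply]
    rw [← hvζ z hz.1]
  -- The base point l = 0 lies in every strip because `L` is positive.
  have hbase : Tendsto (fun z : ℝ × ℕ => ((z.1, 0) : ℝ × ℕ)) (stripFilter L) (stripFilter L) := by
    intro s hs
    have h := (eventually_strip (p := fun z => z ∈ s)).1 hs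
    refine (eventually_strip (p := fun z => (z.1, 0) ∈ s)).2 (h.mono fun ε hε l _ => hε 0 (hL0 ε))
  have hw : Tendsto (fun z => w z.1 (g z) / z.1 ^ d) (stripFilter L) (𝓝 J) := by
    refine hP.weight.comp (f := fun z : ℝ × ℕ => (z.1, g z)) (tendsto_inf.2 ⟨?_, ?_⟩)
    · exact tendsto_comap_iff.2 hfst
    · exact tendsto_comap_iff.2 hv0
  -- The Taylor error is at most a multiple of (|v_l| + |v_0|)|v_l - v_0|/ε. Here |v_l| and |v_0|
  -- are O(√ε) and |v_l - v_0| = εl, so the error is O(√ε L).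
  have hphase : Tendsto (fun z : ℝ × ℕ => P (v z) / z.1
      - (P (v (z.1, 0)) / z.1 + z.2 * P' (EuclideanSpace.single i 1))) (stripFilter L) (𝓝 0) := by
    obtain ⟨c', hc'⟩ := hP'
    have h1 : Tendsto (fun z => |c'| * (‖ζ z‖ + ‖ζ (z.1, 0)‖) * (√z.1 * L z.1)) (stripFilter L)
        (𝓝 0) := by
      have := ((hζ.norm.add (hζ.comp hbase).norm).const_mul |c'|).mul (hL'.comp hfst)
      simpa using this
    refine squeeze_zero_norm' ?_ h1
    filter_upwards [hpos, (hv0.prodMk_nhds (hv0.comp hbase)).eventually hc'] with z hz h2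
    have hz1 := hz.1
    simp only [Function.comp_apply] at h2
    have h3 : v z - v (z.1, 0) = (z.1 * z.2) • (EuclideanSpace.single i 1 : Vec d) := by
      rw [← he, hv]
      ext j
      simp only [hg, gridPt]
      simp
      ring
    have h4 : P (v z) / z.1 - (P (v (z.1, 0)) / z.1 + z.2 * P' (EuclideanSpace.single i 1))
        = (P (v z) - P (v (z.1, 0)) - P' (v z - v (z.1, 0))) / z.1 := by
      rw [h3, map_smul, smul_eq_mul]
      field_simp
      ring
    rw [h4, norm_div, Real.norm_of_nonneg hz1.le, div_le_iff₀ hz1]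
    refine h2.trans ?_
    have h6 : ∀ z' : ℝ × ℕ, z'.1 = z.1 → ‖v z'‖ = √z.1 * ‖ζ z'‖ := by
      intro z' hz'
      rw [hvζ z' (hz' ▸ hz1), norm_smul, Real.norm_of_nonneg (Real.sqrt_nonneg _), hz']
    rw [h3, norm_smul, hn, mul_one, h6 z rfl, h6 (z.1, 0) rfl, Real.norm_of_nonneg (by positivity)]
    have h5 : (z.2 : ℝ) ≤ L z.1 := by exact_mod_cast hz.2.le
    calc c' * (√z.1 * ‖ζ z‖ + √z.1 * ‖ζ (z.1, 0)‖) * (z.1 * z.2)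
        = c' * ((‖ζ z‖ + ‖ζ (z.1, 0)‖) * (√z.1 * z.2)) * z.1 := by ring
      _ ≤ |c'| * ((‖ζ z‖ + ‖ζ (z.1, 0)‖) * (√z.1 * L z.1)) * z.1 := by
          gcongr
          exact le_abs_self _
      _ = _ := by ring
  have hGd := hG.tendsto_sub hX hphase
  have hcw : Tendsto (fun z => c (v z) * ((w z.1 (g z) / z.1 ^ d : ℝ) : ℂ)) (stripFilter L)
      (𝓝 (c 0 * J)) :=
    (hc.tendsto.comp hv0).mul ((Complex.continuous_ofReal.tendsto J).comp hw)
  have hGc : Continuous (G (f 0 + q y)) := hG.continuous.comp (by fun_prop : Continuous fun p =>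
    ((f 0 + q y, p) : ℝ × ℝ))
  obtain ⟨M, hM⟩ := (isCompact_Icc.image hGc : IsCompact (G (f 0 + q y) '' Set.Icc 0 1)
    ).isBounded.exists_norm_le
  have hM' : ∀ p, ‖G (f 0 + q y) p‖ ≤ M := by
    intro p
    have := hM _ ⟨Int.fract p, ⟨Int.fract_nonneg p, (Int.fract_lt_one p).le⟩, rfl⟩
    rwa [← hG.periodic_int _ _ ⌊p⌋, Int.fract_add_floor] at this
  set ξ := P' (EuclideanSpace.single i 1) with hξdef
  have hdiff : Tendsto (fun z : ℝ × ℕ => c (v z) * ((w z.1 (g z) / z.1 ^ d : ℝ) : ℂ) *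
        G (f (v z) + F (v z) / z.1) (P (v z) / z.1)
      - c 0 * J * G (f 0 + q y) (P (v (z.1, 0)) / z.1 + z.2 * ξ)) (stripFilter L) (𝓝 0) := by
    have h1 := hcw.mul hGd
    rw [mul_zero] at h1
    have h2 : Tendsto (fun z : ℝ × ℕ => (c (v z) * ((w z.1 (g z) / z.1 ^ d : ℝ) : ℂ) - c 0 * J)
        * G (f 0 + q y) (P (v (z.1, 0)) / z.1 + z.2 * ξ)) (stripFilter L) (𝓝 0) := by
      have h3 := (hcw.sub_const (c 0 * J)).norm.mul_const M
      rw [sub_self, norm_zero, zero_mul] at h3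
      refine squeeze_zero_norm (fun z => ?_) h3
      rw [norm_mul]
      exact mul_le_mul_of_nonneg_left (hM' _) (norm_nonneg _)
    have h4 := h1.add h2
    rw [add_zero] at h4
    refine h4.congr fun z => ?_
    ring
  have havg := tendsto_average_zero hdiff
  have hmain : Tendsto (fun ε => (L ε : ℂ)⁻¹ * ∑ l ∈ Finset.range (L ε),
      G (f 0 + q y) (P (v (ε, 0)) / ε + l * ξ)) (𝓝[>] 0)
      (𝓝 (∫ p in (0 : ℝ)..1, G (f 0 + q y) p)) := by
    rw [Metric.tendsto_nhds]
    intro η hη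
    obtain ⟨L₀, h⟩ := equidistribution hξ hGc (hG.periodic _) (half_pos hη)
    filter_upwards [hL.eventually_ge_atTop L₀] with ε hε
    have h1 := h (L ε) hε (P (v (ε, 0)) / ε)
    have h2 : (0 : ℝ) < L ε := by exact_mod_cast hL0 ε
    have h2' : (L ε : ℂ) ≠ 0 := by exact_mod_cast h2.ne'
    rw [dist_eq_norm]
    have h3 : (L ε : ℂ)⁻¹ * ∑ l ∈ Finset.range (L ε), G (f 0 + q y) (P (v (ε, 0)) / ε + l * ξ)
        - ∫ p in (0 : ℝ)..1, G (f 0 + q y) p = (L ε : ℂ)⁻¹ * (∑ l ∈ Finset.range (L ε),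
          G (f 0 + q y) (P (v (ε, 0)) / ε + l * ξ)
            - L ε * ∫ p in (0 : ℝ)..1, G (f 0 + q y) p) := by
      rw [mul_sub, inv_mul_cancel_left₀ h2']
    rw [h3, norm_mul, norm_inv, Complex.norm_natCast]
    calc _ ≤ (L ε : ℝ)⁻¹ * (η / 2 * L ε) := by gcongr
      _ = η / 2 := by field_simp
      _ < η := half_lt_self hη
  have hfin := havg.add (hmain.const_mul (c 0 * J))
  rw [zero_add] at hfin
  refine hfin.congr fun ε => ?_
  rw [Finset.sum_sub_distrib, ← Finset.mul_sum]
  ring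

/-- The lower bound F(v) ≥ c₁|v|² turns decay in X into decay in y: for v within R√ε of √ε y, 1 +
|X| is at least a multiple of (1 + |y|)². -/
theorem IsProfile.exists_norm_le {K : Set (Vec d)} {f F P q : Vec d → ℝ}
    {w : ℝ → (Fin d → ℤ) → ℝ} {u : ℝ → Vec d} {C₀ J γ : ℝ} {G : ℝ → ℝ → ℂ}
    (hG : IsProfile G C₀ γ) (hP : IsGridPhase K f F P q w u C₀ J) (hγ : 0 ≤ γ) (R : ℝ)
    (hR : 0 ≤ R) :
    ∃ D, 0 ≤ D ∧ ∀ ε : ℝ, 0 < ε → ∀ v ∈ K, ∀ y : Vec d, ‖v - √ε • y‖ ≤ R * √ε → ∀ p,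
      ‖G (f v + F v / ε) p‖ ≤ D * (1 + ‖y‖) ^ (-(2 * γ)) := by
  obtain ⟨C, hC⟩ := hG.decay
  obtain ⟨c₁, hc₁, hc₁', hF⟩ := hP.lower
  by_cases hK : K.Nonempty
  swap
  · exact ⟨0, le_rfl, fun ε _ v hv => absurd ⟨v, hv⟩ hK⟩
  have hC₀ : 0 ≤ C₀ := by
    obtain ⟨v, hv⟩ := hK
    exact (abs_nonneg _).trans (hP.abs_le v hv)
  set b : ℝ := c₁ / (2 * (1 + C₀) * (1 + R) ^ 2) with hb
  have hb0 : 0 < b := by positivity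
  refine ⟨|C| * b ^ (-γ), by positivity, fun ε hε v hv y hy p => ?_⟩
  have hs : 0 < √ε := Real.sqrt_pos.2 hε
  set z : Vec d := (√ε)⁻¹ • v with hz
  have hvz : v = √ε • z := by rw [hz, smul_smul, mul_inv_cancel₀ hs.ne', one_smul]
  have hzy : ‖y‖ ≤ R + ‖z‖ := by
    rw [hvz, ← smul_sub, norm_smul, Real.norm_of_nonneg hs.le, mul_comm R] at hy
    have h1 := le_of_mul_le_mul_left hy hs
    have h2 : ‖y‖ - ‖z‖ ≤ ‖z - y‖ := by rw [norm_sub_rev]; exact norm_sub_norm_le _ _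
    linarith
  have hX1 : c₁ * ‖z‖ ^ 2 ≤ F v / ε := by
    rw [le_div_iff₀ hε]
    refine le_trans (le_of_eq ?_) (hF v hv)
    have h1 : ‖v‖ = √ε * ‖z‖ := by
      conv_lhs => rw [hvz]
      rw [norm_smul, Real.norm_of_nonneg hs.le]
    rw [h1, mul_pow, Real.sq_sqrt hε.le]
    ring
  have hfv := abs_le.1 (hP.abs_le v hv)
  have hX2 : -C₀ ≤ f v + F v / ε := by
    have : 0 ≤ c₁ * ‖z‖ ^ 2 := by positivity
    linarith [hfv.1]
  set X := f v + F v / ε with hX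
  have hXa : X ≤ |X| := le_abs_self X
  have h3 : c₁ * (1 + ‖z‖ ^ 2) ≤ (1 + C₀) * (1 + |X|) := by
    nlinarith [hfv.1, mul_nonneg hC₀ (abs_nonneg X)]
  have h4 : b * (1 + ‖y‖) ^ 2 ≤ 1 + |X| := by
    have h5 : 1 + ‖y‖ ≤ (1 + R) * (1 + ‖z‖) := by nlinarith [norm_nonneg z]
    have h6 : (1 + ‖y‖) ^ 2 ≤ (1 + R) ^ 2 * (2 * (1 + ‖z‖ ^ 2)) := by
      calc (1 + ‖y‖) ^ 2 ≤ ((1 + R) * (1 + ‖z‖)) ^ 2 := by gcongr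
        _ = (1 + R) ^ 2 * (1 + ‖z‖) ^ 2 := by ring
        _ ≤ _ := by gcongr; nlinarith [sq_nonneg (1 - ‖z‖)]
    rw [hb, div_mul_eq_mul_div, div_le_iff₀ (by positivity)]
    calc c₁ * (1 + ‖y‖) ^ 2 ≤ c₁ * ((1 + R) ^ 2 * (2 * (1 + ‖z‖ ^ 2))) := by gcongr
      _ = 2 * (1 + R) ^ 2 * (c₁ * (1 + ‖z‖ ^ 2)) := by ring
      _ ≤ 2 * (1 + R) ^ 2 * ((1 + C₀) * (1 + |X|)) := by gcongr
      _ = _ := by ring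
  have h7 : 0 < b * (1 + ‖y‖) ^ 2 := by positivity
  calc ‖G X p‖ ≤ C * (1 + |X|) ^ (-γ) := hC X p hX2
    _ ≤ |C| * (1 + |X|) ^ (-γ) := by gcongr; exact le_abs_self C
    _ ≤ |C| * (b * (1 + ‖y‖) ^ 2) ^ (-γ) := by
        refine mul_le_mul_of_nonneg_left ?_ (abs_nonneg C)
        exact Real.rpow_le_rpow_of_nonpos h7 h4 (by linarith)
    _ = |C| * b ^ (-γ) * (1 + ‖y‖) ^ (-(2 * γ)) := by
        rw [Real.mul_rpow hb0.le (by positivity), ← Real.rpow_natCast, ← Real.rpow_mul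
          (by positivity)]
        push_cast
        rw [mul_neg, mul_assoc]

/-- Dominated convergence for the y-integral of the shifted averages. The majorant (1 + |y|)^(-2γ)
is integrable in dimension d because γ > d/2. -/
theorem tendsto_lattice_sum {K : Set (Vec d)} {f F P q : Vec d → ℝ}
    {w : ℝ → (Fin d → ℤ) → ℝ} {u : ℝ → Vec d} {C₀ J γ : ℝ} (hP : IsGridPhase K f F P q w u C₀ J)
    {G : ℝ → ℝ → ℂ} (hG : IsProfile G C₀ γ) (hγ : (d : ℝ) / 2 < γ) {c : Vec d → ℂ}
    (hc : ContinuousAt c 0) (hcK : ∀ v ∉ K, c v = 0) {Mc : ℝ} (hcM : ∀ v, ‖c v‖ ≤ Mc) :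
    Tendsto (fun ε : ℝ => ((ε ^ (-(d : ℝ) / 2) : ℝ) : ℂ) * ∑' k, c (gridPt ε (u ε) k) * (w ε k : ℂ) *
      G (f (gridPt ε (u ε) k) + F (gridPt ε (u ε) k) / ε) (P (gridPt ε (u ε) k) / ε)) (𝓝[>] 0)
      (𝓝 (c 0 * J * ∫ y : Vec d, ∫ p in (0 : ℝ)..1, G (f 0 + q y) p)) := by
  obtain ⟨P', ⟨i, hi⟩, hP'⟩ := hP.generic
  obtain ⟨Cw, hw⟩ := hP.weight_le
  obtain ⟨L, hL0, hL, hL'⟩ := exists_shift_count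
  have hγ0 : 0 ≤ γ := by
    have : (0 : ℝ) ≤ d := Nat.cast_nonneg d
    linarith
  have hMc : 0 ≤ Mc := (norm_nonneg _).trans (hcM 0)
  -- The radius d + 1 covers the cell, since εd ≤ √ε d, and the shifts, since εl ≤ √ε once √ε L ≤ 1.
  obtain ⟨D, hD, hGD⟩ := hG.exists_norm_le hP hγ0 (d + 1 : ℝ) (by positivity)
  set e : Fin d → ℤ := Pi.single i 1 with hedef
  have he : ‖(WithLp.toLp 2 (fun j => (e j : ℝ)) : Vec d)‖ = 1 := by
    have : (WithLp.toLp 2 (fun j => (e j : ℝ)) : Vec d) = EuclideanSpace.single i 1 := by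
      ext j
      by_cases h : j = i
      · subst h; simp [hedef]
      · simp [hedef, h]
    rw [this]
    simp
  set S : ℝ → (Fin d → ℤ) → ℂ := fun ε k => c (gridPt ε (u ε) k) * ((w ε k / ε ^ d : ℝ) : ℂ) *
    G (f (gridPt ε (u ε) k) + F (gridPt ε (u ε) k) / ε) (P (gridPt ε (u ε) k) / ε) with hS
  set Φ : ℝ → Vec d → ℂ := fun ε y => (L ε : ℂ)⁻¹ * ∑ l ∈ Finset.range (L ε),
    S ε (cellIndex (√ε) (u ε) y + (l : ℤ) • e) with hΦ
  have hmeas : ∀ ε, AEStronglyMeasurable (Φ ε) volume := by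
    intro ε
    have h1 : Measurable fun k : Fin d → ℤ => (L ε : ℂ)⁻¹ * ∑ l ∈ Finset.range (L ε),
      S ε (k + (l : ℤ) • e) := Measurable.of_discrete
    exact (h1.comp (measurable_cellIndex (√ε) (u ε))).aestronglyMeasurable
  have hbound : ∀ᶠ ε in 𝓝[>] (0 : ℝ), ∀ᵐ y : Vec d,
      ‖Φ ε y‖ ≤ Mc * |Cw| * D * (1 + ‖y‖) ^ (-(2 * γ)) := by
    filter_upwards [hw, self_mem_nhdsWithin, hL'.eventually (gt_mem_nhds (zero_lt_one' ℝ)),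
      (tendsto_nhdsWithin_of_tendsto_nhds tendsto_id).eventually (gt_mem_nhds (zero_lt_one' ℝ))]
      with ε h1 h2 h3 h4
    replace h2 : 0 < ε := h2
    refine Eventually.of_forall fun y => ?_
    have h5 : ∀ l ∈ Finset.range (L ε), ‖S ε (cellIndex (√ε) (u ε) y + (l : ℤ) • e)‖
        ≤ Mc * |Cw| * D * (1 + ‖y‖) ^ (-(2 * γ)) := by
      intro l hl
      set k := cellIndex (√ε) (u ε) y + (l : ℤ) • e with hk
      by_cases hkK : gridPt ε (u ε) k ∈ K
      · have h6 := gridPt_cellIndex_add h2 (u ε) y e l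
        rw [he, mul_one, ← hk] at h6
        have hs : 0 < √ε := Real.sqrt_pos.2 h2
        have hs1 : √ε ≤ 1 := Real.sqrt_le_one.2 (le_of_lt h4)
        have h7 : ‖gridPt ε (u ε) k - √ε • y‖ ≤ (d + 1 : ℝ) * √ε := by
          refine h6.trans ?_
          have h8 : (l : ℝ) ≤ L ε := by exact_mod_cast (Finset.mem_range.1 hl).le
          have h9 : √ε * l ≤ 1 := le_trans (by gcongr) h3.le
          rw [← Real.mul_self_sqrt h2.le, Real.sqrt_mul_self hs.le]
          have hd0 : (0 : ℝ) ≤ d := Nat.cast_nonneg d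
          calc √ε * √ε * d + √ε * √ε * l = √ε * (√ε * d) + √ε * (√ε * l) := by ring
            _ ≤ √ε * (1 * d) + √ε * 1 := by gcongr
            _ = _ := by ring
        have h10 := hGD ε h2 _ hkK y h7 (P (gridPt ε (u ε) k) / ε)
        have h11 : ‖((w ε k / ε ^ d : ℝ) : ℂ)‖ ≤ |Cw| := by
          rw [Complex.norm_real, Real.norm_eq_abs, abs_div, abs_of_pos (pow_pos h2 d),
            div_le_iff₀ (pow_pos h2 d)]
          exact (h1 k hkK).trans (mul_le_mul_of_nonneg_right (le_abs_self _) (pow_pos h2 d).le)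
        rw [hS]
        simp only
        rw [norm_mul, norm_mul]
        calc _ ≤ Mc * |Cw| * (D * (1 + ‖y‖) ^ (-(2 * γ))) := by
              gcongr
              exact hcM _
          _ = _ := by ring
      · rw [hS]
        simp only
        rw [hcK _ hkK]
        simp only [zero_mul, norm_zero]
        positivity
    have hLp : (0 : ℝ) < L ε := by exact_mod_cast hL0 ε
    rw [hΦ]
    simp only
    rw [norm_mul, norm_inv, Complex.norm_natCast, inv_mul_le_iff₀ hLp]
    refine (norm_sum_le _ _).trans ((Finset.sum_le_sum h5).trans ?_)
    simp
  have hint : Integrable (fun y : Vec d => Mc * |Cw| * D * (1 + ‖y‖) ^ (-(2 * γ))) := by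
    refine (integrable_one_add_norm ?_).const_mul _
    rw [finrank_euclideanSpace, Fintype.card_fin]
    linarith
  have hlim : ∀ᵐ y : Vec d, Tendsto (fun ε => Φ ε y) (𝓝[>] 0)
      (𝓝 (c 0 * J * ∫ p in (0 : ℝ)..1, G (f 0 + q y) p)) := Eventually.of_forall fun y =>
    tendsto_average_gridPt hP hG hc hi hP' hL0 hL hL' y
      (fun z => cellIndex (√z.1) (u z.1) y + (z.2 : ℤ) • e) fun z => rfl
  have hconv := tendsto_integral_filter_of_dominated_convergence _
    (Eventually.of_forall hmeas) hbound hint hlim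
  rw [integral_const_mul] at hconv
  refine hconv.congr' ?_
  filter_upwards [self_mem_nhdsWithin] with ε hε
  replace hε : 0 < ε := hε
  have hfin : (Function.support (S ε)).Finite := by
    refine (finite_gridPt_mem hε (u ε) hP.bounded).subset fun k hk => ?_
    by_contra h
    exact hk (by simp only [hS]; rw [hcK _ h, zero_mul, zero_mul])
  have hs : 0 < √ε := Real.sqrt_pos.2 hε
  have h1 := tsum_eq_integral_average hs (u ε) hfin e (hL0 ε)
  have hεd : ((ε ^ d : ℝ) : ℂ) ≠ 0 := by exact_mod_cast (pow_pos hε d).ne'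
  have h2 : ∀ k, c (gridPt ε (u ε) k) * (w ε k : ℂ) *
      G (f (gridPt ε (u ε) k) + F (gridPt ε (u ε) k) / ε) (P (gridPt ε (u ε) k) / ε)
      = ((ε ^ d : ℝ) : ℂ) * S ε k := by
    intro k
    simp only [hS]
    rw [Complex.ofReal_div]
    field_simp
  simp only [h2]
  rw [tsum_mul_left, h1]
  -- The normalization balances the weight ε^d against the cell volume (√ε)^d of the integral
  -- representation.
  have h3 : ε ^ (-(d : ℝ) / 2) * ε ^ d * (√ε ^ d)⁻¹ = 1 := by
    rw [Real.sqrt_eq_rpow, ← Real.rpow_natCast, ← Real.rpow_natCast, ← Real.rpow_mul hε.le,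
      ← Real.rpow_neg hε.le, ← Real.rpow_add hε, ← Real.rpow_add hε]
    rw [show -(d : ℝ) / 2 + d + -(1 / 2 * d) = 0 by ring, Real.rpow_zero]
  rw [← mul_assoc, ← mul_assoc, ← Complex.ofReal_mul, ← Complex.ofReal_inv, ← Complex.ofReal_mul,
    h3, Complex.ofReal_one, one_mul]

end Lattice

end
end DTB

namespace DTB
noncomputable section

/-! ### Surface measure of the sphere in a parametrization. -/

section Area

variable {d : ℕ}

theorem finrank_tangent (Θ : Sph (d + 1)) : finrank ℝ (ℝ ∙ (Θ : Vec (d + 1)))ᗮ = d :=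
  Submodule.finrank_orthogonal_span_singleton (ne_zero_of_mem_unit_sphere Θ)

/-- The standard orthonormal basis of `Θ^⊥`, indexed by `Fin d`. -/
def tangentBasis (Θ : Sph (d + 1)) : OrthonormalBasis (Fin d) ℝ (ℝ ∙ (Θ : Vec (d + 1)))ᗮ :=
  (stdOrthonormalBasis ℝ _).reindex (finCongr (finrank_tangent Θ))

/-- The isometry `(s, w) ↦ sΘ + ∑ w_i b_i`, where `b` is the basis of `Θ^⊥`. -/
def axisIso (Θ : Sph (d + 1)) : WithLp 2 (ℝ × Vec d) ≃ₗᵢ[ℝ] Vec (d + 1) :=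
  LinearIsometry.toLinearIsometryEquiv
    { toFun := fun z => z.fst • (Θ : Vec (d + 1)) + ((tangentBasis Θ).repr.symm z.snd : Vec (d + 1))
      map_add' := fun x y => by
        simp only [WithLp.add_fst, WithLp.add_snd, map_add, Submodule.coe_add, add_smul]
        abel
      map_smul' := fun c x => by
        simp [smul_smul]
      norm_map' := fun z => by
        have h1 : ⟪z.fst • (Θ : Vec (d + 1)),
            ((tangentBasis Θ).repr.symm z.snd : Vec (d + 1))⟫ = 0 := by
          rw [inner_smul_left]
          have := Submodule.mem_orthogonal_singleton_iff_inner_right.1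
            ((tangentBasis Θ).repr.symm z.snd).2
          rw [this, mul_zero]
        have h2 : ‖z.fst • (Θ : Vec (d + 1))
            + ((tangentBasis Θ).repr.symm z.snd : Vec (d + 1))‖ ^ 2 = ‖z‖ ^ 2 := by
          rw [norm_add_sq_real, h1, WithLp.prod_norm_sq_eq_of_L2, norm_smul,
            norm_eq_of_mem_sphere, Submodule.norm_coe, LinearIsometryEquiv.norm_map]
          ring
        exact (sq_eq_sq₀ (norm_nonneg _) (norm_nonneg _)).1 h2 }
    (by
      rw [LinearEquiv.finrank_eq (WithLp.linearEquiv 2 ℝ (ℝ × Vec d))]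
      simp [add_comm])

/-- The coordinates of a vector along `Θ` and in the orthonormal basis of `Θ^⊥`. -/
def axisCoord (Θ : Sph (d + 1)) : Vec (d + 1) ≃L[ℝ] ℝ × Vec d :=
  (axisIso Θ).symm.toContinuousLinearEquiv.trans (WithLp.prodContinuousLinearEquiv 2 ℝ ℝ (Vec d))

theorem measurePreserving_axisCoord (Θ : Sph (d + 1)) : MeasurePreserving (axisCoord Θ) :=
  (WithLp.volume_preserving_ofLp ℝ (Vec d)).comp (axisIso Θ).symm.measurePreserving

/-- The linear map `(s, w) ↦ s t + A w` in the coordinates given by `Θ`. -/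
def coneMap (Θ : Sph (d + 1)) (t : Vec (d + 1)) (A : Vec d →L[ℝ] Vec (d + 1)) :
    ℝ × Vec d →L[ℝ] ℝ × Vec d :=
  (axisCoord Θ : Vec (d + 1) →L[ℝ] ℝ × Vec d).comp
    ((ContinuousLinearMap.fst ℝ ℝ (Vec d)).smulRight t + A.comp (ContinuousLinearMap.snd ℝ ℝ (Vec d)))

/-- The absolute value of the determinant of `coneMap`. -/
def coneJac (Θ : Sph (d + 1)) (t : Vec (d + 1)) (A : Vec d →L[ℝ] Vec (d + 1)) : ℝ :=
  |(coneMap Θ t A).det|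

theorem coneJac_nonneg (Θ : Sph (d + 1)) (t : Vec (d + 1)) (A : Vec d →L[ℝ] Vec (d + 1)) :
    0 ≤ coneJac Θ t A := abs_nonneg _

theorem continuousOn_coneJac (Θ : Sph (d + 1)) {X : Type*} [TopologicalSpace X]
    {t : X → Vec (d + 1)} {A : X → Vec d →L[ℝ] Vec (d + 1)} {s : Set X} (ht : ContinuousOn t s)
    (hA : ContinuousOn A s) : ContinuousOn (fun v => coneJac Θ (t v) (A v)) s := by
  refine (ContinuousLinearMap.continuous_det.comp_continuousOn ?_).abs
  unfold coneMap
  refine continuousOn_const.clm_comp (ContinuousOn.add ?_ ?_)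
  · exact (ContinuousLinearMap.smulRightL ℝ (ℝ × Vec d) (Vec (d + 1))
      (ContinuousLinearMap.fst ℝ ℝ (Vec d))).continuous.comp_continuousOn ht
  · exact hA.clm_comp continuousOn_const

/-- Only the d tangential directions are scaled, which gives r^d, the growth of the Jacobian of a
cone with the radius. -/
theorem coneMap_smul_det (Θ : Sph (d + 1)) (t : Vec (d + 1)) (A : Vec d →L[ℝ] Vec (d + 1)) (r : ℝ) :
    (coneMap Θ t (r • A)).det = r ^ d * (coneMap Θ t A).det := by
  have h : ((coneMap Θ t (r • A) : ℝ × Vec d →L[ℝ] ℝ × Vec d) : ℝ × Vec d →ₗ[ℝ] ℝ × Vec d)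
      = ((coneMap Θ t A : ℝ × Vec d →L[ℝ] ℝ × Vec d) : ℝ × Vec d →ₗ[ℝ] ℝ × Vec d) ∘ₗ
        LinearMap.prodMap LinearMap.id (r • LinearMap.id) := by
    refine LinearMap.ext fun z => ?_
    simp [coneMap]
  rw [ContinuousLinearMap.det, h, LinearMap.det_comp, LinearMap.det_prodMap, LinearMap.det_id,
    LinearMap.det_smul, LinearMap.det_id, ContinuousLinearMap.det]
  simp [mul_comm]

/-- The density of the surface measure of the sphere in the parametrization `T`. -/
def areaDensity (Θ : Sph (d + 1)) (T : Vec d → Sph (d + 1)) (v : Vec d) : ℝ :=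
  coneJac Θ (T v) (fderiv ℝ (fun v => (T v : Vec (d + 1))) v)

theorem continuousOn_areaDensity {T : OpenPartialHomeomorph (Vec d) (Sph (d + 1))}
    (hT : ContDiffOn ℝ 1 (fun v => (T v : Vec (d + 1))) T.source) (Θ : Sph (d + 1)) :
    ContinuousOn (areaDensity Θ T) T.source := by
  have h2 := hT.continuousOn_fderiv_of_isOpen T.open_source (n := 1) le_rfl
  exact continuousOn_coneJac Θ hT.continuousOn h2

/-- The measure on the sphere is d + 1 times the volume of the cone over the set. In the coordinates
(r, v) ↦ r T(v) the Jacobian is r^d times the density, and the radial integral 1/(d + 1) cancels the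
normalization. -/
theorem toSphere_image {T : OpenPartialHomeomorph (Vec d) (Sph (d + 1))}
    (hT1 : ContDiffOn ℝ 1 (fun v => (T v : Vec (d + 1))) T.source)
    {E : Set (Vec d)} (hE : MeasurableSet E) (hES : E ⊆ T.source) (Θ : Sph (d + 1)) :
    (volume : Measure (Vec (d + 1))).toSphere (T '' E)
      = ∫⁻ v in E, ENNReal.ofReal (areaDensity Θ T v) := by
  have hT : ∀ v ∈ T.source, DifferentiableAt ℝ (fun v => (T v : Vec (d + 1))) v := fun v hv =>
    (hT1.contDiffAt (T.open_source.mem_nhds hv)).differentiableAt one_ne_zero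
  set τ : Vec d → Vec (d + 1) := fun v => (T v : Vec (d + 1)) with hτ
  have hTE : MeasurableSet (T '' E) :=
    hE.image_of_continuousOn_injOn (T.continuousOn.mono hES) (T.injOn.mono hES)
  set Ψ : ℝ × Vec d → ℝ × Vec d := fun z => axisCoord Θ (z.1 • τ z.2) with hΨ
  have hcone : axisCoord Θ '' (Set.Ioo (0 : ℝ) 1 • ((↑) '' (T '' E) : Set (Vec (d + 1))))
      = Ψ '' (Set.Ioo (0 : ℝ) 1 ×ˢ E) := by
    ext z
    simp only [Set.mem_image, Set.mem_smul, Set.mem_prod, Prod.exists, hΨ, hτ]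
    constructor
    · rintro ⟨_, ⟨r, hr, _, ⟨_, ⟨v, hv, rfl⟩, rfl⟩, rfl⟩, rfl⟩
      exact ⟨r, v, ⟨hr, hv⟩, rfl⟩
    · rintro ⟨r, v, ⟨hr, hv⟩, rfl⟩
      exact ⟨_, ⟨r, hr, _, ⟨_, ⟨v, hv, rfl⟩, rfl⟩, rfl⟩, rfl⟩
  have hvol : volume (Set.Ioo (0 : ℝ) 1 • ((↑) '' (T '' E) : Set (Vec (d + 1))))
      = volume (Ψ '' (Set.Ioo (0 : ℝ) 1 ×ˢ E)) := by
    rw [← hcone, ← (measurePreserving_axisCoord Θ).measure_preimage_emb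
      (axisCoord Θ).toHomeomorph.measurableEmbedding]
    congr 1
    exact ((axisCoord Θ).injective.preimage_image _).symm
  have hinj : Set.InjOn Ψ (Set.Ioo (0 : ℝ) 1 ×ˢ E) := by
    rintro ⟨r, v⟩ ⟨hr, hv⟩ ⟨r', v'⟩ ⟨hr', hv'⟩ h
    have h1 : r • τ v = r' • τ v' := (axisCoord Θ).injective h
    have h2 : r = r' := by
      have h3 := congrArg norm h1
      rw [norm_smul, norm_smul, hτ, norm_eq_of_mem_sphere, norm_eq_of_mem_sphere, mul_one, mul_one,
        Real.norm_of_nonneg hr.1.le, Real.norm_of_nonneg hr'.1.le] at h3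
      exact h3
    subst h2
    have h4 : τ v = τ v' := smul_right_injective _ hr.1.ne' h1
    exact Prod.ext rfl (T.injOn (hES hv) (hES hv') (Subtype.ext h4))
  have hderiv : ∀ z ∈ Set.Ioo (0 : ℝ) 1 ×ˢ E, HasFDerivWithinAt Ψ
      (coneMap Θ (τ z.2) (z.1 • fderiv ℝ τ z.2)) (Set.Ioo (0 : ℝ) 1 ×ˢ E) z := by
    rintro ⟨r, v⟩ ⟨hr, hv⟩
    have h1 : HasFDerivAt (fun z : ℝ × Vec d => τ z.2)
        ((fderiv ℝ τ v).comp (ContinuousLinearMap.snd ℝ ℝ (Vec d))) (r, v) :=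
      HasFDerivAt.comp (g := τ) (r, v) (hT v (hES hv)).hasFDerivAt hasFDerivAt_snd
    have h2 := (hasFDerivAt_fst (𝕜 := ℝ) (p := ((r, v) : ℝ × Vec d))).smul h1
    have h3 := ((axisCoord Θ : Vec (d + 1) →L[ℝ] ℝ × Vec d).hasFDerivAt.comp (r, v) h2)
    refine (h3.congr_fderiv ?_).hasFDerivWithinAt
    ext z <;> simp [coneMap]
  have hmeas : AEMeasurable (fun v => ENNReal.ofReal (coneJac Θ (τ v) (fderiv ℝ τ v)))
      (volume.restrict E) :=
    (((continuousOn_areaDensity hT1 Θ).mono hES).aemeasurable hE).ennreal_ofReal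
  have : (volume : Measure (ℝ × Vec d)).IsAddHaarMeasure :=
    Measure.prod.instIsAddHaarMeasure _ _
  rw [Measure.toSphere_apply' _ hTE, hvol, ← lintegral_abs_det_fderiv_eq_addHaar_image volume
    (measurableSet_Ioo.prod hE) hderiv hinj]
  have h5 : ∀ z ∈ Set.Ioo (0 : ℝ) 1 ×ˢ E,
      ENNReal.ofReal |(coneMap Θ (τ z.2) (z.1 • fderiv ℝ τ z.2)).det|
      = ENNReal.ofReal (z.1 ^ d) * ENNReal.ofReal (coneJac Θ (τ z.2) (fderiv ℝ τ z.2)) := by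
    rintro ⟨r, v⟩ ⟨hr, hv⟩
    rw [coneMap_smul_det, abs_mul, abs_of_pos (pow_pos hr.1 d), ENNReal.ofReal_mul
      (pow_pos hr.1 d).le]
    rfl
  rw [setLIntegral_congr_fun (measurableSet_Ioo.prod hE) h5, Measure.volume_eq_prod,
    ← Measure.prod_restrict, lintegral_prod_mul (f := fun r : ℝ => ENNReal.ofReal (r ^ d))
      (g := fun v => ENNReal.ofReal (coneJac Θ (τ v) (fderiv ℝ τ v))) (by fun_prop)
      hmeas, ← mul_assoc]
  have h6 : ∫⁻ r in Set.Ioo (0 : ℝ) 1, ENNReal.ofReal (r ^ d) = ENNReal.ofReal (1 / (d + 1)) := by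
    rw [← ofReal_integral_eq_lintegral_ofReal]
    · rw [← integral_Ioc_eq_integral_Ioo, ← intervalIntegral.integral_of_le zero_le_one, integral_pow]
      simp
    · exact ((continuous_pow d).integrableOn_Icc (a := 0) (b := 1)).mono_set Set.Ioo_subset_Icc_self
    · filter_upwards [ae_restrict_mem measurableSet_Ioo] with r hr using pow_nonneg hr.1.le d
  rw [h6, finrank_euclideanSpace, Fintype.card_fin, ← ENNReal.ofReal_natCast,
    ← ENNReal.ofReal_mul (by positivity)]
  rw [show ((d + 1 : ℕ) : ℝ) * (1 / (d + 1)) = 1 by push_cast; field_simp, ENNReal.ofReal_one,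
    one_mul]
  rfl

theorem measurableSet_cell {Q : Set (Vec d)} (hQ : IsCell Q) {ε : ℝ} (hε : 0 < ε) (c : Vec d) :
    MeasurableSet ((fun q => c + ε • q) '' Q) := by
  exact ((Homeomorph.smulOfNeZero ε hε.ne').trans
    (Homeomorph.addLeft c)).measurableEmbedding.measurableSet_image.2 hQ.measurable

theorem volume_cell {Q : Set (Vec d)} (hQ : IsCell Q) {ε : ℝ} (hε : 0 < ε) (c : Vec d) :
    volume ((fun q => c + ε • q) '' Q) = ENNReal.ofReal (ε ^ d) := by
  have h : (fun q => c + ε • q) '' Q = (fun q => c + q) '' (ε • Q) := by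
    rw [← Set.image_smul, Set.image_image]
  rw [h, Set.image_add_left, measure_preimage_add, Measure.addHaar_smul, hQ.volume_eq, mul_one,
    finrank_euclideanSpace, Fintype.card_fin, abs_of_pos (pow_pos hε d)]

theorem cellArea_eq {T : OpenPartialHomeomorph (Vec d) (Sph (d + 1))}
    (hT : ContDiffOn ℝ 1 (fun v => (T v : Vec (d + 1))) T.source) {Q : Set (Vec d)}
    (hQ : IsCell Q) {ε : ℝ} (hε : 0 < ε) (u : Vec d) (k : Fin d → ℤ) (Θ : Sph (d + 1)) :
    cellArea T Q ε u k = (∫⁻ v in ((fun q => gridPt ε u k + ε • q) '' Q) ∩ T.source,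
      ENNReal.ofReal (areaDensity Θ T v)).toReal := by
  rw [cellArea, measureReal_def, toSphere_image hT
    ((measurableSet_cell hQ hε _).inter T.open_source.measurableSet) Set.inter_subset_right Θ]

theorem abs_cellArea_sub_le {T : OpenPartialHomeomorph (Vec d) (Sph (d + 1))}
    (hT : ContDiffOn ℝ 1 (fun v => (T v : Vec (d + 1))) T.source) {Q : Set (Vec d)}
    (hQ : IsCell Q) {ε : ℝ} (hε : 0 < ε) (u : Vec d) (k : Fin d → ℤ) (Θ : Sph (d + 1))
    (hsub : (fun q => gridPt ε u k + ε • q) '' Q ⊆ T.source) {J η : ℝ}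
    (hJ : ∀ v ∈ (fun q => gridPt ε u k + ε • q) '' Q, |areaDensity Θ T v - J| ≤ η) :
    |cellArea T Q ε u k - J * ε ^ d| ≤ η * ε ^ d := by
  set E := (fun q => gridPt ε u k + ε • q) '' Q with hE
  have hEm : MeasurableSet E := measurableSet_cell hQ hε _
  have hEv : volume E = ENNReal.ofReal (ε ^ d) := volume_cell hQ hε _
  have hEr : volume.real E = ε ^ d := by
    rw [measureReal_def, hEv, ENNReal.toReal_ofReal (pow_pos hε d).le]
  have hfin : volume E < ⊤ := by rw [hEv]; exact ENNReal.ofReal_lt_top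
  have hmeas : AEStronglyMeasurable (areaDensity Θ T) (volume.restrict E) :=
    ((continuousOn_areaDensity hT Θ).mono hsub).aestronglyMeasurable hEm
  have hb : ∀ v ∈ E, ‖areaDensity Θ T v‖ ≤ |J| + η := by
    intro v hv
    have h1 := hJ v hv
    rw [Real.norm_eq_abs]
    calc |areaDensity Θ T v| = |J + (areaDensity Θ T v - J)| := by ring_nf
      _ ≤ |J| + |areaDensity Θ T v - J| := abs_add_le _ _
      _ ≤ _ := by gcongr
  have hint : IntegrableOn (areaDensity Θ T) E :=
    IntegrableOn.of_bound hfin hmeas (|J| + η) ((ae_restrict_iff' hEm).2 (Eventually.of_forall hb))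
  have hpos : ∀ v, 0 ≤ areaDensity Θ T v := fun v => coneJac_nonneg _ _ _
  rw [cellArea_eq hT hQ hε u k Θ, ← hE, Set.inter_eq_self_of_subset_left hsub,
    ← integral_eq_lintegral_of_nonneg_ae (Eventually.of_forall hpos) hmeas]
  have h3 : (∫ v in E, areaDensity Θ T v) - J * ε ^ d = ∫ v in E, (areaDensity Θ T v - J) := by
    rw [integral_sub hint (integrableOn_const hfin.ne), setIntegral_const, hEr, smul_eq_mul,
      mul_comm]
  rw [h3, ← Real.norm_eq_abs, ← hEr]
  exact norm_setIntegral_le_of_norm_le_const hfin hJ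

/-- For small ε all cells based in K lie in one compact thickening of K inside the domain, where the
density is bounded. -/
theorem exists_cellArea_le {T : OpenPartialHomeomorph (Vec d) (Sph (d + 1))}
    (hT : ContDiffOn ℝ 1 (fun v => (T v : Vec (d + 1))) T.source) {Q : Set (Vec d)}
    (hQ : IsCell Q) {K : Set (Vec d)} (hK : IsCompact K) (hKT : K ⊆ T.source) (u : ℝ → Vec d)
    (Θ : Sph (d + 1)) :
    ∃ Cw, ∀ᶠ ε in 𝓝[>] (0 : ℝ), ∀ k, gridPt ε (u ε) k ∈ K →
      |cellArea T Q ε (u ε) k| ≤ Cw * ε ^ d := by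
  obtain ⟨δ, hδ, hδK⟩ := hK.exists_cthickening_subset_open T.open_source hKT
  obtain ⟨R, hR0, hR⟩ := hQ.bounded.exists_pos_norm_le
  have hK' : IsCompact (Metric.cthickening δ K) := hK.cthickening
  obtain ⟨M, hM⟩ := hK'.exists_bound_of_continuousOn ((continuousOn_areaDensity hT Θ).mono hδK)
  refine ⟨M, ?_⟩
  have h1 : ∀ᶠ ε in 𝓝[>] (0 : ℝ), ε < δ / R :=
    nhdsWithin_le_nhds (gt_mem_nhds (div_pos hδ hR0))
  filter_upwards [h1, self_mem_nhdsWithin] with ε hε hε0 k hk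
  replace hε0 : 0 < ε := hε0
  have h2 : (fun q => gridPt ε (u ε) k + ε • q) '' Q ⊆ Metric.cthickening δ K := by
    rintro _ ⟨q, hq, rfl⟩
    refine Metric.mem_cthickening_of_dist_le _ _ _ _ hk ?_
    rw [dist_eq_norm, add_sub_cancel_left, norm_smul, Real.norm_of_nonneg hε0.le]
    rw [lt_div_iff₀ hR0] at hε
    exact (mul_le_mul_of_nonneg_left (hR q hq) hε0.le).trans hε.le
  have h3 := abs_cellArea_sub_le hT hQ hε0 (u ε) k Θ (h2.trans hδK) (J := 0) (η := M)
    fun v hv => by simpa using hM v (h2 hv)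
  simpa using h3

/-- Along this filter the cells, of volume ε^d, shrink to the origin, where the density is
continuous. -/
theorem tendsto_cellArea {T : OpenPartialHomeomorph (Vec d) (Sph (d + 1))}
    (hT : ContDiffOn ℝ 1 (fun v => (T v : Vec (d + 1))) T.source) {Q : Set (Vec d)}
    (hQ : IsCell Q) (h0 : (0 : Vec d) ∈ T.source) (u : ℝ → Vec d) (Θ : Sph (d + 1)) :
    Tendsto (fun z : ℝ × (Fin d → ℤ) => cellArea T Q z.1 (u z.1) z.2 / z.1 ^ d)
      (comap Prod.fst (𝓝[>] 0) ⊓ comap (fun z => gridPt z.1 (u z.1) z.2) (𝓝 0))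
      (𝓝 (areaDensity Θ T 0)) := by
  rw [Metric.tendsto_nhds]
  intro η hη
  have hc := (continuousOn_areaDensity hT Θ).continuousAt (T.open_source.mem_nhds h0)
  obtain ⟨ρ, hρ, h1⟩ := Metric.eventually_nhds_iff.1
    ((Metric.tendsto_nhds.1 hc (η / 2) (half_pos hη)).and (T.open_source.mem_nhds h0))
  obtain ⟨R, hR0, hR⟩ := hQ.bounded.exists_pos_norm_le
  have h2 : ∀ᶠ z : ℝ × (Fin d → ℤ) in comap Prod.fst (𝓝[>] 0) ⊓
      comap (fun z => gridPt z.1 (u z.1) z.2) (𝓝 0), 0 < z.1 ∧ z.1 < ρ / 2 / R := by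
    refine (tendsto_comap.mono_left inf_le_left).eventually (f := Prod.fst)
      (p := fun ε : ℝ => 0 < ε ∧ ε < ρ / 2 / R) ?_
    filter_upwards [self_mem_nhdsWithin,
      nhdsWithin_le_nhds (gt_mem_nhds (div_pos (half_pos hρ) hR0))] with ε h h' using ⟨h, h'⟩
  have h3 : ∀ᶠ z : ℝ × (Fin d → ℤ) in comap Prod.fst (𝓝[>] 0) ⊓
      comap (fun z => gridPt z.1 (u z.1) z.2) (𝓝 0), ‖gridPt z.1 (u z.1) z.2‖ < ρ / 2 := by
    refine (tendsto_comap.mono_left inf_le_right).eventually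
      (f := fun z : ℝ × (Fin d → ℤ) => gridPt z.1 (u z.1) z.2)
      (p := fun v : Vec d => ‖v‖ < ρ / 2) ?_
    filter_upwards [Metric.ball_mem_nhds (0 : Vec d) (half_pos hρ)] with v hv
    simpa using hv
  filter_upwards [h2, h3] with z hz2 hz3
  obtain ⟨hz, hz'⟩ := hz2
  have h4 : ∀ v ∈ (fun q => gridPt z.1 (u z.1) z.2 + z.1 • q) '' Q, dist v 0 < ρ := by
    rintro _ ⟨q, hq, rfl⟩
    rw [dist_zero_right]
    rw [lt_div_iff₀ hR0] at hz'
    calc _ ≤ ‖gridPt z.1 (u z.1) z.2‖ + ‖z.1 • q‖ := norm_add_le _ _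
      _ ≤ ‖gridPt z.1 (u z.1) z.2‖ + z.1 * R := by
          rw [norm_smul, Real.norm_of_nonneg hz.le]
          gcongr
          exact hR q hq
      _ < ρ := by linarith
  have h5 := abs_cellArea_sub_le hT hQ hz (u z.1) z.2 Θ (fun v hv => (h1 (h4 v hv)).2)
    (J := areaDensity Θ T 0) (η := η / 2) fun v hv => by
      have := (h1 (h4 v hv)).1
      rw [Real.dist_eq] at this
      exact this.le
  have h6 : cellArea T Q z.1 (u z.1) z.2 / z.1 ^ d - areaDensity Θ T 0
      = (cellArea T Q z.1 (u z.1) z.2 - areaDensity Θ T 0 * z.1 ^ d) / z.1 ^ d := by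
    have := (pow_pos hz d).ne'
    field_simp
  rw [Real.dist_eq, h6, abs_div, abs_of_pos (pow_pos hz d)]
  refine lt_of_le_of_lt ((div_le_iff₀ (pow_pos hz d)).2 h5) (half_lt_self hη)

/-- The part of `A` with values in `Θ^⊥`, in the orthonormal basis of `Θ^⊥`. -/
def tangentPart (Θ : Sph (d + 1)) (A : Vec d →L[ℝ] Vec (d + 1)) : Vec d →L[ℝ] Vec d :=
  ((ContinuousLinearMap.snd ℝ ℝ (Vec d)).comp (axisCoord Θ : Vec (d + 1) →L[ℝ] ℝ × Vec d)).comp A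

theorem axisCoord_symm_apply (Θ : Sph (d + 1)) (s : ℝ) (w : Vec d) :
    (axisCoord Θ).symm (s, w) = s • (Θ : Vec (d + 1)) + ((tangentBasis Θ).repr.symm w : Vec (d + 1)) :=
  rfl

theorem axisCoord_self (Θ : Sph (d + 1)) : axisCoord Θ (Θ : Vec (d + 1)) = (1, 0) := by
  rw [← ContinuousLinearEquiv.eq_symm_apply, axisCoord_symm_apply]
  simp

theorem axisCoord_of_inner_eq_zero (Θ : Sph (d + 1)) {x : Vec (d + 1)}
    (hx : ⟪(Θ : Vec (d + 1)), x⟫ = 0) : (axisCoord Θ x).1 = 0 := by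
  obtain ⟨⟨s, w⟩, rfl⟩ := (axisCoord Θ).symm.surjective x
  rw [axisCoord_symm_apply, inner_add_right, inner_smul_right,
    Submodule.mem_orthogonal_singleton_iff_inner_right.1 ((tangentBasis Θ).repr.symm w).2,
    real_inner_self_eq_norm_sq, norm_eq_of_mem_sphere] at hx
  simpa using hx

/-- At Θ itself the cone map splits into the radial line and the tangent space, and only the
tangential determinant remains. -/
theorem coneJac_self (Θ : Sph (d + 1)) {A : Vec d →L[ℝ] Vec (d + 1)}
    (hA : ∀ w, ⟪(Θ : Vec (d + 1)), A w⟫ = 0) :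
    coneJac Θ Θ A = |LinearMap.det (tangentPart Θ A : Vec d →ₗ[ℝ] Vec d)| := by
  have h : ((coneMap Θ Θ A : ℝ × Vec d →L[ℝ] ℝ × Vec d) : ℝ × Vec d →ₗ[ℝ] ℝ × Vec d)
      = LinearMap.prodMap LinearMap.id (tangentPart Θ A : Vec d →ₗ[ℝ] Vec d) := by
    refine LinearMap.ext fun z => ?_
    simp only [coneMap, tangentPart, ContinuousLinearMap.coe_coe, ContinuousLinearMap.comp_apply,
      _root_.add_apply, ContinuousLinearMap.smulRight_apply, map_add, map_smul,
      ContinuousLinearEquiv.coe_coe, axisCoord_self, LinearMap.prodMap_apply, LinearMap.id_apply,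
      ContinuousLinearMap.coe_fst', ContinuousLinearMap.coe_snd']
    ext1
    · simp [axisCoord_of_inner_eq_zero Θ (hA z.2)]
    · simp
  rw [coneJac, ContinuousLinearMap.det, h, LinearMap.det_prodMap, LinearMap.det_id, one_mul]

theorem tangentPart_symm (Θ : Sph (d + 1)) {A : Vec d →L[ℝ] Vec (d + 1)}
    (hA : ∀ w, ⟪(Θ : Vec (d + 1)), A w⟫ = 0) (w : Vec d) :
    A w = ((tangentBasis Θ).repr.symm (tangentPart Θ A w) : Vec (d + 1)) := by
  have h := axisCoord_symm_apply Θ (axisCoord Θ (A w)).1 (axisCoord Θ (A w)).2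
  rw [Prod.mk.eta, ContinuousLinearEquiv.symm_apply_apply, axisCoord_of_inner_eq_zero Θ (hA w),
    zero_smul, zero_add] at h
  exact h

end Area

end
end DTB

namespace DTB
noncomputable section

/-! ### Taylor expansions. -/

section Taylor

variable {E : Type*} [NormedAddCommGroup E] [NormedSpace ℝ E]

/-- Second order Taylor expansion with Peano remainder. -/
theorem exists_taylor_two {f : E → ℝ} {x : E} (hf : ContDiffAt ℝ 2 f x) {η : ℝ} (hη : 0 < η) :
    ∀ᶠ h in 𝓝 (0 : E),
      |f (x + h) - f x - fderiv ℝ f x h - fderiv ℝ (fderiv ℝ f) x h h / 2| ≤ η * ‖h‖ ^ 2 := by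
  have hd : DifferentiableAt ℝ (fderiv ℝ f) x :=
    (hf.fderiv_right (m := 1) (by norm_num)).differentiableAt one_ne_zero
  have h1 := (hasFDerivAt_iff_isLittleO_nhds_zero.1 hd.hasFDerivAt).def hη
  have h2 : ∀ᶠ h in 𝓝 (0 : E), DifferentiableAt ℝ f (x + h) := by
    have h3 : ∀ᶠ y in 𝓝 x, DifferentiableAt ℝ f y :=
      (hf.eventually (by simp)).mono fun y hy => hy.differentiableAt two_ne_zero
    have h4 : Tendsto (fun h => x + h) (𝓝 0) (𝓝 x) := by
      simpa using (continuous_const_add x).tendsto 0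
    exact h4.eventually h3
  obtain ⟨r, hr, h5⟩ := Metric.eventually_nhds_iff_ball.1 (h1.and h2)
  have hsymm : IsSymmSndFDerivAt ℝ f x := hf.isSymmSndFDerivAt (by simp)
  filter_upwards [Metric.ball_mem_nhds (0 : E) hr] with h hh
  set D := fderiv ℝ (fderiv ℝ f) x with hD
  -- By symmetry of `D`, the function minus its linear and quadratic parts has derivative f'(x + k)
  -- - f'(x) - D k. This is at most η‖h‖ on the ball, and the mean value inequality concludes.
  have h6 : ∀ k ∈ Metric.closedBall (0 : E) ‖h‖, HasFDerivWithinAt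
      (fun k => f (x + k) - fderiv ℝ f x k - D k k / 2)
      (fderiv ℝ f (x + k) - fderiv ℝ f x - D k) (Metric.closedBall (0 : E) ‖h‖) k := by
    intro k hk
    have hk' : k ∈ Metric.ball (0 : E) r := by
      rw [mem_closedBall_zero_iff] at hk
      rw [mem_ball_zero_iff] at hh ⊢
      exact hk.trans_lt hh
    have h7 : HasFDerivAt (fun k => f (x + k)) (fderiv ℝ f (x + k)) k :=
      (hasFDerivAt_comp_add_left x).2 (h5 k hk').2.hasFDerivAt
    have h8 : HasFDerivAt (fun k => D k k) (D k + D.flip k) k := by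
      have := D.hasFDerivAt (x := k) |>.clm_apply (hasFDerivAt_id k)
      refine this.congr_fderiv ?_
      ext z
      simp
    have h9 := (h7.sub (fderiv ℝ f x).hasFDerivAt).sub (h8.mul_const (1 / 2 : ℝ))
    refine (HasFDerivAt.congr_of_eventuallyEq (h9.congr_fderiv ?_)
      (Eventually.of_forall fun z => ?_)).hasFDerivWithinAt
    · ext z
      have := hsymm k z
      simp only [← hD] at this
      simp [this]
      ring
    · simp only [Pi.sub_apply]
      ring
  have h10 : ∀ k ∈ Metric.closedBall (0 : E) ‖h‖,
      ‖fderiv ℝ f (x + k) - fderiv ℝ f x - D k‖ ≤ η * ‖h‖ := by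
    intro k hk
    rw [mem_closedBall_zero_iff] at hk
    rw [mem_ball_zero_iff] at hh
    refine ((h5 k (by rw [mem_ball_zero_iff]; exact hk.trans_lt hh)).1).trans ?_
    gcongr
  have h11 := (convex_closedBall (0 : E) ‖h‖).norm_image_sub_le_of_norm_hasFDerivWithin_le h6 h10
    (Metric.mem_closedBall_self (norm_nonneg h)) (mem_closedBall_zero_iff.2 le_rfl : h ∈ _)
  simp only [add_zero, map_zero, sub_zero, zero_div, Real.norm_eq_abs] at h11
  calc _ = |f (x + h) - fderiv ℝ f x h - D h h / 2 - f x| := by congr 1; ring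
    _ ≤ _ := h11.trans_eq (by ring)

/-- Taylor expansion of first order, uniformly near a point. -/
theorem exists_taylor_one {f : E → ℝ} {x : E} (hf : ContDiffAt ℝ 2 f x) :
    ∃ c, ∀ᶠ z in 𝓝 ((x, x) : E × E), |f z.1 - f z.2 - fderiv ℝ f x (z.1 - z.2)|
      ≤ c * (‖z.1 - x‖ + ‖z.2 - x‖) * ‖z.1 - z.2‖ := by
  have hd : ContDiffAt ℝ 1 (fderiv ℝ f) x := hf.fderiv_right (m := 1) (by norm_num)
  obtain ⟨c, t, ht, hc⟩ := hd.exists_lipschitzOnWith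
  have h3 : ∀ᶠ y in 𝓝 x, DifferentiableAt ℝ f y :=
    (hf.eventually (by simp)).mono fun y hy => hy.differentiableAt two_ne_zero
  obtain ⟨r, hr, h5⟩ := Metric.eventually_nhds_iff_ball.1 (h3.and ht)
  refine ⟨c, ?_⟩
  filter_upwards [prod_mem_nhds (Metric.ball_mem_nhds x hr) (Metric.ball_mem_nhds x hr)]
    with z hz
  set ρ := max ‖z.1 - x‖ ‖z.2 - x‖ with hρ
  have hρr : ρ < r := by
    rw [hρ, max_lt_iff]
    exact ⟨by simpa [dist_eq_norm] using hz.1, by simpa [dist_eq_norm] using hz.2⟩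
  have hsub : Metric.closedBall x ρ ⊆ Metric.ball x r := Metric.closedBall_subset_ball hρr
  have h6 := (convex_closedBall x ρ).norm_image_sub_le_of_norm_hasFDerivWithin_le'
    (f := f) (f' := fderiv ℝ f) (φ := fderiv ℝ f x) (C := c * ρ) (x := z.2) (y := z.1)
    (fun y hy => (h5 y (hsub hy)).1.hasFDerivAt.hasFDerivWithinAt)
    (fun y hy => by
      refine (hc.norm_sub_le (h5 y (hsub hy)).2 (mem_of_mem_nhds ht)).trans ?_
      rw [mem_closedBall_iff_norm] at hy
      gcongr)
    (by rw [mem_closedBall_iff_norm]; exact le_max_right _ _)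
    (by rw [mem_closedBall_iff_norm]; exact le_max_left _ _)
  refine h6.trans ?_
  gcongr
  exact max_le_add_of_nonneg (norm_nonneg _) (norm_nonneg _)

end Taylor

/-! ### Euler's identity and its derivative. -/

section Homogeneous

variable {n : ℕ} {H : Vec n → ℝ}

/-- Euler's identity: differentiate H(lξ) = l H(ξ) at l = 1. -/
theorem fderiv_apply_self (hs : ContDiffOn ℝ ∞ H {0}ᶜ)
    (hh : ∀ ξ : Vec n, ξ ≠ 0 → ∀ l : ℝ, 0 < l → H (l • ξ) = l * H ξ) {ξ : Vec n} (hξ : ξ ≠ 0) :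
    fderiv ℝ H ξ ξ = H ξ := by
  have hd : DifferentiableAt ℝ H ξ :=
    (hs.contDiffAt (isOpen_compl_singleton.mem_nhds hξ)).differentiableAt (by simp)
  have h1 : HasDerivAt (fun l : ℝ => H (l • ξ)) (fderiv ℝ H ξ ξ) 1 := by
    have h2 : HasDerivAt (fun l : ℝ => l • ξ) ξ 1 := by
      simpa using (hasDerivAt_id (1 : ℝ)).smul_const ξ
    have h3 : HasFDerivAt H (fderiv ℝ H ξ) ((fun l : ℝ => l • ξ) 1) := by
      simpa using hd.hasFDerivAt
    exact h3.comp_hasDerivAt 1 h2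
  have h4 : HasDerivAt (fun l : ℝ => H (l • ξ)) (H ξ) 1 := by
    have h5 : HasDerivAt (fun l : ℝ => l * H ξ) (H ξ) 1 := by
      simpa using (hasDerivAt_id (1 : ℝ)).mul_const (H ξ)
    refine h5.congr_of_eventuallyEq ?_
    filter_upwards [lt_mem_nhds (zero_lt_one' ℝ)] with l hl using hh ξ hξ l hl
  exact h1.unique h4

/-- Differentiating Euler's identity, the first derivatives cancel and the radial direction is seen
to lie in the kernel of the second derivative. -/
theorem snd_fderiv_apply_self (hs : ContDiffOn ℝ ∞ H {0}ᶜ)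
    (hh : ∀ ξ : Vec n, ξ ≠ 0 → ∀ l : ℝ, 0 < l → H (l • ξ) = l * H ξ) {ξ : Vec n} (hξ : ξ ≠ 0)
    (w : Vec n) : fderiv ℝ (fderiv ℝ H) ξ w ξ = 0 := by
  have hc : ContDiffAt ℝ ∞ H ξ := hs.contDiffAt (isOpen_compl_singleton.mem_nhds hξ)
  have hd : DifferentiableAt ℝ (fderiv ℝ H) ξ :=
    ((hc.of_le (n := ∞) (m := 2) (by norm_cast)).fderiv_right (m := 1)
      (by norm_num)).differentiableAt one_ne_zero
  have h1 := hd.hasFDerivAt.clm_apply (hasFDerivAt_id ξ)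
  have h2 : HasFDerivAt (fun y => (fderiv ℝ H y) (id y)) (fderiv ℝ H ξ) ξ := by
    refine (hc.differentiableAt (by simp)).hasFDerivAt.congr_of_eventuallyEq ?_
    filter_upwards [isOpen_compl_singleton.mem_nhds hξ] with y hy using
      fderiv_apply_self hs hh hy
  have h3 := congrArg (fun L : Vec n →L[ℝ] ℝ => L w) (h1.unique h2)
  simpa using h3

end Homogeneous

/-! ### The phase near the distinguished direction. -/

section HessianRoot

variable {d : ℕ} {H : Vec (d + 1) → ℝ} {Θ : Sph (d + 1)}

open scoped MatrixOrder ComplexOrder in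
theorem exists_eq_conjTranspose_mul_self {ι : Type*} [Fintype ι] [DecidableEq ι]
    {M : Matrix ι ι ℝ} (hM : M.PosSemidef) : ∃ X : Matrix ι ι ℝ, M = X.conjTranspose * X := by
  obtain ⟨X, hX, -, h⟩ := CFC.exists_sqrt_of_isSelfAdjoint_of_quasispectrumRestricts
    hM.isHermitian (QuasispectrumRestricts.nnreal_of_nonneg hM.nonneg)
  refine ⟨X, ?_⟩
  rw [← Matrix.star_eq_conjTranspose, hX.star_eq, h]

theorem abs_det_neg {ι : Type*} [Fintype ι] [DecidableEq ι] (M : Matrix ι ι ℝ) :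
    |(-M).det| = |M.det| := by
  rw [Matrix.det_neg, abs_mul, abs_pow, abs_neg, abs_one, one_pow, one_mul]

/-- A square root of minus the Hessian along the tangent plane. -/
theorem exists_hess_root (hneg : HessNegDef H (Θ : Vec (d + 1))) :
    ∃ B : Vec d ≃L[ℝ] Vec d,
      (∀ w, -(fderiv ℝ (fderiv ℝ H) Θ ((tangentBasis Θ).repr.symm w : Vec (d + 1))
        ((tangentBasis Θ).repr.symm w : Vec (d + 1))) = ‖B w‖ ^ 2) ∧
      |LinearMap.det ((B : Vec d →L[ℝ] Vec d) : Vec d →ₗ[ℝ] Vec d)|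
        = √|(hessMatrix H (Θ : Vec (d + 1))).det| := by
  set e := finCongr (finrank_tangent Θ) with he
  -- The Hessian matrix is indexed by the dimension of the orthogonal complement; reindexing by `Fin
  -- d` lets a root of it act on the parameter space.
  set M : Matrix (Fin d) (Fin d) ℝ := (-hessMatrix H (Θ : Vec (d + 1))).submatrix e.symm e.symm
    with hM
  have hMp : M.PosDef := hneg.submatrix e.symm.injective
  have hMdet : M.det = |(hessMatrix H (Θ : Vec (d + 1))).det| := by
    rw [← abs_det_neg, ← Matrix.det_submatrix_equiv_self e.symm, ← hM, abs_of_pos hMp.det_pos]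
  obtain ⟨X, hX⟩ := exists_eq_conjTranspose_mul_self hMp.posSemidef
  have hXdet : X.det ^ 2 = |(hessMatrix H (Θ : Vec (d + 1))).det| := by
    rw [← hMdet, hX, Matrix.det_mul, Matrix.det_conjTranspose, star_trivial, sq]
  have hX0 : X.det ≠ 0 := by
    intro h
    rw [h, ← hMdet] at hXdet
    exact hMp.det_pos.ne (by simpa using hXdet)
  set L : Vec d →ₗ[ℝ] Vec d := Matrix.toLpLin 2 2 X with hL
  have hLdet : LinearMap.det L = X.det := LinearMap.det_toLpLin 2 X
  have hMX : ∀ i j, M i j = ∑ k, X k i * X k j := by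
    intro i j
    rw [hX, Matrix.mul_apply]
    simp [Matrix.conjTranspose_apply]
  have hLq : ∀ w : Vec d, ‖L w‖ ^ 2 = ∑ i, ∑ j, w i * w j * M i j := by
    intro w
    rw [EuclideanSpace.real_norm_sq_eq]
    have h1 : ∀ k, (L w) k = ∑ i, X k i * w i := by
      intro k
      rw [hL, Matrix.toLpLin_apply]
      rfl
    have h2 : ∀ k, (L w) k ^ 2 = ∑ i, ∑ j, X k i * w i * (X k j * w j) := fun k => by
      rw [h1, sq, Finset.sum_mul_sum]
    simp only [h2]
    rw [Finset.sum_comm]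
    refine Finset.sum_congr rfl fun i _ => ?_
    rw [Finset.sum_comm]
    refine Finset.sum_congr rfl fun j _ => ?_
    rw [hMX, Finset.mul_sum]
    refine Finset.sum_congr rfl fun k _ => ?_
    ring
  refine ⟨(LinearMap.equivOfDetNeZero L (by rwa [hLdet])).toContinuousLinearEquiv, ?_, ?_⟩
  · intro w
    have h1 : ((tangentBasis Θ).repr.symm w : Vec (d + 1))
        = ∑ i, w i • (tangentBasis Θ i : Vec (d + 1)) := by
      rw [← OrthonormalBasis.sum_repr_symm]
      simp
    have h2 : ‖((LinearMap.equivOfDetNeZero L (by rwa [hLdet])).toContinuousLinearEquiv) w‖ ^ 2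
        = ‖L w‖ ^ 2 := rfl
    rw [h2, hLq, h1]
    rw [map_sum, ← Finset.sum_neg_distrib, Finset.sum_comm]
    refine Finset.sum_congr rfl fun j _ => ?_
    rw [map_smul, map_sum, _root_.sum_apply, smul_eq_mul, ← mul_neg, ← Finset.sum_neg_distrib,
      Finset.mul_sum]
    refine Finset.sum_congr rfl fun i _ => ?_
    rw [map_smul, _root_.smul_apply, smul_eq_mul]
    have h3 : M i j = -(fderiv ℝ (fderiv ℝ H) Θ (tangentBasis Θ i : Vec (d + 1))
        (tangentBasis Θ j : Vec (d + 1))) := by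
      rw [hM, Matrix.submatrix_apply, Matrix.neg_apply, hessMatrix, Matrix.of_apply, tangentBasis,
        OrthonormalBasis.reindex_apply, OrthonormalBasis.reindex_apply]
    rw [h3]
    ring
  · have h1 : (((LinearMap.equivOfDetNeZero L (by rwa [hLdet])).toContinuousLinearEquiv :
        Vec d →L[ℝ] Vec d) : Vec d →ₗ[ℝ] Vec d) = L := by
      ext
      rfl
    rw [h1, hLdet, ← hXdet, Real.sqrt_sq_eq_abs]

/-- By Euler's identity the phase ξ·H'(Θ) - H(ξ) is minus the second order Taylor remainder of H at
Θ. Its quadratic part ignores the radial component and is positive on the tangential one, while on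
the unit sphere the radial component of ξ - Θ is only -|ξ - Θ|²/2. -/
theorem exists_phase_lower (hs : ContDiffOn ℝ ∞ H {0}ᶜ)
    (hh : ∀ ξ : Vec (d + 1), ξ ≠ 0 → ∀ l : ℝ, 0 < l → H (l • ξ) = l * H ξ)
    (hneg : HessNegDef H (Θ : Vec (d + 1))) :
    ∃ c > 0, ∀ᶠ ξ in 𝓝 (Θ : Vec (d + 1)), ‖ξ‖ = 1 →
      c * ‖ξ - (Θ : Vec (d + 1))‖ ^ 2 ≤ ⟪ξ, gradient H (Θ : Vec (d + 1))⟫ - H ξ := by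
  obtain ⟨B, hB, -⟩ := exists_hess_root hneg
  have hΘ : (Θ : Vec (d + 1)) ≠ 0 := ne_zero_of_mem_unit_sphere Θ
  have hc : ContDiffAt ℝ 2 H Θ :=
    (hs.contDiffAt (isOpen_compl_singleton.mem_nhds hΘ)).of_le (n := ∞) (m := 2)
      (by norm_cast)
  obtain ⟨K, hK, hBK⟩ : ∃ K : ℝ, 0 < K ∧ ∀ w, ‖w‖ ≤ K * ‖B w‖ := by
    refine ⟨‖(B.symm : Vec d →L[ℝ] Vec d)‖ + 1, by positivity, fun w => ?_⟩
    calc ‖w‖ = ‖(B.symm : Vec d →L[ℝ] Vec d) (B w)‖ := by simp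
      _ ≤ ‖(B.symm : Vec d →L[ℝ] Vec d)‖ * ‖B w‖ := ContinuousLinearMap.le_opNorm _ _
      _ ≤ _ := by gcongr; linarith
  set lam : ℝ := (K ^ 2)⁻¹ with hlam
  have hlam0 : 0 < lam := by positivity
  -- The quadratic part is at least (lam/2)(3/4)‖h‖² = (3/8) lam ‖h‖²; the remainder takes lam/8 and
  -- leaves lam/4.
  have hT := exists_taylor_two hc (show 0 < lam / 8 by positivity)
  refine ⟨lam / 4, by positivity, ?_⟩
  have h0 : Tendsto (fun ξ : Vec (d + 1) => ξ - Θ) (𝓝 (Θ : Vec (d + 1))) (𝓝 0) := by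
    simpa using (continuous_sub_right (Θ : Vec (d + 1))).tendsto (Θ : Vec (d + 1))
  filter_upwards [h0.eventually hT, h0.eventually (Metric.ball_mem_nhds 0 one_pos)] with ξ h1 h2 hξ
  rw [dist_zero_right] at h2
  rw [add_sub_cancel] at h1
  set h := ξ - (Θ : Vec (d + 1)) with hh'
  set D := fderiv ℝ (fderiv ℝ H) (Θ : Vec (d + 1)) with hD
  have hinner : ⟪(Θ : Vec (d + 1)), h⟫ = -‖h‖ ^ 2 / 2 := by
    have h3 : ‖ξ‖ ^ 2 = ‖(Θ : Vec (d + 1))‖ ^ 2 + 2 * ⟪(Θ : Vec (d + 1)), h⟫ + ‖h‖ ^ 2 := by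
      rw [← norm_add_sq_real, hh', add_sub_cancel]
    rw [hξ, norm_eq_of_mem_sphere] at h3
    linarith
  obtain ⟨⟨s, w⟩, hsw⟩ := (axisCoord Θ).symm.surjective h
  rw [axisCoord_symm_apply] at hsw
  set t := ((tangentBasis Θ).repr.symm w : Vec (d + 1)) with ht
  have hort : ⟪(Θ : Vec (d + 1)), t⟫ = 0 :=
    Submodule.mem_orthogonal_singleton_iff_inner_right.1 ((tangentBasis Θ).repr.symm w).2
  have hs' : s = -‖h‖ ^ 2 / 2 := by
    rw [← hinner, ← hsw, inner_add_right, inner_smul_right, hort, real_inner_self_eq_norm_sq,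
      norm_eq_of_mem_sphere]
    ring
  have htn : ‖t‖ = ‖w‖ := by
    rw [ht, Submodule.norm_coe, LinearIsometryEquiv.norm_map]
  have hnorm : ‖h‖ ^ 2 = s ^ 2 + ‖w‖ ^ 2 := by
    rw [← hsw, norm_add_sq_real, inner_smul_left, hort, norm_smul, norm_eq_of_mem_sphere, htn]
    simp
  have hsymm : IsSymmSndFDerivAt ℝ H Θ := hc.isSymmSndFDerivAt (by simp)
  have hDΘ : ∀ z, D z Θ = 0 := fun z => snd_fderiv_apply_self hs hh hΘ z
  have hDΘ' : ∀ z, D Θ z = 0 := fun z => by rw [hsymm.eq Θ z]; exact hDΘ z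
  have hDh : D h h = -‖B w‖ ^ 2 := by
    have h6 : D (s • (Θ : Vec (d + 1)) + t) (s • (Θ : Vec (d + 1)) + t) = D t t := by
      simp [hDΘ, hDΘ']
    rw [← hB w, neg_neg, ← hsw, h6]
  have hgrad : ⟪ξ, gradient H (Θ : Vec (d + 1))⟫ = H Θ + fderiv ℝ H Θ h := by
    rw [real_inner_comm, gradient, InnerProductSpace.toDual_symm_apply,
      ← fderiv_apply_self hs hh hΘ, ← map_add, hh', add_sub_cancel]
  have hw1 : lam * ‖w‖ ^ 2 ≤ ‖B w‖ ^ 2 := by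
    rw [hlam, inv_mul_le_iff₀ (by positivity), ← mul_pow]
    exact pow_le_pow_left₀ (norm_nonneg _) (hBK w) 2
  have hw2 : 3 / 4 * ‖h‖ ^ 2 ≤ ‖w‖ ^ 2 := by
    have h4 : s ^ 2 ≤ ‖h‖ ^ 2 / 4 := by
      rw [hs']
      nlinarith [norm_nonneg h, sq_nonneg (‖h‖), mul_nonneg (sq_nonneg ‖h‖)
        (by nlinarith [norm_nonneg h] : (0 : ℝ) ≤ 1 - ‖h‖ ^ 2)]
    linarith
  have h5 := (abs_le.1 h1).2
  rw [hDh] at h5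
  rw [hgrad]
  nlinarith [mul_le_mul_of_nonneg_left hw2 hlam0.le]

/-- The second variable moves, tending to y, because grid points only approach √ε y. Terms of order
zero and one cancel by Euler's identity, and the Taylor remainder is o(ε). -/
theorem tendsto_phase (hs : ContDiffOn ℝ ∞ H {0}ᶜ)
    (hh : ∀ ξ : Vec (d + 1), ξ ≠ 0 → ∀ l : ℝ, 0 < l → H (l • ξ) = l * H ξ)
    {τ : Vec d → Vec (d + 1)} {A : Vec d →L[ℝ] Vec (d + 1)} (hτ : HasFDerivAt τ A 0)
    (hτ0 : τ 0 = Θ) (y : Vec d) :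
    Tendsto (fun z : ℝ × Vec d => (⟪τ (√z.1 • z.2), gradient H (Θ : Vec (d + 1))⟫
      - H (τ (√z.1 • z.2))) / z.1) (𝓝[>] 0 ×ˢ 𝓝 y)
      (𝓝 (-(fderiv ℝ (fderiv ℝ H) (Θ : Vec (d + 1)) (A y) (A y)) / 2)) := by
  have hΘ : (Θ : Vec (d + 1)) ≠ 0 := ne_zero_of_mem_unit_sphere Θ
  have hc : ContDiffAt ℝ 2 H Θ :=
    (hs.contDiffAt (isOpen_compl_singleton.mem_nhds hΘ)).of_le (n := ∞) (m := 2)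
      (by norm_cast)
  set D := fderiv ℝ (fderiv ℝ H) (Θ : Vec (d + 1)) with hD
  set l : Filter (ℝ × Vec d) := 𝓝[>] 0 ×ˢ 𝓝 y with hl
  have hpos : ∀ᶠ z in l, 0 < z.1 := tendsto_fst.eventually self_mem_nhdsWithin
  have hsq : Tendsto (fun z : ℝ × Vec d => √z.1) l (𝓝 0) := by
    have h : Tendsto (fun ε : ℝ => √ε) (𝓝[>] 0) (𝓝 0) := by
      simpa using (Real.continuous_sqrt.tendsto 0).mono_left nhdsWithin_le_nhds
    exact h.comp tendsto_fst
  have hv : Tendsto (fun z : ℝ × Vec d => √z.1 • z.2) l (𝓝 0) := by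
    simpa using hsq.smul (tendsto_snd : Tendsto Prod.snd l (𝓝 y))
  set h : ℝ × Vec d → Vec (d + 1) := fun z => τ (√z.1 • z.2) - Θ with hhdef
  have hw : Tendsto (fun z => (√z.1)⁻¹ • h z) l (𝓝 (A y)) := by
    have h1 := (hasFDerivAt_iff_isLittleO_nhds_zero.1 hτ).comp_tendsto hv
    have h2 : (fun z : ℝ × Vec d => √z.1 • z.2) =O[l] fun z => √z.1 := by
      have h3 : (fun z : ℝ × Vec d => z.2) =O[l] fun _ => (1 : ℝ) :=
        (tendsto_snd : Tendsto Prod.snd l (𝓝 y)).isBigO_one ℝ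
      simpa using (Asymptotics.isBigO_refl (fun z : ℝ × Vec d => √z.1) l).smul h3
    have h4 := (h1.trans_isBigO h2).tendsto_inv_smul_nhds_zero
    have h5 : Tendsto (fun z : ℝ × Vec d => A z.2) l (𝓝 (A y)) :=
      (A.continuous.tendsto y).comp tendsto_snd
    have h6 := h4.add h5
    rw [zero_add] at h6
    refine h6.congr' (hpos.mono fun z hz => ?_)
    have hz' : √z.1 ≠ 0 := (Real.sqrt_pos.2 hz).ne'
    simp only [Function.comp_apply, zero_add, hτ0, map_smul, hhdef]
    rw [smul_sub _ _ (√z.1 • A z.2), smul_smul, inv_mul_cancel₀ hz', one_smul]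
    abel
  have hh0 : Tendsto h l (𝓝 0) := by
    have h1 := hsq.smul hw
    rw [zero_smul] at h1
    refine h1.congr' (hpos.mono fun z hz => ?_)
    rw [smul_smul, mul_inv_cancel₀ (Real.sqrt_pos.2 hz).ne', one_smul]
  have hT : (fun k => H (Θ + k) - H Θ - fderiv ℝ H Θ k - D k k / 2)
      =o[𝓝 (0 : Vec (d + 1))] fun k => ‖k‖ ^ 2 := by
    rw [Asymptotics.isLittleO_iff]
    intro η hη
    filter_upwards [exists_taylor_two hc hη] with k hk
    simpa using hk
  have h7 := hT.comp_tendsto hh0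
  have h8 : (fun z => ‖h z‖ ^ 2) =O[l] fun z => z.1 := by
    have h9 : (fun z => ‖(√z.1)⁻¹ • h z‖ ^ 2) =O[l] fun _ => (1 : ℝ) :=
      (hw.norm.pow 2).isBigO_one ℝ
    have h10 := (Asymptotics.isBigO_refl (fun z : ℝ × Vec d => z.1) l).mul h9
    simp only [mul_one] at h10
    refine h10.congr' (hpos.mono fun z hz => ?_) (Eventually.of_forall fun _ => rfl)
    simp only
    rw [norm_smul, mul_pow, norm_inv, Real.norm_of_nonneg (Real.sqrt_nonneg _), inv_pow,
      Real.sq_sqrt hz.le, ← mul_assoc, mul_inv_cancel₀ hz.ne', one_mul]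
  have h11 := (h7.trans_isBigO h8).tendsto_div_nhds_zero
  have h12 : Tendsto (fun z => -(D ((√z.1)⁻¹ • h z) ((√z.1)⁻¹ • h z)) / 2) l
      (𝓝 (-(D (A y) (A y)) / 2)) := by
    have h13 : Continuous fun k : Vec (d + 1) => -(D k k) / 2 := by fun_prop
    exact (h13.tendsto (A y)).comp hw
  have h14 := h12.sub h11
  rw [sub_zero] at h14
  refine h14.congr' (hpos.mono fun z hz => ?_)
  simp only [Function.comp_apply]
  have hgrad : ⟪τ (√z.1 • z.2), gradient H (Θ : Vec (d + 1))⟫ = H Θ + fderiv ℝ H Θ (h z) := by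
    rw [real_inner_comm, gradient, InnerProductSpace.toDual_symm_apply,
      ← fderiv_apply_self hs hh hΘ, ← map_add, hhdef]
    simp
  have hsum : τ (√z.1 • z.2) = Θ + h z := by simp [hhdef]
  rw [hgrad, hsum]
  have h15 : D ((√z.1)⁻¹ • h z) ((√z.1)⁻¹ • h z) = D (h z) (h z) / z.1 := by
    simp only [map_smul, _root_.smul_apply, smul_eq_mul]
    rw [← mul_assoc, ← mul_inv, Real.mul_self_sqrt hz.le, inv_mul_eq_div]
  rw [h15]
  have hz' := hz.ne'
  field_simp
  ring

theorem integral_comp_linearEquiv {d : ℕ} (L : Vec d ≃L[ℝ] Vec d) (g : Vec d → ℂ) :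
    ((|LinearMap.det ((L : Vec d →L[ℝ] Vec d) : Vec d →ₗ[ℝ] Vec d)| : ℝ) : ℂ) * ∫ y, g (L y)
      = ∫ z, g z := by
  have h := integral_image_eq_integral_abs_det_fderiv_smul volume MeasurableSet.univ
    (f := L) (f' := fun _ => (L : Vec d →L[ℝ] Vec d))
    (fun x _ => (L : Vec d →L[ℝ] Vec d).hasFDerivAt.hasFDerivWithinAt) L.injective.injOn g
  rw [Set.image_univ, L.surjective.range_eq, Measure.restrict_univ] at h
  rw [h, ← integral_const_mul]
  rfl

/-- Reduction of the quadratic phase in a parametrization of the sphere to `‖z‖² / 2`. -/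
theorem integral_quadratic_phase (hneg : HessNegDef H (Θ : Vec (d + 1)))
    {A : Vec d →L[ℝ] Vec (d + 1)} (hA : ∀ w, ⟪(Θ : Vec (d + 1)), A w⟫ = 0)
    (hAi : Function.Injective A) (Φ : ℝ → ℂ) :
    (coneJac Θ Θ A : ℂ) *
      ∫ y, Φ (-(fderiv ℝ (fderiv ℝ H) (Θ : Vec (d + 1)) (A y) (A y)) / 2)
    = ((√|(hessMatrix H (Θ : Vec (d + 1))).det|)⁻¹ : ℝ) * ∫ z : Vec d, Φ (‖z‖ ^ 2 / 2) := by
  obtain ⟨B, hB, hBd⟩ := exists_hess_root hneg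
  have hinj : Function.Injective (tangentPart Θ A) := by
    intro w w' h
    refine hAi ?_
    rw [tangentPart_symm Θ hA, tangentPart_symm Θ hA, h]
  have hdet : LinearMap.det (tangentPart Θ A : Vec d →ₗ[ℝ] Vec d) ≠ 0 := by
    have h := (LinearEquiv.ofInjectiveEndo (tangentPart Θ A : Vec d →ₗ[ℝ] Vec d) hinj).isUnit_det'
    exact h.ne_zero
  set N : Vec d ≃L[ℝ] Vec d :=
    (LinearMap.equivOfDetNeZero (tangentPart Θ A : Vec d →ₗ[ℝ] Vec d) hdet).toContinuousLinearEquiv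
    with hN
  have hNa : ∀ y, N y = tangentPart Θ A y := fun y => rfl
  have hNl : ((N : Vec d →L[ℝ] Vec d) : Vec d →ₗ[ℝ] Vec d) = tangentPart Θ A := by
    ext
    rfl
  have h1 : ∀ y, -(fderiv ℝ (fderiv ℝ H) (Θ : Vec (d + 1)) (A y) (A y)) = ‖B (N y)‖ ^ 2 := by
    intro y
    rw [← hB, hNa, ← tangentPart_symm Θ hA]
  simp only [h1]
  have h2 := integral_comp_linearEquiv N (fun y => Φ (‖B y‖ ^ 2 / 2))
  have h3 := integral_comp_linearEquiv B (fun y => Φ (‖y‖ ^ 2 / 2))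
  rw [hNl] at h2
  rw [coneJac_self Θ hA, h2, ← h3, hBd, ← mul_assoc, ← Complex.ofReal_mul, inv_mul_cancel₀,
    Complex.ofReal_one, one_mul]
  rw [← hBd]
  exact abs_ne_zero.2 (LinearEquiv.isUnit_det' B.toLinearEquiv).ne_zero

end HessianRoot

end
end DTB

namespace DTB
noncomputable section

/-! ### The sampled directions as a grid with quadratic phase. -/

section Directions

variable {d : ℕ} {T : OpenPartialHomeomorph (Vec d) (Sph (d + 1))} {U : Set (Vec d)}
  {Ω : Set (Sph (d + 1))} {Θ : Sph (d + 1)}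

namespace IsDirectionMap

theorem contDiffOn (hT : IsDirectionMap T U Ω Θ) :
    ContDiffOn ℝ ∞ (fun v => (T v : Vec (d + 1))) T.source := by
  rw [hT.source_eq, ← contMDiffOn_iff_contDiffOn]
  exact (contMDiff_coe_sphere (E := Vec (d + 1)) (n := d)).comp_contMDiffOn hT.smooth

theorem zero_mem_source (hT : IsDirectionMap T U Ω Θ) : (0 : Vec d) ∈ T.source := by
  rw [hT.source_eq]
  exact hT.zero_mem

theorem contDiffAt (hT : IsDirectionMap T U Ω Θ) :
    ContDiffAt ℝ ∞ (fun v => (T v : Vec (d + 1))) 0 :=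
  hT.contDiffOn.contDiffAt (T.open_source.mem_nhds hT.zero_mem_source)

theorem hasFDerivAt (hT : IsDirectionMap T U Ω Θ) :
    HasFDerivAt (fun v => (T v : Vec (d + 1))) (fderiv ℝ (fun v => (T v : Vec (d + 1))) 0) 0 :=
  (hT.contDiffAt.differentiableAt (by simp)).hasFDerivAt

/-- Differentiate |T(v)|² = 1 at the origin. -/
theorem inner_fderiv (hT : IsDirectionMap T U Ω Θ) (w : Vec d) :
    ⟪(Θ : Vec (d + 1)), fderiv ℝ (fun v => (T v : Vec (d + 1))) 0 w⟫ = 0 := by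
  have h1 := hT.hasFDerivAt.inner ℝ hT.hasFDerivAt
  have h2 : HasFDerivAt (fun v => ⟪(T v : Vec (d + 1)), (T v : Vec (d + 1))⟫)
      (0 : Vec d →L[ℝ] ℝ) 0 := by
    refine (hasFDerivAt_const (1 : ℝ) (0 : Vec d)).congr_of_eventuallyEq
      (Eventually.of_forall fun v => ?_)
    simp only
    rw [real_inner_self_eq_norm_sq, norm_eq_of_mem_sphere, one_pow]
  have h3 := congrArg (fun L : Vec d →L[ℝ] ℝ => L w) (h1.unique h2)
  simp only [ContinuousLinearMap.comp_apply, ContinuousLinearMap.prod_apply,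
    fderivInnerCLM_apply, hT.map_zero, _root_.zero_apply] at h3
  rw [real_inner_comm (Θ : Vec (d + 1))] at h3
  linarith

/-- The composition of T with its smooth inverse is the identity near 0, so the manifold derivative
of T has a left inverse; the inclusion of the sphere is an immersion. -/
theorem fderiv_injective (hT : IsDirectionMap T U Ω Θ) :
    Function.Injective (fderiv ℝ (fun v => (T v : Vec (d + 1))) 0) := by
  have h0 : U ∈ 𝓝 (0 : Vec d) := by
    rw [← hT.source_eq]
    exact T.open_source.mem_nhds hT.zero_mem_source
  have hΩ : Ω ∈ 𝓝 (T 0) := by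
    rw [← hT.target_eq]
    exact T.open_target.mem_nhds (T.map_source hT.zero_mem_source)
  have h1 : MDifferentiableAt (𝓡 d) (𝓡 d) T 0 :=
    (hT.smooth.contMDiffAt h0).mdifferentiableAt (by simp)
  have h2 : MDifferentiableAt (𝓡 d) (𝓡 d) T.symm (T 0) :=
    (hT.smooth_symm.contMDiffAt hΩ).mdifferentiableAt (by simp)
  have h3 : MDifferentiableAt (𝓡 d) 𝓘(ℝ, Vec (d + 1)) ((↑) : Sph (d + 1) → Vec (d + 1)) (T 0) :=
    (contMDiff_coe_sphere (m := ∞) (T 0)).mdifferentiableAt (by simp)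
  have h4 : fderiv ℝ (fun v => (T v : Vec (d + 1))) 0
      = (mfderiv (𝓡 d) 𝓘(ℝ, Vec (d + 1)) ((↑) : Sph (d + 1) → Vec (d + 1)) (T 0)).comp
        (mfderiv (𝓡 d) (𝓡 d) T 0) := by
    rw [← mfderiv_eq_fderiv]
    exact mfderiv_comp (I' := 𝓡 d) (0 : Vec d) h3 h1
  have h5 : (mfderiv (𝓡 d) (𝓡 d) T.symm (T 0)).comp (mfderiv (𝓡 d) (𝓡 d) T 0)
      = ContinuousLinearMap.id ℝ _ := by
    rw [← mfderiv_comp (I' := 𝓡 d) (0 : Vec d) h2 h1]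
    rw [Filter.EventuallyEq.mfderiv_eq (f₁ := T.symm ∘ T) (f := id)]
    · exact mfderiv_id
    · filter_upwards [T.open_source.mem_nhds hT.zero_mem_source] with v hv using T.left_inv hv
  intro w w' h
  rw [h4] at h
  have h6 := mfderiv_coe_sphere_injective (n := d) (T 0) h
  have h7 := congrArg (mfderiv (𝓡 d) (𝓡 d) T.symm (T 0)) h6
  have h8 := fun z => congrArg (fun L => L z) h5
  exact (h8 w).symm.trans (h7.trans (h8 w'))

/-- Near the origin the injective derivative gives the bound. On the rest of K the distance |T(v) -
Θ| is positive by injectivity of T and attains a minimum by compactness. -/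
theorem exists_norm_le (hT : IsDirectionMap T U Ω Θ) {K : Set (Vec d)} (hK : IsCompact K)
    (hKU : K ⊆ U) : ∃ c > 0, ∀ v ∈ K, c * ‖v‖ ≤ ‖(T v : Vec (d + 1)) - Θ‖ := by
  have hloc : ∃ c > 0, ∀ᶠ v in 𝓝 (0 : Vec d), c * ‖v‖ ≤ ‖(T v : Vec (d + 1)) - Θ‖ := by
    set A := fderiv ℝ (fun v => (T v : Vec (d + 1))) 0 with hA
    obtain ⟨M, hM0, hM⟩ := (A : Vec d →ₗ[ℝ] Vec (d + 1)).exists_antilipschitzWith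
      (LinearMap.ker_eq_bot.2 hT.fderiv_injective)
    have hM0' : (0 : ℝ) < M := hM0
    refine ⟨(2 * (M : ℝ))⁻¹, by positivity, ?_⟩
    have h1 := (hasFDerivAt_iff_isLittleO_nhds_zero.1 hT.hasFDerivAt).def
      (show 0 < (2 * (M : ℝ))⁻¹ by positivity)
    filter_upwards [h1] with v hv
    rw [zero_add, hT.map_zero] at hv
    have h2 : ‖v‖ ≤ M * ‖A v‖ := by
      have := hM.le_mul_dist v 0
      simpa using this
    have h3 : ‖A v‖ ≤ ‖(T v : Vec (d + 1)) - Θ‖ + ‖(T v : Vec (d + 1)) - Θ - A v‖ := by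
      calc ‖A v‖ = ‖((T v : Vec (d + 1)) - Θ) - ((T v : Vec (d + 1)) - Θ - A v)‖ := by
            rw [sub_sub_cancel]
        _ ≤ _ := norm_sub_le _ _
    have h4 : (M : ℝ)⁻¹ * ‖v‖ ≤ ‖A v‖ := by rwa [inv_mul_le_iff₀ hM0']
    have h5 : (2 * (M : ℝ))⁻¹ * ‖v‖ + (2 * (M : ℝ))⁻¹ * ‖v‖ = (M : ℝ)⁻¹ * ‖v‖ := by
      field_simp
      ring
    linarith
  obtain ⟨c, hc, hev⟩ := hloc
  obtain ⟨r, hr, hball⟩ := Metric.eventually_nhds_iff_ball.1 hev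
  have hK' : IsCompact (K \ Metric.ball 0 r) := hK.diff Metric.isOpen_ball
  rcases (K \ Metric.ball (0 : Vec d) r).eq_empty_or_nonempty with h0 | h0
  · exact ⟨c, hc, fun v hv => hball v (by
      by_contra h
      exact (h0 ▸ Set.notMem_empty v) ⟨hv, h⟩)⟩
  have hKs : K ⊆ T.source := hT.source_eq ▸ hKU
  obtain ⟨v₀, hv₀, hmin⟩ := hK'.exists_isMinOn h0 (f := fun v => ‖(T v : Vec (d + 1)) - Θ‖)
    (((hT.contDiffOn.continuousOn.mono (Set.sdiff_subset.trans hKs)).sub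
      continuousOn_const).norm)
  have hpos : 0 < ‖(T v₀ : Vec (d + 1)) - Θ‖ := by
    rw [norm_pos_iff, sub_ne_zero]
    intro h
    have h1 : T v₀ = T 0 := by rw [hT.map_zero]; exact Subtype.ext h
    have h2 := T.injOn (hKs hv₀.1) hT.zero_mem_source h1
    exact hv₀.2 (by rw [h2]; exact Metric.mem_ball_self hr)
  obtain ⟨R, hR, hKR⟩ := hK.isBounded.exists_pos_norm_le
  refine ⟨min c (‖(T v₀ : Vec (d + 1)) - Θ‖ / R), lt_min hc (by positivity), fun v hv => ?_⟩
  by_cases h : v ∈ Metric.ball (0 : Vec d) r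
  · exact le_trans (by gcongr; exact min_le_left _ _) (hball v h)
  · have h1 : ‖(T v₀ : Vec (d + 1)) - Θ‖ ≤ ‖(T v : Vec (d + 1)) - Θ‖ := hmin ⟨hv, h⟩
    refine le_trans ?_ h1
    calc _ ≤ ‖(T v₀ : Vec (d + 1)) - Θ‖ / R * R := by
          gcongr
          · exact min_le_right _ _
          · exact hKR v hv
      _ = _ := by field_simp

end IsDirectionMap

/-- The phase that must be generic is H(T(v)), whereas genericity is assumed for T(v)·x₀. The
derivatives of the two at the origin agree because x₀ is the gradient of H at Θ. -/
theorem isGridPhase {H : Vec (d + 1) → ℝ} (hs : ContDiffOn ℝ ∞ H {0}ᶜ)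
    (hh : ∀ ξ : Vec (d + 1), ξ ≠ 0 → ∀ l : ℝ, 0 < l → H (l • ξ) = l * H ξ)
    (hT : IsDirectionMap T U Ω Θ)
    (hlow : ∃ c > 0, ∀ α ∈ Ω, c * ‖(α : Vec (d + 1)) - Θ‖ ^ 2
      ≤ ⟪(α : Vec (d + 1)), gradient H (Θ : Vec (d + 1))⟫ - H α)
    (hgen : IsGenericFor T (gradient H (Θ : Vec (d + 1)))) {Q : Set (Vec d)} (hQ : IsCell Q)
    (u : ℝ → Vec d) {K : Set (Vec d)} (hK : IsCompact K) (hKU : K ⊆ U) (x : Vec (d + 1)) :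
    IsGridPhase K (fun v => ⟪(T v : Vec (d + 1)), x⟫)
      (fun v => ⟪(T v : Vec (d + 1)), gradient H (Θ : Vec (d + 1))⟫ - H (T v))
      (fun v => H (T v))
      (fun y => -(fderiv ℝ (fderiv ℝ H) (Θ : Vec (d + 1))
        (fderiv ℝ (fun v => (T v : Vec (d + 1))) 0 y)
        (fderiv ℝ (fun v => (T v : Vec (d + 1))) 0 y)) / 2)
      (fun ε k => cellArea T Q ε (u ε) k) u ‖x‖ (areaDensity Θ T 0) := by
  have hΘ : (Θ : Vec (d + 1)) ≠ 0 := ne_zero_of_mem_unit_sphere Θ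
  have hKs : K ⊆ T.source := hT.source_eq ▸ hKU
  have hT1 : ContDiffOn ℝ 1 (fun v => (T v : Vec (d + 1))) T.source :=
    hT.contDiffOn.of_le (by norm_cast)
  refine ⟨hK.isBounded, fun v _ => ?_, ?_, fun y => ?_, ?_, ?_, ?_⟩
  · refine (abs_real_inner_le_norm _ _).trans ?_
    rw [norm_eq_of_mem_sphere, one_mul]
  · obtain ⟨c, hc, hcK⟩ := hT.exists_norm_le hK hKU
    obtain ⟨c', hc', hcΩ⟩ := hlow
    refine ⟨min 1 (c' * c ^ 2), lt_min one_pos (by positivity), min_le_left _ _, fun v hv => ?_⟩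
    have h1 : T v ∈ Ω := hT.target_eq ▸ T.map_source (hKs hv)
    refine le_trans ?_ (hcΩ (T v) h1)
    calc min 1 (c' * c ^ 2) * ‖v‖ ^ 2 ≤ c' * c ^ 2 * ‖v‖ ^ 2 := by gcongr; exact min_le_right _ _
      _ = c' * (c * ‖v‖) ^ 2 := by ring
      _ ≤ _ := by gcongr; exact hcK v hv
  · have h1 := tendsto_phase hs hh hT.hasFDerivAt (by rw [hT.map_zero]) y
    have h2 : Tendsto (fun z : ℝ × Vec d => √z.1 • z.2) (𝓝[>] 0 ×ˢ 𝓝 y) (𝓝 0) := by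
      have h : Tendsto (fun ε : ℝ => √ε) (𝓝[>] 0) (𝓝 0) := by
        simpa using (Real.continuous_sqrt.tendsto 0).mono_left nhdsWithin_le_nhds
      simpa using (h.comp tendsto_fst).smul
        (tendsto_snd : Tendsto Prod.snd ((𝓝[>] (0 : ℝ)) ×ˢ 𝓝 y) (𝓝 y))
    have h3 : Tendsto (fun v => ⟪(T v : Vec (d + 1)), x⟫) (𝓝 0)
        (𝓝 ⟪(T 0 : Vec (d + 1)), x⟫) :=
      (hT.contDiffAt.continuousAt.inner continuousAt_const)
    exact (h3.comp h2).add h1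
  · obtain ⟨i, hi⟩ := hgen
    have hc : ContDiffAt ℝ 2 (fun v => H (T v)) 0 := by
      have h1 : ContDiffAt ℝ ∞ H (T 0 : Vec (d + 1)) := by
        rw [hT.map_zero]
        exact hs.contDiffAt (isOpen_compl_singleton.mem_nhds hΘ)
      exact (h1.comp (0 : Vec d) hT.contDiffAt).of_le (by norm_cast)
    refine ⟨fderiv ℝ (fun v => H (T v)) 0, ⟨i, ?_⟩, ?_⟩
    · have hd : HasFDerivAt H (fderiv ℝ H Θ) (T 0 : Vec (d + 1)) := by
        rw [hT.map_zero]
        exact ((hs.contDiffAt (isOpen_compl_singleton.mem_nhds hΘ)).differentiableAt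
          (by simp)).hasFDerivAt
      have h1 := (hd.comp (0 : Vec d) hT.hasFDerivAt).fderiv
      have h2 := (hT.hasFDerivAt.inner ℝ (hasFDerivAt_const (gradient H (Θ : Vec (d + 1)))
        (0 : Vec d))).fderiv
      rw [h2] at hi
      rw [show (fun v => H (T v)) = H ∘ fun v => (T v : Vec (d + 1)) from rfl, h1]
      convert hi using 1
      simp only [ContinuousLinearMap.comp_apply, ContinuousLinearMap.prod_apply,
        fderivInnerCLM_apply, _root_.zero_apply, inner_zero_right, zero_add]
      rw [real_inner_comm, gradient, InnerProductSpace.toDual_symm_apply]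
    · obtain ⟨c, h⟩ := exists_taylor_one hc
      simp only [sub_zero] at h
      exact ⟨c, h⟩
  · exact exists_cellArea_le hT1 hQ hK hKs u Θ
  · exact tendsto_cellArea hT1 hQ hT.zero_mem_source u Θ

/-- The direction map followed by the antipodal map. -/
def negMap (T : OpenPartialHomeomorph (Vec d) (Sph (d + 1))) :
    OpenPartialHomeomorph (Vec d) (Sph (d + 1)) :=
  T.transHomeomorph (Homeomorph.neg (Sph (d + 1)))

theorem negMap_apply (v : Vec d) : negMap T v = -T v := rfl

theorem negMap_source : (negMap T).source = T.source := rfl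

theorem IsDirectionMap.neg (hT : IsDirectionMap T U (-Ω) (-Θ)) :
    IsDirectionMap (negMap T) U Ω Θ := by
  refine ⟨hT.source_eq, ?_, ?_, ?_, hT.zero_mem, ?_⟩
  · have h : (negMap T).target = (Homeomorph.neg (Sph (d + 1))).symm ⁻¹' T.target := rfl
    rw [h, hT.target_eq]
    ext α
    simp
  · exact (contMDiff_neg_sphere (E := Vec (d + 1)) (n := d)).comp_contMDiffOn hT.smooth
  · refine hT.smooth_symm.comp
      (contMDiff_neg_sphere (E := Vec (d + 1)) (n := d)).contMDiffOn fun α hα => ?_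
    simpa using hα
  · rw [negMap_apply, hT.map_zero, neg_neg]

theorem IsGenericFor.neg {x₀ : Vec (d + 1)} (hT : IsGenericFor T x₀) :
    IsGenericFor (negMap T) x₀ := by
  obtain ⟨i, hi⟩ := hT
  refine ⟨i, ?_⟩
  have h : (fun v => ⟪(negMap T v : Vec (d + 1)), x₀⟫)
      = fun v => -⟪(T v : Vec (d + 1)), x₀⟫ := by
    funext v
    rw [negMap_apply, ← inner_neg_left]
    rfl
  rw [h, fderiv_fun_neg]
  simpa using hi

/-- The antipodal map changes the sign of the whole cone map, hence not the modulus of its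
determinant. -/
theorem areaDensity_negMap (v : Vec d) : areaDensity Θ (negMap T) v = areaDensity Θ T v := by
  have h1 : (fun v => (negMap T v : Vec (d + 1))) = fun v => -(T v : Vec (d + 1)) := rfl
  have h2 : coneMap Θ (-(T v : Vec (d + 1))) (-fderiv ℝ (fun v => (T v : Vec (d + 1))) v)
      = -coneMap Θ (T v) (fderiv ℝ (fun v => (T v : Vec (d + 1))) v) := by
    refine ContinuousLinearMap.ext fun z => ?_
    simp [coneMap]
    exact add_comm _ _
  have h3 : (negMap T v : Vec (d + 1)) = -(T v : Vec (d + 1)) := rfl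
  rw [areaDensity, areaDensity, h1, fderiv_fun_neg, h3, coneJac, h2, coneJac,
    ContinuousLinearMap.det, ContinuousLinearMap.det, ContinuousLinearMap.toLinearMap_neg,
    ← neg_one_smul ℝ (_ : _ →ₗ[ℝ] _), LinearMap.det_smul, abs_mul, abs_pow, abs_neg, abs_one, one_pow, one_mul]

theorem cellArea_negMap (hT : ContDiffOn ℝ 1 (fun v => (T v : Vec (d + 1))) T.source)
    {Q : Set (Vec d)} (hQ : IsCell Q) {ε : ℝ} (hε : 0 < ε) (u : Vec d) (k : Fin d → ℤ) :
    cellArea (negMap T) Q ε u k = cellArea T Q ε u k := by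
  have h1 : ContDiffOn ℝ 1 (fun v => (negMap T v : Vec (d + 1))) (negMap T).source := hT.neg
  rw [cellArea_eq hT hQ hε u k (T 0), cellArea_eq h1 hQ hε u k (T 0), negMap_source]
  simp only [areaDensity_negMap]

end Directions

end
end DTB

namespace DTB
noncomputable section

/-! ### Boundary values of powers as integrals over half-lines of frequencies. -/

section Boundary

open scoped FourierTransform

/-- Multiplication by i rotates the right half-plane without crossing the cut of the principal
branch, so the logarithms add. -/
theorem I_mul_cpow {z : ℂ} (hz : 0 < z.re) (w : ℂ) :
    (Complex.I * z) ^ w = Complex.exp (Complex.I * (Real.pi / 2) * w) * z ^ w := by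
  have hz0 : z ≠ 0 := by rintro rfl; simp at hz
  have harg := abs_lt.1 (Complex.abs_arg_lt_pi_div_two_iff.2 (Or.inl hz))
  rw [Complex.cpow_def_of_ne_zero (mul_ne_zero Complex.I_ne_zero hz0),
    Complex.cpow_def_of_ne_zero hz0, Complex.log_mul Complex.I_ne_zero hz0, Complex.log_I,
    ← Complex.exp_add]
  · congr 1; ring
  · rw [Complex.arg_I]
    constructor <;> linarith [harg.1, harg.2, Real.pi_pos]

theorem neg_I_mul_cpow' {z : ℂ} (hz : 0 < z.re) (w : ℂ) :
    (-Complex.I * z) ^ w = Complex.exp (-(Complex.I * (Real.pi / 2) * w)) * z ^ w := by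
  have hz0 : z ≠ 0 := by rintro rfl; simp at hz
  have hI : -Complex.I ≠ 0 := neg_ne_zero.2 Complex.I_ne_zero
  have harg := abs_lt.1 (Complex.abs_arg_lt_pi_div_two_iff.2 (Or.inl hz))
  rw [Complex.cpow_def_of_ne_zero (mul_ne_zero hI hz0),
    Complex.cpow_def_of_ne_zero hz0, Complex.log_mul hI hz0, Complex.log_neg_I,
    ← Complex.exp_add]
  · congr 1; ring
  · rw [Complex.arg_neg_I]
    constructor <;> linarith [harg.1, harg.2, Real.pi_pos]

theorem tendsto_lap_zero {a : ℝ} {g : ℝ → ℂ} (hg : Continuous g)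
    (hint : IntegrableOn (fun l : ℝ => l ^ a * ‖g l‖) (Set.Ioi 0)) :
    Tendsto (fun δ : ℝ => lap a g δ) (𝓝[>] 0)
      (𝓝 (∫ l in Set.Ioi (0 : ℝ), ((l ^ a : ℝ) : ℂ) * g l)) := by
  unfold lap
  refine tendsto_integral_filter_of_dominated_convergence _ ?_ ?_ hint ?_
  · refine Eventually.of_forall fun δ => Measurable.aestronglyMeasurable ?_
    have := hg.measurable
    fun_prop
  · filter_upwards [self_mem_nhdsWithin] with δ hδ
    replace hδ : 0 < δ := hδ
    filter_upwards [ae_restrict_mem measurableSet_Ioi] with l hl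
    replace hl : 0 < l := hl
    rw [norm_mul, norm_mul, Complex.norm_real, Real.norm_of_nonneg (Real.rpow_nonneg hl.le _),
      ← Complex.ofReal_mul, ← Complex.ofReal_neg, Complex.norm_exp_ofReal]
    have h1 : Real.exp (-(δ * l)) ≤ 1 := Real.exp_le_one_iff.2 (by nlinarith)
    have h2 : 0 ≤ l ^ a * ‖g l‖ := by positivity
    nlinarith
  · refine Eventually.of_forall fun l => ?_
    have h : Continuous fun δ : ℝ => ((l ^ a : ℝ) : ℂ) * g l * Complex.exp (-(δ * l)) := by fun_prop
    simpa using (h.tendsto 0).mono_left nhdsWithin_le_nhds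

variable {κ : ℝ} {ψ : ℝ → ℂ}

theorem add_I_cpow {δ : ℝ} (hδ : 0 < δ) (κ t : ℝ) :
    ((t : ℂ) + δ * Complex.I) ^ (-(κ : ℂ)) = Complex.exp (-(Complex.I * κ * (Real.pi / 2))) *
      ((δ : ℂ) + Complex.I * ((-t : ℝ) : ℂ)) ^ (-(κ : ℂ)) := by
  have h : ((t : ℂ) + δ * Complex.I) = Complex.I * ((δ : ℂ) + Complex.I * ((-t : ℝ) : ℂ)) := by
    push_cast
    linear_combination (t : ℂ) * Complex.I_mul_I
  rw [h, I_mul_cpow (by simpa using hδ)]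
  congr 2
  ring

theorem sub_I_cpow {δ : ℝ} (hδ : 0 < δ) (κ t : ℝ) :
    ((t : ℂ) - δ * Complex.I) ^ (-(κ : ℂ)) = Complex.exp (Complex.I * κ * (Real.pi / 2)) *
      ((δ : ℂ) + Complex.I * (t : ℂ)) ^ (-(κ : ℂ)) := by
  have h : ((t : ℂ) - δ * Complex.I) = -Complex.I * ((δ : ℂ) + Complex.I * (t : ℂ)) := by
    linear_combination (t : ℂ) * Complex.I_mul_I
  rw [h, neg_I_mul_cpow' (by simpa using hδ)]
  congr 2
  ring

theorem integrable_eta_cpow_mul (hκ : 0 < κ) {δ : ℝ} (hδ : 0 < δ) (hψ : Integrable ψ) {σ : ℝ} :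
    Integrable fun t : ℝ => ((δ : ℂ) + Complex.I * ((σ * t : ℝ) : ℂ)) ^ (-(κ : ℂ)) * ψ t := by
  refine hψ.bdd_mul (c := δ ^ (-κ)) ?_ (Eventually.of_forall fun t => ?_)
  · exact ((continuous_eta_cpow hδ _).comp (continuous_const_mul σ)).aestronglyMeasurable
  · rw [norm_eta_cpow]
    refine Real.rpow_le_rpow_of_nonpos hδ ?_ (by linarith)
    simpa [abs_of_pos hδ] using norm_eta_add_ge' δ (σ * t)

/-- The convolution formula for the Abel means at t = 0, with a = κ - 1. -/
theorem integral_eta_cpow_mul (hκ : 0 < κ) {δ : ℝ} (hδ : 0 < δ) (hψ : Integrable ψ) :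
    ∫ t : ℝ, ((δ : ℂ) + Complex.I * ((-t : ℝ) : ℂ)) ^ (-(κ : ℂ)) * ψ t
      = (Real.Gamma κ : ℂ)⁻¹ * lap (κ - 1) (ft ψ) δ := by
  have h := abelExt_eq (a := κ - 1) (by linarith) hδ hψ 0
  have hΓ : (Real.Gamma κ : ℂ) ≠ 0 := by exact_mod_cast (Real.Gamma_pos_of_pos hκ).ne'
  have hpi : (Real.pi : ℂ) ≠ 0 := by exact_mod_cast Real.pi_ne_zero
  rw [abelExt] at h
  simp only [halfKer, zero_sub, Complex.ofReal_sub, Complex.ofReal_one, sub_add_cancel,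
    Complex.ofReal_zero, mul_zero, add_zero, mul_assoc] at h
  rw [integral_const_mul] at h
  push_cast at h ⊢
  field_simp at h ⊢
  rw [h]

theorem ft_comp_neg (ψ : ℝ → ℂ) (l : ℝ) : ft (fun t => ψ (-t)) l = ft ψ (-l) := by
  unfold ft
  rw [← integral_neg_eq_self]
  simp

theorem integral_eta_cpow_mul' (hκ : 0 < κ) {δ : ℝ} (hδ : 0 < δ) (hψ : Integrable ψ) :
    ∫ t : ℝ, ((δ : ℂ) + Complex.I * (t : ℂ)) ^ (-(κ : ℂ)) * ψ t
      = (Real.Gamma κ : ℂ)⁻¹ * lap (κ - 1) (fun l => ft ψ (-l)) δ := by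
  have h := integral_eta_cpow_mul hκ hδ hψ.comp_neg
  rw [← integral_neg_eq_self] at h
  simp only [neg_neg] at h
  rw [h]
  congr 2
  funext l
  exact ft_comp_neg ψ l

/-- The two boundary values see opposite half-lines of frequencies: t - iδ = -i(δ + it) and t + iδ =
i(δ - it), and negative powers of δ ± it are Laplace integrals. -/
theorem boundaryApprox_eq (hκ : 0 < κ) {δ : ℝ} (hδ : 0 < δ) (hψ : Integrable ψ) (Cp Cm : ℂ) :
    boundaryApprox κ Cp Cm ψ δ
      = Cp * (Complex.exp (Complex.I * κ * (Real.pi / 2)) * ((Real.Gamma κ : ℂ)⁻¹ *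
          lap (κ - 1) (fun l => ft ψ (-l)) δ))
        + Cm * (Complex.exp (-(Complex.I * κ * (Real.pi / 2))) * ((Real.Gamma κ : ℂ)⁻¹ *
          lap (κ - 1) (ft ψ) δ)) := by
  rw [← integral_eta_cpow_mul hκ hδ hψ, ← integral_eta_cpow_mul' hκ hδ hψ, boundaryApprox,
    ← integral_const_mul, ← integral_const_mul, ← integral_const_mul, ← integral_const_mul,
    ← integral_add]
  · refine integral_congr_ae (Eventually.of_forall fun t => ?_)
    simp only
    rw [add_I_cpow hδ, sub_I_cpow hδ]
    ring
  · have := integrable_eta_cpow_mul hκ hδ hψ (σ := 1)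
    simp only [one_mul] at this
    exact (this.const_mul _).const_mul _
  · have := integrable_eta_cpow_mul hκ hδ hψ (σ := -1)
    simp only [neg_one_mul] at this
    exact (this.const_mul _).const_mul _

theorem boundaryApprox_average (hκ : 0 < κ) {δ : ℝ} (hδ : 0 < δ) {ψ' : ℝ → ℂ} (hψ : Integrable ψ)
    (hψ' : Integrable ψ') (Cp Cm : ℂ) :
    boundaryApprox κ Cp Cm (fun t => (ψ t + ψ' t) / 2) δ
      = (boundaryApprox κ Cp Cm ψ δ + boundaryApprox κ Cp Cm ψ' δ) / 2 := by
  have hi : ∀ {f : ℝ → ℂ}, Integrable f → Integrable fun t : ℝ =>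
      (Cp * ((t : ℂ) - δ * Complex.I) ^ (-(κ : ℂ)) + Cm * ((t : ℂ) + δ * Complex.I) ^ (-(κ : ℂ)))
        * f t := by
    intro f hf
    have h1 := ((integrable_eta_cpow_mul hκ hδ hf (σ := 1)).const_mul
      (Complex.exp (Complex.I * κ * (Real.pi / 2)))).const_mul Cp
    have h2 := ((integrable_eta_cpow_mul hκ hδ hf (σ := -1)).const_mul
      (Complex.exp (-(Complex.I * κ * (Real.pi / 2))))).const_mul Cm
    refine (h1.add h2).congr (Eventually.of_forall fun t => ?_)
    simp only [Pi.add_apply, one_mul, neg_one_mul]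
    rw [add_I_cpow hδ, sub_I_cpow hδ]
    ring
  unfold boundaryApprox
  rw [← integral_add (hi hψ) (hi hψ'), ← integral_div]
  refine integral_congr_ae (Eventually.of_forall fun t => ?_)
  simp only
  ring

theorem tendsto_boundaryApprox (hκ : 0 < κ) (hψ : Integrable ψ)
    (hp : IntegrableOn (fun l : ℝ => l ^ (κ - 1) * ‖ft ψ (-l)‖) (Set.Ioi 0))
    (hm : IntegrableOn (fun l : ℝ => l ^ (κ - 1) * ‖ft ψ l‖) (Set.Ioi 0)) (Cp Cm : ℂ) :
    Tendsto (boundaryApprox κ Cp Cm ψ) (𝓝[>] 0)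
      (𝓝 (Cp * (Complex.exp (Complex.I * κ * (Real.pi / 2)) * ((Real.Gamma κ : ℂ)⁻¹ *
          ∫ l in Set.Ioi (0 : ℝ), ((l ^ (κ - 1) : ℝ) : ℂ) * ft ψ (-l)))
        + Cm * (Complex.exp (-(Complex.I * κ * (Real.pi / 2))) * ((Real.Gamma κ : ℂ)⁻¹ *
          ∫ l in Set.Ioi (0 : ℝ), ((l ^ (κ - 1) : ℝ) : ℂ) * ft ψ l)))) := by
  have h1 := tendsto_lap_zero ((continuous_ft hψ).comp continuous_neg) hp
  have h2 := tendsto_lap_zero (continuous_ft hψ) hm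
  refine Tendsto.congr' ?_ ((((h1.const_mul _).const_mul _).const_mul Cp).add
    (((h2.const_mul _).const_mul _).const_mul Cm))
  filter_upwards [self_mem_nhdsWithin] with δ hδ
  exact (boundaryApprox_eq hκ hδ hψ Cp Cm).symm

theorem ft_shiftTest (φ : ℝ → ℝ) (h l : ℝ) :
    ft (shiftTest φ h) (-l) = ft (fun y => (φ y : ℂ)) l * Complex.exp (-(Complex.I * l * h)) := by
  unfold ft shiftTest
  rw [← integral_mul_const, ← integral_sub_left_eq_self (fun t => ((φ (h - t) : ℝ) : ℂ) *
    Complex.exp (Complex.I * ((-l : ℝ) : ℂ) * t)) volume h]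
  refine integral_congr_ae (Eventually.of_forall fun y => ?_)
  simp only [sub_sub_cancel]
  rw [mul_assoc _ (Complex.exp _) (Complex.exp _), ← Complex.exp_add]
  congr 2
  push_cast
  ring

theorem ft_shiftTest' (φ : ℝ → ℝ) (h l : ℝ) :
    ft (shiftTest φ h) l
      = (starRingEnd ℂ) (ft (fun y => (φ y : ℂ)) l * Complex.exp (-(Complex.I * l * h))) := by
  rw [← ft_shiftTest]
  unfold ft shiftTest
  rw [← integral_conj]
  refine integral_congr_ae (Eventually.of_forall fun y => ?_)
  simp [← Complex.exp_conj]

/-- Both frequency integrals converge absolutely because κ - 1 < m, and they are conjugate to each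
other because φ is real. -/
theorem IsTestKernel.tendsto_boundaryApprox {m : ℕ} {φ : ℝ → ℝ} (hφ : IsTestKernel m φ)
    (hκ : 0 < κ) (hκm : κ - 1 < m) (h : ℝ) (Cp Cm : ℂ) :
    Tendsto (boundaryApprox κ Cp Cm (shiftTest φ h)) (𝓝[>] 0)
      (𝓝 (Cp * (Complex.exp (Complex.I * κ * (Real.pi / 2)) * ((Real.Gamma κ : ℂ)⁻¹ *
          halfWave (κ - 1) (fun y => (φ y : ℂ)) h))
        + Cm * (Complex.exp (-(Complex.I * κ * (Real.pi / 2))) * ((Real.Gamma κ : ℂ)⁻¹ *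
          (starRingEnd ℂ) (halfWave (κ - 1) (fun y => (φ y : ℂ)) h))))) := by
  have hψ : Integrable (shiftTest φ h) := hφ.integrable.comp_sub_left h
  have hint := hφ.integrable_rpow_mul_ft (a := κ - 1) (by linarith) hκm
  have h1 : ∀ l : ℝ, ‖ft (shiftTest φ h) (-l)‖ = ‖ft (fun y => (φ y : ℂ)) l‖ := by
    intro l
    rw [ft_shiftTest, norm_mul, norm_cexp_neg_I, mul_one]
  have h2 : ∀ l : ℝ, ‖ft (shiftTest φ h) l‖ = ‖ft (fun y => (φ y : ℂ)) l‖ := by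
    intro l
    rw [ft_shiftTest', RCLike.norm_conj, norm_mul, norm_cexp_neg_I, mul_one]
  convert DTB.tendsto_boundaryApprox hκ hψ (by simpa only [h1] using hint)
    (by simpa only [h2] using hint) Cp Cm using 6
  · simp only [halfWave, ft_shiftTest, mul_assoc]
  · rw [halfWave, ← integral_conj]
    simp only [ft_shiftTest', map_mul, Complex.conj_ofReal, mul_assoc]

theorem integrableOn_rpow_mul_ft_schwartz (hκ : 0 < κ) (ψ : 𝓢(ℝ, ℂ)) {σ : ℝ} (hσ : |σ| = 1) :
    IntegrableOn (fun l : ℝ => l ^ (κ - 1) * ‖ft ψ (σ * l)‖) (Set.Ioi 0) := by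
  -- Any k > κ makes l^(κ-1-k) integrable at infinity; near l = 0 it is κ > 0 that gives
  -- integrability.
  set k : ℕ := ⌈κ⌉₊ + 1 with hk
  obtain ⟨C, hC, hdec⟩ := (𝓕 ψ).decay k 0
  have hft : ∀ l : ℝ, ft ψ l = 𝓕 ψ (-(l / (2 * Real.pi))) := by
    intro l
    rw [SchwartzMap.fourier_coe, Real.fourier_real_eq_integral_exp_smul]
    unfold ft
    refine integral_congr_ae (Eventually.of_forall fun y => ?_)
    simp only [smul_eq_mul]
    rw [mul_comm]
    congr 2
    have : (Real.pi : ℂ) ≠ 0 := by exact_mod_cast Real.pi_ne_zero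
    push_cast
    field_simp
  have hmeas : ∀ s : Set ℝ, AEStronglyMeasurable (fun l : ℝ => l ^ (κ - 1) * ‖ft ψ (σ * l)‖)
      (volume.restrict s) := by
    intro s
    have := (continuous_ft ψ.integrable).measurable
    exact Measurable.aestronglyMeasurable (by fun_prop)
  have hbig : ∀ l : ℝ, 0 < l → l ^ k * ‖ft ψ (σ * l)‖ ≤ C * (2 * Real.pi) ^ k := by
    intro l hl
    have h := hdec (-(σ * l / (2 * Real.pi)))
    rw [norm_iteratedFDeriv_zero, ← hft, norm_neg, norm_div, Real.norm_eq_abs, abs_mul, hσ, one_mul,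
      abs_of_pos hl, Real.norm_of_nonneg Real.two_pi_pos.le, div_pow, div_mul_eq_mul_div,
      div_le_iff₀ (by positivity)] at h
    exact h
  rw [← Set.Ioc_union_Ioi_eq_Ioi (zero_le_one (α := ℝ))]
  refine IntegrableOn.union ?_ ?_
  · have h1 : IntegrableOn (fun l : ℝ => l ^ (κ - 1) * ∫ y, ‖ψ y‖) (Set.Ioc 0 1) := by
      refine Integrable.mul_const ?_ _
      exact ((intervalIntegral.intervalIntegrable_rpow' (by linarith)).1)
    refine Integrable.mono' h1 (hmeas _) ?_
    filter_upwards [ae_restrict_mem measurableSet_Ioc] with l hl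
    have h0 : 0 ≤ l ^ (κ - 1) := Real.rpow_nonneg hl.1.le _
    rw [Real.norm_of_nonneg (by positivity)]
    exact mul_le_mul_of_nonneg_left (norm_ft_le _ _) h0
  · have h1 : IntegrableOn (fun l : ℝ => C * (2 * Real.pi) ^ k * l ^ (κ - 1 - k)) (Set.Ioi 1) := by
      refine Integrable.const_mul (integrableOn_Ioi_rpow_of_lt ?_ one_pos) _
      have := Nat.le_ceil κ
      rw [hk]
      push_cast
      linarith
    refine Integrable.mono' h1 (hmeas _) ?_
    filter_upwards [ae_restrict_mem measurableSet_Ioi] with l hl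
    have hl0 : 0 < l := zero_lt_one.trans hl
    have h0 : 0 ≤ l ^ (κ - 1 - k) := Real.rpow_nonneg hl0.le _
    have h2 : l ^ (κ - 1) = l ^ (κ - 1 - k) * l ^ k := by
      rw [← Real.rpow_natCast, ← Real.rpow_add hl0, sub_add_cancel]
    rw [Real.norm_of_nonneg (mul_nonneg (Real.rpow_nonneg hl0.le _) (norm_nonneg _)), h2, mul_assoc,
      mul_comm (C * _)]
    exact mul_le_mul_of_nonneg_left (hbig l hl0) h0

theorem invFourierPairing_eq (hψ : Integrable ψ)
    (hp : IntegrableOn (fun l : ℝ => l ^ (κ - 1) * ‖ft ψ (-l)‖) (Set.Ioi 0))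
    (hm : IntegrableOn (fun l : ℝ => l ^ (κ - 1) * ‖ft ψ l‖) (Set.Ioi 0)) (mp mm : ℂ) :
    invFourierPairing κ mp mm ψ = 1 / (2 * Real.pi) *
      (mp * (∫ l in Set.Ioi (0 : ℝ), ((l ^ (κ - 1) : ℝ) : ℂ) * ft ψ (-l))
        + mm * ∫ l in Set.Ioi (0 : ℝ), ((l ^ (κ - 1) : ℝ) : ℂ) * ft ψ l) := by
  have hc := continuous_ft hψ
  have hft : ∀ l : ℝ, (∫ t : ℝ, ψ t * Complex.exp (-(Complex.I * l * t))) = ft ψ (-l) := by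
    intro l
    simp [ft]
  have hint : ∀ σ : ℝ, IntegrableOn (fun l : ℝ => l ^ (κ - 1) * ‖ft ψ (σ * l)‖) (Set.Ioi 0) →
      IntegrableOn (fun l : ℝ => ((l ^ (κ - 1) : ℝ) : ℂ) * ft ψ (σ * l)) (Set.Ioi 0) := by
    intro σ h
    refine Integrable.mono' h (Measurable.aestronglyMeasurable ?_) ?_
    · have := hc.measurable
      fun_prop
    · filter_upwards [ae_restrict_mem measurableSet_Ioi] with l hl
      rw [norm_mul, Complex.norm_real, Real.norm_of_nonneg (Real.rpow_nonneg (le_of_lt hl) _)]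
  have hp' := hint (-1) (by simpa using hp)
  have hm' := hint 1 (by simpa using hm)
  simp only [neg_one_mul, one_mul] at hp' hm'
  rw [invFourierPairing]
  congr 1
  simp only [hft]
  set f : ℝ → ℂ := fun l => (mp * (posPow l (κ - 1) : ℂ) + mm * (negPow l (κ - 1) : ℂ)) * ft ψ (-l)
    with hf
  have hf1 : ∀ l ∈ Set.Ioi (0 : ℝ), f l = mp * (((l ^ (κ - 1) : ℝ) : ℂ) * ft ψ (-l)) := by
    intro l hl
    have hl' : ¬ (0 < -l) := by simpa using le_of_lt hl
    simp only [hf, posPow, negPow, if_pos (show 0 < l from hl), if_neg hl']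
    push_cast
    ring
  have hf2 : ∀ l ∈ Set.Ioi (0 : ℝ), f (-l) = mm * (((l ^ (κ - 1) : ℝ) : ℂ) * ft ψ l) := by
    intro l hl
    have hl' : ¬ (0 < -l) := by simpa using le_of_lt hl
    simp only [hf, posPow, negPow, neg_neg, if_pos (show 0 < l from hl), if_neg hl']
    push_cast
    ring
  have hi1 : IntegrableOn f (Set.Ioi 0) :=
    IntegrableOn.congr_fun (f := fun l => mp * (((l ^ (κ - 1) : ℝ) : ℂ) * ft ψ (-l)))
      (hp'.const_mul mp) (fun l hl => (hf1 l hl).symm) measurableSet_Ioi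
  have hi2 : IntegrableOn f (Set.Iic 0) := by
    have h1 : IntegrableOn (fun l => f (-l)) (Set.Ioi 0) :=
      IntegrableOn.congr_fun (f := fun l => mm * (((l ^ (κ - 1) : ℝ) : ℂ) * ft ψ l))
        (hm'.const_mul mm) (fun l hl => (hf2 l hl).symm) measurableSet_Ioi
    rw [← integrableOn_Ici_iff_integrableOn_Ioi] at h1
    have h2 := h1.comp_neg
    simpa using h2
  rw [← intervalIntegral.integral_Iic_add_Ioi hi2 hi1, setIntegral_congr_fun measurableSet_Ioi hf1,
    integral_const_mul, add_comm]
  congr 1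
  have h3 := integral_comp_neg_Ioi (0 : ℝ) f
  rw [neg_zero] at h3
  rw [← h3, setIntegral_congr_fun measurableSet_Ioi hf2, integral_const_mul]

end Boundary

end
end DTB

namespace DTB
noncomputable section

/-! ### The signature of the Hessian and the antipodal map. -/

section Signature

variable {n : ℕ}

/-- The matrix of a bilinear form on a subspace, in an orthonormal basis. -/
def formMatrix (B : Vec n →L[ℝ] Vec n →L[ℝ] ℝ) (V : Submodule ℝ (Vec n)) :
    Matrix (Fin (finrank ℝ V)) (Fin (finrank ℝ V)) ℝ :=
  Matrix.of fun j k => B (stdOrthonormalBasis ℝ V j : Vec n) (stdOrthonormalBasis ℝ V k : Vec n)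

/-- The number of positive minus the number of negative eigenvalues. -/
def matSignature {m : ℕ} (A : Matrix (Fin m) (Fin m) ℝ) : ℤ :=
  (A.charpoly.roots.map fun x => (SignType.sign x : ℤ)).sum

theorem hessMatrix_eq_formMatrix (H : Vec n → ℝ) (α : Vec n) :
    hessMatrix H α = formMatrix (fderiv ℝ (fderiv ℝ H) α) (ℝ ∙ α)ᗮ := rfl

theorem formMatrix_neg (B : Vec n →L[ℝ] Vec n →L[ℝ] ℝ) (V : Submodule ℝ (Vec n)) :
    formMatrix (-B) V = -formMatrix B V := by
  ext j k
  simp [formMatrix]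

theorem matSignature_of_posDef {m : ℕ} {A : Matrix (Fin m) (Fin m) ℝ} (hA : A.PosDef) :
    matSignature A = m := by
  rw [matSignature, hA.isHermitian.roots_charpoly_eq_eigenvalues, Multiset.map_map]
  rw [Multiset.map_congr rfl (g := fun _ => (1 : ℤ))]
  · simp
  · intro i _
    have := hA.eigenvalues_pos i
    simp [sign_pos this]

theorem matSignature_of_neg_posDef {m : ℕ} {A : Matrix (Fin m) (Fin m) ℝ} (hA : (-A).PosDef) :
    matSignature A = -m := by
  have hH : A.IsHermitian := by simpa using hA.isHermitian.neg
  rw [matSignature, hH.roots_charpoly_eq_eigenvalues, Multiset.map_map]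
  rw [Multiset.map_congr rfl (g := fun _ => (-1 : ℤ))]
  · simp
  · intro i _
    have hv : (hH.eigenvectorBasis i : Fin m → ℝ) ≠ 0 := by
      intro h
      apply hH.eigenvectorBasis.toBasis.ne_zero i
      ext j
      simpa using congrFun h j
    have h1 := hA.dotProduct_mulVec_pos hv
    have h2 := hH.eigenvalues_eq i
    rw [Matrix.neg_mulVec, dotProduct_neg] at h1
    have : hH.eigenvalues i < 0 := by
      rw [h2]
      simpa using h1
    simp [sign_neg this]

theorem fderiv_comp_neg {F : Type*} [NormedAddCommGroup F] [NormedSpace ℝ F] (f : Vec n → F)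
    (x : Vec n) : fderiv ℝ (fun y => f (-y)) x = -fderiv ℝ f (-x) := by
  have h := (LinearIsometryEquiv.neg ℝ (E := Vec n)).toContinuousLinearEquiv.comp_right_fderiv
    (f := f) (x := x)
  refine h.trans ?_
  ext v
  simp

/-- An odd function has an even first derivative, hence an odd second one; oddness near the point
suffices. -/
theorem fderiv_fderiv_neg {H : Vec n → ℝ} {Θ : Vec n}
    (hodd : ∀ᶠ ξ in 𝓝 Θ, H (-ξ) = -H ξ) :
    fderiv ℝ (fderiv ℝ H) (-Θ) = -fderiv ℝ (fderiv ℝ H) Θ := by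
  have h0 : ∀ᶠ ξ in 𝓝 (-Θ), H ξ = -H (-ξ) := by
    have : Tendsto (fun ξ : Vec n => -ξ) (𝓝 (-Θ)) (𝓝 Θ) := 
      (continuous_neg (G := Vec n)).tendsto' _ _ (neg_neg Θ)
    filter_upwards [this.eventually hodd] with ξ hξ
    simpa using hξ
  have h1 : ∀ᶠ ξ in 𝓝 (-Θ), fderiv ℝ H ξ = fderiv ℝ H (-ξ) := by
    filter_upwards [h0.eventually_nhds] with ξ hξ
    rw [Filter.EventuallyEq.fderiv_eq hξ, fderiv_fun_neg, fderiv_comp_neg, neg_neg]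
  rw [Filter.EventuallyEq.fderiv_eq h1, fderiv_comp_neg, neg_neg]

/-- Homogeneity spreads the oddness from Ω to the open cone over Ω, so that it can be differentiated
in all directions of the space. -/
theorem eventually_odd {H : Vec n → ℝ}
    (hh : ∀ ξ : Vec n, ξ ≠ 0 → ∀ l : ℝ, 0 < l → H (l • ξ) = l * H ξ)
    {Ω : Set (Sph n)} (hΩ : IsOpen Ω) {Θ : Sph n} (hΘ : Θ ∈ Ω)
    (hodd : ∀ α ∈ Ω, H (-(α : Vec n)) = -H α) : ∀ᶠ ξ in 𝓝 (Θ : Vec n), H (-ξ) = -H ξ := by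
  have hne : (Θ : Vec n) ≠ 0 := ne_zero_of_mem_unit_sphere Θ
  obtain ⟨O, hO, rfl⟩ := isOpen_induced_iff.1 hΩ
  have hc : ContinuousAt (fun ξ : Vec n => ‖ξ‖⁻¹ • ξ) (Θ : Vec n) :=
    (continuousAt_id.norm.inv₀ (by simp)).smul continuousAt_id
  have hev : ∀ᶠ ξ in 𝓝 (Θ : Vec n), ‖ξ‖⁻¹ • ξ ∈ O := by
    refine hc.eventually (hO.mem_nhds ?_)
    have : ‖(Θ : Vec n)‖ = 1 := norm_eq_of_mem_sphere Θ
    simpa [this] using hΘ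
  filter_upwards [hev, isOpen_ne.mem_nhds hne] with ξ hξ hξ0
  replace hξ0 : ξ ≠ 0 := hξ0
  have hn : 0 < ‖ξ‖ := norm_pos_iff.2 hξ0
  have hu : ‖ξ‖⁻¹ • ξ ∈ Metric.sphere (0 : Vec n) 1 := by
    simp [norm_smul, hn.ne']
  have h1 := hodd ⟨_, hu⟩ hξ
  simp only at h1
  have h2 := hh (‖ξ‖⁻¹ • ξ) (by simp [hξ0]) ‖ξ‖ hn
  have h3 := hh (-(‖ξ‖⁻¹ • ξ)) (by simp [hξ0]) ‖ξ‖ hn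
  rw [smul_neg] at h3
  rw [smul_smul, mul_inv_cancel₀ hn.ne', one_smul] at h2 h3
  rw [h3, h2, h1]
  ring

end Signature

/-! ### Coefficients of the limit for Radon transform data. -/

section Radon

variable {d : ℕ} {H : Vec (d + 1) → ℝ} {Θ : Sph (d + 1)}

theorem finrank_orthogonal_span (Θ : Sph (d + 1)) : finrank ℝ (ℝ ∙ (Θ : Vec (d + 1)))ᗮ = d :=
  Submodule.finrank_orthogonal_span_singleton (ne_zero_of_mem_unit_sphere Θ)

theorem det_hessMatrix_ne_zero (hneg : HessNegDef H (Θ : Vec (d + 1))) :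
    (hessMatrix H (Θ : Vec (d + 1))).det ≠ 0 := by
  have := hneg.det_pos
  intro h
  rw [Matrix.det_neg, h, mul_zero] at this
  exact lt_irrefl _ this

theorem omega_of_hessNegDef (hneg : HessNegDef H (Θ : Vec (d + 1))) :
    omega H (Θ : Vec (d + 1))
      = ((√|(hessMatrix H (Θ : Vec (d + 1))).det| / (2 * Real.pi) ^ ((d : ℝ) / 2) : ℝ) : ℂ)
        * Complex.exp (Complex.I * (Real.pi / 4) * d) := by
  have h1 : hessSignature H (Θ : Vec (d + 1)) = -(d : ℤ) := by
    refine (matSignature_of_neg_posDef hneg).trans ?_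
    rw [finrank_orthogonal_span]
  rw [omega, h1]
  push_cast
  rw [add_sub_cancel_right]
  congr 2
  ring

/-- At -Θ the Hessian is the negative of the one at Θ, on the same tangent plane. The signature is d
instead of -d and the phase of ω is conjugated. -/
theorem omega_neg_of_hessNegDef (hodd : ∀ᶠ ξ in 𝓝 (Θ : Vec (d + 1)), H (-ξ) = -H ξ)
    (hneg : HessNegDef H (Θ : Vec (d + 1))) :
    omega H (-(Θ : Vec (d + 1)))
      = ((√|(hessMatrix H (Θ : Vec (d + 1))).det| / (2 * Real.pi) ^ ((d : ℝ) / 2) : ℝ) : ℂ)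
        * Complex.exp (-(Complex.I * (Real.pi / 4) * d)) := by
  have hV : (ℝ ∙ (-(Θ : Vec (d + 1))))ᗮ = (ℝ ∙ (Θ : Vec (d + 1)))ᗮ := by
    rw [← Set.neg_singleton, Submodule.span_neg]
  -- The index types of the two matrices depend on the subspace and are equal only propositionally;
  -- testing with an arbitrary function `F` of the matrix avoids a transport.
  have hM : ∀ F : (∀ m, Matrix (Fin m) (Fin m) ℝ → ℝ), F _ (hessMatrix H (-(Θ : Vec (d + 1))))
      = F _ (-hessMatrix H (Θ : Vec (d + 1))) := by
    intro F
    rw [hessMatrix_eq_formMatrix, hessMatrix_eq_formMatrix, fderiv_fderiv_neg hodd, hV,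
      formMatrix_neg]
  have h1 : (hessSignature H (-(Θ : Vec (d + 1))) : ℝ) = d := by
    refine (hM fun m A => (matSignature A : ℝ)).trans ?_
    rw [matSignature_of_posDef hneg, finrank_orthogonal_span]
    simp
  have h2 : |(hessMatrix H (-(Θ : Vec (d + 1)))).det| = |(hessMatrix H (Θ : Vec (d + 1))).det| := by
    refine (hM fun m A => |A.det|).trans ?_
    simp [Matrix.det_neg, abs_mul]
  have h3 : (hessSignature H (-(Θ : Vec (d + 1))) : ℂ) = d := by exact_mod_cast h1
  rw [omega, h2, h3]
  push_cast
  rw [add_sub_cancel_right]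

variable {v₀ a₀ : Sph (d + 1) → ℂ} {s : ℝ}

/-- Since p^(s-1) sgn p has parity (-1)^s, the two coefficients of the data differ by this sign; the
two terms of c⁽¹⁾ then agree and cancel the factor 2 i^s. The symmetry of v₀ serves to express the
coefficient with the minus sign through the value at -Θ. -/
theorem cOne_radon_of_int (hs1 : 1 ≤ s) (hs : s = ⌊s⌋₊) (b : ℂ)
    (hodd : ∀ᶠ ξ in 𝓝 (Θ : Vec (d + 1)), H (-ξ) = -H ξ)
    (hneg : HessNegDef H (Θ : Vec (d + 1)))
    (hv : v₀ (-Θ)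
        = Complex.exp (-(Complex.I * ((kappa₁ (d + 1) s + 1 : ℝ) : ℂ) * Real.pi)) * v₀ Θ)
    (hp : a₀ Θ = radonLead H v₀ s Θ 1) (hm : a₀ (-Θ) = radonLead H v₀ s Θ (-1)) :
    cOne s 1 b (a₀ Θ) (a₀ (-Θ)) = b * (omega H (Θ : Vec (d + 1)) * v₀ Θ) ∧
    cOne s (-1) b (a₀ Θ) (a₀ (-Θ)) = b * (omega H (-(Θ : Vec (d + 1))) * v₀ (-Θ)) := by
  obtain ⟨k, hk⟩ : ∃ k : ℕ, ⌊s⌋₊ = k + 1 :=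
    Nat.exists_eq_succ_of_ne_zero (Nat.floor_pos.2 hs1).ne'
  have hsk : s = ((k + 1 : ℕ) : ℝ) := by rw [← hk]; exact hs
  have hΓ : Real.Gamma s = k.factorial := by
    rw [hsk]; push_cast; exact Real.Gamma_nat_eq_factorial k
  have hfac : (k.factorial : ℂ) ≠ 0 := by exact_mod_cast k.factorial_ne_zero
  have he1 : Complex.exp (Complex.I * (Real.pi / 2) * s) = Complex.I ^ (k + 1) := by
    rw [hsk, show Complex.I * (Real.pi / 2) * (((k + 1 : ℕ) : ℝ) : ℂ)
      = ((k + 1 : ℕ) : ℂ) * (Real.pi / 2 * Complex.I) by push_cast; ring, Complex.exp_nat_mul,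
      Complex.exp_pi_div_two_mul_I]
  have he2 : Complex.exp (-(Complex.I * (Real.pi / 2) * s)) = (-Complex.I) ^ (k + 1) := by
    rw [hsk, show -(Complex.I * (Real.pi / 2) * (((k + 1 : ℕ) : ℝ) : ℂ))
      = ((k + 1 : ℕ) : ℂ) * (-(Real.pi / 2 * Complex.I)) by push_cast; ring, Complex.exp_nat_mul,
      Complex.exp_neg, Complex.exp_pi_div_two_mul_I, Complex.inv_I]
  have hI : Complex.I ^ (k + 1) ≠ 0 := pow_ne_zero _ Complex.I_ne_zero
  have hnegI : (-Complex.I) ^ (k + 1) = (-1) ^ (k + 1) * Complex.I ^ (k + 1) := by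
    rw [← mul_pow, neg_one_mul]
  have hsq : ((-1 : ℂ) ^ (k + 1)) * (-1) ^ (k + 1) = 1 := by
    rw [← mul_pow]; simp
  have hap : a₀ Θ = omega H (Θ : Vec (d + 1)) * v₀ Θ / (2 * Complex.I ^ (k + 1) * k.factorial) := by
    rw [hp, radonLead, if_pos hs, hk]
    simp
  have ham : a₀ (-Θ) = (-1) ^ (k + 1) * a₀ Θ := by
    rw [hm, radonLead, if_pos hs, hk, hap]
    simp [pow_succ]
    ring
  have hω : omega H (-(Θ : Vec (d + 1))) * v₀ (-Θ)
      = (-1) ^ (k + 1) * (omega H (Θ : Vec (d + 1)) * v₀ Θ) := by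
    rw [omega_of_hessNegDef hneg, omega_neg_of_hessNegDef hodd hneg, hv]
    have h1 : Complex.exp (-(Complex.I * (Real.pi / 4) * d))
        * Complex.exp (-(Complex.I * ((kappa₁ (d + 1) s + 1 : ℝ) : ℂ) * Real.pi))
        = (-1) ^ (k + 1) * Complex.exp (Complex.I * (Real.pi / 4) * d) := by
      have h2 : (-1 : ℂ) ^ (k + 1) = Complex.exp (((k + 1 : ℕ) : ℂ) * (-(Real.pi * Complex.I))) := by
        rw [Complex.exp_nat_mul, Complex.exp_neg, Complex.exp_pi_mul_I]
        norm_num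
      rw [h2, ← Complex.exp_add, ← Complex.exp_add, kappa₁, hsk]
      congr 1
      push_cast
      ring
    linear_combination ((√|(hessMatrix H (Θ : Vec (d + 1))).det|
      / (2 * Real.pi) ^ ((d : ℝ) / 2) : ℝ) : ℂ) * v₀ Θ * h1
  constructor
  · rw [cOne, hΓ, ham]
    simp only [Complex.ofReal_one, mul_one, he1, he2, hnegI]
    rw [hap]
    push_cast
    field_simp
    linear_combination b * omega H (Θ : Vec (d + 1)) * v₀ Θ * hsq
  · rw [cOne, hΓ, ham, hω]
    have h3 : -(Complex.I * ((-1 : ℝ) : ℂ) * (Real.pi / 2) * s) = Complex.I * (Real.pi / 2) * s := by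
      push_cast; ring
    have h4 : (Complex.I * ((-1 : ℝ) : ℂ) * (Real.pi / 2) * s) = -(Complex.I * (Real.pi / 2) * s) := by
      push_cast; ring
    rw [h3, h4, he1, he2, hnegI, hap]
    push_cast
    field_simp
    ring

/-- With E = e^(iπs/2), both coefficients are combinations of the values at Θ and -Θ with factors E
and E⁻¹. In c⁽¹⁾ the terms with the opposite value cancel, and E⁻² - E² = -2i sin(πs) divides out.
-/
theorem cOne_radon_of_not_int (hs1 : 1 ≤ s) (hs : ¬ s = ⌊s⌋₊) (b : ℂ)
    (hp : a₀ Θ = radonLead H v₀ s Θ 1) (hm : a₀ (-Θ) = radonLead H v₀ s Θ (-1)) :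
    cOne s 1 b (a₀ Θ) (a₀ (-Θ)) = b * (omega H (Θ : Vec (d + 1)) * v₀ Θ) ∧
    cOne s (-1) b (a₀ Θ) (a₀ (-Θ)) = b * (omega H (-(Θ : Vec (d + 1))) * v₀ (-Θ)) := by
  have hΓ : (Real.Gamma s : ℂ) ≠ 0 := by
    exact_mod_cast (Real.Gamma_pos_of_pos (by linarith)).ne'
  have hsin : Real.sin (Real.pi * s) ≠ 0 := by
    intro h
    obtain ⟨k, hk⟩ := Real.sin_eq_zero_iff.1 h
    have hks : (k : ℝ) = s := by
      have := Real.pi_ne_zero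
      field_simp at hk
      linarith
    apply hs
    have hk0 : 0 ≤ k := by
      have : (0 : ℝ) ≤ k := by linarith
      exact_mod_cast this
    lift k to ℕ using hk0
    rw [← hks]
    simp
  have hsin' : (Complex.sin (Real.pi * s) : ℂ) ≠ 0 := by exact_mod_cast hsin
  have hap : a₀ Θ = radonCoef H v₀ s 1 Θ := by
    rw [hp, radonLead, if_neg hs]
    simp [posPow, negPow]
  have ham : a₀ (-Θ) = radonCoef H v₀ s (-1) Θ := by
    rw [hm, radonLead, if_neg hs]
    simp [posPow, negPow]
  set E : ℂ := Complex.exp (Complex.I * (Real.pi / 2) * s) with hE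
  have hE0 : E ≠ 0 := Complex.exp_ne_zero _
  have hEm : Complex.exp (-(Complex.I * (Real.pi / 2) * s)) = E⁻¹ := by rw [hE, Complex.exp_neg]
  have hF : Complex.exp (Complex.I * ((s - 1 : ℝ) : ℂ) * (Real.pi / 2)) = -Complex.I * E := by
    rw [hE, show Complex.I * ((s - 1 : ℝ) : ℂ) * (Real.pi / 2)
      = -(Real.pi / 2 * Complex.I) + Complex.I * (Real.pi / 2) * s by push_cast; ring,
      Complex.exp_add, Complex.exp_neg, Complex.exp_pi_div_two_mul_I, Complex.inv_I]
  have hFm : Complex.exp (-(Complex.I * ((s - 1 : ℝ) : ℂ) * (Real.pi / 2))) = Complex.I * E⁻¹ := by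
    rw [Complex.exp_neg, hF, mul_inv, inv_neg, Complex.inv_I, neg_neg]
  have hS : Complex.sin (Real.pi * s) = (E⁻¹ ^ 2 - E ^ 2) * Complex.I / 2 := by
    rw [Complex.sin, ← hEm, hE, ← Complex.exp_nat_mul, ← Complex.exp_nat_mul]
    congr 4 <;> · push_cast; ring
  have hS0 : E⁻¹ ^ 2 - E ^ 2 ≠ 0 := by
    intro h
    rw [hS, h] at hsin'
    simp at hsin'
  have hS1 : 1 - E ^ 4 ≠ 0 := by
    intro h
    apply hS0
    field_simp
    linear_combination h
  have hc : (((1 / (2 * Real.sin (Real.pi * s) * Real.Gamma s) : ℝ)) : ℂ)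
      = (Real.Gamma s : ℂ)⁻¹ * ((E⁻¹ ^ 2 - E ^ 2) * Complex.I)⁻¹ := by
    push_cast
    rw [hS]
    field_simp
  have e3 : Complex.I * ((1 : ℝ) : ℂ) * (Real.pi / 2) * s = Complex.I * (Real.pi / 2) * s := by
    push_cast; ring
  have e4 : Complex.I * ((-1 : ℝ) : ℂ) * (Real.pi / 2) * s = -(Complex.I * (Real.pi / 2) * s) := by
    push_cast; ring
  have e5 : Complex.I * ((1 : ℝ) : ℂ) * ((s - 1 : ℝ) : ℂ) * (Real.pi / 2)
      = Complex.I * ((s - 1 : ℝ) : ℂ) * (Real.pi / 2) := by push_cast; ring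
  have e6 : Complex.I * ((-1 : ℝ) : ℂ) * ((s - 1 : ℝ) : ℂ) * (Real.pi / 2)
      = -(Complex.I * ((s - 1 : ℝ) : ℂ) * (Real.pi / 2)) := by push_cast; ring
  rw [hap, ham]
  constructor
  · rw [cOne, radonCoef, radonCoef, hc, e3, e5, e6, neg_neg, hF, hFm, hEm, ← hE]
    field_simp
    ring
  · rw [cOne, radonCoef, radonCoef, hc, e4, e5, e6, neg_neg, hF, hFm, hEm, neg_neg, ← hE]
    field_simp
    ring

/-- The two expressions for the data agree for all p; p = 1 and p = -1 isolate the two coefficients.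
-/
theorem cOne_radon (hs1 : 1 ≤ s) (b : ℂ)
    (hodd : ∀ᶠ ξ in 𝓝 (Θ : Vec (d + 1)), H (-ξ) = -H ξ)
    (hneg : HessNegDef H (Θ : Vec (d + 1)))
    (hv : s = ⌊s⌋₊ → v₀ (-Θ)
        = Complex.exp (-(Complex.I * ((kappa₁ (d + 1) s + 1 : ℝ) : ℂ) * Real.pi)) * v₀ Θ)
    (ha : ∀ p : ℝ, a₀ Θ * (posPow p (s - 1) : ℂ) + a₀ (-Θ) * (negPow p (s - 1) : ℂ)
      = radonLead H v₀ s Θ p) :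
    cOne s 1 b (a₀ Θ) (a₀ (-Θ)) = b * (omega H (Θ : Vec (d + 1)) * v₀ Θ) ∧
    cOne s (-1) b (a₀ Θ) (a₀ (-Θ)) = b * (omega H (-(Θ : Vec (d + 1))) * v₀ (-Θ)) := by
  have hp : a₀ Θ = radonLead H v₀ s Θ 1 := by simp [← ha, posPow, negPow]
  have hm : a₀ (-Θ) = radonLead H v₀ s Θ (-1) := by simp [← ha, posPow, negPow]
  by_cases hs : s = ⌊s⌋₊
  · exact cOne_radon_of_int hs1 hs b hodd hneg (hv hs) hp hm
  · exact cOne_radon_of_not_int hs1 hs b hp hm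

theorem muFactor_mul (hneg : HessNegDef H (Θ : Vec (d + 1))) (κ : ℝ) :
    muFactor H κ Θ * (√|(hessMatrix H (Θ : Vec (d + 1))).det| / (2 * Real.pi) ^ ((d : ℝ) / 2))
      = Real.Gamma κ / Real.pi := by
  have h1 : 0 < √|(hessMatrix H (Θ : Vec (d + 1))).det| :=
    Real.sqrt_pos.2 (abs_pos.2 (det_hessMatrix_ne_zero hneg))
  have h2 : 0 < (2 * Real.pi) ^ ((d : ℝ) / 2) := Real.rpow_pos_of_pos Real.two_pi_pos _
  rw [muFactor]
  push_cast
  rw [add_sub_cancel_right]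
  field_simp

variable {B₀ : Sph (d + 1) → ℂ} {β : ℝ}

/-- The modulus of ω cancels the determinant factor of μ, and its phase e^(iπd/4) cancels the phase
of c⁽²⁾. -/
theorem muPlus_radon (hneg : HessNegDef H (Θ : Vec (d + 1)))
    (h : cOne s 1 (B₀ Θ) (a₀ Θ) (a₀ (-Θ)) = B₀ Θ * (omega H (Θ : Vec (d + 1)) * v₀ Θ)) :
    muPlus H B₀ a₀ β s Θ = (Real.Gamma (kappa₂ (d + 1) β s) / (2 * Real.pi) : ℝ) *
      (Complex.exp (-(Complex.I * kappa₂ (d + 1) β s * (Real.pi / 2))) * muCoef B₀ v₀ Θ) := by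
  have h1 : ((Real.Gamma (kappa₂ (d + 1) β s) / (2 * Real.pi) : ℝ) : ℂ)
      = (muFactor H (kappa₂ (d + 1) β s) Θ : ℂ)
        * ((√|(hessMatrix H (Θ : Vec (d + 1))).det| / (2 * Real.pi) ^ ((d : ℝ) / 2) : ℝ) : ℂ) / 2 := by
    rw [← Complex.ofReal_mul, muFactor_mul hneg]
    push_cast
    ring
  have h2 : Complex.exp (-(Complex.I * ((1 : ℝ) : ℂ) * (((((d + 1 : ℕ) : ℝ) - 1) / 2 : ℝ) : ℂ)
      * (Real.pi / 2))) * Complex.exp (Complex.I * (Real.pi / 4) * d) = 1 := by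
    rw [← Complex.exp_add]
    convert Complex.exp_zero using 2
    push_cast
    ring
  rw [muPlus, cTwo, h, omega_of_hessNegDef hneg, muCoef]
  linear_combination (B₀ Θ * v₀ Θ
    * Complex.exp (-(Complex.I * kappa₂ (d + 1) β s * (Real.pi / 2)))) * (-2 * h1 +
      (muFactor H (kappa₂ (d + 1) β s) Θ : ℂ)
        * ((√|(hessMatrix H (Θ : Vec (d + 1))).det| / (2 * Real.pi) ^ ((d : ℝ) / 2) : ℝ) : ℂ) * h2)

theorem muMinus_radon (hneg : HessNegDef H (Θ : Vec (d + 1)))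
    (hodd : ∀ᶠ ξ in 𝓝 (Θ : Vec (d + 1)), H (-ξ) = -H ξ)
    (h : cOne s (-1) (B₀ (-Θ)) (a₀ Θ) (a₀ (-Θ))
      = B₀ (-Θ) * (omega H (-(Θ : Vec (d + 1))) * v₀ (-Θ))) :
    muMinus H B₀ a₀ β s Θ = (Real.Gamma (kappa₂ (d + 1) β s) / (2 * Real.pi) : ℝ) *
      (muCoef B₀ v₀ (-Θ) / Complex.exp (-(Complex.I * kappa₂ (d + 1) β s * (Real.pi / 2)))) := by
  have h1 : ((Real.Gamma (kappa₂ (d + 1) β s) / (2 * Real.pi) : ℝ) : ℂ)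
      = (muFactor H (kappa₂ (d + 1) β s) Θ : ℂ)
        * ((√|(hessMatrix H (Θ : Vec (d + 1))).det| / (2 * Real.pi) ^ ((d : ℝ) / 2) : ℝ) : ℂ) / 2 := by
    rw [← Complex.ofReal_mul, muFactor_mul hneg]
    push_cast
    ring
  have h2 : Complex.exp (-(Complex.I * ((-1 : ℝ) : ℂ) * (((((d + 1 : ℕ) : ℝ) - 1) / 2 : ℝ) : ℂ)
      * (Real.pi / 2))) * Complex.exp (-(Complex.I * (Real.pi / 4) * d)) = 1 := by
    rw [← Complex.exp_add]
    convert Complex.exp_zero using 2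
    push_cast
    ring
  rw [muMinus, cTwo, h, omega_neg_of_hessNegDef hodd hneg, muCoef,
    Complex.exp_neg (Complex.I * kappa₂ (d + 1) β s * _), div_inv_eq_mul]
  linear_combination (B₀ (-Θ) * v₀ (-Θ)
    * Complex.exp (Complex.I * kappa₂ (d + 1) β s * (Real.pi / 2))) * (-2 * h1 +
      (muFactor H (kappa₂ (d + 1) β s) Θ : ℂ)
        * ((√|(hessMatrix H (Θ : Vec (d + 1))).det| / (2 * Real.pi) ^ ((d : ℝ) / 2) : ℝ) : ℂ) * h2)

theorem tendsto_boundaryApprox_invFourierPairing {κ : ℝ} (hκ : 0 < κ) (mp mm : ℂ) (ψ : 𝓢(ℝ, ℂ)) :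
    Tendsto (boundaryApprox κ
      ((Real.Gamma κ / (2 * Real.pi) : ℝ) * (Complex.exp (-(Complex.I * κ * (Real.pi / 2))) * mp))
      ((Real.Gamma κ / (2 * Real.pi) : ℝ) * (mm / Complex.exp (-(Complex.I * κ * (Real.pi / 2))))) ψ)
      (𝓝[>] 0) (𝓝 (invFourierPairing κ mp mm ψ)) := by
  have hp := integrableOn_rpow_mul_ft_schwartz hκ ψ (σ := -1) (by simp)
  have hm := integrableOn_rpow_mul_ft_schwartz hκ ψ (σ := 1) (by simp)
  simp only [neg_one_mul, one_mul] at hp hm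
  rw [invFourierPairing_eq ψ.integrable hp hm]
  convert tendsto_boundaryApprox hκ ψ.integrable hp hm _ _ using 2
  have hΓ : (Real.Gamma κ : ℂ) ≠ 0 := by exact_mod_cast (Real.Gamma_pos_of_pos hκ).ne'
  have hE := Complex.exp_ne_zero (Complex.I * κ * (Real.pi / 2))
  rw [Complex.exp_neg]
  push_cast
  field_simp

end Radon

end
end DTB

namespace DTB
noncomputable section

/-! ### The sampled convolution as a periodic decaying profile. -/

section Profiles

theorem IsProfile.conj {G : ℝ → ℝ → ℂ} {C₀ γ : ℝ} (hG : IsProfile G C₀ γ) :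
    IsProfile (fun X p => (starRingEnd ℂ) (G X p)) C₀ γ := by
  obtain ⟨C, hC⟩ := hG.decay
  refine ⟨Complex.continuous_conj.comp hG.continuous, fun X p => ?_, C, fun X p h => ?_⟩
  · rw [hG.periodic]
  · rw [RCLike.norm_conj]
    exact hC X p h

theorem IsInterpKernel.isTestKernel {β : ℝ} {φ : ℝ → ℝ} (hφ : IsInterpKernel β φ) :
    IsTestKernel ⌊β⌋₊ φ := ⟨hφ.compact, hφ.smooth, hφ.lipschitz⟩

/-- The assumptions on the kernel are invariant under reflection, as needed for the antipodal
directions. -/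
theorem IsInterpKernel.comp_neg {β : ℝ} {φ : ℝ → ℝ} (hφ : IsInterpKernel β φ) :
    IsInterpKernel β fun t => φ (-t) := by
  obtain ⟨K, hK⟩ := hφ.lipschitz
  refine ⟨fun m hm t => ?_, hφ.compact.comp_homeomorph (Homeomorph.neg ℝ),
    hφ.smooth.comp contDiff_neg, ⟨K, ?_⟩, ?_⟩
  · have h := hφ.exact m hm (-t)
    rw [← (Equiv.neg ℤ).tsum_eq] at h
    have h' : ∀ j : ℤ, (((Equiv.neg ℤ) j : ℤ) : ℝ) ^ m * φ (-t - ((Equiv.neg ℤ) j : ℤ))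
        = (-1) ^ m * ((j : ℝ) ^ m * φ (-(t - j))) := by
      intro j
      rw [Equiv.neg_apply, Int.cast_neg, neg_pow, mul_assoc, show -(t - (j : ℝ)) = -t - -(j : ℝ) by ring]
    simp_rw [h'] at h
    rw [tsum_mul_left, neg_pow t] at h
    exact mul_left_cancel₀ (pow_ne_zero m (by norm_num)) h
  · have h : iteratedDeriv ⌊β⌋₊ (fun t => φ (-t))
        = fun t => (-1) ^ ⌊β⌋₊ * iteratedDeriv ⌊β⌋₊ φ (-t) := by
      funext t
      rw [iteratedDeriv_comp_neg, smul_eq_mul]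
    rw [h]
    refine LipschitzWith.of_dist_le_mul fun x y => ?_
    have := hK.dist_le_mul (-x) (-y)
    rw [Real.dist_eq, ← mul_sub, abs_mul, abs_pow, abs_neg, abs_one, one_pow, one_mul, ← Real.dist_eq]
    simpa [dist_neg_neg] using this
  · rw [integral_neg_eq_self]
    exact hφ.normalized

/-- The exponent must lie in [⌈β⌉ - 1, ⌈β⌉] to fit Taylor polynomials of degree below ⌈β⌉, be less
than β for summability, and exceed a + δ for decay. The midpoint of a + δ and β, raised to ⌈β⌉ - 1
if necessary, satisfies all of this. -/
theorem exists_taylor_exponent {β a δ : ℝ} (ha : 0 < a) (hδ : 0 ≤ δ) (h : a + δ < β) :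
    ∃ θ : ℝ, a ≤ θ ∧ (⌈β⌉₊ : ℝ) - 1 ≤ θ ∧ θ ≤ ⌈β⌉₊ ∧ θ < β ∧ δ < θ - a := by
  have hβ : 0 ≤ β := by linarith
  have h1 := Nat.le_ceil β
  have h2 := Nat.ceil_lt_add_one hβ
  refine ⟨max ((⌈β⌉₊ : ℝ) - 1) ((β + a + δ) / 2), ?_, le_max_left _ _, max_le ?_ ?_,
    max_lt ?_ ?_, ?_⟩
  · exact le_max_of_le_right (by linarith)
  · linarith
  · linarith
  · linarith
  · linarith
  · have := le_max_right ((⌈β⌉₊ : ℝ) - 1) ((β + a + δ) / 2)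
    linarith

variable {β a : ℝ} {φ : ℝ → ℝ}

namespace IsInterpKernel

theorem isProfile_sampled (hφ : IsInterpKernel β φ) {θ : ℝ} {A : ℝ → ℝ}
    (hA : IsAmplitude a θ ⌈β⌉₊ A) (ha : 0 < a) (haθ : a ≤ θ) (hθ : θ < β) (C₀ : ℝ) :
    IsProfile (sampled β φ A) C₀ (θ - a) := by
  have hβ : 0 ≤ β := by linarith
  have h1 := Nat.floor_le hβ
  have h2 := Nat.lt_floor_add_one β
  obtain ⟨C, -, hC⟩ := hφ.isTestKernel.exists_sampled_bound h1 h2 hφ.exact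
    (by linarith [Nat.ceil_lt_add_one hβ]) hA ha haθ hθ C₀
  refine ⟨hφ.isTestKernel.continuous_sampled h1 h2 hA ha.le (haθ.trans_lt hθ),
    fun X p => sampled_add_one β φ A X p, C, fun X p h => ?_⟩
  rw [neg_sub]
  exact hC X p h

/-- For a = s - 1 and δ = d/2 the hypothesis a + δ < β says that κ₂ is positive. -/
theorem exists_isProfile (hφ : IsInterpKernel β φ) (ha : 0 < a) {δ : ℝ} (hδ : 0 ≤ δ)
    (h : a + δ < β) (C₀ : ℝ) : ∃ γ, δ < γ ∧
      IsProfile (sampled β φ fun y => posPow y a) C₀ γ ∧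
      IsProfile (sampled β φ fun y => negPow y a) C₀ γ := by
  obtain ⟨θ, h1, h2, h3, h4, h5⟩ := exists_taylor_exponent ha hδ h
  exact ⟨θ - a, h5, hφ.isProfile_sampled (isAmplitude_posPow ha h1 h2 h3) ha h1 h4 C₀,
    hφ.isProfile_sampled (isAmplitude_negPow _ ha h1) ha h1 h4 C₀⟩

theorem summable_sampled_posPow (hφ : IsInterpKernel β φ) (ha : 0 < a) (haβ : a < β) (X p : ℝ) :
    Summable fun j : ℤ => psi β φ (X + p - j) * (posPow (j - p) a : ℂ) := by
  obtain ⟨θ, h1, h2, h3, h4, h5⟩ := exists_taylor_exponent ha le_rfl (by simpa using haβ)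
  exact hφ.isTestKernel.summable_sampled (Nat.floor_le (by linarith)) (Nat.lt_floor_add_one β)
    (isAmplitude_posPow ha h1 h2 h3) ha.le haβ X p

theorem summable_sampled_negPow (hφ : IsInterpKernel β φ) (ha : 0 < a) (haβ : a < β) (X p : ℝ) :
    Summable fun j : ℤ => psi β φ (X + p - j) * (negPow (j - p) a : ℂ) :=
  hφ.isTestKernel.summable_sampled (Nat.floor_le (by linarith)) (Nat.lt_floor_add_one β)
    (isAmplitude_negPow ⌈β⌉₊ ha le_rfl) ha.le haβ X p

theorem integral_sampled_posPow (hφ : IsInterpKernel β φ) (ha : 0 < a) (haβ : a < β) (X : ℝ) :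
    ∫ p in (0 : ℝ)..1, sampled β φ (fun y => posPow y a) X p
      = 1 / (2 * Real.pi) * (Real.Gamma (a + 1) : ℂ) *
        Complex.exp (Complex.I * (Real.pi / 2) * ((a + 1 : ℝ) : ℂ)) *
        halfWave (β - (a + 1)) (fun y => (φ y : ℂ)) X := by
  obtain ⟨θ, h1, h2, h3, h4, h5⟩ := exists_taylor_exponent ha le_rfl (by simpa using haβ)
  have hm := Nat.floor_le (show 0 ≤ β by linarith)
  have hm' := Nat.lt_floor_add_one β
  have hw := hφ.isTestKernel.integral_psi_mul_rpow hm hm' ha haβ (Or.inl rfl) X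
  simp only [Complex.ofReal_one, mul_one] at hw
  rw [hφ.isTestKernel.integral_sampled hm hm' (isAmplitude_posPow ha h1 h2 h3) ha.le haβ, ← hw,
    ← setIntegral_eq_integral_of_forall_compl_eq_zero (s := Set.Ioi (0 : ℝ))]
  · refine setIntegral_congr_fun measurableSet_Ioi fun y hy => ?_
    simp only [posPow, if_pos (show 0 < y from hy), one_mul]
  · intro y hy
    simp [posPow, show ¬ 0 < y from hy]

theorem integral_sampled_negPow (hφ : IsInterpKernel β φ) (ha : 0 < a) (haβ : a < β) (X : ℝ) :
    ∫ p in (0 : ℝ)..1, sampled β φ (fun y => negPow y a) X p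
      = 1 / (2 * Real.pi) * (Real.Gamma (a + 1) : ℂ) *
        Complex.exp (-(Complex.I * (Real.pi / 2) * ((a + 1 : ℝ) : ℂ))) *
        halfWave (β - (a + 1)) (fun y => (φ y : ℂ)) X := by
  have hm := Nat.floor_le (show 0 ≤ β by linarith)
  have hm' := Nat.lt_floor_add_one β
  have hw := hφ.isTestKernel.integral_psi_mul_rpow hm hm' ha haβ (Or.inr rfl) X
  have he : Complex.I * ((-1 : ℝ) : ℂ) * (Real.pi / 2) * ((a + 1 : ℝ) : ℂ)
      = -(Complex.I * (Real.pi / 2) * ((a + 1 : ℝ) : ℂ)) := by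
    push_cast
    ring
  rw [he] at hw
  rw [hφ.isTestKernel.integral_sampled hm hm' (isAmplitude_negPow ⌈β⌉₊ ha le_rfl) ha.le haβ, ← hw,
    ← integral_neg_eq_self,
    ← setIntegral_eq_integral_of_forall_compl_eq_zero (s := Set.Ioi (0 : ℝ))]
  · refine setIntegral_congr_fun measurableSet_Ioi fun y hy => ?_
    simp only [negPow, posPow, neg_neg, if_pos (show 0 < y from hy), neg_one_mul]
  · intro y hy
    simp [negPow, posPow, show ¬ 0 < y from hy]

/-- The decay of the half-wave integral is not obtained from oscillation: up to the nonzero constant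
`w` this integral is the mean of a profile over one period, and it inherits the decay of the
profile. -/
theorem integral_halfWave (hφ : IsInterpKernel β φ) (ha : 0 < a) {d : ℕ}
    (h : a + (d : ℝ) / 2 < β) (X : ℝ) :
    ∫ z : Vec d, halfWave (β - (a + 1)) (fun y => (φ y : ℂ)) (X + ‖z‖ ^ 2 / 2)
      = (((2 * Real.pi) ^ ((d : ℝ) / 2) : ℝ) : ℂ) *
        Complex.exp (-(Complex.I * ((d : ℝ) / 2 : ℝ) * (Real.pi / 2))) *
        halfWave (β - (a + 1) - d / 2) (fun y => (φ y : ℂ)) X := by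
  have hd : (0 : ℝ) ≤ d / 2 := by positivity
  -- The arguments X + |z|²/2 are all at least -|X|, so decay is required on this range.
  obtain ⟨γ, hγ, hP, -⟩ := hφ.exists_isProfile ha hd h |X|
  obtain ⟨C, hC⟩ := hP.decay
  set w : ℂ := 1 / (2 * Real.pi) * (Real.Gamma (a + 1) : ℂ) *
        Complex.exp (Complex.I * (Real.pi / 2) * ((a + 1 : ℝ) : ℂ)) with hw
  have hw0 : 0 < ‖w‖ := by
    refine norm_pos_iff.2 (mul_ne_zero (mul_ne_zero ?_ ?_) (Complex.exp_ne_zero _))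
    · have : (Real.pi : ℂ) ≠ 0 := by exact_mod_cast Real.pi_ne_zero
      simp [this]
    · exact_mod_cast (Real.Gamma_pos_of_pos (by linarith)).ne'
  have hm' := Nat.lt_floor_add_one β
  refine (hφ.isTestKernel.integral_halfWave_sq (C := C / ‖w‖) (by linarith) (by linarith)
    (by linarith) hγ fun Y hY => ?_).2
  have h1 := hφ.integral_sampled_posPow ha (by linarith) Y
  rw [← hw] at h1
  have h2 := intervalIntegral.norm_integral_le_of_norm_le_const (a := (0 : ℝ)) (b := 1)
    (f := sampled β φ (fun y => posPow y a) Y) (C := C * (1 + |Y|) ^ (-γ))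
    fun p _ => hC Y p ((neg_abs_le X).trans hY)
  rw [h1, norm_mul, sub_zero, abs_one, mul_one] at h2
  rw [div_mul_eq_mul_div, le_div_iff₀ hw0, mul_comm]
  exact h2

theorem integral_sampled_posPow_sq (hφ : IsInterpKernel β φ) (ha : 0 < a) {d : ℕ}
    (h : a + (d : ℝ) / 2 < β) (X : ℝ) :
    ∫ z : Vec d, ∫ p in (0 : ℝ)..1, sampled β φ (fun y => posPow y a) (X + ‖z‖ ^ 2 / 2) p
      = 1 / (2 * Real.pi) * (Real.Gamma (a + 1) : ℂ) *
        Complex.exp (Complex.I * (Real.pi / 2) * ((a + 1 : ℝ) : ℂ)) *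
        ((((2 * Real.pi) ^ ((d : ℝ) / 2) : ℝ) : ℂ) *
        Complex.exp (-(Complex.I * ((d : ℝ) / 2 : ℝ) * (Real.pi / 2))) *
        halfWave (β - (a + 1) - d / 2) (fun y => (φ y : ℂ)) X) := by
  have hd : (0 : ℝ) ≤ d / 2 := by positivity
  simp_rw [hφ.integral_sampled_posPow ha (show a < β by linarith)]
  rw [integral_const_mul, hφ.integral_halfWave ha h]

theorem integral_sampled_negPow_sq (hφ : IsInterpKernel β φ) (ha : 0 < a) {d : ℕ}
    (h : a + (d : ℝ) / 2 < β) (X : ℝ) :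
    ∫ z : Vec d, ∫ p in (0 : ℝ)..1, sampled β φ (fun y => negPow y a) (X + ‖z‖ ^ 2 / 2) p
      = 1 / (2 * Real.pi) * (Real.Gamma (a + 1) : ℂ) *
        Complex.exp (-(Complex.I * (Real.pi / 2) * ((a + 1 : ℝ) : ℂ))) *
        ((((2 * Real.pi) ^ ((d : ℝ) / 2) : ℝ) : ℂ) *
        Complex.exp (-(Complex.I * ((d : ℝ) / 2 : ℝ) * (Real.pi / 2))) *
        halfWave (β - (a + 1) - d / 2) (fun y => (φ y : ℂ)) X) := by
  have hd : (0 : ℝ) ≤ d / 2 := by positivity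
  simp_rw [hφ.integral_sampled_negPow ha (show a < β by linarith)]
  rw [integral_const_mul, hφ.integral_halfWave ha h]

end IsInterpKernel

theorem integral_integral_conj {d : ℕ} (G : ℝ → ℝ → ℂ) (q : Vec d → ℝ) :
    ∫ z : Vec d, ∫ p in (0 : ℝ)..1, (starRingEnd ℂ) (G (q z) p)
      = (starRingEnd ℂ) (∫ z : Vec d, ∫ p in (0 : ℝ)..1, G (q z) p) := by
  rw [← integral_conj]
  simp only [intervalIntegral.integral_of_le zero_le_one, integral_conj]

end Profiles

/-! ### The filtered data of one direction. -/

section Filtered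

variable {n : ℕ} {β a s : ℝ} {φ : ℝ → ℝ} {B₀ : Sph n → ℂ} {Bt : Sph n → ℝ → ℂ}

theorem tendsto_applyApprox_symbol (hφ : IsInterpKernel β φ) (hβ : 0 ≤ β)
    (hB : ∀ α (l : ℝ), 0 < l → Bt α l = ((l ^ β : ℝ) : ℂ) * B₀ α)
    (hB' : ∀ α (l : ℝ), Bt (-α) (-l) = Bt α l) (α : Sph n) {ε : ℝ} (hε : 0 < ε) (c t : ℝ) :
    Tendsto (applyApprox (Bt α) (fun p => φ ((p - ε * c) / ε)) t) (𝓝[>] 0)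
      (𝓝 (((ε ^ (-β) : ℝ) : ℂ) *
        (B₀ α * psi β φ (t / ε - c) + B₀ (-α) * (starRingEnd ℂ) (psi β φ (t / ε - c))))) := by
  refine hφ.isTestKernel.tendsto_applyApprox (Nat.floor_le hβ) (Nat.lt_floor_add_one β)
    (fun l hl => hB α l hl) (fun l hl => ?_) hε c t
  rw [← hB' α (-l), neg_neg, hB (-α) l hl]

/-- Homogeneity: the sample point is εj = c + ε(j - c/ε), so the data contribute ε^a and the filter
ε^(-β), and what is left depends only on X and c/ε. -/
theorem hasSum_filteredTerm (hφ : IsInterpKernel β φ) (ha : 0 < a) (haβ : a < β)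
    (hB : ∀ α (l : ℝ), 0 < l → Bt α l = ((l ^ β : ℝ) : ℂ) * B₀ α)
    (hB' : ∀ α (l : ℝ), Bt (-α) (-l) = Bt α l) {g : Sph n → ℝ → ℂ} {α : Sph n} {A₁ A₂ : ℂ} {c : ℝ}
    (hg : ∀ p : ℝ, g α (c + p) = A₁ * (posPow p a : ℂ) + A₂ * (negPow p a : ℂ))
    {ε : ℝ} (hε : 0 < ε) (x : Vec n) {X : ℝ} (hX : X = (⟪(α : Vec n), x⟫ - c) / ε) :
    HasSum (filteredTerm Bt φ g ε x α) (((ε ^ (a - β) : ℝ) : ℂ) *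
      (B₀ α * A₁ * sampled β φ (fun y => posPow y a) X (c / ε)
        + B₀ α * A₂ * sampled β φ (fun y => negPow y a) X (c / ε)
        + B₀ (-α) * A₁ * (starRingEnd ℂ) (sampled β φ (fun y => posPow y a) X (c / ε))
        + B₀ (-α) * A₂ * (starRingEnd ℂ) (sampled β φ (fun y => negPow y a) X (c / ε)))) := by
  have hP := (hφ.summable_sampled_posPow ha haβ X (c / ε)).hasSum
  have hN := (hφ.summable_sampled_negPow ha haβ X (c / ε)).hasSum
  have hP' := hP.map (starRingEnd ℂ) Complex.continuous_conj
  have hN' := hN.map (starRingEnd ℂ) Complex.continuous_conj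
  have hεa : ε ^ (a - β) = ε ^ (-β) * ε ^ a := by
    rw [← Real.rpow_add hε]
    congr 1
    ring
  refine (congrArg (fun f => HasSum f _) (funext fun j => ?_)).mpr (((((hP.mul_left (B₀ α * A₁)).add
    (hN.mul_left (B₀ α * A₂))).add (hP'.mul_left (B₀ (-α) * A₁))).add
    (hN'.mul_left (B₀ (-α) * A₂))).mul_left ((ε ^ (a - β) : ℝ) : ℂ))
  have h1 : ε * (j : ℝ) = c + ε * (j - c / ε) := by
    field_simp
    ring
  have h2 : ⟪(α : Vec n), x⟫ / ε - j = X + c / ε - j := by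
    rw [hX]
    ring
  have h3 : negPow (ε * (j - c / ε)) a = ε ^ a * negPow (j - c / ε) a := by
    rw [negPow, ← mul_neg, posPow_mul hε, negPow]
  rw [filteredTerm, applyB,
    (tendsto_applyApprox_symbol hφ (by linarith) hB hB' α hε j ⟪(α : Vec n), x⟫).limUnder_eq, h2, h1,
    hg, posPow_mul hε, h3, hεa]
  simp only [Function.comp_apply, map_mul, Complex.conj_ofReal]
  push_cast
  ring

theorem regKernel_neg {Bt : Sph n → ℝ → ℂ} (hB' : ∀ α (l : ℝ), Bt (-α) (-l) = Bt α l) (α : Sph n)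
    (δ p : ℝ) : regKernel (Bt (-α)) δ (-p) = regKernel (Bt α) δ p := by
  unfold regKernel
  rw [← integral_neg_eq_self]
  simp [hB']

theorem applyB_neg (hB' : ∀ α (l : ℝ), Bt (-α) (-l) = Bt α l) (α : Sph n) (ψ : ℝ → ℝ) (t : ℝ) :
    applyB (Bt (-α)) ψ (-t) = applyB (Bt α) (fun p => ψ (-p)) t := by
  unfold applyB
  congr 1
  funext δ
  unfold applyApprox
  rw [← integral_neg_eq_self]
  refine integral_congr_ae (Eventually.of_forall fun p => ?_)
  simp only
  rw [← regKernel_neg hB' α δ (t - p)]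
  congr 2
  ring

/-- Reversing α, p and j leaves the symbol and the data unchanged and only reflects the kernel. -/
theorem filteredTerm_neg (hB' : ∀ α (l : ℝ), Bt (-α) (-l) = Bt α l) {g : Sph n → ℝ → ℂ} {α : Sph n}
    (hg : ∀ p, g (-α) (-p) = g α p) (ε : ℝ) (x : Vec n) (j : ℤ) :
    filteredTerm Bt φ g ε x (-α) (-j) = filteredTerm Bt (fun t => φ (-t)) g ε x α j := by
  unfold filteredTerm
  rw [show ε * ((-j : ℤ) : ℝ) = -(ε * j) by push_cast; ring, hg, coe_neg_sphere, inner_neg_left,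
    applyB_neg hB']
  congr 3
  funext p
  congr 1
  ring

end Filtered

/-! ### The sum over the directions. -/

section Directional

variable {d : ℕ} {H : Vec (d + 1) → ℝ} {Θ : Sph (d + 1)} {Ω : Set (Sph (d + 1))} {U : Set (Vec d)}
  {T : OpenPartialHomeomorph (Vec d) (Sph (d + 1))} {Q : Set (Vec d)}

/-- The limit of the lattice sum still shows the parametrization, through its area density and the
pulled back quadratic form; `integral_quadratic_phase` removes both. -/
theorem tendsto_directional_sum (hs : ContDiffOn ℝ ∞ H {0}ᶜ)
    (hh : ∀ ξ : Vec (d + 1), ξ ≠ 0 → ∀ l : ℝ, 0 < l → H (l • ξ) = l * H ξ)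
    (hneg : HessNegDef H (Θ : Vec (d + 1))) (hT : IsDirectionMap T U Ω Θ)
    (hlow : ∃ c > 0, ∀ α ∈ Ω, c * ‖(α : Vec (d + 1)) - Θ‖ ^ 2
      ≤ ⟪(α : Vec (d + 1)), gradient H (Θ : Vec (d + 1))⟫ - H α)
    (hgen : IsGenericFor T (gradient H (Θ : Vec (d + 1)))) (hQ : IsCell Q) (u : ℝ → Vec d)
    {C : Set (Sph (d + 1))} (hC : IsCompact C) (hCΩ : C ⊆ Ω) {q : Sph (d + 1) → ℂ}
    (hq : Continuous q) (hqC : ∀ α ∈ Ω, α ∉ C → q α = 0) (x : Vec (d + 1)) {G : ℝ → ℝ → ℂ} {γ : ℝ}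
    (hγ : (d : ℝ) / 2 < γ) (hG : IsProfile G ‖x‖ γ) :
    Tendsto (fun ε : ℝ => ((ε ^ (-(d : ℝ) / 2) : ℝ) : ℂ) *
      ∑' k : {k : Fin d → ℤ // gridPt ε (u ε) k ∈ T.source},
        q (T (gridPt ε (u ε) k)) * (cellArea T Q ε (u ε) k : ℂ) *
        G (⟪(T (gridPt ε (u ε) k) : Vec (d + 1)), x⟫
          + (⟪(T (gridPt ε (u ε) k) : Vec (d + 1)), gradient H (Θ : Vec (d + 1))⟫
            - H (T (gridPt ε (u ε) k))) / ε) (H (T (gridPt ε (u ε) k)) / ε)) (𝓝[>] 0)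
      (𝓝 (q Θ * ((√|(hessMatrix H (Θ : Vec (d + 1))).det|)⁻¹ : ℝ) *
        ∫ z : Vec d, ∫ p in (0 : ℝ)..1, G (⟪(Θ : Vec (d + 1)), x⟫ + ‖z‖ ^ 2 / 2) p)) := by
  set K : Set (Vec d) := T.symm '' C with hK
  have hKc : IsCompact K := hC.image_of_continuousOn
    (T.continuousOn_symm.mono (by rw [hT.target_eq]; exact hCΩ))
  have hKU : K ⊆ U := by
    rintro _ ⟨α, hα, rfl⟩
    rw [← hT.source_eq]
    exact T.map_target (by rw [hT.target_eq]; exact hCΩ hα)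
  have hzero : ∀ v ∈ U, v ∉ K → q (T v) = 0 := by
    intro v hv hvK
    rw [← hT.source_eq] at hv
    refine hqC _ (by rw [← hT.target_eq]; exact T.map_source hv) fun hTC => hvK ?_
    exact ⟨T v, hTC, T.left_inv hv⟩
  -- The cutoff discards the meaningless values of `T` outside its domain; inside the domain it
  -- changes nothing, since q vanishes off C.
  set c : Vec d → ℂ := K.indicator fun v => q (T v) with hc
  have hcU : ∀ v ∈ U, c v = q (T v) := by
    intro v hv
    by_cases hvK : v ∈ K
    · exact Set.indicator_of_mem hvK _
    · rw [hzero v hv hvK]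
      exact Set.indicator_of_notMem hvK _
  have hU : U ∈ 𝓝 (0 : Vec d) := by
    rw [← hT.source_eq]
    exact T.open_source.mem_nhds hT.zero_mem_source
  have hc0 : ContinuousAt c 0 := by
    have h1 : ContinuousAt (fun v => q (T v)) 0 :=
      hq.continuousAt.comp (T.continuousAt hT.zero_mem_source)
    refine h1.congr ?_
    filter_upwards [hU] with v hv
    exact (hcU v hv).symm
  obtain ⟨M, hM⟩ := (isCompact_univ (X := Sph (d + 1))).exists_bound_of_continuousOn hq.continuousOn
  have hcM : ∀ v, ‖c v‖ ≤ M := by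
    intro v
    refine (norm_indicator_le_norm_self _ _).trans (hM _ trivial)
  have key := tendsto_lattice_sum (isGridPhase hs hh hT hlow hgen hQ u hKc hKU x) hG hγ hc0
    (fun v hv => Set.indicator_of_notMem hv _) hcM
  have hlim := integral_quadratic_phase hneg hT.inner_fderiv hT.fderiv_injective
    (fun r => ∫ p in (0 : ℝ)..1, G (⟪(Θ : Vec (d + 1)), x⟫ + r) p)
  have h0 : c 0 = q Θ := by rw [hcU 0 hT.zero_mem, hT.map_zero]
  have hJ : areaDensity Θ T 0
      = coneJac Θ (Θ : Vec (d + 1)) (fderiv ℝ (fun v => (T v : Vec (d + 1))) 0) := by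
    rw [areaDensity, hT.map_zero]
  rw [h0, hJ, hT.map_zero, mul_assoc, hlim, ← mul_assoc] at key
  refine key.congr fun ε => ?_
  congr 1
  refine Eq.trans ?_ (tsum_subtype {k : Fin d → ℤ | gridPt ε (u ε) k ∈ T.source} fun k =>
    q (T (gridPt ε (u ε) k)) * (cellArea T Q ε (u ε) k : ℂ) *
        G (⟪(T (gridPt ε (u ε) k) : Vec (d + 1)), x⟫
          + (⟪(T (gridPt ε (u ε) k) : Vec (d + 1)), gradient H (Θ : Vec (d + 1))⟫
            - H (T (gridPt ε (u ε) k))) / ε) (H (T (gridPt ε (u ε) k)) / ε)).symm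
  refine tsum_congr fun k => ?_
  by_cases hk : gridPt ε (u ε) k ∈ T.source
  · rw [Set.indicator_of_mem (show k ∈ {k | gridPt ε (u ε) k ∈ T.source} from hk),
      hcU _ (by rwa [← hT.source_eq])]
  · rw [Set.indicator_of_notMem (show k ∉ {k | gridPt ε (u ε) k ∈ T.source} from hk)]
    have : c (gridPt ε (u ε) k) = 0 :=
      Set.indicator_of_notMem (fun h => hk (by rw [hT.source_eq]; exact hKU h)) _
    rw [this, zero_mul, zero_mul]

end Directional

end
end DTB

namespace DTB
noncomputable section

/-! ### The limit of the reconstruction. -/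

section Limit

variable {d : ℕ} {H : Vec (d + 1) → ℝ} {Θ : Sph (d + 1)} {Ω : Set (Sph (d + 1))} {U : Set (Vec d)}
  {T : OpenPartialHomeomorph (Vec d) (Sph (d + 1))} {Q : Set (Vec d)}
  {β s : ℝ} {φ : ℝ → ℝ} {B₀ a₀ : Sph (d + 1) → ℂ} {Bt g₀ : Sph (d + 1) → ℝ → ℂ}

theorem finite_directions (hT : IsDirectionMap T U Ω Θ) {C : Set (Sph (d + 1))} (hC : IsCompact C)
    (hCΩ : C ⊆ Ω) {ε : ℝ} (hε : 0 < ε) (u : Vec d) :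
    {k : {k : Fin d → ℤ // gridPt ε u k ∈ T.source} | T (gridPt ε u k) ∈ C}.Finite := by
  have hK : Bornology.IsBounded (T.symm '' C) := (hC.image_of_continuousOn
    (T.continuousOn_symm.mono (by rw [hT.target_eq]; exact hCΩ))).isBounded
  refine ((finite_gridPt_mem hε u hK).preimage
    (Subtype.val_injective (p := fun k => gridPt ε u k ∈ T.source)).injOn).subset fun k hk => ?_
  exact ⟨_, hk, T.left_inv k.2⟩

theorem summable_directions (hT : IsDirectionMap T U Ω Θ) {C : Set (Sph (d + 1))} (hC : IsCompact C)
    (hCΩ : C ⊆ Ω) {ε : ℝ} (hε : 0 < ε) (u : Vec d)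
    {f : {k : Fin d → ℤ // gridPt ε u k ∈ T.source} → ℂ}
    (hf : ∀ k : {k : Fin d → ℤ // gridPt ε u k ∈ T.source}, T (gridPt ε u k) ∉ C → f k = 0) : Summable f := by
  refine summable_of_hasFiniteSupport ((finite_directions hT hC hCΩ hε u).subset fun k hk => ?_)
  by_contra h
  exact hk (hf k h)

/-- The limit of the reconstruction from the directions near `Θ`; here `W` is the half-wave integral of
the kernel. -/
def transitionLimit (H : Vec (d + 1) → ℝ) (B₀ a₀ : Sph (d + 1) → ℂ) (s : ℝ) (Θ : Sph (d + 1))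
    (W : ℂ) : ℂ :=
  ((√|(hessMatrix H (Θ : Vec (d + 1))).det|)⁻¹ : ℝ) * (((2 * Real.pi) ^ ((d : ℝ) / 2) : ℝ) : ℂ) *
    (1 / (2 * Real.pi)) * (cTwo (d + 1) s 1 (B₀ Θ) (a₀ Θ) (a₀ (-Θ)) * W
      + cTwo (d + 1) s (-1) (B₀ (-Θ)) (a₀ Θ) (a₀ (-Θ)) * (starRingEnd ℂ) W)

theorem kappa₂_add (d : ℕ) (β s : ℝ) : kappa₂ (d + 1) β s + (s - 1 - β) = -(d : ℝ) / 2 := by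
  rw [kappa₂]
  push_cast
  ring

theorem kappa₂_sub_one (d : ℕ) (β s : ℝ) :
    kappa₂ (d + 1) β s - 1 = β - (s - 1 + 1) - (d : ℝ) / 2 := by
  rw [kappa₂]
  push_cast
  ring

/-- The Gamma factor and the exponentials e^(±iκ₂π/2) in μ cancel those of the boundary value
formula, and half-wave integrals with exponent κ₂ - 1 remain. -/
theorem tendsto_boundaryApprox_mu (hφ : IsInterpKernel β φ) (hs : 1 < s)
    (hκ : 0 < kappa₂ (d + 1) β s) (h : ℝ) :
    Tendsto (boundaryApprox (kappa₂ (d + 1) β s) (muPlus H B₀ a₀ β s Θ) (muMinus H B₀ a₀ β s Θ)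
      (shiftTest φ h)) (𝓝[>] 0)
      (𝓝 (2 * transitionLimit H B₀ a₀ s Θ
        (halfWave (kappa₂ (d + 1) β s - 1) (fun y => (φ y : ℂ)) h))) := by
  have hκm : kappa₂ (d + 1) β s - 1 < ⌊β⌋₊ := by
    have := Nat.lt_floor_add_one β
    have h0 : (0 : ℝ) ≤ (d : ℝ) / 2 := by positivity
    rw [kappa₂_sub_one]
    linarith
  convert hφ.isTestKernel.tendsto_boundaryApprox hκ hκm h _ _ using 2
  have hΓ : (Real.Gamma (kappa₂ (d + 1) β s) : ℂ) ≠ 0 := by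
    exact_mod_cast (Real.Gamma_pos_of_pos hκ).ne'
  have hE := Complex.exp_ne_zero (Complex.I * kappa₂ (d + 1) β s * (Real.pi / 2))
  have hπ : (Real.pi : ℂ) ≠ 0 := by exact_mod_cast Real.pi_ne_zero
  have hF : (muFactor H (kappa₂ (d + 1) β s) Θ : ℂ)
      = ((√|(hessMatrix H (Θ : Vec (d + 1))).det|)⁻¹ : ℝ) *
        (((2 * Real.pi) ^ ((d : ℝ) / 2) : ℝ) : ℂ) * (Real.Gamma (kappa₂ (d + 1) β s) / Real.pi) := by
    rw [muFactor, show ((((d + 1 : ℕ) : ℝ) - 1) / 2) = (d : ℝ) / 2 by push_cast; ring, div_eq_mul_inv,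
      mul_comm ((2 * Real.pi) ^ ((d : ℝ) / 2))]
    simp only [Complex.ofReal_mul, Complex.ofReal_div]
  rw [muPlus, muMinus, hF, transitionLimit, Complex.exp_neg]
  generalize cTwo (d + 1) s 1 (B₀ Θ) (a₀ Θ) (a₀ (-Θ)) = c1
  generalize cTwo (d + 1) s (-1) (B₀ (-Θ)) (a₀ Θ) (a₀ (-Θ)) = c2
  generalize halfWave _ _ _ = W
  generalize (((2 * Real.pi) ^ ((d : ℝ) / 2) : ℝ) : ℂ) = P
  generalize (((√|(hessMatrix H (Θ : Vec (d + 1))).det|)⁻¹ : ℝ) : ℂ) = D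
  field_simp

/-- Four profiles contribute: each one-sided power with the filtered kernel and with its conjugate.
Their limits combine to c⁽²⁾_+ times the half-wave integral plus c⁽²⁾_- times its conjugate. -/
theorem tendsto_discreteB (hs : ContDiffOn ℝ ∞ H {0}ᶜ)
    (hh : ∀ ξ : Vec (d + 1), ξ ≠ 0 → ∀ l : ℝ, 0 < l → H (l • ξ) = l * H ξ)
    (hneg : HessNegDef H (Θ : Vec (d + 1))) (hT : IsDirectionMap T U Ω Θ)
    (hlow : ∃ c > 0, ∀ α ∈ Ω, c * ‖(α : Vec (d + 1)) - Θ‖ ^ 2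
      ≤ ⟪(α : Vec (d + 1)), gradient H (Θ : Vec (d + 1))⟫ - H α)
    (hgen : IsGenericFor T (gradient H (Θ : Vec (d + 1)))) (hQ : IsCell Q) (u : ℝ → Vec d)
    {C : Set (Sph (d + 1))} (hC : IsCompact C) (hCΩ : C ⊆ Ω)
    (hCa : ∀ α ∈ Ω, α ∉ C → a₀ α = 0 ∧ a₀ (-α) = 0)
    (hφ : IsInterpKernel β φ) (hs1 : 1 < s) (hκ : 0 < kappa₂ (d + 1) β s)
    (hB₀ : Continuous B₀) (ha₀ : Continuous a₀)
    (hB : ∀ α (l : ℝ), 0 < l → Bt α l = ((l ^ β : ℝ) : ℂ) * B₀ α)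
    (hB' : ∀ α (l : ℝ), Bt (-α) (-l) = Bt α l)
    (hg : ∀ α ∈ Ω, ∀ p : ℝ, g₀ α (H α + p)
      = a₀ α * (posPow p (s - 1) : ℂ) + a₀ (-α) * (negPow p (s - 1) : ℂ)) (x : Vec (d + 1)) :
    Tendsto (fun ε : ℝ => ((ε ^ kappa₂ (d + 1) β s : ℝ) : ℂ) *
      discreteB Bt φ g₀ T Q (u ε) ε (gradient H (Θ : Vec (d + 1)) + ε • x)) (𝓝[>] 0)
      (𝓝 (transitionLimit H B₀ a₀ s Θ
        (halfWave (kappa₂ (d + 1) β s - 1) (fun y => (φ y : ℂ)) ⟪x, (Θ : Vec (d + 1))⟫))) := by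
  have ha : 0 < s - 1 := by linarith
  have hβ : s - 1 + (d : ℝ) / 2 < β := by
    have := kappa₂_sub_one d β s
    linarith
  have hd : (0 : ℝ) ≤ d / 2 := by positivity
  obtain ⟨γ, hγ, hP, hN⟩ := hφ.exists_isProfile ha hd hβ ‖x‖
  have hneg' : Continuous fun α : Sph (d + 1) => -α := continuous_neg
  have key : ∀ {q : Sph (d + 1) → ℂ}, Continuous q → (∀ α ∈ Ω, α ∉ C → q α = 0) →
      ∀ {G : ℝ → ℝ → ℂ}, IsProfile G ‖x‖ γ → _ := fun hq hqC _ hG =>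
    tendsto_directional_sum hs hh hneg hT hlow hgen hQ u hC hCΩ hq hqC x hγ hG
  have t1 := key (hB₀.mul ha₀) (fun α hα hαC => by
    simp [(hCa α hα hαC).1]) hP
  have t2 := key (hB₀.mul (ha₀.comp hneg')) (fun α hα hαC => by
    simp [(hCa α hα hαC).2]) hN
  have t3 := key ((hB₀.comp hneg').mul ha₀) (fun α hα hαC => by
    simp [(hCa α hα hαC).1]) hP.conj
  have t4 := key ((hB₀.comp hneg').mul (ha₀.comp hneg')) (fun α hα hαC => by
    simp [(hCa α hα hαC).2]) hN.conj
  have hsum := ((t1.add t2).add t3).add t4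
  refine Tendsto.congr' ?_ (hsum.trans (le_of_eq ?_))
  · filter_upwards [self_mem_nhdsWithin] with ε hε
    replace hε : 0 < ε := hε
    -- The power ε^κ₂ times the factor ε^(s-1-β) of each direction is ε^(-d/2), the normalization of
    -- the lattice sum.
    rw [← mul_add, ← mul_add, ← mul_add, ← Summable.tsum_add, ← Summable.tsum_add,
      ← Summable.tsum_add, ← kappa₂_add d β s, Real.rpow_add hε, Complex.ofReal_mul, mul_assoc,
      ← tsum_mul_left, discreteB]
    · congr 1
      refine tsum_congr fun k => ?_
      have hk : T (gridPt ε (u ε) k) ∈ Ω := by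
        rw [← hT.target_eq]
        exact T.map_source k.2
      have hX : ⟪(T (gridPt ε (u ε) k) : Vec (d + 1)), x⟫
          + (⟪(T (gridPt ε (u ε) k) : Vec (d + 1)), gradient H (Θ : Vec (d + 1))⟫
            - H (T (gridPt ε (u ε) k))) / ε
          = (⟪(T (gridPt ε (u ε) k) : Vec (d + 1)), gradient H (Θ : Vec (d + 1)) + ε • x⟫
            - H (T (gridPt ε (u ε) k))) / ε := by
        rw [inner_add_right, inner_smul_right]
        field_simp
        ring
      rw [directionTerm, (hasSum_filteredTerm hφ ha (by linarith) hB hB' (hg _ hk) hε _ hX).tsum_eq]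
      simp only [Function.comp_apply, Pi.mul_apply]
      ring
    all_goals
      refine summable_directions hT hC hCΩ hε (u ε) fun k hk => ?_
      have hkΩ : T (gridPt ε (u ε) k) ∈ Ω := by
        rw [← hT.target_eq]
        exact T.map_source k.2
      simp [(hCa _ hkΩ hk).1, (hCa _ hkΩ hk).2]
  · have hΓ : Real.Gamma (s - 1 + 1) = Real.Gamma s := by rw [sub_add_cancel]
    have e0 : (starRingEnd ℂ) 2 = 2 := Complex.conj_ofReal 2
    have e1 : (starRingEnd ℂ) (Complex.exp (Complex.I * (Real.pi / 2) * s))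
        = Complex.exp (-(Complex.I * (Real.pi / 2) * s)) := by
      simp [← Complex.exp_conj, e0]
    have e2 : (starRingEnd ℂ) (Complex.exp (-(Complex.I * (Real.pi / 2) * s)))
        = Complex.exp (Complex.I * (Real.pi / 2) * s) := by
      simp [← Complex.exp_conj, e0]
    have e3 : (starRingEnd ℂ) (Complex.exp (-(Complex.I * ((d : ℝ) / 2 : ℝ) * (Real.pi / 2))))
        = Complex.exp (Complex.I * ((d : ℝ) / 2 : ℝ) * (Real.pi / 2)) := by
      simp [← Complex.exp_conj, e0]
    have e4 : (starRingEnd ℂ) (1 / (2 * (Real.pi : ℂ))) = 1 / (2 * Real.pi) := by simp [e0]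
    have hdim : (((d + 1 : ℕ) : ℝ) - 1) / 2 = (d : ℝ) / 2 := by
      push_cast
      ring
    rw [integral_integral_conj (sampled β φ fun y => posPow y (s - 1)),
      integral_integral_conj (sampled β φ fun y => negPow y (s - 1)),
      hφ.integral_sampled_posPow_sq ha hβ, hφ.integral_sampled_negPow_sq ha hβ, transitionLimit,
      kappa₂_sub_one, cTwo, cTwo, cOne, cOne, hdim, real_inner_comm]
    simp only [map_mul, e1, e2, e3, e4, Complex.conj_ofReal, sub_add_cancel, Complex.ofReal_one,
      Complex.ofReal_neg, mul_one, mul_neg, neg_mul, neg_neg, Pi.mul_apply, Function.comp_apply]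
    congr 1
    ring

theorem summable_directionTerm (hT : IsDirectionMap T U Ω Θ) (Q : Set (Vec d))
    {C : Set (Sph (d + 1))} (hC : IsCompact C) (hCΩ : C ⊆ Ω)
    (hCa : ∀ α ∈ Ω, α ∉ C → a₀ α = 0 ∧ a₀ (-α) = 0)
    (hφ : IsInterpKernel β φ) (hs1 : 0 < s - 1) (hβ : s - 1 < β)
    (hB : ∀ α (l : ℝ), 0 < l → Bt α l = ((l ^ β : ℝ) : ℂ) * B₀ α)
    (hB' : ∀ α (l : ℝ), Bt (-α) (-l) = Bt α l)
    (hg : ∀ α ∈ Ω, ∀ p : ℝ, g₀ α (H α + p)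
      = a₀ α * (posPow p (s - 1) : ℂ) + a₀ (-α) * (negPow p (s - 1) : ℂ))
    {ε : ℝ} (hε : 0 < ε) (u : Vec d) (x : Vec (d + 1)) :
    Summable fun k : {k : Fin d → ℤ // gridPt ε u k ∈ T.source} =>
      directionTerm Bt φ g₀ T Q u ε x k := by
  refine summable_directions hT hC hCΩ hε u fun k hk => ?_
  have hkΩ : T (gridPt ε u k) ∈ Ω := by
    rw [← hT.target_eq]
    exact T.map_source k.2
  rw [directionTerm, (hasSum_filteredTerm hφ hs1 hβ hB hB' (hg _ hkΩ) hε x rfl).tsum_eq,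
    (hCa _ hkΩ hk).1, (hCa _ hkΩ hk).2]
  simp

/-- The terms j and -j are paired, so that each antipodal direction is a direction in Ω with the
reflected kernel; the antipodal map does not change the cell areas. -/
theorem discreteB_negMap (hT : IsDirectionMap T U (-Ω) (-Θ)) (hQ : IsCell Q)
    (hB' : ∀ α (l : ℝ), Bt (-α) (-l) = Bt α l) (hg : ∀ α ∈ Ω, ∀ p, g₀ (-α) (-p) = g₀ α p)
    {ε : ℝ} (hε : 0 < ε) (u : Vec d) (x : Vec (d + 1)) :
    discreteB Bt φ g₀ T Q u ε x = discreteB Bt (fun t => φ (-t)) g₀ (negMap T) Q u ε x := by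
  unfold discreteB
  rw [negMap_source]
  refine tsum_congr fun k => ?_
  have hk : -T (gridPt ε u k) ∈ Ω := by
    have : T (gridPt ε u k) ∈ -Ω := by
      rw [← hT.target_eq]
      exact T.map_source k.2
    exact this
  have hc : ContDiffOn ℝ 1 (fun v => (T v : Vec (d + 1))) T.source :=
    hT.contDiffOn.of_le (by norm_cast)
  rw [directionTerm, directionTerm, cellArea_negMap hc hQ hε, ← (Equiv.neg ℤ).tsum_eq]
  congr 1
  refine tsum_congr fun j => ?_
  rw [negMap_apply, ← filteredTerm_neg hB' (hg _ hk), neg_neg, Equiv.neg_apply]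

/-- Since H is odd, replacing (α, p) by (-α, -p) exchanges the two one-sided powers together with
their coefficients. -/
theorem apply_neg_eq (hodd : ∀ α ∈ Ω, H (-(α : Vec (d + 1))) = -H α)
    (hg : ∀ α ∈ Ω ∪ -Ω, ∀ p : ℝ, g₀ α (H α + p)
      = a₀ α * (posPow p (s - 1) : ℂ) + a₀ (-α) * (negPow p (s - 1) : ℂ)) :
    ∀ α ∈ Ω, ∀ p, g₀ (-α) (-p) = g₀ α p := by
  intro α hα p
  have h1 := hg α (Or.inl hα) (p - H α)
  have h2 := hg (-α) (Or.inr (by simpa using hα)) (-(p - H α))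
  rw [coe_neg_sphere, hodd α hα] at h2
  rw [show H α + (p - H α) = p by ring] at h1
  rw [show -H α + -(p - H α) = -p by ring, neg_neg] at h2
  rw [h1, h2]
  simp only [negPow, neg_neg]
  ring

/-- Smallness of Ω serves two purposes: to separate Ω from -Ω, and to have the quadratic lower bound
of the phase on all of Ω. -/
theorem exists_small_neighborhood (hs : ContDiffOn ℝ ∞ H {0}ᶜ)
    (hh : ∀ ξ : Vec (d + 1), ξ ≠ 0 → ∀ l : ℝ, 0 < l → H (l • ξ) = l * H ξ) (Θ : Sph (d + 1)) :
    ∃ Ω₀ ∈ 𝓝 Θ, (∀ α ∈ Ω₀, 0 < ⟪(α : Vec (d + 1)), (Θ : Vec (d + 1))⟫) ∧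
      (HessNegDef H (Θ : Vec (d + 1)) → ∃ c > 0, ∀ α ∈ Ω₀, c * ‖(α : Vec (d + 1)) - Θ‖ ^ 2
        ≤ ⟪(α : Vec (d + 1)), gradient H (Θ : Vec (d + 1))⟫ - H α) := by
  have h1 : ∀ᶠ α : Sph (d + 1) in 𝓝 Θ, 0 < ⟪(α : Vec (d + 1)), (Θ : Vec (d + 1))⟫ := by
    have hc : Continuous fun α : Sph (d + 1) => ⟪(α : Vec (d + 1)), (Θ : Vec (d + 1))⟫ := by
      fun_prop
    refine hc.continuousAt.eventually_const_lt ?_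
    change 0 < ⟪(Θ : Vec (d + 1)), (Θ : Vec (d + 1))⟫
    rw [real_inner_self_eq_norm_sq, norm_eq_of_mem_sphere]
    norm_num
  -- The neighborhood is chosen before negative definiteness is assumed, so a neighborhood must be
  -- supplied also when it fails.
  by_cases hneg : HessNegDef H (Θ : Vec (d + 1))
  · obtain ⟨c, hc, hlow⟩ := exists_phase_lower hs hh hneg
    have h2 : ∀ᶠ α : Sph (d + 1) in 𝓝 Θ, c * ‖(α : Vec (d + 1)) - Θ‖ ^ 2
        ≤ ⟪(α : Vec (d + 1)), gradient H (Θ : Vec (d + 1))⟫ - H α := by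
      filter_upwards [(continuous_subtype_val (p := fun y => y ∈ Metric.sphere (0 : Vec (d + 1)) 1)).continuousAt.eventually
        hlow] with α hα
      exact hα (norm_eq_of_mem_sphere α)
    exact ⟨_, h1.and h2, fun α hα => hα.1, fun _ => ⟨c, hc, fun α hα => hα.2⟩⟩
  · exact ⟨_, h1, fun α hα => hα, fun h => absurd h hneg⟩

/-- Removing the open set -Ω from the symmetrized support leaves a closed subset of the compact
sphere, contained in Ω; as Ω and -Ω are disjoint, no point of Ω is lost. -/
theorem exists_compact_support (hΩ : IsOpen Ω) (hdisj : ∀ α ∈ Ω, -α ∉ Ω)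
    (ha : tsupport a₀ ⊆ Ω ∪ -Ω) : ∃ C : Set (Sph (d + 1)), IsCompact C ∧ C ⊆ Ω ∧
      ∀ α ∈ Ω, α ∉ C → a₀ α = 0 ∧ a₀ (-α) = 0 := by
  have hc : Continuous fun α : Sph (d + 1) => -α := continuous_neg
  have ho : IsOpen (-Ω) := hΩ.preimage hc
  refine ⟨(tsupport a₀ ∪ (fun α => -α) ⁻¹' tsupport a₀) \ -Ω, ?_, ?_, ?_⟩
  · exact (((isClosed_tsupport a₀).union ((isClosed_tsupport a₀).preimage hc)).sdiff ho).isCompact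
  · rintro α ⟨h | h, hn⟩
    · exact (ha h).resolve_right hn
    · rcases ha h with h' | h'
      · exact absurd h' hn
      · simpa using h'
  · intro α hα hαC
    have hn : α ∉ -Ω := fun h => hdisj α hα h
    have h : α ∉ tsupport a₀ ∪ (fun α => -α) ⁻¹' tsupport a₀ := fun h => hαC ⟨h, hn⟩
    rw [Set.mem_union, not_or] at h
    exact ⟨image_eq_zero_of_notMem_tsupport h.1, image_eq_zero_of_notMem_tsupport h.2⟩

end Limit

end
end DTB

/-! ### The main theorem. -/

open DTB in
theorem mainTheorem2 {d : ℕ} (hd : 1 ≤ d)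
    (H : Vec (d + 1) → ℝ)
    (hH_smooth : ContDiffOn ℝ ∞ H {0}ᶜ)
    (hH_hom : ∀ ξ : Vec (d + 1), ξ ≠ 0 → ∀ l : ℝ, 0 < l → H (l • ξ) = l * H ξ)
    (Θ₀ : Sph (d + 1)) (x₀ : Vec (d + 1)) (hx₀ : x₀ = gradient H (Θ₀ : Vec (d + 1))) :
    -- the neighborhood `Ω` of `Θ₀` is sufficiently small
    ∃ Ω₀ ∈ 𝓝 Θ₀, ∀ Ω : Set (Sph (d + 1)), Ω ⊆ Ω₀ → IsOpen Ω → Θ₀ ∈ Ω →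
    (∀ α ∈ Ω, H (-(α : Vec (d + 1))) = -H α) →
    (∀ α ∈ Ω, HessNegDef H (α : Vec (d + 1))) →
    -- the symbol
    ∀ (β s : ℝ) (B₀ : Sph (d + 1) → ℂ) (Bt : Sph (d + 1) → ℝ → ℂ),
    ContMDiff (𝓡 d) 𝓘(ℝ, ℂ) ∞ B₀ →
    (∀ α (l : ℝ), 0 < l → Bt α l = ((l ^ β : ℝ) : ℂ) * B₀ α) →
    (∀ α (l : ℝ), Bt (-α) (-l) = Bt α l) →
    -- the data
    ∀ (a₀ : Sph (d + 1) → ℂ) (g₀ : Sph (d + 1) → ℝ → ℂ),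
    ContMDiff (𝓡 d) 𝓘(ℝ, ℂ) ∞ a₀ →
    tsupport a₀ ⊆ Ω ∪ -Ω →
    (∀ α ∈ Ω ∪ -Ω, ∀ p : ℝ, g₀ α (H α + p)
      = a₀ α * (posPow p (s - 1) : ℂ) + a₀ (-α) * (negPow p (s - 1) : ℂ)) →
    ((d + 1 : ℕ) + 1 : ℝ) / 2 ≤ s →
    0 < kappa₂ (d + 1) β s →
    -- the interpolation kernel
    ∀ φ : ℝ → ℝ, IsInterpKernel β φ →
    -- the sampled directions; `x₀` is generic
    ∀ (U : Set (Vec d)) (Tp Tm : OpenPartialHomeomorph (Vec d) (Sph (d + 1))),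
    IsDirectionMap Tp U Ω Θ₀ → IsDirectionMap Tm U (-Ω) (-Θ₀) →
    IsGenericFor Tp x₀ → IsGenericFor Tm x₀ →
    ∀ (Q : Set (Vec d)), IsCell Q →
    ∀ (u : ℝ → Vec d), (∀ ε i, u ε i ∈ Set.Ico (0 : ℝ) 1) →
    -- all limits and series in the definition of the reconstruction converge
    ((∀ α ∈ Ω ∪ -Ω, ∀ ε : ℝ, 0 < ε → ∀ x : Vec (d + 1),
        (∀ j : ℤ, ∃ L : ℂ, Tendsto (applyApprox (Bt α) (fun p => φ ((p - ε * j) / ε))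
          ⟪(α : Vec (d + 1)), x⟫) (𝓝[>] 0) (𝓝 L)) ∧
        Summable (filteredTerm Bt φ g₀ ε x α)) ∧
      (∀ T ∈ ({Tp, Tm} : Set (OpenPartialHomeomorph (Vec d) (Sph (d + 1)))),
        ∀ ε : ℝ, 0 < ε → ∀ x : Vec (d + 1),
        Summable fun k : {k : Fin d → ℤ // gridPt ε (u ε) k ∈ T.source} =>
          directionTerm Bt φ g₀ T Q (u ε) ε x k)) ∧
    -- `(φ * μ)(h)` is well defined
    (∀ h : ℝ, Tendsto (boundaryApprox (kappa₂ (d + 1) β s)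
        (muPlus H B₀ a₀ β s Θ₀) (muMinus H B₀ a₀ β s Θ₀) (shiftTest φ h)) (𝓝[>] 0)
      (𝓝 (mu H B₀ a₀ β s Θ₀ (shiftTest φ h)))) ∧
    -- the limit, with the directions in `Ω` counted twice instead of those in `-Ω`
    (∀ x : Vec (d + 1), Tendsto
      (fun ε : ℝ => ((ε ^ kappa₂ (d + 1) β s : ℝ) : ℂ) *
        (2 * discreteB Bt φ g₀ Tp Q (u ε) ε (x₀ + ε • x))) (𝓝[>] 0)
      (𝓝 (mu H B₀ a₀ β s Θ₀ (shiftTest φ ⟪x, (Θ₀ : Vec (d + 1))⟫)))) ∧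
    -- the limit, with all directions in `Ω ∪ -Ω`; the kernel on the right is `φ` if `φ` is even
    (∀ x : Vec (d + 1), Tendsto
      (fun ε : ℝ => ((ε ^ kappa₂ (d + 1) β s : ℝ) : ℂ) *
        (discreteB Bt φ g₀ Tp Q (u ε) ε (x₀ + ε • x)
          + discreteB Bt φ g₀ Tm Q (u ε) ε (x₀ + ε • x))) (𝓝[>] 0)
      (𝓝 (mu H B₀ a₀ β s Θ₀
        (shiftTest (fun t => (φ t + φ (-t)) / 2) ⟪x, (Θ₀ : Vec (d + 1))⟫)))) ∧
    -- the case when `g₀` is the leading singularity of a Radon transform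
    (∀ v₀ : Sph (d + 1) → ℂ,
      (s = ⌊s⌋₊ → ∀ α ∈ Ω, v₀ (-α)
        = Complex.exp (-(Complex.I * ((kappa₁ (d + 1) s + 1 : ℝ) : ℂ) * Real.pi)) * v₀ α) →
      (∀ α ∈ Ω ∪ -Ω, ∀ p : ℝ, g₀ α (H α + p) = radonLead H v₀ s α p) →
      mu H B₀ a₀ β s Θ₀
        = muCTB (kappa₂ (d + 1) β s) (muCoef B₀ v₀ Θ₀) (muCoef B₀ v₀ (-Θ₀)) ∧
      ∀ ψ : 𝓢(ℝ, ℂ), Tendsto (boundaryApprox (kappa₂ (d + 1) β s)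
          (muPlus H B₀ a₀ β s Θ₀) (muMinus H B₀ a₀ β s Θ₀) ψ) (𝓝[>] 0)
        (𝓝 (invFourierPairing (kappa₂ (d + 1) β s)
          (muCoef B₀ v₀ Θ₀) (muCoef B₀ v₀ (-Θ₀)) ψ))) := by
  obtain ⟨Ω₀, hΩ₀, hpos, hlow₀⟩ := exists_small_neighborhood hH_smooth hH_hom Θ₀
  refine ⟨Ω₀, hΩ₀, fun Ω hΩsub hΩ hΘ hodd hneg β s B₀ Bt hB₀ hB hB' a₀ g₀ ha₀ hsupp hg hs hκ φ hφ
    U Tp Tm hTp hTm hgp hgm Q hQ u _ => ?_⟩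
  subst hx₀
  have hd1 : (1 : ℝ) ≤ d := by exact_mod_cast hd
  -- As n ≥ 2, one has s ≥ 3/2; the exponent s - 1 is positive and the one-sided powers are
  -- continuous.
  have hs1 : 1 < s := by
    push_cast at hs
    linarith
  have hβ : s - 1 < β := by
    have := kappa₂_sub_one d β s
    linarith
  have hnegΘ := hneg Θ₀ hΘ
  obtain ⟨c, hc, hlow⟩ := hlow₀ hnegΘ
  have hdisj : ∀ α ∈ Ω, -α ∉ Ω := by
    intro α hα hα'
    have h1 := hpos α (hΩsub hα)
    have h2 := hpos (-α) (hΩsub hα')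
    rw [coe_neg_sphere, inner_neg_left] at h2
    linarith
  have hlowΩ : ∃ c > 0, ∀ α ∈ Ω, c * ‖(α : Vec (d + 1)) - Θ₀‖ ^ 2
      ≤ ⟪(α : Vec (d + 1)), gradient H (Θ₀ : Vec (d + 1))⟫ - H α :=
    ⟨c, hc, fun α hα => hlow α (hΩsub hα)⟩
  obtain ⟨C, hC, hCΩ, hCa⟩ := exists_compact_support hΩ hdisj hsupp
  have hgΩ := fun α (hα : α ∈ Ω) => hg α (Or.inl hα)
  have hgneg := apply_neg_eq hodd hg
  have hlim := fun {ψ : ℝ → ℝ} (hψ : IsInterpKernel β ψ) {T} hT hgT x =>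
    tendsto_discreteB (T := T) (U := U) hH_smooth hH_hom hnegΘ hT hlowΩ hgT hQ u hC hCΩ hCa hψ hs1 hκ
      hB₀.continuous ha₀.continuous hB hB' hgΩ x
  have hmu := fun {ψ : ℝ → ℝ} (hψ : IsInterpKernel β ψ) h =>
    tendsto_boundaryApprox_mu (H := H) (Θ := Θ₀) (B₀ := B₀) (a₀ := a₀) hψ hs1 hκ h
  refine ⟨⟨fun α hα ε hε x => ⟨fun j => ?_, ?_⟩, fun T hT ε hε x => ?_⟩, fun h => ?_, fun x => ?_,
    fun x => ?_, fun v₀ hv₀ hradon => ?_⟩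
  · exact ⟨_, tendsto_applyApprox_symbol hφ (by linarith) hB hB' α hε j _⟩
  · exact (hasSum_filteredTerm hφ (by linarith) hβ hB hB' (hg α hα) hε x rfl).summable
  · rcases hT with rfl | rfl
    · exact summable_directionTerm hTp Q hC hCΩ hCa hφ (by linarith) hβ hB hB' hgΩ hε (u ε) x
    -- For the directions in -Ω the compact set is the antipodal image of the one for Ω.
    · refine summable_directionTerm hTm Q (hC.image continuous_neg) ?_ ?_ hφ (by linarith) hβ hB hB'
        (fun α hα => hg α (Or.inr hα)) hε (u ε) x
      · rintro _ ⟨α, hα, rfl⟩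
        simpa using hCΩ hα
      · intro α hα hαC
        have h := hCa (-α) hα fun h => hαC ⟨-α, h, neg_neg α⟩
        rw [neg_neg] at h
        exact ⟨h.2, h.1⟩
  · rw [mu, boundaryDist, (hmu hφ h).limUnder_eq]
    exact hmu hφ h
  · rw [mu, boundaryDist, (hmu hφ _).limUnder_eq]
    refine ((hlim hφ hTp hgp x).const_mul 2).congr fun ε => ?_
    ring
  -- The directions near -Θ₀ enter as directions near Θ₀ with the reflected kernel. Each family
  -- contributes half of a pairing with μ, and the halves add up to the pairing with the even part
  -- of φ.
  · have hpair := (hlim hφ hTp hgp x).add (hlim hφ.comp_neg hTm.neg hgm.neg x)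
    have hmid : Tendsto (boundaryApprox (kappa₂ (d + 1) β s) (muPlus H B₀ a₀ β s Θ₀)
        (muMinus H B₀ a₀ β s Θ₀)
        (shiftTest (fun t => (φ t + φ (-t)) / 2) ⟪x, (Θ₀ : Vec (d + 1))⟫)) (𝓝[>] 0)
        (𝓝 ((2 * transitionLimit H B₀ a₀ s Θ₀ (halfWave (kappa₂ (d + 1) β s - 1)
          (fun y => (φ y : ℂ)) ⟪x, (Θ₀ : Vec (d + 1))⟫) + 2 * transitionLimit H B₀ a₀ s Θ₀ (halfWave
          (kappa₂ (d + 1) β s - 1) (fun y => (φ (-y) : ℂ)) ⟪x, (Θ₀ : Vec (d + 1))⟫)) / 2)) := by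
      refine (((hmu hφ ⟪x, (Θ₀ : Vec (d + 1))⟫).add (hmu hφ.comp_neg _)).div_const 2).congr' ?_
      filter_upwards [self_mem_nhdsWithin] with δ hδ
      have hi := fun {ψ : ℝ → ℝ} (hψ : IsInterpKernel β ψ) =>
        hψ.isTestKernel.integrable.comp_sub_left ⟪x, (Θ₀ : Vec (d + 1))⟫
      have h := boundaryApprox_average hκ hδ (hi hφ) (hi hφ.comp_neg) (muPlus H B₀ a₀ β s Θ₀)
        (muMinus H B₀ a₀ β s Θ₀)
      refine h.symm.trans (congrArg (fun f => boundaryApprox _ _ _ f δ) (funext fun t => ?_))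
      simp [shiftTest]
    rw [mu, boundaryDist, hmid.limUnder_eq, ← mul_add, mul_div_cancel_left₀ _ (two_ne_zero' ℂ)]
    refine hpair.congr' ?_
    filter_upwards [self_mem_nhdsWithin] with ε hε
    rw [discreteB_negMap hTm hQ hB' hgneg hε, mul_add]
  · have hoddΘ := eventually_odd hH_hom hΩ hΘ hodd
    have hone := fun b => cOne_radon hs1.le b hoddΘ hnegΘ (fun h => hv₀ h Θ₀ hΘ)
      (fun p => (hgΩ Θ₀ hΘ p).symm.trans (hradon Θ₀ (Or.inl hΘ) p))
    have hp := muPlus_radon (β := β) hnegΘ (hone (B₀ Θ₀)).1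
    have hm := muMinus_radon (β := β) hnegΘ hoddΘ (hone (B₀ (-Θ₀))).2
    refine ⟨?_, fun ψ => ?_⟩
    · rw [mu, muCTB, hp, hm]
    · rw [hp, hm]
      exact tendsto_boundaryApprox_invFourierPairing hκ _ _ ψ
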